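/- Let $k$ be a field and let $\alpha=\sum_{i\ge 0}\alpha_i t^i\in k[[t]]$ be a rational power series, $\alpha=p/q$ with $p,q\in k[t]$ coprime and $q(0)=1$. Put $K=\max\{\deg p+1,\deg q\}$ (with $\deg 0=-1$) and $u(t)=u_\alpha(t)=t^{K}q(t^{-1})\in k[t]$. Let $\mathrm{Cob}_2$ be the monoidal category whose objects are the integers $n\ge 0$ (the object $[n]$ is a disjoint union of $n$ circles), whose morphisms are the homeomorphism classes, relative to the boundary, of oriented two-dimensional cobordisms, and whose tensor product is disjoint union. Let $x\in\mathrm{End}([1])$ be the handle (the composite $[1]\to[2]\to[1]$ of the two pairs of pants) and let $s_i\in\mathrm{End}([0])$ be the closed connected surface of genus $i$. Let $\mathrm{SCob}_\alpha$ be the quotient of the $k$-linearization of $\mathrm{Cob}_2$ by the tensor ideal generated by $u(x)=0$ and $s_i=\alpha_i\,\mathrm{id}_{[0]}$ for all $i\ge 0$, and let $\mathrm{DCob}_\alpha$ be the idempotent completion of the additive closure of $\mathrm{SCob}_\alpha$, a $k$-linear monoidal category. For $n\ge 0$ let $D_n\subseteq\mathrm{DCob}_\alpha$ be the full subcategory generated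 by $[0],\dots,[n]$ under finite direct sums and direct summands, and let $D_{-1}=\{0\}$. Then $D_m\otimes D_n\subseteq D_{m+n}$. Let $D_n/D_{n-1}$ be the quotient of $D_n$ by the morphisms that factor through an object of $D_{n-1}$, and let $\mathrm{gr}(\mathrm{DCob}_\alpha)=\bigoplus_{n\ge 0}D_n/D_{n-1}$, with objects the sequences $(X_n)_{n\ge 0}$, $X_n\in D_n/D_{n-1}$, almost all zero, with morphisms taken componentwise, and with the graded monoidal structure $(X\otimes Y)_n=\bigoplus_{i+j=n}X_i\otimes Y_j$. Let $P_n=k[x_1,\dots,x_n]/(u(x_1),\dots,u(x_n))$, let the symmetric group $S_n$ act on $P_n$ by $\sigma(x_i)=x_{\sigma(i)}$, and let $R_n=P_n\rtimes k[S_n]$ be the skew group algebra, with product $(a\otimes g)(b\otimes h)=a\,g(b)\otimes gh$. Let $R_m\otimes R_n\to R_{m+n}$ be the homomorphism of algebras that sends $(f\otimes\sigma)\otimes(f'\otimes\sigma')$ to $f(x_1,\dots,x_m)\,f'(x_{m+1},\dots,x_{m+n})\otimes(\sigma,\sigma')$. Let $\mathcal S_\alpha=\bigoplus_{n\ge 0}\mathrm{proj}(R_n)$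 be the category of sequences of finitely generated projective right $R_n$-modules, $n\ge 0$, almost all zero, with the monoidal structure given on $M\in\mathrm{proj}(R_m)$ and $N\in\mathrm{proj}(R_n)$ by induction, $M\otimes N=(M\boxtimes N)\otimes_{R_m\otimes R_n}R_{m+n}$, and with unit object $R_0=k$ in degree $0$. **Theorem.** There is a $k$-linear equivalence of monoidal categories $F:\mathrm{gr}(\mathrm{DCob}_\alpha)\to\mathcal S_\alpha$ that is compatible with the gradings: for every $i$, an object $X$ is concentrated in degree $i$ if and only if $F(X)$ is. Furthermore, let $K_0$ denote the Grothendieck ring of an additive monoidal category (the abelian group generated by the isomorphism classes of objects with the relations $[X\oplus Y]=[X]+[Y]$, and with $[X][Y]=[X\otimes Y]$). Filter $K_0(\mathrm{DCob}_\alpha)$ by the subgroups $F_n$ spanned by the classes of the objects of $D_n$, with $F_{-1}=0$, let $\mathrm{gr}\,K_0(\mathrm{DCob}_\alpha)=\bigoplus_{n\ge 0}F_n/F_{n-1}$ be the associated graded ring, and grade $K_0(\mathcal S_\alpha)$ by the subgroups spanned by the classes of the objects concentrated in a given degree. Then $\mathrm{gr}\,K_0(\mathrm{DCob}_\alpha)\cong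 K_0(\mathcal S_\alpha)$ as graded rings. -/

import Mathlib

open CategoryTheory MonoidalCategory Limits

universe u v w

namespace KhovanovSazdanovic

/-! ### Two-dimensional cobordisms -/

section Pushforward

open Classical in
/-- Sum of the weights `w` over the fibres of `f`. -/
noncomputable def push {V Z : Type} [Finite V] (f : V → Z) (w : V → ℤ) (z : Z) : ℤ :=
  letI := Fintype.ofFinite V
  ∑ v, if f v = z then w v else 0

variable {V V' Z Y : Type} [Finite V] [Finite V']

theorem push_push [Finite Z] (f : V → Z) (g : Z → Y) (w : V → ℤ) :
    push g (push f w) = push (g ∘ f) w := by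
  classical
  funext y
  simp only [push]
  let _ := Fintype.ofFinite V
  let _ := Fintype.ofFinite Z
  have : ∀ z : Z, (if g z = y then ∑ v, (if f v = z then w v else 0) else 0)
      = ∑ v, (if g z = y then (if f v = z then w v else 0) else 0) := by
    intro z; split_ifs <;> simp
  simp only [this]
  rw [Finset.sum_comm]
  refine Finset.sum_congr rfl fun v _ => ?_
  rw [Finset.sum_eq_single (f v)]
  · simp
  · intro b _ hb
    simp [hb.symm]
  · simp

theorem push_add (f : V → Z) (w w' : V → ℤ) : push f (w + w') = push f w + push f w' := by
  classical
  funext z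
  simp only [push, Pi.add_apply, ← Finset.sum_add_distrib]
  refine Finset.sum_congr rfl fun v _ => ?_
  split_ifs <;> simp

theorem push_id (w : V → ℤ) : push (fun v => v) w = w := by
  classical
  funext z
  simp [push]

theorem push_equiv (e : V ≃ Z) (w : V → ℤ) (z : Z) : push e w z = w (e.symm z) := by
  classical
  simp only [push]
  let _ := Fintype.ofFinite V
  rw [Finset.sum_eq_single (e.symm z)]
  · simp
  · intro b _ hb
    rw [if_neg]
    rintro rfl
    simp at hb
  · simp

theorem push_sum (f : V ⊕ V' → Z) (w : V ⊕ V' → ℤ) :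
    push f w = push (f ∘ Sum.inl) (w ∘ Sum.inl) + push (f ∘ Sum.inr) (w ∘ Sum.inr) := by
  classical
  funext z
  simp only [push, Pi.add_apply]
  have h : Fintype.ofFinite (V ⊕ V') =
      @instFintypeSum _ _ (Fintype.ofFinite V) (Fintype.ofFinite V') := Subsingleton.elim _ _
  rw [h]
  exact @Fintype.sum_sum_type _ _ _ (Fintype.ofFinite V) (Fintype.ofFinite V') _ _

theorem push_inj (f : V → Z) (g : Z → Y) (hg : Function.Injective g) (w : V → ℤ) (z : Z) :
    push (g ∘ f) w (g z) = push f w z := by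
  classical
  simp [push, hg.eq_iff]

theorem push_out (f : V → Z) (w : V → ℤ) (z : Z) (h : ∀ v, f v ≠ z) :
    push f w z = 0 := by
  classical
  simp [push, h]

end Pushforward

/-- A two-dimensional oriented cobordism from the disjoint union of circles indexed by `A` to the
one indexed by `B`, given by its classifying data: the finite set of connected components, the
component containing each boundary circle, and the genus of each component. Components that
contain no boundary circle are closed surfaces. -/
structure Surface (A B : Type) where
  Comp : Type
  finite : Finite Comp
  inn : A → Comp
  out : B → Comp
  genus : Comp → ℕ

attribute [instance] Surface.finite

namespace Surface

variable {A B D E A' B' D' : Type}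

/-- The number `genus - 1` of a component. -/
def wt (c : Surface A B) (v : c.Comp) : ℤ := (c.genus v : ℤ) - 1

/-- Homeomorphism of cobordisms relative to the boundary. -/
def Iso (c d : Surface A B) : Prop :=
  ∃ e : c.Comp ≃ d.Comp, (∀ a, e (c.inn a) = d.inn a) ∧ (∀ b, e (c.out b) = d.out b) ∧
    ∀ v, d.genus (e v) = c.genus v

theorem Iso.refl (c : Surface A B) : Iso c c := ⟨Equiv.refl _, by simp, by simp, by simp⟩

theorem Iso.symm {c d : Surface A B} (h : Iso c d) : Iso d c := by
  obtain ⟨e, h1, h2, h3⟩ := h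
  refine ⟨e.symm, fun a => ?_, fun b => ?_, fun v => ?_⟩
  · rw [← h1, e.symm_apply_apply]
  · rw [← h2, e.symm_apply_apply]
  · rw [← h3, e.apply_symm_apply]

theorem Iso.trans {c d e : Surface A B} (h : Iso c d) (h' : Iso d e) : Iso c e := by
  obtain ⟨f, h1, h2, h3⟩ := h
  obtain ⟨g, h1', h2', h3'⟩ := h'
  exact ⟨f.trans g, by simp [h1, h1'], by simp [h2, h2'], by simp [h3, h3']⟩

instance setoid (A B : Type) : Setoid (Surface A B) :=
  ⟨Iso, Iso.refl, Iso.symm, Iso.trans⟩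

/-- The outgoing circle `b` of `c` is glued to the incoming circle `b` of `d`. -/
def GlueRel (c : Surface A B) (d : Surface B D) (x y : c.Comp ⊕ d.Comp) : Prop :=
  ∃ b, x = Sum.inl (c.out b) ∧ y = Sum.inr (d.inn b)

/-- The components of the surface obtained by gluing `c` and `d`. -/
def GlueComp (c : Surface A B) (d : Surface B D) : Type := Quot (GlueRel c d)

instance instFinite1 (c : Surface A B) (d : Surface B D) : Finite (GlueComp c d) :=
  inferInstanceAs (Finite (Quot _))

def glueL (c : Surface A B) (d : Surface B D) (v : c.Comp) : GlueComp c d := Quot.mk _ (Sum.inl v)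

def glueR (c : Surface A B) (d : Surface B D) (v : d.Comp) : GlueComp c d := Quot.mk _ (Sum.inr v)

theorem glue_condition (c : Surface A B) (d : Surface B D) (b : B) :
    glueL c d (c.out b) = glueR c d (d.inn b) := Quot.sound ⟨b, rfl, rfl⟩

/-- `genus - 1` of a component of the glued surface: the sum of the `genus - 1` of the pieces plus
the number of circles along which these pieces are glued (additivity of the Euler
characteristic). -/
noncomputable def glueWt [Finite B] (c : Surface A B) (d : Surface B D) : GlueComp c d → ℤ :=
  push (glueL c d) c.wt + push (glueR c d) d.wt + push (fun b => glueL c d (c.out b)) (fun _ => 1)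

/-- Gluing of cobordisms. -/
noncomputable abbrev glue [Finite B] (c : Surface A B) (d : Surface B D) : Surface A D where
  Comp := GlueComp c d
  finite := inferInstance
  inn a := glueL c d (c.inn a)
  out b := glueR c d (d.out b)
  genus z := (glueWt c d z + 1).toNat

/-- A connected graph with `V` vertices and `E` edges satisfies `V ≤ E + 1`. -/
theorem neg_one_le_glueWt [Finite B] (c : Surface A B) (d : Surface B D) (z : GlueComp c d) :
    -1 ≤ glueWt c d z := by
  classical
  let _ := Fintype.ofFinite B
  let q : c.Comp ⊕ d.Comp → GlueComp c d := Quot.mk _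
  let _ := Fintype.ofFinite (c.Comp ⊕ d.Comp)
  -- the vertices and edges lying over `z`
  let Vz := {x : c.Comp ⊕ d.Comp // q x = z}
  let Ez := {b : B // glueL c d (c.out b) = z}
  let ends : Ez → Sym2 Vz := fun b =>
    s(⟨Sum.inl (c.out b.1), b.2⟩, ⟨Sum.inr (d.inn b.1), (glue_condition c d b.1).symm.trans b.2⟩)
  let G : SimpleGraph Vz := SimpleGraph.fromEdgeSet (Set.range ends)
  have key : ∀ x y : c.Comp ⊕ d.Comp, Relation.EqvGen (GlueRel c d) x y →
      ∀ (hx : q x = z) (hy : q y = z), G.Reachable ⟨x, hx⟩ ⟨y, hy⟩ := by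
    intro x y h
    induction h with
    | rel x y h =>
      intro hx hy
      obtain ⟨b, rfl, rfl⟩ := h
      refine SimpleGraph.Adj.reachable ?_
      rw [SimpleGraph.fromEdgeSet_adj]
      exact ⟨⟨⟨b, hx⟩, rfl⟩, fun h => by cases congrArg Subtype.val h⟩
    | refl x => intro hx hy; rfl
    | symm x y _ ih => intro hx hy; exact (ih hy hx).symm
    | trans x y w h1 _ ih1 ih2 =>
      intro hx hy
      have hw : q y = z := by
        rw [← hx]; exact (Quot.eqvGen_sound h1).symm
      exact (ih1 hx hw).trans (ih2 hw hy)
  have hne : Nonempty Vz := by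
    obtain ⟨x, hx⟩ := Quot.exists_rep z
    exact ⟨⟨x, hx⟩⟩
  have hconn : G.Connected := by
    refine ⟨fun x y => key _ _ (Quot.eqvGen_exact ?_) x.2 y.2⟩
    exact x.2.trans y.2.symm
  have h1 := hconn.card_vert_le_card_edgeSet_add_one
  have h2 : Nat.card G.edgeSet ≤ Nat.card Ez := by
    have h3 : G.edgeSet ⊆ Set.range ends := by
      rw [SimpleGraph.edgeSet_fromEdgeSet]
      exact Set.sdiff_subset
    refine (Nat.card_mono (Set.finite_range ends) h3).trans ?_
    exact Finite.card_range_le ends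
  have h4 : (push (fun b => glueL c d (c.out b)) (fun _ => 1) z : ℤ) = Nat.card Ez := by
    rw [Nat.card_eq_fintype_card, Fintype.card_subtype]
    simp only [push]
    rw [Finset.sum_boole]
  have h5 : -(Nat.card Vz : ℤ) ≤ push (glueL c d) c.wt z + push (glueR c d) d.wt z := by
    have : push (glueL c d) c.wt z + push (glueR c d) d.wt z
        = push q (Sum.elim c.wt d.wt) z := by
      rw [push_sum]; rfl
    rw [this, Nat.card_eq_fintype_card, Fintype.card_subtype]
    have h6 : -((Finset.univ.filter fun x => q x = z).card : ℤ)
        = push q (fun _ => -1) z := by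
      simp only [push]
      rw [← Finset.sum_filter]
      simp only [Finset.sum_const, smul_neg, nsmul_eq_mul, mul_one]
    rw [h6]
    simp only [push]
    refine Finset.sum_le_sum fun x _ => ?_
    split_ifs
    · rcases x with x | x <;> simp only [Sum.elim_inl, Sum.elim_inr, wt] <;> omega
    · rfl
  have h7 : glueWt c d z = push (glueL c d) c.wt z + push (glueR c d) d.wt z +
    push (fun b => glueL c d (c.out b)) (fun _ => 1) z := rfl
  have h8 : (Nat.card Vz : ℤ) ≤ Nat.card Ez + 1 := by exact_mod_cast h1.trans (by omega)
  omega

theorem glue_wt [Finite B] (c : Surface A B) (d : Surface B D) :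
    (glue c d).wt = glueWt c d := by
  funext z
  have := neg_one_le_glueWt c d z
  simp only [wt]
  omega

/-- Recognition of a glued surface. -/
theorem glue_iso [Finite B] (c : Surface A B) (d : Surface B D) (s : Surface A D)
    (f : c.Comp → s.Comp) (g : d.Comp → s.Comp) (h : s.Comp → GlueComp c d)
    (hfg : ∀ b, f (c.out b) = g (d.inn b))
    (hf : ∀ v, h (f v) = glueL c d v) (hg : ∀ v, h (g v) = glueR c d v)
    (hsurj : ∀ s, (∃ v, f v = s) ∨ ∃ v, g v = s)
    (hinn : ∀ a, f (c.inn a) = s.inn a) (hout : ∀ a, g (d.out a) = s.out a)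
    (hwt : s.wt = push f c.wt + push g d.wt + push (fun b => f (c.out b)) (fun _ => 1)) :
    Iso (glue c d) s := by
  let k : GlueComp c d → s.Comp := Quot.lift (Sum.elim f g) (by
    rintro _ _ ⟨b, rfl, rfl⟩; exact hfg b)
  let e : GlueComp c d ≃ s.Comp := ⟨k, h, by
      rintro ⟨v | v⟩
      · exact hf v
      · exact hg v, by
      intro v
      rcases hsurj v with ⟨v, rfl⟩ | ⟨v, rfl⟩
      · rw [hf]; rfl
      · rw [hg]; rfl⟩
  refine ⟨e, hinn, hout, fun v => ?_⟩
  have h1 : s.wt (e v) = (glue c d).wt v := by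
    rw [glue_wt, hwt]
    have h2 : push e (glueWt c d) (e v) = glueWt c d v := by
      rw [push_equiv]; exact congrArg _ (e.symm_apply_apply v)
    rw [← h2, glueWt, push_add, push_add, push_push, push_push, push_push]
    rfl
  simp only [Surface.wt] at h1
  exact_mod_cast sub_left_injective h1

theorem Iso.wt {c d : Surface A B} {e : c.Comp ≃ d.Comp}
    (h : ∀ v, d.genus (e v) = c.genus v) : d.wt = push e c.wt := by
  funext z
  rw [push_equiv, Surface.wt, Surface.wt, ← h, e.apply_symm_apply]

theorem glue_congr [Finite B] {c c' : Surface A B} {d d' : Surface B D} (h : Iso c c')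
    (h' : Iso d d') : Iso (glue c d) (glue c' d') := by
  obtain ⟨e, h1, h2, h3⟩ := h
  obtain ⟨e', h1', h2', h3'⟩ := h'
  refine glue_iso _ _ _ (fun v => glueL c' d' (e v)) (fun v => glueR c' d' (e' v))
    (Quot.lift (Sum.elim (fun v => glueL c d (e.symm v)) (fun v => glueR c d (e'.symm v))) ?_)
    ?_ ?_ ?_ ?_ ?_ ?_ ?_
  · rintro _ _ ⟨b, rfl, rfl⟩
    simp only [Sum.elim_inl, Sum.elim_inr, ← h2, ← h1', e.symm_apply_apply, e'.symm_apply_apply]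
    exact glue_condition c d b
  · intro b
    rw [h2, h1']
    exact glue_condition c' d' b
  · intro v
    change glueL c d (e.symm (e v)) = _
    simp
  · intro v
    change glueR c d (e'.symm (e' v)) = _
    simp
  · rintro ⟨v | v⟩
    · exact Or.inl ⟨e.symm v, by simp; rfl⟩
    · exact Or.inr ⟨e'.symm v, by simp; rfl⟩
  · intro a; simp only [h1]
  · intro a; simp only [h2']
  · rw [glue_wt, glueWt, Iso.wt h3, Iso.wt h3', push_push, push_push]
    simp only [h2]
    rfl

theorem glue_assoc [Finite B] [Finite D] (c : Surface A B) (d : Surface B D) (s : Surface D E) :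
    Iso (glue (glue c d) s) (glue c (glue d s)) := by
  let g : GlueComp c d → GlueComp c (glue d s) :=
    Quot.lift (Sum.elim (glueL c (glue d s)) (fun v => glueR c (glue d s) (glueL d s v))) (by
      rintro _ _ ⟨b, rfl, rfl⟩
      exact glue_condition c (glue d s) b)
  let g' : GlueComp d s → GlueComp (glue c d) s :=
    Quot.lift (Sum.elim (fun v => glueL (glue c d) s (glueR c d v)) (glueR (glue c d) s)) (by
      rintro _ _ ⟨b, rfl, rfl⟩
      exact glue_condition (glue c d) s b)
  refine glue_iso _ _ _ g (fun v => glueR c (glue d s) (glueR d s v))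
    (Quot.lift (Sum.elim (fun v => glueL (glue c d) s (glueL c d v)) g') ?_) ?_ ?_ ?_ ?_ ?_ ?_ ?_
  · rintro _ _ ⟨b, rfl, rfl⟩
    exact congrArg (glueL (glue c d) s) (glue_condition c d b)
  · intro b
    exact congrArg (glueR c (glue d s)) (glue_condition d s b)
  · intro v
    induction v using Quot.ind with
    | mk v => rcases v with v | v <;> rfl
  · intro v; rfl
  · rintro ⟨v | v⟩
    · exact Or.inl ⟨glueL c d v, rfl⟩
    induction v using Quot.ind with | mk v => ?_
    rcases v with v | v
    · exact Or.inl ⟨glueR c d v, rfl⟩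
    · exact Or.inr ⟨v, rfl⟩
  · intro a; rfl
  · intro a; rfl
  · have e1 : push g (glue c d).wt = push (fun v => g (glueL c d v)) c.wt +
        push (fun v => g (glueR c d v)) d.wt +
        push (fun b => g (glueL c d (c.out b))) (fun _ => 1) := by
      rw [glue_wt]
      erw [push_add, push_add, push_push, push_push, push_push]
      rfl
    have e2 : push (glueR c (glue d s)) (glue d s).wt =
        push (fun v => glueR c (glue d s) (glueL d s v)) d.wt +
        push (fun v => glueR c (glue d s) (glueR d s v)) s.wt +
        push (fun b => glueR c (glue d s) (glueL d s (d.out b))) (fun _ => 1) := by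
      rw [glue_wt]
      erw [push_add, push_add, push_push, push_push, push_push]
      rfl
    rw [glue_wt, glueWt, e1, e2]
    have e3 : (fun v => g (glueL c d v)) = glueL c (glue d s) := rfl
    have e4 : (fun v => g (glueR c d v)) = fun v => glueR c (glue d s) (glueL d s v) := rfl
    have e5 : (fun b => g ((glue c d).out b)) =
      fun b => glueR c (glue d s) (glueL d s (d.out b)) := rfl
    rw [e3, e4, e5]
    funext z
    simp only [Pi.add_apply]
    have e6 : (fun b => g (glueL c d (c.out b))) = fun b => glueL c (glue d s) (c.out b) := rfl
    rw [e6]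
    ring

/-- The union of cylinders connecting `a` to `e a`. -/
abbrev ofEquiv [Finite B] (e : A ≃ B) : Surface A B where
  Comp := B
  finite := inferInstance
  inn := e
  out b := b
  genus _ := 0

theorem ofEquiv_glue [Finite A] [Finite B] (e : A ≃ B) (c : Surface B D) :
    Iso (glue (ofEquiv e) c) ⟨c.Comp, c.finite, fun a => c.inn (e a), c.out, c.genus⟩ := by
  refine glue_iso (ofEquiv e) c _ c.inn (fun v => v) (glueR _ c) (fun b => rfl) ?_ (fun _ => rfl)
    (fun s => Or.inr ⟨s, rfl⟩) (fun _ => rfl) (fun _ => rfl) ?_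
  · intro v; exact (glue_condition (ofEquiv e) c v).symm
  · rw [push_id]
    have h : (ofEquiv e).wt = fun _ => -1 := by funext v; simp [wt]
    rw [h]
    have h2 : push c.inn (fun _ : B => (-1 : ℤ)) + push c.inn (fun _ => 1) = 0 := by
      rw [← push_add]; funext z; simp [push]
    have h3 : ∀ a b d : c.Comp → ℤ, a + d = 0 → b = a + b + d := by
      intro a b d h; rw [add_right_comm, h, zero_add]
    exact h3 _ _ _ h2

theorem glue_ofEquiv [Finite A] [Finite B] [Finite D] (c : Surface A B) (e : B ≃ D) :
    Iso (glue c (ofEquiv e)) ⟨c.Comp, c.finite, c.inn, fun b => c.out (e.symm b), c.genus⟩ := by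
  refine glue_iso c (ofEquiv e) _ (fun v => v) (fun b => c.out (e.symm b)) (glueL c _)
    (fun b => by simp) (fun _ => rfl) ?_
    (fun s => Or.inl ⟨s, rfl⟩) (fun _ => rfl) (fun _ => rfl) ?_
  · intro v
    refine (glue_condition c (ofEquiv e) _).trans ?_
    exact congrArg (glueR c (ofEquiv e)) (e.apply_symm_apply v)
  · rw [push_id]
    have h : (ofEquiv e).wt = fun _ => -1 := by funext v; simp [wt]
    rw [h]
    have h1 : push (fun b => c.out (e.symm b)) (fun _ : D => (-1 : ℤ)) =
        push c.out (fun _ => -1) := by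
      have : (fun _ : D => (-1 : ℤ)) = push e (fun _ => -1) := by
        funext z; rw [push_equiv]
      rw [this, push_push]
      congr 1
      funext b; simp
    have h2 : push c.out (fun _ : B => (-1 : ℤ)) + push c.out (fun _ => 1) = 0 := by
      rw [← push_add]; funext z; simp [push]
    have h3 : ∀ a b d : c.Comp → ℤ, a + d = 0 → b = b + a + d := by
      intro a b d h; rw [add_assoc, h, add_zero]
    exact h3 _ _ _ (by erw [h1]; exact h2)

/-- Disjoint union of cobordisms. -/
abbrev disj (c : Surface A B) (d : Surface A' B') : Surface (A ⊕ A') (B ⊕ B') where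
  Comp := c.Comp ⊕ d.Comp
  finite := inferInstance
  inn := Sum.map c.inn d.inn
  out := Sum.map c.out d.out
  genus := Sum.elim c.genus d.genus

theorem disj_congr {c c' : Surface A B} {d d' : Surface A' B'} (h : Iso c c') (h' : Iso d d') :
    Iso (disj c d) (disj c' d') := by
  obtain ⟨e, h1, h2, h3⟩ := h
  obtain ⟨e', h1', h2', h3'⟩ := h'
  refine ⟨Equiv.sumCongr e e', ?_, ?_, ?_⟩
  · rintro (a | a)
    · exact congrArg Sum.inl (h1 a)
    · exact congrArg Sum.inr (h1' a)
  · rintro (a | a)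
    · exact congrArg Sum.inl (h2 a)
    · exact congrArg Sum.inr (h2' a)
  · rintro (a | a)
    · exact h3 a
    · exact h3' a

theorem disj_glue [Finite B] [Finite B'] (c : Surface A B) (d : Surface B D) (c' : Surface A' B')
    (d' : Surface B' D') :
    Iso (glue (disj c c') (disj d d')) (disj (glue c d) (glue c' d')) := by
  refine glue_iso _ _ _ (Sum.map (glueL c d) (glueL c' d')) (Sum.map (glueR c d) (glueR c' d'))
    (Sum.elim
      (Quot.lift (Sum.elim (fun v => glueL (disj c c') (disj d d') (Sum.inl v))
        (fun v => glueR (disj c c') (disj d d') (Sum.inl v))) ?_)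
      (Quot.lift (Sum.elim (fun v => glueL (disj c c') (disj d d') (Sum.inr v))
        (fun v => glueR (disj c c') (disj d d') (Sum.inr v))) ?_)) ?_ ?_ ?_ ?_ ?_ ?_ ?_
  · rintro _ _ ⟨b, rfl, rfl⟩
    exact glue_condition (disj c c') (disj d d') (Sum.inl b)
  · rintro _ _ ⟨b, rfl, rfl⟩
    exact glue_condition (disj c c') (disj d d') (Sum.inr b)
  · rintro (b | b)
    · exact congrArg Sum.inl (glue_condition c d b)
    · exact congrArg Sum.inr (glue_condition c' d' b)
  · rintro (v | v) <;> rfl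
  · rintro (v | v) <;> rfl
  · rintro (v | v) <;> induction v using Quot.ind with | mk v => ?_
    all_goals rcases v with v | v
    · exact Or.inl ⟨Sum.inl v, rfl⟩
    · exact Or.inr ⟨Sum.inl v, rfl⟩
    · exact Or.inl ⟨Sum.inr v, rfl⟩
    · exact Or.inr ⟨Sum.inr v, rfl⟩
  · rintro (a | a) <;> rfl
  · rintro (a | a) <;> rfl
  · have hw : ∀ {X Y X' Y' : Type} (s : Surface X Y) (s' : Surface X' Y'),
        (disj s s').wt = Sum.elim s.wt s'.wt := by
      intros; funext v; rcases v with v | v <;> rfl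
    have hp : ∀ {V V' Z Z' : Type} [Finite V] [Finite V'] [Finite Z] [Finite Z'] (f : V → Z)
        (g : V' → Z') (w : V ⊕ V' → ℤ), push (Sum.map f g) w =
          Sum.elim (push f (w ∘ Sum.inl)) (push g (w ∘ Sum.inr)) := by
      intro V V' Z Z' _ _ _ _ f g w
      funext z
      rw [push_sum]
      rcases z with z | z
      · have h1 := push_inj f (Sum.inl : Z → Z ⊕ Z') Sum.inl_injective (w ∘ Sum.inl) z
        have h2 := push_out (Sum.inr ∘ g : V' → Z ⊕ Z') (w ∘ Sum.inr) (Sum.inl z) (by simp)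
        exact (congrArg₂ (· + ·) h1 h2).trans (add_zero _)
      · have h1 := push_inj g (Sum.inr : Z' → Z ⊕ Z') Sum.inr_injective (w ∘ Sum.inr) z
        have h2 := push_out (Sum.inl ∘ f : V → Z ⊕ Z') (w ∘ Sum.inl) (Sum.inr z) (by simp)
        exact (congrArg₂ (· + ·) h2 h1).trans (zero_add _)
    have hb : (fun b => Sum.map (glueL c d) (glueL c' d') ((disj c c').out b)) =
        Sum.map (fun b => glueL c d (c.out b)) (fun b => glueL c' d' (c'.out b)) := by
      funext b; rcases b with b | b <;> rfl
    rw [hb, hw, hw, hw, glue_wt, glue_wt]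
    erw [hp, hp, hp]
    funext z
    rcases z with z | z <;> rfl

end Surface

/-- A finite collection of circles. -/
structure Circles where
  carrier : Type
  [finite : Finite carrier]

attribute [instance] Circles.finite

namespace Circles

open Surface

/-- Morphisms are homeomorphism classes of cobordisms. -/
noncomputable instance instCategory2 : Category Circles where
  Hom A B := Quotient (Surface.setoid A.carrier B.carrier)
  id A := ⟦ofEquiv (Equiv.refl A.carrier)⟧
  comp f g := Quotient.map₂ glue (fun _ _ h _ _ h' => glue_congr h h') f g
  id_comp f := by
    induction f using Quotient.ind
    exact Quotient.sound (ofEquiv_glue _ _)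
  comp_id f := by
    induction f using Quotient.ind
    exact Quotient.sound (glue_ofEquiv _ _)
  assoc f g h := by
    induction f using Quotient.ind
    induction g using Quotient.ind
    induction h using Quotient.ind
    exact Quotient.sound (glue_assoc _ _ _)

/-- The class of a cobordism. -/
noncomputable def cls {A B : Circles} (c : Surface A.carrier B.carrier) : A ⟶ B := Quotient.mk _ c

theorem cls_surj {A B : Circles} (f : A ⟶ B) : ∃ c, cls c = f := Quotient.exists_rep f

theorem cls_comp {A B D : Circles} (c : Surface A.carrier B.carrier)
    (d : Surface B.carrier D.carrier) : cls c ≫ cls d = cls (glue c d) := rfl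

/-- Cylinders along a bijection. -/
noncomputable def eqv {A B : Circles} (e : A.carrier ≃ B.carrier) : A ⟶ B := cls (ofEquiv e)

theorem eqv_refl (A : Circles) : eqv (Equiv.refl A.carrier) = 𝟙 A := rfl

theorem eqv_comp_cls {A B D : Circles} (e : A.carrier ≃ B.carrier)
    (c : Surface B.carrier D.carrier) :
    eqv e ≫ cls c = cls ⟨c.Comp, c.finite, fun a => c.inn (e a), c.out, c.genus⟩ :=
  Quotient.sound (ofEquiv_glue e c)

theorem cls_comp_eqv {A B D : Circles} (c : Surface A.carrier B.carrier)
    (e : B.carrier ≃ D.carrier) :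
    cls c ≫ eqv e = cls ⟨c.Comp, c.finite, c.inn, fun b => c.out (e.symm b), c.genus⟩ :=
  Quotient.sound (glue_ofEquiv c e)

theorem eqv_comp_eqv {A B D : Circles} (e : A.carrier ≃ B.carrier) (f : B.carrier ≃ D.carrier) :
    eqv e ≫ eqv f = eqv (e.trans f) := eqv_comp_cls e _

/-- The isomorphism given by a bijection of circles. -/
noncomputable def eqvIso {A B : Circles} (e : A.carrier ≃ B.carrier) : A ≅ B where
  hom := eqv e
  inv := eqv e.symm
  hom_inv_id := by rw [eqv_comp_eqv, Equiv.self_trans_symm, eqv_refl]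
  inv_hom_id := by rw [eqv_comp_eqv, Equiv.symm_trans_self, eqv_refl]

/-- Disjoint union of circles. -/
abbrev union (A B : Circles) : Circles := ⟨A.carrier ⊕ B.carrier⟩

/-- Disjoint union of cobordisms. -/
noncomputable def unionHom {A B A' B' : Circles} (f : A ⟶ B) (g : A' ⟶ B') : union A A' ⟶ union B B' :=
  Quotient.map₂ disj (fun _ _ h _ _ h' => disj_congr h h') f g

theorem unionHom_cls {A B A' B' : Circles} (c : Surface A.carrier B.carrier)
    (d : Surface A'.carrier B'.carrier) : unionHom (cls c) (cls d) = cls (disj c d) := rfl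

theorem unionHom_eqv {A B A' B' : Circles} (e : A.carrier ≃ B.carrier)
    (f : A'.carrier ≃ B'.carrier) :
    unionHom (eqv e) (eqv f) = (eqv (Equiv.sumCongr e f) : union A A' ⟶ union B B') := by
  refine Quotient.sound ⟨Equiv.refl _, ?_, ?_, ?_⟩
  · rintro (a | a) <;> rfl
  · rintro (a | a) <;> rfl
  · rintro (a | a) <;> rfl

/-- The monoidal structure is given by disjoint union. -/
noncomputable instance instMonoidalCategory3 : MonoidalCategory Circles :=
  letI : MonoidalCategoryStruct Circles :=
    { tensorObj := union
      tensorHom := unionHom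
      whiskerLeft := fun A _ _ f => unionHom (𝟙 A) f
      whiskerRight := fun f A => unionHom f (𝟙 A)
      tensorUnit := ⟨Empty⟩
      associator := fun A B D => eqvIso (Equiv.sumAssoc A.carrier B.carrier D.carrier)
      leftUnitor := fun A => eqvIso (Equiv.emptySum Empty A.carrier)
      rightUnitor := fun A => eqvIso (Equiv.sumEmpty A.carrier Empty) }
  have h1 : ∀ A B : Circles, unionHom (𝟙 A) (𝟙 B) = 𝟙 (union A B) := fun A B => by
    rw [← eqv_refl, ← eqv_refl, unionHom_eqv, Equiv.sumCongr_refl]; rfl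
  MonoidalCategory.ofTensorHom
    (id_tensorHom_id := h1)
    (id_tensorHom := fun _ _ _ _ => rfl)
    (tensorHom_id := fun _ _ => rfl)
    (tensorHom_comp_tensorHom := fun f₁ f₂ g₁ g₂ => by
      obtain ⟨f₁, rfl⟩ := cls_surj f₁
      obtain ⟨f₂, rfl⟩ := cls_surj f₂
      obtain ⟨g₁, rfl⟩ := cls_surj g₁
      obtain ⟨g₂, rfl⟩ := cls_surj g₂
      exact Quotient.sound (disj_glue f₁ g₁ f₂ g₂))
    (associator_naturality := fun f g h => by
      obtain ⟨f, rfl⟩ := cls_surj f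
      obtain ⟨g, rfl⟩ := cls_surj g
      obtain ⟨h, rfl⟩ := cls_surj h
      refine (cls_comp_eqv _ _).trans (Eq.trans ?_ (eqv_comp_cls _ _).symm)
      refine Quotient.sound ⟨Equiv.sumAssoc _ _ _, ?_, ?_, ?_⟩
      · rintro ((a | a) | a) <;> rfl
      · rintro (a | (a | a)) <;> rfl
      · rintro ((a | a) | a) <;> rfl)
    (leftUnitor_naturality := fun f => by
      obtain ⟨f, rfl⟩ := cls_surj f
      refine (cls_comp_eqv _ _).trans (Eq.trans ?_ (eqv_comp_cls _ _).symm)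
      refine Quotient.sound ⟨Equiv.emptySum Empty _, ?_, ?_, ?_⟩
      · rintro (a | a)
        · exact a.elim
        · rfl
      · intro b; rfl
      · rintro (a | a)
        · exact a.elim
        · rfl)
    (rightUnitor_naturality := fun f => by
      obtain ⟨f, rfl⟩ := cls_surj f
      refine (cls_comp_eqv _ _).trans (Eq.trans ?_ (eqv_comp_cls _ _).symm)
      refine Quotient.sound ⟨Equiv.sumEmpty _ Empty, ?_, ?_, ?_⟩
      · rintro (a | a)
        · rfl
        · exact a.elim
      · intro b; rfl
      · rintro (a | a)
        · rfl
        · exact a.elim)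
    (pentagon := fun A B D E => by
      change unionHom (eqv _) (eqv (Equiv.refl _)) ≫ eqv _ ≫ unionHom (eqv (Equiv.refl _)) (eqv _) =
        eqv _ ≫ eqv _
      rw [unionHom_eqv, unionHom_eqv, eqv_comp_eqv, eqv_comp_eqv, eqv_comp_eqv]
      congr 1
      ext (((a | a) | a) | a) <;> rfl)
    (triangle := fun A B => by
      change eqv _ ≫ unionHom (eqv (Equiv.refl _)) (eqv _) = unionHom (eqv _) (eqv (Equiv.refl _))
      rw [unionHom_eqv, unionHom_eqv, eqv_comp_eqv]
      congr 1
      ext ((a | a) | a)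
      · rfl
      · exact a.elim
      · rfl)

end Circles

/-- The category of two-dimensional cobordisms: its objects are the natural numbers, where `n`
stands for the disjoint union of `n` circles. -/
abbrev Cob : Type := InducedCategory Circles fun n : ℕ => (⟨Fin n⟩ : Circles)

namespace Cob

/-- The object `[n]`. -/
def obj (n : ℕ) : Cob := n

/-- The forgetful functor, which is fully faithful. -/
noncomputable abbrev toCircles : Cob ⥤ Circles := inducedFunctor _

/-- `Fin m ⊔ Fin n ≅ Fin (m + n)`. -/
noncomputable def μ (m n : Cob) :
    toCircles.obj m ⊗ toCircles.obj n ≅ toCircles.obj (obj (Nat.add m n)) :=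
  Circles.eqvIso finSumFinEquiv

/-- `∅ ≅ Fin 0`. -/
noncomputable def ε : 𝟙_ Circles ≅ toCircles.obj (obj 0) := Circles.eqvIso finZeroEquiv.symm

/-- The tensor product is `[m] ⊗ [n] = [m + n]`, and disjoint union on morphisms. -/
noncomputable instance instMonoidalCategoryStruct4 : MonoidalCategoryStruct Cob where
  tensorObj m n := obj (Nat.add m n)
  tensorUnit := obj 0
  tensorHom f g := InducedCategory.homMk ((μ _ _).inv ≫ (f.hom ⊗ₘ g.hom) ≫ (μ _ _).hom)
  whiskerLeft X _ _ g := InducedCategory.homMk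
    ((μ _ _).inv ≫ (toCircles.obj X ◁ g.hom) ≫ (μ _ _).hom)
  whiskerRight f Y := InducedCategory.homMk
    ((μ _ _).inv ≫ (f.hom ▷ toCircles.obj Y) ≫ (μ _ _).hom)
  associator X Y Z := InducedCategory.isoMk
    (((μ _ _).symm ≪≫ ((μ _ _).symm ⊗ᵢ .refl _))
        ≪≫ α_ (toCircles.obj X) (toCircles.obj Y) (toCircles.obj Z)
        ≪≫ ((.refl _ ⊗ᵢ μ _ _) ≪≫ μ _ _))
  leftUnitor X := InducedCategory.isoMk
    (((μ _ _).symm ≪≫ (ε.symm ⊗ᵢ .refl _)) ≪≫ λ_ (toCircles.obj X))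
  rightUnitor X := InducedCategory.isoMk
    (((μ _ _).symm ≪≫ (.refl _ ⊗ᵢ ε.symm)) ≪≫ ρ_ (toCircles.obj X))

noncomputable instance instMonoidalCategory5 : MonoidalCategory Cob :=
  Monoidal.induced toCircles
    { μIso := μ
      εIso := ε
      whiskerLeft_eq := fun _ _ _ _ => rfl
      whiskerRight_eq := fun _ _ => rfl
      tensorHom_eq := fun _ _ => rfl
      associator_eq := fun _ _ _ => rfl
      leftUnitor_eq := fun _ => rfl
      rightUnitor_eq := fun _ => rfl }

/-- The connected genus zero cobordism from `m` circles to `n` circles. -/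
noncomputable def connected (m n : ℕ) : obj m ⟶ obj n :=
  InducedCategory.homMk (Circles.cls ⟨Unit, inferInstance, fun _ => (), fun _ => (), fun _ => 0⟩)

/-- The pair of pants `[2] ⟶ [1]`. -/
noncomputable def mul : obj 2 ⟶ obj 1 := connected 2 1

/-- The reverse pair of pants `[1] ⟶ [2]`. -/
noncomputable def comul : obj 1 ⟶ obj 2 := connected 1 2

/-- The disc `[0] ⟶ [1]`. -/
noncomputable def cup : obj 0 ⟶ obj 1 := connected 0 1

/-- The disc `[1] ⟶ [0]`. -/
noncomputable def cap : obj 1 ⟶ obj 0 := connected 1 0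

/-- The handle endomorphism of `[1]`. -/
noncomputable def handle : End (obj 1) := comul ≫ mul

/-- The closed surface of genus `i`. -/
noncomputable def closed (i : ℕ) : obj 0 ⟶ obj 0 := cup ≫ (handle ^ i : End (obj 1)) ≫ cap

end Cob

/-! ### Linear monoidal categories -/

/-- A constructor for monoidal categories using whiskering only. -/
abbrev ofWhisker {C : Type u} [Category.{v} C] (S : MonoidalCategoryStruct C)
    (hom : ∀ {X₁ Y₁ X₂ Y₂ : C} (f : X₁ ⟶ Y₁) (g : X₂ ⟶ Y₂), f ⊗ₘ g = f ▷ X₂ ≫ Y₁ ◁ g)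
    (wl_id : ∀ X Y : C, X ◁ 𝟙 Y = 𝟙 (X ⊗ Y))
    (wr_id : ∀ X Y : C, 𝟙 X ▷ Y = 𝟙 (X ⊗ Y))
    (wl_comp : ∀ (X : C) {Y Z W : C} (f : Y ⟶ Z) (g : Z ⟶ W), X ◁ (f ≫ g) = X ◁ f ≫ X ◁ g)
    (wr_comp : ∀ {Y Z W : C} (f : Y ⟶ Z) (g : Z ⟶ W) (X : C), (f ≫ g) ▷ X = f ▷ X ≫ g ▷ X)
    (exch : ∀ {W X Y Z : C} (f : W ⟶ X) (g : Y ⟶ Z), W ◁ g ≫ f ▷ Z = f ▷ Y ≫ X ◁ g)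
    (nat₁ : ∀ {X X' : C} (f : X ⟶ X') (Y Z : C),
      f ▷ Y ▷ Z ≫ (α_ X' Y Z).hom = (α_ X Y Z).hom ≫ f ▷ (Y ⊗ Z))
    (nat₂ : ∀ (X : C) {Y Y' : C} (f : Y ⟶ Y') (Z : C),
      (X ◁ f) ▷ Z ≫ (α_ X Y' Z).hom = (α_ X Y Z).hom ≫ X ◁ f ▷ Z)
    (nat₃ : ∀ (X Y : C) {Z Z' : C} (f : Z ⟶ Z'),
      (X ⊗ Y) ◁ f ≫ (α_ X Y Z').hom = (α_ X Y Z).hom ≫ X ◁ Y ◁ f)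
    (natl : ∀ {X Y : C} (f : X ⟶ Y), 𝟙_ C ◁ f ≫ (λ_ Y).hom = (λ_ X).hom ≫ f)
    (natr : ∀ {X Y : C} (f : X ⟶ Y), f ▷ 𝟙_ C ≫ (ρ_ Y).hom = (ρ_ X).hom ≫ f)
    (pent : ∀ W X Y Z : C, (α_ W X Y).hom ▷ Z ≫ (α_ W (X ⊗ Y) Z).hom ≫ W ◁ (α_ X Y Z).hom =
      (α_ (W ⊗ X) Y Z).hom ≫ (α_ W X (Y ⊗ Z)).hom)
    (tri : ∀ X Y : C, (α_ X (𝟙_ C) Y).hom ≫ X ◁ (λ_ Y).hom = (ρ_ X).hom ▷ Y) :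
    MonoidalCategory C where
  tensorHom_def := hom
  id_tensorHom_id X Y := by rw [hom, wl_id, wr_id, Category.comp_id]
  tensorHom_comp_tensorHom f₁ f₂ g₁ g₂ := by
    simp only [hom, wl_comp, wr_comp, Category.assoc]
    rw [← Category.assoc (_ ◁ f₂), exch, Category.assoc]
  whiskerLeft_id := wl_id
  id_whiskerRight := wr_id
  associator_naturality f g h := by
    simp only [hom, wl_comp, wr_comp, Category.assoc]
    rw [nat₃, ← Category.assoc (α_ _ _ _).hom (f ▷ _), ← nat₁, Category.assoc,
      ← Category.assoc (α_ _ _ _).hom (_ ◁ g ▷ _), ← nat₂, Category.assoc]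
  leftUnitor_naturality := natl
  rightUnitor_naturality := natr
  pentagon := pent
  triangle := tri

section Linearization

/-- The `k`-linearization of a category `C`: it has the objects of `C`, and the morphisms are the
formal `k`-linear combinations of morphisms of `C`. -/
structure Linearization (k : Type u) (C : Type v) where
  as : C

namespace Linearization

variable {k : Type u} [CommRing k] {C : Type v} [Category.{w} C]

/-- The bilinear extension of the composition. -/
noncomputable def compHom (X Y Z : C) :
    ((X ⟶ Y) →₀ k) →ₗ[k] ((Y ⟶ Z) →₀ k) →ₗ[k] ((X ⟶ Z) →₀ k) :=
  Finsupp.lsum k fun f => LinearMap.toSpanSingleton k _ (Finsupp.lmapDomain k k fun g => f ≫ g)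

theorem compHom_single {X Y Z : C} (f : X ⟶ Y) (g : Y ⟶ Z) (r s : k) :
    compHom X Y Z (Finsupp.single f r) (Finsupp.single g s) = Finsupp.single (f ≫ g) (r * s) := by
  simp only [compHom, Finsupp.lsum_single, LinearMap.toSpanSingleton_apply, LinearMap.smul_apply,
    Finsupp.lmapDomain_apply, Finsupp.mapDomain_single, Finsupp.smul_single, smul_eq_mul]

noncomputable instance instCategory6 : Category (Linearization k C) where
  Hom X Y := (X.as ⟶ Y.as) →₀ k
  id X := Finsupp.single (𝟙 X.as) 1
  comp f g := compHom _ _ _ f g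
  id_comp {X Y} f := by
    refine LinearMap.congr_fun (f := compHom X.as X.as Y.as (Finsupp.single (𝟙 X.as) 1))
      (g := LinearMap.id) ?_ f
    ext f : 2
    simp [compHom]
  comp_id {X Y} f := by
    refine LinearMap.congr_fun (f := (compHom X.as Y.as Y.as).flip (Finsupp.single (𝟙 Y.as) 1))
      (g := LinearMap.id) ?_ f
    ext f : 2
    simp [compHom]
  assoc {X Y Z W} f g h := by
    induction f using Finsupp.induction_linear with
    | zero => simp
    | add f f' hf hf' => simp only [map_add, LinearMap.add_apply, hf, hf']
    | single f r =>
    induction g using Finsupp.induction_linear with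
    | zero => simp
    | add f f' hf hf' => simp only [map_add, LinearMap.add_apply, hf, hf']
    | single g s =>
    induction h using Finsupp.induction_linear with
    | zero => simp
    | add f f' hf hf' => simp only [map_add, hf, hf']
    | single h t =>
      simp only [compHom_single, Category.assoc, mul_assoc]

noncomputable instance instPreadditive7 : Preadditive (Linearization k C) where
  homGroup X Y := inferInstanceAs (AddCommGroup ((X.as ⟶ Y.as) →₀ k))
  add_comp X Y Z f g h := LinearMap.map_add₂ (compHom X.as Y.as Z.as) f g h
  comp_add X Y Z f g h := (compHom X.as Y.as Z.as f).map_add g h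

noncomputable instance instLinear8 : Linear k (Linearization k C) where
  homModule X Y := inferInstanceAs (Module k ((X.as ⟶ Y.as) →₀ k))
  smul_comp X Y Z r f g := LinearMap.map_smul₂ (compHom X.as Y.as Z.as) r f g
  comp_smul X Y Z f r g := (compHom X.as Y.as Z.as f).map_smul r g

/-- The basis vector given by a morphism of `C`. -/
noncomputable def lin {X Y : Linearization k C} (f : X.as ⟶ Y.as) : X ⟶ Y := Finsupp.single f 1

theorem lin_comp {X Y Z : Linearization k C} (f : X.as ⟶ Y.as) (g : Y.as ⟶ Z.as) :
    (lin f ≫ lin g : X ⟶ Z) = lin (f ≫ g) :=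
  (compHom_single f g 1 1).trans (by rw [mul_one]; rfl)

theorem lin_id (X : Linearization k C) : lin (𝟙 X.as) = 𝟙 X := rfl

theorem lin_induction {X Y : Linearization k C} {P : (X ⟶ Y) → Prop} (h0 : P 0)
    (hadd : ∀ f g, P f → P g → P (f + g))
    (hlin : ∀ (r : k) (f : X.as ⟶ Y.as), P (r • lin f)) (f : X ⟶ Y) : P f := by
  refine Finsupp.induction_linear f h0 hadd fun f r => ?_
  have : (Finsupp.single f r : X ⟶ Y) = r • lin f := by
    refine Eq.symm ((Finsupp.smul_single r f (1 : k)).trans ?_)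
    rw [smul_eq_mul, mul_one]
  rw [this]
  exact hlin r f

/-- Linear extension of a map defined on morphisms. -/
noncomputable def ext {X Y X' Y' : Linearization k C} (φ : (X.as ⟶ Y.as) → (X'.as ⟶ Y'.as)) :
    (X ⟶ Y) →ₗ[k] (X' ⟶ Y') :=
  Finsupp.lmapDomain k k φ

theorem ext_lin {X Y X' Y' : Linearization k C} (φ : (X.as ⟶ Y.as) → (X'.as ⟶ Y'.as))
    (f : X.as ⟶ Y.as) : ext (k := k) φ (lin f) = lin (φ f) :=
  Finsupp.mapDomain_single

/-- Isomorphisms of `C` are isomorphisms of the linearization. -/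
noncomputable abbrev linIso {X Y : Linearization k C} (e : X.as ≅ Y.as) : X ≅ Y where
  hom := lin e.hom
  inv := lin e.inv
  hom_inv_id := by rw [lin_comp, e.hom_inv_id, lin_id]
  inv_hom_id := by rw [lin_comp, e.inv_hom_id, lin_id]

variable [MonoidalCategory C]

/-- The tensor product is extended bilinearly. -/
noncomputable instance instMonoidalCategoryStruct9 : MonoidalCategoryStruct (Linearization k C) where
  tensorObj X Y := ⟨X.as ⊗ Y.as⟩
  whiskerLeft X _ _ f := ext (fun g => X.as ◁ g) f
  whiskerRight f Y := ext (fun g => g ▷ Y.as) f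
  tensorUnit := ⟨𝟙_ C⟩
  associator X Y Z := linIso (α_ X.as Y.as Z.as)
  leftUnitor X := linIso (λ_ X.as)
  rightUnitor X := linIso (ρ_ X.as)

section
variable {X Y Z : Linearization k C}

theorem wl_lin (f : Y.as ⟶ Z.as) : X ◁ (lin f : Y ⟶ Z) = lin (X.as ◁ f) := ext_lin _ _

theorem wr_lin (f : Y.as ⟶ Z.as) : (lin f : Y ⟶ Z) ▷ X = lin (f ▷ X.as) := ext_lin _ _

theorem wl_add (f g : Y ⟶ Z) : X ◁ (f + g) = X ◁ f + X ◁ g := map_add (ext _) f g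

theorem wr_add (f g : Y ⟶ Z) : (f + g) ▷ X = f ▷ X + g ▷ X := map_add (ext _) f g

theorem wl_smul (r : k) (f : Y ⟶ Z) : X ◁ (r • f) = r • (X ◁ f) := map_smul (ext _) r f

theorem wr_smul (r : k) (f : Y ⟶ Z) : (r • f) ▷ X = r • (f ▷ X) := map_smul (ext _) r f

theorem wl_zero : X ◁ (0 : Y ⟶ Z) = 0 := map_zero (ext _)

theorem wr_zero : (0 : Y ⟶ Z) ▷ X = 0 := map_zero (ext _)

end

noncomputable instance instMonoidalCategory10 : MonoidalCategory (Linearization k C) :=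
  ofWhisker inferInstance
    (hom := fun _ _ => rfl)
    (wl_id := fun X Y => by
      rw [← lin_id, wl_lin, MonoidalCategory.whiskerLeft_id]; rfl)
    (wr_id := fun X Y => by
      rw [← lin_id, wr_lin, MonoidalCategory.id_whiskerRight]; rfl)
    (wl_comp := fun X {Y Z W} f g => by
      induction f using lin_induction with
      | h0 => simp only [zero_comp, wl_zero]
      | hadd f f' hf hf' => simp only [Preadditive.add_comp, wl_add, hf, hf']
      | hlin r f =>
      induction g using lin_induction with
      | h0 => simp only [comp_zero, wl_zero]
      | hadd f f' hf hf' => simp only [Preadditive.comp_add, wl_add, hf, hf']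
      | hlin s g =>
      simp only [wl_smul, Linear.comp_smul, Linear.smul_comp, lin_comp, wl_lin,
        MonoidalCategory.whiskerLeft_comp])
    (wr_comp := fun {Y Z W} f g X => by
      induction f using lin_induction with
      | h0 => simp only [zero_comp, wr_zero]
      | hadd f f' hf hf' => simp only [Preadditive.add_comp, wr_add, hf, hf']
      | hlin r f =>
      induction g using lin_induction with
      | h0 => simp only [comp_zero, wr_zero]
      | hadd f f' hf hf' => simp only [Preadditive.comp_add, wr_add, hf, hf']
      | hlin s g =>
      simp only [wr_smul, Linear.comp_smul, Linear.smul_comp, lin_comp, wr_lin,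
        MonoidalCategory.comp_whiskerRight])
    (exch := fun {W X Y Z} f g => by
      induction f using lin_induction with
      | h0 => simp only [comp_zero, zero_comp, wr_zero]
      | hadd f f' hf hf' => simp only [Preadditive.add_comp, Preadditive.comp_add, wr_add, hf, hf']
      | hlin r f =>
      induction g using lin_induction with
      | h0 => simp only [comp_zero, zero_comp, wl_zero]
      | hadd f f' hf hf' => simp only [Preadditive.add_comp, Preadditive.comp_add, wl_add, hf, hf']
      | hlin s g =>
      simp only [wr_smul, wl_smul, Linear.comp_smul, Linear.smul_comp, wr_lin, wl_lin]
      erw [lin_comp, lin_comp]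
      rw [MonoidalCategory.whisker_exchange, smul_comm])
    (nat₁ := fun f Y Z => by
      induction f using lin_induction with
      | h0 => simp only [comp_zero, zero_comp, wr_zero]
      | hadd f f' hf hf' => simp only [Preadditive.add_comp, Preadditive.comp_add, wr_add, hf, hf']
      | hlin r f =>
      simp only [wr_smul, Linear.comp_smul, Linear.smul_comp, wr_lin]
      congr 1
      exact (lin_comp _ _).trans
        ((congrArg lin (MonoidalCategory.associator_naturality_left f Y.as Z.as)).trans
          (lin_comp _ _).symm))
    (nat₂ := fun X {Y Y'} f Z => by
      induction f using lin_induction with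
      | h0 => simp only [comp_zero, zero_comp, wr_zero, wl_zero]
      | hadd f f' hf hf' =>
        simp only [Preadditive.add_comp, Preadditive.comp_add, wr_add, wl_add, hf, hf']
      | hlin r f =>
      simp only [wr_smul, wl_smul, Linear.comp_smul, Linear.smul_comp, wr_lin, wl_lin]
      congr 1
      exact (lin_comp _ _).trans
        ((congrArg lin (MonoidalCategory.associator_naturality_middle X.as f Z.as)).trans
          (lin_comp _ _).symm))
    (nat₃ := fun X Y {Z Z'} f => by
      induction f using lin_induction with
      | h0 => simp only [comp_zero, zero_comp, wl_zero]
      | hadd f f' hf hf' =>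
        simp only [Preadditive.add_comp, Preadditive.comp_add, wl_add, hf, hf']
      | hlin r f =>
      simp only [wl_smul, Linear.comp_smul, Linear.smul_comp, wl_lin]
      congr 1
      exact (lin_comp _ _).trans
        ((congrArg lin (MonoidalCategory.associator_naturality_right X.as Y.as f)).trans
          (lin_comp _ _).symm))
    (natl := fun {X Y} f => by
      induction f using lin_induction with
      | h0 => simp only [comp_zero, zero_comp, wl_zero]
      | hadd f f' hf hf' =>
        simp only [Preadditive.add_comp, Preadditive.comp_add, wl_add, hf, hf']
      | hlin r f =>
      simp only [wl_smul, Linear.comp_smul, Linear.smul_comp, wl_lin]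
      congr 1
      exact (lin_comp _ _).trans
        ((congrArg lin (MonoidalCategory.leftUnitor_naturality f)).trans (lin_comp _ _).symm))
    (natr := fun {X Y} f => by
      induction f using lin_induction with
      | h0 => simp only [comp_zero, zero_comp, wr_zero]
      | hadd f f' hf hf' =>
        simp only [Preadditive.add_comp, Preadditive.comp_add, wr_add, hf, hf']
      | hlin r f =>
      simp only [wr_smul, Linear.comp_smul, Linear.smul_comp, wr_lin]
      congr 1
      exact (lin_comp _ _).trans
        ((congrArg lin (MonoidalCategory.rightUnitor_naturality f)).trans (lin_comp _ _).symm))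
    (pent := fun W X Y Z => by
      have e₁ : (α_ W X Y).hom ▷ Z = lin ((α_ W.as X.as Y.as).hom ▷ Z.as) := wr_lin _
      have e₂ : W ◁ (α_ X Y Z).hom = lin (W.as ◁ (α_ X.as Y.as Z.as).hom) := wl_lin _
      rw [e₁, e₂]
      exact (_ ≫= lin_comp _ _).trans ((lin_comp _ _).trans
        ((congrArg lin (MonoidalCategory.pentagon W.as X.as Y.as Z.as)).trans
          (lin_comp _ _).symm)))
    (tri := fun X Y => by
      have e₁ : (ρ_ X).hom ▷ Y = lin ((ρ_ X.as).hom ▷ Y.as) := wr_lin _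
      have e₂ : X ◁ (λ_ Y).hom = lin (X.as ◁ (λ_ Y.as).hom) := wl_lin _
      rw [e₁, e₂]
      exact (lin_comp _ _).trans (congrArg lin (MonoidalCategory.triangle X.as Y.as)))

instance instMonoidalPreadditive11 : MonoidalPreadditive (Linearization k C) where
  whiskerLeft_zero := wl_zero
  zero_whiskerRight := wr_zero
  whiskerLeft_add := wl_add
  add_whiskerRight := wr_add

instance instMonoidalLinear12 : MonoidalLinear k (Linearization k C) where
  whiskerLeft_smul _ _ _ r f := wl_smul r f
  smul_whiskerRight r _ _ f _ := wr_smul r f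

end Linearization

end Linearization

/-! ### Quotients by tensor ideals -/

section TensorIdeal

/-- A tensor ideal of a `k`-linear monoidal category. -/
structure TensorIdeal (k : Type u) [CommRing k] (C : Type v) [Category.{w} C] [Preadditive C]
    [Linear k C] [MonoidalCategory C] where
  sub (X Y : C) : Submodule k (X ⟶ Y)
  comp_left {X Y Z : C} (f : X ⟶ Y) {g : Y ⟶ Z} : g ∈ sub Y Z → f ≫ g ∈ sub X Z
  comp_right {X Y Z : C} {f : X ⟶ Y} (g : Y ⟶ Z) : f ∈ sub X Y → f ≫ g ∈ sub X Z
  whisker_left (X : C) {Y Z : C} {f : Y ⟶ Z} : f ∈ sub Y Z → X ◁ f ∈ sub (X ⊗ Y) (X ⊗ Z)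
  whisker_right {Y Z : C} {f : Y ⟶ Z} (X : C) : f ∈ sub Y Z → f ▷ X ∈ sub (Y ⊗ X) (Z ⊗ X)

namespace TensorIdeal

variable {k : Type u} [CommRing k] {C : Type v} [Category.{w} C] [Preadditive C]
    [Linear k C] [MonoidalCategory C]

/-- The morphisms in the tensor ideal generated by `R`. -/
inductive Generated (k : Type u) [CommRing k] {C : Type v} [Category.{w} C] [Preadditive C]
    [Linear k C] [MonoidalCategory C] (R : ∀ ⦃X Y : C⦄, (X ⟶ Y) → Prop) :
    ∀ {X Y : C}, (X ⟶ Y) → Prop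
  | of {X Y : C} (f : X ⟶ Y) : R f → Generated k R f
  | zero (X Y : C) : Generated k R (0 : X ⟶ Y)
  | add {X Y : C} (f g : X ⟶ Y) : Generated k R f → Generated k R g → Generated k R (f + g)
  | smul {X Y : C} (r : k) (f : X ⟶ Y) : Generated k R f → Generated k R (r • f)
  | comp_left {X Y Z : C} (f : X ⟶ Y) (g : Y ⟶ Z) : Generated k R g → Generated k R (f ≫ g)
  | comp_right {X Y Z : C} (f : X ⟶ Y) (g : Y ⟶ Z) : Generated k R f → Generated k R (f ≫ g)
  | whisker_left (X : C) {Y Z : C} (f : Y ⟶ Z) : Generated k R f → Generated k R (X ◁ f)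
  | whisker_right {Y Z : C} (f : Y ⟶ Z) (X : C) : Generated k R f → Generated k R (f ▷ X)

/-- The tensor ideal generated by a collection of morphisms. -/
def generate (k : Type u) [CommRing k] {C : Type v} [Category.{w} C] [Preadditive C]
    [Linear k C] [MonoidalCategory C] (R : ∀ ⦃X Y : C⦄, (X ⟶ Y) → Prop) : TensorIdeal k C where
  sub X Y :=
    { carrier := {f | Generated k R f}
      zero_mem' := .zero X Y
      add_mem' := fun hf hg => .add _ _ hf hg
      smul_mem' := fun r _ hf => .smul r _ hf }
  comp_left f _ hg := .comp_left f _ hg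
  comp_right g hf := .comp_right _ g hf
  whisker_left X _ _ _ hf := .whisker_left X _ hf
  whisker_right X hf := .whisker_right _ X hf

variable (I : TensorIdeal k C)

/-- The quotient of a category by a tensor ideal: it has the same objects, and the morphisms are
the classes of morphisms modulo the ideal. -/
structure Quot (I : TensorIdeal k C) where
  as : C

namespace Quot

variable {I}

instance instCategory13 : Category I.Quot where
  Hom X Y := (X.as ⟶ Y.as) ⧸ I.sub X.as Y.as
  id X := Submodule.Quotient.mk (𝟙 X.as)
  comp {X Y Z} f g := Quotient.liftOn₂' f g
    (fun f g => Submodule.Quotient.mk (p := I.sub X.as Z.as) (f ≫ g)) (by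
      intro f g f' g' h h'
      have h₁ := (Submodule.quotientRel_def _).1 h
      have h₂ := (Submodule.quotientRel_def _).1 h'
      refine (Submodule.Quotient.eq _).2 ?_
      have : f ≫ g - f' ≫ g' = (f - f') ≫ g + f' ≫ (g - g') := by
        rw [Preadditive.sub_comp, Preadditive.comp_sub]; abel
      rw [this]
      exact Submodule.add_mem _ (I.comp_right _ h₁) (I.comp_left _ h₂))
  id_comp f := by
    induction f using Submodule.Quotient.induction_on with | H f => ?_
    exact congrArg Submodule.Quotient.mk (Category.id_comp f)
  comp_id f := by
    induction f using Submodule.Quotient.induction_on with | H f => ?_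
    exact congrArg Submodule.Quotient.mk (Category.comp_id f)
  assoc f g h := by
    induction f using Submodule.Quotient.induction_on with | H f => ?_
    induction g using Submodule.Quotient.induction_on with | H g => ?_
    induction h using Submodule.Quotient.induction_on with | H h => ?_
    exact congrArg Submodule.Quotient.mk (Category.assoc f g h)

/-- The class of a morphism. -/
def cls {X Y : I.Quot} (f : X.as ⟶ Y.as) : X ⟶ Y := Submodule.Quotient.mk f

theorem cls_surj {X Y : I.Quot} (f : X ⟶ Y) : ∃ g : X.as ⟶ Y.as, cls g = f :=
  Submodule.Quotient.mk_surjective _ f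

theorem cls_eq {X Y : I.Quot} (f g : X.as ⟶ Y.as) :
    (cls f : X ⟶ Y) = cls g ↔ f - g ∈ I.sub X.as Y.as := Submodule.Quotient.eq _

theorem cls_comp {X Y Z : I.Quot} (f : X.as ⟶ Y.as) (g : Y.as ⟶ Z.as) :
    (cls (f ≫ g) : X ⟶ Z) = (cls f : X ⟶ Y) ≫ cls g := rfl

theorem cls_id (X : I.Quot) : cls (𝟙 X.as) = 𝟙 X := rfl

instance instPreadditive14 : Preadditive I.Quot where
  homGroup X Y := inferInstanceAs (AddCommGroup ((X.as ⟶ Y.as) ⧸ I.sub X.as Y.as))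
  add_comp X Y Z f f' g := by
    obtain ⟨f, rfl⟩ := cls_surj f
    obtain ⟨f', rfl⟩ := cls_surj f'
    obtain ⟨g, rfl⟩ := cls_surj g
    exact congrArg cls (Preadditive.add_comp _ _ _ f f' g)
  comp_add X Y Z f g g' := by
    obtain ⟨f, rfl⟩ := cls_surj f
    obtain ⟨g, rfl⟩ := cls_surj g
    obtain ⟨g', rfl⟩ := cls_surj g'
    exact congrArg cls (Preadditive.comp_add _ _ _ f g g')

instance instLinear15 : Linear k I.Quot where
  homModule X Y := inferInstanceAs (Module k ((X.as ⟶ Y.as) ⧸ I.sub X.as Y.as))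
  smul_comp X Y Z r f g := by
    obtain ⟨f, rfl⟩ := cls_surj f
    obtain ⟨g, rfl⟩ := cls_surj g
    exact congrArg cls (Linear.smul_comp _ _ _ r f g)
  comp_smul X Y Z f r g := by
    obtain ⟨f, rfl⟩ := cls_surj f
    obtain ⟨g, rfl⟩ := cls_surj g
    exact congrArg cls (Linear.comp_smul _ _ _ f r g)

theorem cls_add {X Y : I.Quot} (f g : X.as ⟶ Y.as) : (cls (f + g) : X ⟶ Y) = cls f + cls g := rfl

theorem cls_smul {X Y : I.Quot} (r : k) (f : X.as ⟶ Y.as) : (cls (r • f) : X ⟶ Y) = r • cls f := rfl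

theorem cls_zero {X Y : I.Quot} : (cls 0 : X ⟶ Y) = 0 := rfl

/-- The class of an isomorphism. -/
abbrev clsIso {X Y : I.Quot} (e : X.as ≅ Y.as) : X ≅ Y where
  hom := cls e.hom
  inv := cls e.inv
  hom_inv_id := congrArg cls e.hom_inv_id
  inv_hom_id := congrArg cls e.inv_hom_id

variable [MonoidalPreadditive C]

/-- The tensor product of classes of morphisms is the class of the tensor product. -/
instance instMonoidalCategoryStruct16 : MonoidalCategoryStruct I.Quot where
  tensorObj X Y := ⟨X.as ⊗ Y.as⟩
  whiskerLeft X Y Z f := Quotient.liftOn' f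
    (fun f => (cls (X.as ◁ f) : (⟨X.as ⊗ Y.as⟩ : I.Quot) ⟶ ⟨X.as ⊗ Z.as⟩)) (by
      intro f f' h
      have h₁ := (Submodule.quotientRel_def _).1 h
      rw [cls_eq]
      have : X.as ◁ f - X.as ◁ f' = X.as ◁ (f - f') :=
        ((tensorLeft X.as).map_sub (f := f) (g := f')).symm
      rw [this]
      exact I.whisker_left _ h₁)
  whiskerRight {Y Z} f X := Quotient.liftOn' f
    (fun f => (cls (f ▷ X.as) : (⟨Y.as ⊗ X.as⟩ : I.Quot) ⟶ ⟨Z.as ⊗ X.as⟩)) (by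
      intro f f' h
      have h₁ := (Submodule.quotientRel_def _).1 h
      rw [cls_eq]
      have : f ▷ X.as - f' ▷ X.as = (f - f') ▷ X.as :=
        ((tensorRight X.as).map_sub (f := f) (g := f')).symm
      rw [this]
      exact I.whisker_right _ h₁)
  tensorUnit := ⟨𝟙_ C⟩
  associator X Y Z := clsIso (α_ X.as Y.as Z.as)
  leftUnitor X := clsIso (λ_ X.as)
  rightUnitor X := clsIso (ρ_ X.as)

instance instMonoidalCategory17 : MonoidalCategory I.Quot :=
  ofWhisker inferInstance
    (hom := fun _ _ => rfl)
    (wl_id := fun X Y => congrArg cls (MonoidalCategory.whiskerLeft_id X.as Y.as))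
    (wr_id := fun X Y => congrArg cls (MonoidalCategory.id_whiskerRight X.as Y.as))
    (wl_comp := fun X {Y Z W} f g => by
      obtain ⟨f, rfl⟩ := cls_surj f
      obtain ⟨g, rfl⟩ := cls_surj g
      exact congrArg cls (MonoidalCategory.whiskerLeft_comp X.as f g))
    (wr_comp := fun f g X => by
      obtain ⟨f, rfl⟩ := cls_surj f
      obtain ⟨g, rfl⟩ := cls_surj g
      exact congrArg cls (MonoidalCategory.comp_whiskerRight f g X.as))
    (exch := fun f g => by
      obtain ⟨f, rfl⟩ := cls_surj f
      obtain ⟨g, rfl⟩ := cls_surj g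
      exact congrArg cls (MonoidalCategory.whisker_exchange f g))
    (nat₁ := fun f Y Z => by
      obtain ⟨f, rfl⟩ := cls_surj f
      exact congrArg cls (MonoidalCategory.associator_naturality_left f Y.as Z.as))
    (nat₂ := fun X {Y Y'} f Z => by
      obtain ⟨f, rfl⟩ := cls_surj f
      exact congrArg cls (MonoidalCategory.associator_naturality_middle X.as f Z.as))
    (nat₃ := fun X Y {Z Z'} f => by
      obtain ⟨f, rfl⟩ := cls_surj f
      exact congrArg cls (MonoidalCategory.associator_naturality_right X.as Y.as f))
    (natl := fun f => by
      obtain ⟨f, rfl⟩ := cls_surj f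
      exact congrArg cls (MonoidalCategory.leftUnitor_naturality f))
    (natr := fun f => by
      obtain ⟨f, rfl⟩ := cls_surj f
      exact congrArg cls (MonoidalCategory.rightUnitor_naturality f))
    (pent := fun W X Y Z => congrArg cls (MonoidalCategory.pentagon W.as X.as Y.as Z.as))
    (tri := fun X Y => congrArg cls (MonoidalCategory.triangle X.as Y.as))

instance instMonoidalPreadditive18 : MonoidalPreadditive I.Quot where
  whiskerLeft_zero := congrArg cls MonoidalPreadditive.whiskerLeft_zero
  zero_whiskerRight := congrArg cls MonoidalPreadditive.zero_whiskerRight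
  whiskerLeft_add f g := by
    obtain ⟨f, rfl⟩ := cls_surj f
    obtain ⟨g, rfl⟩ := cls_surj g
    exact congrArg cls (MonoidalPreadditive.whiskerLeft_add f g)
  add_whiskerRight f g := by
    obtain ⟨f, rfl⟩ := cls_surj f
    obtain ⟨g, rfl⟩ := cls_surj g
    exact congrArg cls (MonoidalPreadditive.add_whiskerRight f g)

instance instMonoidalLinear19 [MonoidalLinear k C] : MonoidalLinear k I.Quot where
  whiskerLeft_smul X _ _ r f := by
    obtain ⟨f, rfl⟩ := cls_surj f
    exact congrArg cls (MonoidalLinear.whiskerLeft_smul X.as r f)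
  smul_whiskerRight r _ _ f X := by
    obtain ⟨f, rfl⟩ := cls_surj f
    exact congrArg cls (MonoidalLinear.smul_whiskerRight r f X.as)

end Quot

end TensorIdeal

end TensorIdeal

/-! ### Skein categories -/

section SCob

open Polynomial

variable (k : Type u) [Field k]

/-- The degree of the rational function `p / q`: the maximum of `deg p + 1` and `deg q`, where
the zero polynomial has degree `-1`. -/
noncomputable def kdeg {k : Type u} [Field k] (p q : k[X]) : ℕ :=
  open Classical in max (if p = 0 then 0 else p.natDegree + 1) q.natDegree

/-- The polynomial `t ^ kdeg * q (1 / t)`. -/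
noncomputable def uPoly {k : Type u} [Field k] (p q : k[X]) : k[X] := q.reflect (kdeg p q)

/-- The `k`-linear category of two-dimensional cobordisms. -/
abbrev LinCob : Type := Linearization k Cob

/-- The object `[n]`. -/
abbrev LinCob.obj (n : ℕ) : LinCob k := ⟨Cob.obj n⟩

/-- The skein relations: a closed surface of genus `i` is the scalar `α i`, and the polynomial `u`
annihilates the handle. -/
inductive SkeinRel {k : Type u} [Field k] (α : ℕ → k) (u : k[X]) :
    ∀ ⦃X Y : LinCob k⦄, (X ⟶ Y) → Prop
  | closed (i : ℕ) : SkeinRel α u (X := LinCob.obj k 0) (Y := LinCob.obj k 0)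
      (Linearization.lin (k := k) (X := LinCob.obj k 0) (Y := LinCob.obj k 0) (Cob.closed i) - α i • 𝟙 (LinCob.obj k 0))
  | handle : SkeinRel α u (X := LinCob.obj k 1) (Y := LinCob.obj k 1)
      (u.sum fun i a => a • Linearization.lin (k := k) (X := LinCob.obj k 1) (Y := LinCob.obj k 1)
        (Cob.handle ^ i : End (Cob.obj 1)))

/-- The skein category: the quotient of the linearized cobordism category by the tensor ideal
generated by the skein relations. -/
abbrev SCob {k : Type u} [Field k] (α : ℕ → k) (u : k[X]) : Type :=
  (TensorIdeal.generate k (SkeinRel α u)).Quot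

/-- The object `[n]`. -/
abbrev SCob.obj {k : Type u} [Field k] (α : ℕ → k) (u : k[X]) (n : ℕ) : SCob α u :=
  ⟨LinCob.obj k n⟩

end SCob

/-! ### Additive envelopes of monoidal categories -/

section Mat

namespace Mat

variable {C : Type u} [Category.{v} C] [Preadditive C]

open Classical in
/-- The matrix with entries `f i` in the positions `(i, e i)`, and zeros elsewhere. -/
noncomputable def mono {M N : Mat_ C} (e : M.ι → N.ι) (f : ∀ i, M.X i ⟶ N.X (e i)) : M ⟶ N :=
  fun i j => if h : e i = j then f i ≫ eqToHom (congrArg N.X h) else 0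

open Classical in
/-- The matrix with entries `f i` in the positions `(e i, i)`, and zeros elsewhere. -/
noncomputable def comono {M N : Mat_ C} (e : M.ι → N.ι) (f : ∀ i, N.X (e i) ⟶ M.X i) : N ⟶ M :=
  fun j i => if h : e i = j then eqToHom (congrArg N.X h.symm) ≫ f i else 0

section
variable {M N K : Mat_ C}

theorem mono_self (e : M.ι → N.ι) (f : ∀ i, M.X i ⟶ N.X (e i)) (i : M.ι) :
    mono e f i (e i) = f i := by
  simp [mono]

theorem mono_ne (e : M.ι → N.ι) (f : ∀ i, M.X i ⟶ N.X (e i)) (i : M.ι) (j : N.ι) (h : e i ≠ j) :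
    mono e f i j = 0 := by
  simp [mono, h]

theorem mono_comp (e : M.ι → N.ι) (f : ∀ i, M.X i ⟶ N.X (e i)) (g : N ⟶ K) (i : M.ι) (j : K.ι) :
    (mono e f ≫ g) i j = f i ≫ g (e i) j := by
  rw [Mat_.comp_apply, Finset.sum_eq_single (e i), mono_self]
  · intro b _ hb
    rw [mono_ne _ _ _ _ hb.symm, Limits.zero_comp]
  · simp

theorem comp_mono (f : M ⟶ N) (e : N.ι → K.ι) (he : Function.Injective e)
    (g : ∀ i, N.X i ⟶ K.X (e i)) (i : M.ι) (j : N.ι) :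
    (f ≫ mono e g) i (e j) = f i j ≫ g j := by
  rw [Mat_.comp_apply, Finset.sum_eq_single j, mono_self]
  · intro b _ hb
    rw [mono_ne _ _ _ _ (fun h => hb (he h)), Limits.comp_zero]
  · simp

theorem hom_ext_surj {f g : M ⟶ N} {J : Type} (e : J → N.ι) (he : Function.Surjective e)
    (h : ∀ i j, f i (e j) = g i (e j)) : f = g := by
  ext i j
  obtain ⟨j, rfl⟩ := he j
  exact h i j

theorem mono_comp_mono (e : M.ι → N.ι) (f : ∀ i, M.X i ⟶ N.X (e i))
    (e' : N.ι → K.ι) (g : ∀ i, N.X i ⟶ K.X (e' i)) :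
    mono e f ≫ mono e' g = mono (fun i => e' (e i)) (fun i => f i ≫ g (e i)) := by
  ext i j
  rw [mono_comp]
  by_cases h : e' (e i) = j
  · subst h
    rw [mono_self]
    exact (mono_self (fun i => e' (e i)) (fun i => f i ≫ g (e i)) i).symm
  · rw [mono_ne _ _ _ _ h, Limits.comp_zero]
    exact (mono_ne (fun i => e' (e i)) _ i j h).symm

theorem mono_id : mono (fun i => i) (fun i => 𝟙 (M.X i)) = 𝟙 M := by
  ext i j
  by_cases h : i = j
  · subst h
    rw [Mat_.id_apply_self, mono_self]
  · rw [Mat_.id_apply_of_ne _ _ _ h, mono_ne _ _ _ _ h]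

theorem comono_self (e : M.ι → N.ι) (f : ∀ i, N.X (e i) ⟶ M.X i) (i : M.ι) :
    comono e f (e i) i = f i := by
  simp [comono]

theorem comono_ne (e : M.ι → N.ι) (f : ∀ i, N.X (e i) ⟶ M.X i) (i : M.ι) (j : N.ι) (h : e i ≠ j) :
    comono e f j i = 0 := by
  simp [comono, h]

/-- The isomorphism given by isomorphisms between the entries. -/
noncomputable abbrev monoIso (e : M.ι → N.ι) (he : Function.Bijective e)
    (f : ∀ i, M.X i ≅ N.X (e i)) : M ≅ N where
  hom := mono e fun i => (f i).hom
  inv := comono e fun i => (f i).inv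
  hom_inv_id := by
    ext i j
    rw [mono_comp]
    by_cases h : i = j
    · subst h
      rw [comono_self, Mat_.id_apply_self, Iso.hom_inv_id]
    · rw [Mat_.id_apply_of_ne _ _ _ h,
        comono_ne _ _ _ _ (fun h' => h (he.1 h'.symm)), Limits.comp_zero]
  inv_hom_id := by
    refine hom_ext_surj e he.2 fun i j => ?_
    obtain ⟨i, rfl⟩ := he.2 i
    rw [comp_mono _ _ he.1]
    by_cases h : i = j
    · subst h
      rw [comono_self, Mat_.id_apply_self, Iso.inv_hom_id]
    · rw [Mat_.id_apply_of_ne _ _ _ (fun h' => h (he.1 h')),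
        comono_ne _ _ _ _ (fun h' => h (he.1 h'.symm)), Limits.zero_comp]

end

section Linear

variable {k : Type w} [CommRing k] [Linear k C]

instance instLinear20 : Linear k (Mat_ C) where
  homModule M N := inferInstanceAs (Module k (∀ i : M.ι, ∀ j : N.ι, M.X i ⟶ N.X j))
  smul_comp M N K r f g := by
    ext i j
    change ∑ l, (r • f i l) ≫ g l j = r • ∑ l, f i l ≫ g l j
    simp only [Linear.smul_comp, Finset.smul_sum]
  comp_smul M N K f r g := by
    ext i j
    change ∑ l, f i l ≫ (r • g l j) = r • ∑ l, f i l ≫ g l j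
    simp only [Linear.comp_smul, Finset.smul_sum]

end Linear

variable [MonoidalCategory C]

/-- The tensor product of tuples. -/
abbrev tObj (M N : Mat_ C) : Mat_ C := ⟨M.ι × N.ι, fun i => M.X i.1 ⊗ N.X i.2⟩

/-- The tensor product (Kronecker product) of matrices. -/
def tHom {M M' N N' : Mat_ C} (f : M ⟶ M') (g : N ⟶ N') : tObj M N ⟶ tObj M' N' :=
  fun i j => f i.1 j.1 ⊗ₘ g i.2 j.2

variable [MonoidalPreadditive C]

theorem tHom_mono {M M' N N' : Mat_ C} (e : M.ι → M'.ι) (f : ∀ i, M.X i ⟶ M'.X (e i))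
    (e' : N.ι → N'.ι) (f' : ∀ i, N.X i ⟶ N'.X (e' i)) :
    tHom (mono e f) (mono e' f') =
      mono (M := tObj M N) (N := tObj M' N') (fun i => (e i.1, e' i.2))
        (fun i => f i.1 ⊗ₘ f' i.2) := by
  ext i ⟨j, j'⟩
  change mono e f i.1 j ⊗ₘ mono e' f' i.2 j' = _
  by_cases h : e i.1 = j
  · subst h
    by_cases h' : e' i.2 = j'
    · subst h'
      rw [mono_self, mono_self]
      exact (mono_self (M := tObj M N) (N := tObj M' N') (fun i => (e i.1, e' i.2))
        (fun i => f i.1 ⊗ₘ f' i.2) i).symm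
    · rw [mono_ne e' _ _ _ h', MonoidalPreadditive.tensor_zero,
        mono_ne (M := tObj M N) (N := tObj M' N') _ _ _ _ (fun h => h' (congrArg Prod.snd h))]
  · rw [mono_ne e _ _ _ h, MonoidalPreadditive.zero_tensor,
      mono_ne (M := tObj M N) (N := tObj M' N') _ _ _ _ (fun h' => h (congrArg Prod.fst h'))]

theorem tHom_id (M N : Mat_ C) : tHom (𝟙 M) (𝟙 N) = 𝟙 (tObj M N) := by
  rw [← mono_id, ← mono_id, tHom_mono, ← mono_id]
  congr 1
  funext i
  exact MonoidalCategory.id_tensorHom_id _ _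

theorem tHom_comp {M M' M'' N N' N'' : Mat_ C} (f : M ⟶ M') (g : N ⟶ N') (f' : M' ⟶ M'')
    (g' : N' ⟶ N'') : tHom f g ≫ tHom f' g' = tHom (f ≫ f') (g ≫ g') := by
  ext i j
  change ∑ l : M'.ι × N'.ι, (f i.1 l.1 ⊗ₘ g i.2 l.2) ≫ (f' l.1 j.1 ⊗ₘ g' l.2 j.2) =
    (∑ l, f i.1 l ≫ f' l j.1) ⊗ₘ (∑ l, g i.2 l ≫ g' l j.2)
  simp only [sum_tensor, tensor_sum, tensorHom_comp_tensorHom, Fintype.sum_prod_type]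
  exact Finset.sum_comm

variable (C) in
/-- The unit object, a tuple of length one. -/
abbrev tUnit : Mat_ C := ⟨Unit, fun _ => 𝟙_ C⟩

/-- `(M ⊗ N) ⊗ K ≅ M ⊗ (N ⊗ K)` -/
noncomputable abbrev assocIso (M N K : Mat_ C) : tObj (tObj M N) K ≅ tObj M (tObj N K) :=
  monoIso (M := tObj (tObj M N) K) (N := tObj M (tObj N K)) (fun i => (i.1.1, (i.1.2, i.2)))
    (Equiv.prodAssoc M.ι N.ι K.ι).bijective fun i => α_ (M.X i.1.1) (N.X i.1.2) (K.X i.2)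

/-- `𝟙 ⊗ M ≅ M` -/
noncomputable abbrev leftIso (M : Mat_ C) : tObj (tUnit C) M ≅ M :=
  monoIso (M := tObj (tUnit C) M) (fun i => i.2) (Equiv.punitProd M.ι).bijective
    fun i => λ_ (M.X i.2)

/-- `M ⊗ 𝟙 ≅ M` -/
noncomputable abbrev rightIso (M : Mat_ C) : tObj M (tUnit C) ≅ M :=
  monoIso (M := tObj M (tUnit C)) (fun i => i.1) (Equiv.prodPUnit M.ι).bijective
    fun i => ρ_ (M.X i.1)

/-- The monoidal structure on the additive envelope. -/
noncomputable instance instMonoidalCategory21 : MonoidalCategory (Mat_ C) :=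
  letI : MonoidalCategoryStruct (Mat_ C) :=
    { tensorObj := tObj
      tensorHom := tHom
      whiskerLeft := fun M _ _ f => tHom (𝟙 M) f
      whiskerRight := fun f M => tHom f (𝟙 M)
      tensorUnit := tUnit C
      associator := assocIso
      leftUnitor := leftIso
      rightUnitor := rightIso }
  MonoidalCategory.ofTensorHom
    (id_tensorHom_id := tHom_id)
    (id_tensorHom := fun _ _ _ _ => rfl)
    (tensorHom_id := fun _ _ => rfl)
    (tensorHom_comp_tensorHom := tHom_comp)
    (associator_naturality := fun {M N K M' N' K'} f g h => by
      refine hom_ext_surj _ (Equiv.prodAssoc M'.ι N'.ι K'.ι).surjective fun i j => ?_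
      refine (comp_mono (M := tObj (tObj M N) K) (N := tObj (tObj M' N') K')
        (K := tObj M' (tObj N' K')) _ _ (Equiv.prodAssoc M'.ι N'.ι K'.ι).injective _ i j).trans
        (Eq.trans ?_ (mono_comp (M := tObj (tObj M N) K) (N := tObj M (tObj N K))
        (K := tObj M' (tObj N' K')) _ _ _ i _).symm)
      exact MonoidalCategory.associator_naturality _ _ _)
    (leftUnitor_naturality := fun {M N} f => by
      refine hom_ext_surj _ (Equiv.punitProd N.ι).surjective fun i j => ?_
      refine (comp_mono (M := tObj (tUnit C) M) (N := tObj (tUnit C) N) (K := N) _ _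
        (Equiv.punitProd N.ι).injective _ i j).trans
        (Eq.trans ?_ (mono_comp (M := tObj (tUnit C) M) (N := M) (K := N) _ _ _ i _).symm)
      have : (𝟙 (tUnit C) : tUnit C ⟶ tUnit C) i.1 j.1 = 𝟙 (𝟙_ C) := Mat_.id_apply_self _ _
      change ((𝟙 (tUnit C) : tUnit C ⟶ tUnit C) i.1 j.1 ⊗ₘ f i.2 j.2) ≫ (λ_ _).hom = _
      rw [this, id_tensorHom]
      exact MonoidalCategory.leftUnitor_naturality _)
    (rightUnitor_naturality := fun {M N} f => by
      refine hom_ext_surj _ (Equiv.prodPUnit N.ι).surjective fun i j => ?_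
      refine (comp_mono (M := tObj M (tUnit C)) (N := tObj N (tUnit C)) (K := N) _ _
        (Equiv.prodPUnit N.ι).injective _ i j).trans
        (Eq.trans ?_ (mono_comp (M := tObj M (tUnit C)) (N := M) (K := N) _ _ _ i _).symm)
      have : (𝟙 (tUnit C) : tUnit C ⟶ tUnit C) i.2 j.2 = 𝟙 (𝟙_ C) := Mat_.id_apply_self _ _
      change (f i.1 j.1 ⊗ₘ (𝟙 (tUnit C) : tUnit C ⟶ tUnit C) i.2 j.2) ≫ (ρ_ _).hom = _
      rw [this, tensorHom_id]
      exact MonoidalCategory.rightUnitor_naturality _)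
    (pentagon := fun M N K L => by
      change tHom (assocIso M N K).hom (𝟙 L) ≫ (assocIso M (tObj N K) L).hom ≫
        tHom (𝟙 M) (assocIso N K L).hom = (assocIso (tObj M N) K L).hom ≫
          (assocIso M N (tObj K L)).hom
      rw [← mono_id, ← mono_id, tHom_mono, tHom_mono, mono_comp_mono, mono_comp_mono,
        mono_comp_mono]
      refine congrArg (mono _) (funext fun i => ?_)
      have := MonoidalCategory.pentagon (M.X i.1.1.1) (N.X i.1.1.2) (K.X i.1.2) (L.X i.2)
      rw [← id_tensorHom, ← tensorHom_id] at this
      exact this)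
    (triangle := fun M N => by
      change (assocIso M (tUnit C) N).hom ≫ tHom (𝟙 M) (leftIso N).hom =
        tHom (rightIso M).hom (𝟙 N)
      rw [← mono_id, ← mono_id, tHom_mono, tHom_mono, mono_comp_mono]
      refine congrArg (mono _) (funext fun i => ?_)
      have := MonoidalCategory.triangle (M.X i.1.1) (N.X i.2)
      rw [← id_tensorHom, ← tensorHom_id] at this
      exact this)

theorem tHom_add {M M' N N' : Mat_ C} (f : M ⟶ M') (g g' : N ⟶ N') :
    tHom f (g + g') = tHom f g + tHom f g' := by
  ext i j
  exact MonoidalPreadditive.tensor_add _ _ _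

theorem add_tHom {M M' N N' : Mat_ C} (f f' : M ⟶ M') (g : N ⟶ N') :
    tHom (f + f') g = tHom f g + tHom f' g := by
  ext i j
  exact MonoidalPreadditive.add_tensor _ _ _

theorem tHom_zero {M M' N N' : Mat_ C} (f : M ⟶ M') : tHom f (0 : N ⟶ N') = 0 := by
  ext i j
  exact MonoidalPreadditive.tensor_zero _

theorem zero_tHom {M M' N N' : Mat_ C} (g : N ⟶ N') : tHom (0 : M ⟶ M') g = 0 := by
  ext i j
  exact MonoidalPreadditive.zero_tensor _

instance instMonoidalPreadditive22 : MonoidalPreadditive (Mat_ C) where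
  whiskerLeft_zero := tHom_zero _
  zero_whiskerRight := zero_tHom _
  whiskerLeft_add f g := tHom_add _ f g
  add_whiskerRight f g := add_tHom f g _

instance instMonoidalLinear23 {k : Type w} [CommRing k] [Linear k C] [MonoidalLinear k C] :
    MonoidalLinear k (Mat_ C) where
  whiskerLeft_smul X Y Z r f := by
    ext i j
    change (𝟙 X : X ⟶ X) i.1 j.1 ⊗ₘ (r • f i.2 j.2) = r • ((𝟙 X : X ⟶ X) i.1 j.1 ⊗ₘ f i.2 j.2)
    rw [MonoidalCategory.tensorHom_def, MonoidalLinear.whiskerLeft_smul, Linear.comp_smul, ← MonoidalCategory.tensorHom_def]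
  smul_whiskerRight r _ _ f X := by
    ext i j
    change (r • f i.1 j.1) ⊗ₘ (𝟙 X : X ⟶ X) i.2 j.2 = r • (f i.1 j.1 ⊗ₘ (𝟙 X : X ⟶ X) i.2 j.2)
    rw [MonoidalCategory.tensorHom_def, MonoidalLinear.smul_whiskerRight, Linear.smul_comp, ← MonoidalCategory.tensorHom_def]

end Mat

end Mat

/-! ### Idempotent completions of monoidal categories -/

section Karoubi

open Idempotents

namespace Kar

variable {C : Type u} [Category.{v} C]

/-- The isomorphism given by an isomorphism compatible with the idempotents. -/
abbrev isoOf {P Q : Karoubi C} (e : P.X ≅ Q.X) (h : P.p ≫ e.hom = e.hom ≫ Q.p) : P ≅ Q where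
  hom := ⟨P.p ≫ e.hom, by rw [Category.assoc, ← h, P.idem_assoc, P.idem_assoc]⟩
  inv := ⟨e.inv ≫ P.p, by
    have h' : Q.p ≫ e.inv = e.inv ≫ P.p := by
      rw [Iso.comp_inv_eq, Category.assoc, h, e.inv_hom_id_assoc]
    rw [Category.assoc, P.idem, ← h', Q.idem_assoc]⟩
  hom_inv_id := by
    ext
    simp
  inv_hom_id := by
    ext
    change (e.inv ≫ P.p) ≫ P.p ≫ e.hom = Q.p
    rw [Category.assoc, P.idem_assoc, h, e.inv_hom_id_assoc]

section Linear

variable {k : Type w} [CommRing k] [Preadditive C] [Linear k C]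

instance instSMul24 {P Q : Karoubi C} : SMul k (P ⟶ Q) where
  smul r f := ⟨r • f.f, by rw [Linear.smul_comp, Linear.comp_smul, f.comm]⟩

theorem smul_f {P Q : Karoubi C} (r : k) (f : P ⟶ Q) : (r • f).f = r • f.f := rfl

instance instLinear25 : Linear k (Karoubi C) where
  homModule P Q :=
    { one_smul := fun f => by ext; exact one_smul k f.f
      mul_smul := fun r s f => by ext; exact mul_smul r s f.f
      smul_zero := fun r => by ext; exact smul_zero r
      smul_add := fun r f g => by ext; exact smul_add r f.f g.f
      add_smul := fun r s f => by ext; exact add_smul r s f.f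
      zero_smul := fun f => by ext; exact zero_smul k f.f }
  smul_comp P Q R r f g := by ext; exact Linear.smul_comp _ _ _ r f.f g.f
  comp_smul P Q R f r g := by ext; exact Linear.comp_smul _ _ _ f.f r g.f

end Linear

variable [MonoidalCategory C]

/-- The tensor product of formal direct summands. -/
abbrev tObj (P Q : Karoubi C) : Karoubi C where
  X := P.X ⊗ Q.X
  p := P.p ⊗ₘ Q.p
  idem := by rw [tensorHom_comp_tensorHom, P.idem, Q.idem]

/-- The tensor product of morphisms. -/
abbrev tHom {P P' Q Q' : Karoubi C} (f : P ⟶ P') (g : Q ⟶ Q') : tObj P Q ⟶ tObj P' Q' where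
  f := f.f ⊗ₘ g.f
  comm := by simp only [tensorHom_comp_tensorHom, Karoubi.comp_p, Karoubi.p_comp]

variable (C) in
/-- The unit object. -/
abbrev tUnit : Karoubi C := ⟨𝟙_ C, 𝟙 _, Category.comp_id _⟩

/-- The monoidal structure on the idempotent completion. -/
instance instMonoidalCategory26 : MonoidalCategory (Karoubi C) :=
  letI : MonoidalCategoryStruct (Karoubi C) :=
    { tensorObj := tObj
      tensorHom := tHom
      whiskerLeft := fun P _ _ f => tHom (𝟙 P) f
      whiskerRight := fun f P => tHom f (𝟙 P)
      tensorUnit := tUnit C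
      associator := fun P Q R => isoOf (P := tObj (tObj P Q) R) (Q := tObj P (tObj Q R))
        (α_ P.X Q.X R.X) (MonoidalCategory.associator_naturality _ _ _)
      leftUnitor := fun P => isoOf (P := tObj (tUnit C) P) (Q := P) (λ_ P.X) (by
        change (𝟙 (𝟙_ C) ⊗ₘ P.p) ≫ _ = _
        rw [id_tensorHom]; exact MonoidalCategory.leftUnitor_naturality _)
      rightUnitor := fun P => isoOf (P := tObj P (tUnit C)) (Q := P) (ρ_ P.X) (by
        change (P.p ⊗ₘ 𝟙 (𝟙_ C)) ≫ _ = _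
        rw [tensorHom_id]; exact MonoidalCategory.rightUnitor_naturality _) }
  MonoidalCategory.ofTensorHom
    (id_tensorHom_id := fun _ _ => rfl)
    (id_tensorHom := fun _ _ _ _ => rfl)
    (tensorHom_id := fun _ _ => rfl)
    (tensorHom_comp_tensorHom := fun f g f' g' => by
      ext
      exact MonoidalCategory.tensorHom_comp_tensorHom f.f g.f f'.f g'.f)
    (associator_naturality := fun {P Q R P' Q' R'} f g h => by
      ext
      change ((f.f ⊗ₘ g.f) ⊗ₘ h.f) ≫ ((P'.p ⊗ₘ Q'.p) ⊗ₘ R'.p) ≫ (α_ P'.X Q'.X R'.X).hom =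
        (((P.p ⊗ₘ Q.p) ⊗ₘ R.p) ≫ (α_ P.X Q.X R.X).hom) ≫ (f.f ⊗ₘ (g.f ⊗ₘ h.f))
      rw [Category.assoc, ← MonoidalCategory.associator_naturality, ← Category.assoc,
        ← Category.assoc]
      simp only [tensorHom_comp_tensorHom, Karoubi.comp_p, Karoubi.p_comp])
    (leftUnitor_naturality := fun {P Q} f => by
      ext
      change (𝟙 (𝟙_ C) ⊗ₘ f.f) ≫ (𝟙 (𝟙_ C) ⊗ₘ Q.p) ≫ (λ_ Q.X).hom =
        ((𝟙 (𝟙_ C) ⊗ₘ P.p) ≫ (λ_ P.X).hom) ≫ f.f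
      simp only [id_tensorHom, Category.assoc, ← MonoidalCategory.leftUnitor_naturality]
      simp only [← Category.assoc, ← MonoidalCategory.whiskerLeft_comp, Karoubi.comp_p,
        Karoubi.p_comp])
    (rightUnitor_naturality := fun {P Q} f => by
      ext
      change (f.f ⊗ₘ 𝟙 (𝟙_ C)) ≫ (Q.p ⊗ₘ 𝟙 (𝟙_ C)) ≫ (ρ_ Q.X).hom =
        ((P.p ⊗ₘ 𝟙 (𝟙_ C)) ≫ (ρ_ P.X).hom) ≫ f.f
      simp only [tensorHom_id, Category.assoc, ← MonoidalCategory.rightUnitor_naturality]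
      simp only [← Category.assoc, ← MonoidalCategory.comp_whiskerRight, Karoubi.comp_p,
        Karoubi.p_comp])
    (pentagon := fun P Q R S => by
      ext
      change ((((P.p ⊗ₘ Q.p) ⊗ₘ R.p) ≫ (α_ P.X Q.X R.X).hom) ⊗ₘ S.p) ≫
        (((P.p ⊗ₘ (Q.p ⊗ₘ R.p)) ⊗ₘ S.p) ≫ (α_ P.X (Q.X ⊗ R.X) S.X).hom) ≫
        (P.p ⊗ₘ (((Q.p ⊗ₘ R.p) ⊗ₘ S.p) ≫ (α_ Q.X R.X S.X).hom)) =
        ((((P.p ⊗ₘ Q.p) ⊗ₘ R.p) ⊗ₘ S.p) ≫ (α_ (P.X ⊗ Q.X) R.X S.X).hom) ≫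
        (((P.p ⊗ₘ Q.p) ⊗ₘ (R.p ⊗ₘ S.p)) ≫ (α_ P.X Q.X (R.X ⊗ S.X)).hom)
      have e₁ : (((P.p ⊗ₘ Q.p) ⊗ₘ R.p) ≫ (α_ P.X Q.X R.X).hom) ⊗ₘ S.p =
          (((P.p ⊗ₘ Q.p) ⊗ₘ R.p) ⊗ₘ S.p) ≫ ((α_ P.X Q.X R.X).hom ⊗ₘ 𝟙 S.X) := by
        rw [tensorHom_comp_tensorHom, Category.comp_id]
      have e₂ : P.p ⊗ₘ (((Q.p ⊗ₘ R.p) ⊗ₘ S.p) ≫ (α_ Q.X R.X S.X).hom) =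
          (P.p ⊗ₘ ((Q.p ⊗ₘ R.p) ⊗ₘ S.p)) ≫ (𝟙 P.X ⊗ₘ (α_ Q.X R.X S.X).hom) := by
        rw [tensorHom_comp_tensorHom, Category.comp_id]
      have e₃ : ((α_ P.X Q.X R.X).hom ⊗ₘ 𝟙 S.X) ≫ ((P.p ⊗ₘ (Q.p ⊗ₘ R.p)) ⊗ₘ S.p) =
          (((P.p ⊗ₘ Q.p) ⊗ₘ R.p) ⊗ₘ S.p) ≫ ((α_ P.X Q.X R.X).hom ⊗ₘ 𝟙 S.X) := by
        rw [tensorHom_comp_tensorHom, tensorHom_comp_tensorHom, Category.comp_id, Category.id_comp,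
          MonoidalCategory.associator_naturality]
      have e₄ : (α_ P.X (Q.X ⊗ R.X) S.X).hom ≫ (P.p ⊗ₘ ((Q.p ⊗ₘ R.p) ⊗ₘ S.p)) =
          ((P.p ⊗ₘ (Q.p ⊗ₘ R.p)) ⊗ₘ S.p) ≫ (α_ P.X (Q.X ⊗ R.X) S.X).hom :=
        (MonoidalCategory.associator_naturality _ _ _).symm
      have e₅ : (α_ (P.X ⊗ Q.X) R.X S.X).hom ≫ ((P.p ⊗ₘ Q.p) ⊗ₘ (R.p ⊗ₘ S.p)) =
          (((P.p ⊗ₘ Q.p) ⊗ₘ R.p) ⊗ₘ S.p) ≫ (α_ (P.X ⊗ Q.X) R.X S.X).hom :=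
        (MonoidalCategory.associator_naturality _ _ _).symm
      have i₁ : ((P.p ⊗ₘ (Q.p ⊗ₘ R.p)) ⊗ₘ S.p) ≫ ((P.p ⊗ₘ (Q.p ⊗ₘ R.p)) ⊗ₘ S.p) =
          ((P.p ⊗ₘ (Q.p ⊗ₘ R.p)) ⊗ₘ S.p) := by
        simp only [tensorHom_comp_tensorHom, Karoubi.idem]
      have i₂ : (((P.p ⊗ₘ Q.p) ⊗ₘ R.p) ⊗ₘ S.p) ≫ (((P.p ⊗ₘ Q.p) ⊗ₘ R.p) ⊗ₘ S.p) =
          (((P.p ⊗ₘ Q.p) ⊗ₘ R.p) ⊗ₘ S.p) := by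
        simp only [tensorHom_comp_tensorHom, Karoubi.idem]
      rw [e₁, e₂]
      simp only [Category.assoc]
      rw [reassoc_of% e₄, reassoc_of% i₁, reassoc_of% e₃, reassoc_of% i₂, reassoc_of% e₅,
        reassoc_of% i₂, tensorHom_id, id_tensorHom, MonoidalCategory.pentagon])
    (triangle := fun P Q => by
      ext
      change (((P.p ⊗ₘ 𝟙 (𝟙_ C)) ⊗ₘ Q.p) ≫ (α_ P.X (𝟙_ C) Q.X).hom) ≫
        (P.p ⊗ₘ ((𝟙 (𝟙_ C) ⊗ₘ Q.p) ≫ (λ_ Q.X).hom)) =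
        (((P.p ⊗ₘ 𝟙 (𝟙_ C)) ≫ (ρ_ P.X).hom) ⊗ₘ Q.p)
      have e₁ : P.p ⊗ₘ ((𝟙 (𝟙_ C) ⊗ₘ Q.p) ≫ (λ_ Q.X).hom) =
          (P.p ⊗ₘ (𝟙 (𝟙_ C) ⊗ₘ Q.p)) ≫ (𝟙 P.X ⊗ₘ (λ_ Q.X).hom) := by
        rw [tensorHom_comp_tensorHom, Category.comp_id]
      have e₂ : ((P.p ⊗ₘ 𝟙 (𝟙_ C)) ≫ (ρ_ P.X).hom) ⊗ₘ Q.p =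
          ((P.p ⊗ₘ 𝟙 (𝟙_ C)) ⊗ₘ Q.p) ≫ ((ρ_ P.X).hom ⊗ₘ 𝟙 Q.X) := by
        rw [tensorHom_comp_tensorHom, Category.comp_id]
      have e₃ : (α_ P.X (𝟙_ C) Q.X).hom ≫ (P.p ⊗ₘ (𝟙 (𝟙_ C) ⊗ₘ Q.p)) =
          ((P.p ⊗ₘ 𝟙 (𝟙_ C)) ⊗ₘ Q.p) ≫ (α_ P.X (𝟙_ C) Q.X).hom :=
        (MonoidalCategory.associator_naturality _ _ _).symm
      have i₁ : ((P.p ⊗ₘ 𝟙 (𝟙_ C)) ⊗ₘ Q.p) ≫ ((P.p ⊗ₘ 𝟙 (𝟙_ C)) ⊗ₘ Q.p) =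
          ((P.p ⊗ₘ 𝟙 (𝟙_ C)) ⊗ₘ Q.p) := by
        simp only [tensorHom_comp_tensorHom, Karoubi.idem, Category.comp_id]
      rw [e₁, e₂]
      simp only [Category.assoc]
      rw [reassoc_of% e₃, reassoc_of% i₁, id_tensorHom P.X, MonoidalCategory.triangle,
        ← tensorHom_id (ρ_ P.X).hom])

variable [Preadditive C] [MonoidalPreadditive C]

instance instMonoidalPreadditive27 : MonoidalPreadditive (Karoubi C) where
  whiskerLeft_zero := by
    intros; ext; exact MonoidalPreadditive.tensor_zero _
  zero_whiskerRight := by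
    intros; ext; exact MonoidalPreadditive.zero_tensor _
  whiskerLeft_add _ _ := by
    ext; exact MonoidalPreadditive.tensor_add _ _ _
  add_whiskerRight _ _ := by
    ext; exact MonoidalPreadditive.add_tensor _ _ _

instance instMonoidalLinear28 {k : Type w} [CommRing k] [Linear k C] [MonoidalLinear k C] :
    MonoidalLinear k (Karoubi C) where
  whiskerLeft_smul P _ _ r f := by
    ext
    change P.p ⊗ₘ (r • f.f) = r • (P.p ⊗ₘ f.f)
    rw [MonoidalCategory.tensorHom_def, MonoidalLinear.whiskerLeft_smul, Linear.comp_smul,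
      ← MonoidalCategory.tensorHom_def]
  smul_whiskerRight r _ _ f P := by
    ext
    change (r • f.f) ⊗ₘ P.p = r • (f.f ⊗ₘ P.p)
    rw [MonoidalCategory.tensorHom_def, MonoidalLinear.smul_whiskerRight, Linear.smul_comp,
      ← MonoidalCategory.tensorHom_def]

end Kar

end Karoubi

open Idempotents in
/-- The additive and idempotent completion of the skein category. -/
abbrev DCob {k : Type u} [Field k] (α : ℕ → k) (u : Polynomial k) : Type (max 1 u) :=
  Karoubi (Mat_ (SCob α u))

/-- The object `[n]`. -/
noncomputable abbrev DCob.obj {k : Type u} [Field k] (α : ℕ → k) (u : Polynomial k) (n : ℕ) :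
    DCob α u :=
  (Idempotents.toKaroubi _).obj ((Mat_.embedding (SCob α u)).obj (SCob.obj α u n))

/-! ### Filtered monoidal categories and their associated graded categories -/

section GradedObject

variable {C : Type u} [Category.{v} C] [Preadditive C]

namespace Graded

instance instPreadditive29 : Preadditive (GradedObject ℕ C) where
  homGroup X Y := inferInstanceAs (AddCommGroup (∀ i, X i ⟶ Y i))
  add_comp X Y Z f g h := by
    funext i; exact Preadditive.add_comp _ _ _ (f i) (g i) (h i)
  comp_add X Y Z f g h := by
    funext i; exact Preadditive.comp_add _ _ _ (f i) (g i) (h i)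

theorem add_apply {X Y : GradedObject ℕ C} (f g : X ⟶ Y) (i : ℕ) : (f + g) i = f i + g i := rfl

theorem zero_apply {X Y : GradedObject ℕ C} (i : ℕ) : (0 : X ⟶ Y) i = 0 := rfl

theorem neg_apply {X Y : GradedObject ℕ C} (f : X ⟶ Y) (i : ℕ) : (-f) i = - f i := rfl

instance instLinear30 {k : Type w} [CommRing k] [Linear k C] : Linear k (GradedObject ℕ C) where
  homModule X Y := inferInstanceAs (Module k (∀ i, X i ⟶ Y i))
  smul_comp X Y Z r f g := by
    funext i; exact Linear.smul_comp _ _ _ r (f i) (g i)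
  comp_smul X Y Z f r g := by
    funext i; exact Linear.comp_smul _ _ _ (f i) r (g i)

variable [HasFiniteBiproducts C] [MonoidalCategory C] [MonoidalPreadditive C]

open GradedObject.Monoidal in
instance instMonoidalPreadditive31 : MonoidalPreadditive (GradedObject ℕ C) where
  whiskerLeft_zero {X Y Z} := by
    apply GradedObject.hom_ext
    intro n
    apply tensorObj_ext
    intro i j h
    change _ ≫ GradedObject.Monoidal.tensorHom (𝟙 X) (0 : Y ⟶ Z) n = _
    rw [ι_tensorHom, zero_apply, zero_apply, MonoidalPreadditive.tensor_zero, Limits.zero_comp,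
      Limits.comp_zero]
  zero_whiskerRight {X Y Z} := by
    apply GradedObject.hom_ext
    intro n
    apply tensorObj_ext
    intro i j h
    change _ ≫ GradedObject.Monoidal.tensorHom (0 : Y ⟶ Z) (𝟙 X) n = _
    rw [ι_tensorHom, zero_apply, zero_apply, MonoidalPreadditive.zero_tensor, Limits.zero_comp,
      Limits.comp_zero]
  whiskerLeft_add {X Y Z} f g := by
    apply GradedObject.hom_ext
    intro n
    apply tensorObj_ext
    intro i j h
    change _ ≫ GradedObject.Monoidal.tensorHom (𝟙 X) (f + g) n =
      ιTensorObj X Y i j n h ≫ (GradedObject.Monoidal.tensorHom (𝟙 X) f n +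
        GradedObject.Monoidal.tensorHom (𝟙 X) g n)
    rw [Preadditive.comp_add, ι_tensorHom, ι_tensorHom, ι_tensorHom, add_apply,
      MonoidalPreadditive.tensor_add, Preadditive.add_comp]
  add_whiskerRight {X Y Z} f g := by
    apply GradedObject.hom_ext
    intro n
    apply tensorObj_ext
    intro i j h
    change _ ≫ GradedObject.Monoidal.tensorHom (f + g) (𝟙 X) n =
      ιTensorObj Y X i j n h ≫ (GradedObject.Monoidal.tensorHom f (𝟙 X) n +
        GradedObject.Monoidal.tensorHom g (𝟙 X) n)
    rw [Preadditive.comp_add, ι_tensorHom, ι_tensorHom, ι_tensorHom, add_apply,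
      MonoidalPreadditive.add_tensor, Preadditive.add_comp]

end Graded

end GradedObject

section Filtration

/-- In a preadditive category, `Z` is a direct sum of `X` and `Y`. -/
def IsDirectSum {C : Type u} [Category.{v} C] [Preadditive C] (X Y Z : C) : Prop :=
  ∃ (i : X ⟶ Z) (j : Y ⟶ Z) (p : Z ⟶ X) (q : Z ⟶ Y),
    i ≫ p = 𝟙 X ∧ j ≫ q = 𝟙 Y ∧ i ≫ q = 0 ∧ j ≫ p = 0 ∧ p ≫ i + q ≫ j = 𝟙 Z

theorem isDirectSum_biprod {C : Type u} [Category.{v} C] [Preadditive C] (X Y : C)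
    [HasBinaryBiproduct X Y] : IsDirectSum X Y (X ⊞ Y) :=
  ⟨biprod.inl, biprod.inr, biprod.fst, biprod.snd, biprod.inl_fst, biprod.inr_snd,
    biprod.inl_snd, biprod.inr_fst, biprod.total⟩

/-- An increasing filtration of an additive monoidal category by full additive subcategories
`D 0 ⊆ D 1 ⊆ …` that are closed under direct summands, compatible with the tensor product. -/
structure Filtration (C : Type u) [Category.{v} C] [Preadditive C] [HasFiniteBiproducts C]
    [MonoidalCategory C] where
  D : ℕ → ObjectProperty C
  mono {m n : ℕ} {X : C} : m ≤ n → D m X → D n X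
  retract {n : ℕ} {X Y : C} : Retract X Y → D n Y → D n X
  zero {n : ℕ} {X : C} : IsZero X → D n X
  sum {n : ℕ} {X Y Z : C} : IsDirectSum X Y Z → D n X → D n Y → D n Z
  unit : D 0 (𝟙_ C)
  tensor {m n : ℕ} {X Y : C} : D m X → D n Y → D (m + n) (X ⊗ Y)

namespace Filtration

theorem zero_tensor {C : Type u} [Category.{v} C] [Preadditive C] [MonoidalCategory C]
    [MonoidalPreadditive C] {X Y : C} (h : IsZero X) : IsZero (X ⊗ Y) := by
  refine (IsZero.iff_id_eq_zero _).2 ?_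
  rw [← MonoidalCategory.id_whiskerRight, (IsZero.iff_id_eq_zero X).1 h,
    MonoidalPreadditive.zero_whiskerRight]

theorem tensor_zero {C : Type u} [Category.{v} C] [Preadditive C] [MonoidalCategory C]
    [MonoidalPreadditive C] {X Y : C} (h : IsZero Y) : IsZero (X ⊗ Y) := by
  refine (IsZero.iff_id_eq_zero _).2 ?_
  rw [← MonoidalCategory.whiskerLeft_id, (IsZero.iff_id_eq_zero Y).1 h,
    MonoidalPreadditive.whiskerLeft_zero]

/-- A property closed under direct sums and isomorphisms is closed under finite coproducts. -/
theorem closed_coproducts {C : Type u} [Category.{v} C] [Preadditive C] [HasFiniteBiproducts C]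
    {P : ObjectProperty C} (hz : ∀ {X : C}, IsZero X → P X)
    (hb : ∀ {X Y Z : C}, IsDirectSum X Y Z → P X → P Y → P Z)
    (hr : ∀ {X Y : C}, Retract X Y → P Y → P X) :
    P.IsClosedUnderFiniteCoproducts := by
  have : HasZeroObject C := hasZeroObject_of_hasFiniteBiproducts C
  have : HasBinaryBiproducts C := hasBinaryBiproducts_of_finite_biproducts C
  have : P.IsStableUnderRetracts := ⟨hr⟩
  have : P.ContainsZero := ⟨⟨_, isZero_zero C, hz (isZero_zero C)⟩⟩
  have : P.IsClosedUnderBinaryCoproducts := by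
    refine .mk' ?_
    rintro X ⟨G, hG⟩
    have e : G ≅ pair (G.obj ⟨.left⟩) (G.obj ⟨.right⟩) := diagramIsoPair G
    refine hr (Iso.retract ?_) (hb (isDirectSum_biprod _ _) (hG ⟨.left⟩) (hG ⟨.right⟩))
    exact HasColimit.isoOfNatIso e ≪≫ (biprod.isoCoprod _ _).symm
  exact .mk'

variable {C : Type u} [Category.{v} C] [Preadditive C] [HasFiniteBiproducts C]
    [MonoidalCategory C] (F : Filtration C)

/-- The previous step `D (n - 1)` of the filtration, with `D (-1) = 0`. -/
def lower : ℕ → ObjectProperty C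
  | 0 => fun X => IsZero X
  | n + 1 => F.D n

theorem lower_le {n : ℕ} {X : C} (h : F.lower n X) : F.D n X := by
  cases n with
  | zero => exact F.zero h
  | succ n => exact F.mono n.le_succ h

theorem lower_zero {n : ℕ} {X : C} (h : IsZero X) : F.lower n X := by
  cases n with
  | zero => exact h
  | succ n => exact F.zero h

theorem lower_sum {n : ℕ} {X Y Z : C} (s : IsDirectSum X Y Z) (h : F.lower n X)
    (h' : F.lower n Y) : F.lower n Z := by
  cases n with
  | zero =>
    obtain ⟨i, j, p, q, -, -, -, -, e⟩ := s
    refine (IsZero.iff_id_eq_zero Z).2 ?_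
    rw [← e, IsZero.eq_of_tgt h p 0, IsZero.eq_of_tgt h' q 0, Limits.zero_comp, Limits.zero_comp,
      add_zero]
  | succ n => exact F.sum s h h'

theorem lower_retract {n : ℕ} {X Y : C} (r : Retract X Y) (h : F.lower n Y) : F.lower n X := by
  cases n with
  | zero =>
    refine (IsZero.iff_id_eq_zero X).2 ?_
    rw [← r.retract, IsZero.eq_of_tgt h r.i 0, Limits.zero_comp]
  | succ n => exact F.retract r h

variable [MonoidalPreadditive C]

theorem lower_tensor {m n : ℕ} {X Y : C} (h : F.lower m X) (h' : F.D n Y) :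
    F.lower (m + n) (X ⊗ Y) := by
  cases m with
  | zero => exact F.lower_zero (zero_tensor h)
  | succ m =>
    rw [Nat.succ_add]
    exact F.tensor (X := X) (Y := Y) h h'

theorem tensor_lower {m n : ℕ} {X Y : C} (h : F.D m X) (h' : F.lower n Y) :
    F.lower (m + n) (X ⊗ Y) := by
  cases n with
  | zero => exact F.lower_zero (tensor_zero h')
  | succ n => exact F.tensor (X := X) (Y := Y) h h'

/-- A component of a tensor product of graded objects is a finite coproduct. -/
theorem closed_tensorObj {P : ObjectProperty C} (hP : P.IsClosedUnderFiniteCoproducts)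
    {X Y : GradedObject ℕ C} (n : ℕ) (h : ∀ i j, i + j = n → P (X i ⊗ Y j)) :
    P ((X ⊗ Y : GradedObject ℕ C) n) :=
  P.prop_of_isColimit_cofan (GradedObject.isColimitCofanMapObj
    (((GradedObject.mapBifunctor (curriedTensor C) ℕ ℕ).obj X).obj Y)
      (fun i : ℕ × ℕ => i.1 + i.2) n) fun i => h _ _ i.2

theorem D_tensorObj {X Y : GradedObject ℕ C} (hX : ∀ n, F.D n (X n)) (hY : ∀ n, F.D n (Y n))
    (n : ℕ) : F.D n ((X ⊗ Y : GradedObject ℕ C) n) := by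
  refine closed_tensorObj (closed_coproducts F.zero F.sum F.retract) n ?_
  rintro i j rfl
  exact F.tensor (hX i) (hY j)

theorem lower_tensorObj {X Y : GradedObject ℕ C} (n : ℕ)
    (h : ∀ i j, i + j = n → F.lower n (X i ⊗ Y j)) :
    F.lower n ((X ⊗ Y : GradedObject ℕ C) n) :=
  closed_tensorObj (closed_coproducts F.lower_zero F.lower_sum F.lower_retract) n h

/-- Sequences of objects `X n` in `D n`, almost all of which lie in `D (n - 1)`. -/
def seqProp : ObjectProperty (GradedObject ℕ C) := fun X =>
  (∀ n, F.D n (X n)) ∧ ∃ N, ∀ n, N ≤ n → F.lower n (X n)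

instance seqProp_isMonoidal : F.seqProp.IsMonoidal where
  prop_unit := by
    have h : ∀ n, n ≠ 0 → IsZero ((𝟙_ (GradedObject ℕ C)) n) := fun n hn => by
      have : HasZeroObject C := hasZeroObject_of_hasFiniteBiproducts C
      exact (IsZero.of_iso (isZero_zero C) ((GradedObject.Monoidal.isInitialTensorUnitApply
        n hn).uniqueUpToIso (isZero_zero C).isInitial))
    refine ⟨fun n => ?_, 1, fun n hn => F.lower_zero (h n (by omega))⟩
    by_cases hn : n = 0
    · subst hn
      exact F.retract (GradedObject.Monoidal.tensorUnit₀ (I := ℕ) (C := C)).retract F.unit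
    · exact F.zero (h n hn)
  prop_tensor := by
    rintro X Y ⟨hX, N, hN⟩ ⟨hY, M, hM⟩
    refine ⟨F.D_tensorObj hX hY, N + M, fun n hn => F.lower_tensorObj n ?_⟩
    rintro i j rfl
    by_cases h : N ≤ i
    · exact F.lower_tensor (hN i h) (hY j)
    · exact F.tensor_lower (hX i) (hM j (by omega))

/-- A morphism of sequences factors through a sequence of objects of lower filtration degree. -/
def Negligible {X Y : GradedObject ℕ C} (f : X ⟶ Y) : Prop :=
  ∃ (Z : GradedObject ℕ C) (a : X ⟶ Z) (b : Z ⟶ Y), (∀ n, F.lower n (Z n)) ∧ a ≫ b = f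

variable {k : Type w} [CommRing k] [Linear k C]

variable (k) in
/-- The tensor ideal of sequences of morphisms that factor, in each degree `n`, through an object
of `D (n - 1)`. -/
def ideal : TensorIdeal k F.seqProp.FullSubcategory where
  sub X Y :=
    { carrier := {f | F.Negligible f.hom}
      zero_mem' := by
        have : HasZeroObject C := hasZeroObject_of_hasFiniteBiproducts C
        exact ⟨fun _ => HasZeroObject.zero' C |>.1, 0, 0, fun _ => F.lower_zero (isZero_zero C),
          Limits.comp_zero⟩
      add_mem' := by
        rintro f g ⟨Z, a, b, hZ, h⟩ ⟨Z', a', b', hZ', h'⟩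
        have : HasBinaryBiproducts C := hasBinaryBiproducts_of_finite_biproducts C
        refine ⟨fun n => Z n ⊞ Z' n, fun n => biprod.lift (a n) (a' n),
          fun n => biprod.desc (b n) (b' n),
          fun n => F.lower_sum (isDirectSum_biprod _ _) (hZ n) (hZ' n), ?_⟩
        change _ = f.hom + g.hom
        funext n
        rw [← h, ← h']
        exact biprod.lift_desc
      smul_mem' := by
        rintro r f ⟨Z, a, b, hZ, h⟩
        refine ⟨Z, r • a, b, hZ, ?_⟩
        rw [Linear.smul_comp, h]
        rfl }
  comp_left f g := by
    rintro ⟨Z, a, b, hZ, h⟩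
    exact ⟨Z, f.hom ≫ a, b, hZ, by rw [Category.assoc, h]; rfl⟩
  comp_right := by
    rintro X Y Z f g ⟨W, a, b, hW, h⟩
    exact ⟨W, a, b ≫ g.hom, hW, by rw [← Category.assoc, h]; rfl⟩
  whisker_left := by
    rintro X Y Z f ⟨W, a, b, hW, h⟩
    refine ⟨X.obj ⊗ W, X.obj ◁ a, X.obj ◁ b, fun n => F.lower_tensorObj n ?_, ?_⟩
    · rintro i j rfl
      exact F.tensor_lower (X.property.1 i) (hW j)
    · rw [← MonoidalCategory.whiskerLeft_comp, h]; rfl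
  whisker_right := by
    rintro Y Z f X ⟨W, a, b, hW, h⟩
    refine ⟨W ⊗ X.obj, a ▷ X.obj, b ▷ X.obj, fun n => F.lower_tensorObj n ?_, ?_⟩
    · rintro i j rfl
      exact F.lower_tensor (hW i) (X.property.1 j)
    · rw [← MonoidalCategory.comp_whiskerRight, h]; rfl

variable (k) in
/-- The associated graded category, the direct sum of the quotient categories `D n / D (n - 1)`:
its objects are the sequences of objects `X n` in `D n / D (n - 1)`, almost all zero, and its
morphisms are the sequences of morphisms in `D n / D (n - 1)`. The tensor product has the
components `⨁ i + j = n, X i ⊗ Y j`. -/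
abbrev gr : Type _ := (F.ideal k).Quot

variable (k) in
/-- The objects of the associated graded category concentrated in degree `i`. -/
def grDeg (i : ℕ) : ObjectProperty (F.gr k) := fun X => ∀ j, j ≠ i → F.lower j (X.as.obj j)

end Filtration

end Filtration

section DCobFiltration

theorem IsDirectSum.tensor_right {C : Type u} [Category.{v} C] [Preadditive C] [MonoidalCategory C]
    [MonoidalPreadditive C] {X Y Z : C} (h : IsDirectSum X Y Z) (W : C) :
    IsDirectSum (X ⊗ W) (Y ⊗ W) (Z ⊗ W) := by
  obtain ⟨i, j, p, q, h₁, h₂, h₃, h₄, h₅⟩ := h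
  refine ⟨i ▷ W, j ▷ W, p ▷ W, q ▷ W, ?_, ?_, ?_, ?_, ?_⟩ <;>
    simp only [← MonoidalCategory.comp_whiskerRight, ← MonoidalPreadditive.add_whiskerRight, *,
      MonoidalCategory.id_whiskerRight, MonoidalPreadditive.zero_whiskerRight]

theorem IsDirectSum.tensor_left {C : Type u} [Category.{v} C] [Preadditive C] [MonoidalCategory C]
    [MonoidalPreadditive C] {X Y Z : C} (h : IsDirectSum X Y Z) (W : C) :
    IsDirectSum (W ⊗ X) (W ⊗ Y) (W ⊗ Z) := by
  obtain ⟨i, j, p, q, h₁, h₂, h₃, h₄, h₅⟩ := h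
  refine ⟨W ◁ i, W ◁ j, W ◁ p, W ◁ q, ?_, ?_, ?_, ?_, ?_⟩ <;>
    simp only [← MonoidalCategory.whiskerLeft_comp, ← MonoidalPreadditive.whiskerLeft_add, *,
      MonoidalCategory.whiskerLeft_id, MonoidalPreadditive.whiskerLeft_zero]

namespace DCob

variable {k : Type u} [Field k] (α : ℕ → k) (u : Polynomial k)

/-- The additive, idempotent complete subcategory generated by the objects `[0], …, [n]`. -/
inductive Gen (n : ℕ) : DCob α u → Prop
  | obj (m : ℕ) (h : m ≤ n) : Gen n (DCob.obj α u m)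
  | zero (X : DCob α u) : IsZero X → Gen n X
  | sum (X Y Z : DCob α u) : IsDirectSum X Y Z → Gen n X → Gen n Y → Gen n Z
  | summand (X Y : DCob α u) : Nonempty (Retract X Y) → Gen n Y → Gen n X

variable {α u}

theorem gen_mono {m n : ℕ} (hmn : m ≤ n) {X : DCob α u} (h : Gen α u m X) : Gen α u n X := by
  induction h with
  | obj l h => exact .obj l (h.trans hmn)
  | zero X h => exact .zero X h
  | sum X Y Z h _ _ h₁ h₂ => exact .sum X Y Z h h₁ h₂
  | summand X Y h _ h₁ => exact .summand X Y h h₁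

variable (α u) in
/-- `[m] ⊗ [n] ≅ [m + n]` -/
noncomputable def objTensor (m n : ℕ) : DCob.obj α u m ⊗ DCob.obj α u n ≅ DCob.obj α u (m + n) :=
  Kar.isoOf (P := Kar.tObj (DCob.obj α u m) (DCob.obj α u n)) (Q := DCob.obj α u (m + n))
    (Mat.monoIso (M := Mat.tObj (DCob.obj α u m).X (DCob.obj α u n).X)
      (N := (DCob.obj α u (m + n)).X)
      (fun i => i.1) (Equiv.prodPUnit _).bijective fun _ => Iso.refl (SCob.obj α u (m + n))) (by
    refine Eq.trans ?_ (Category.comp_id _).symm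
    refine Eq.trans ?_ (Category.id_comp _)
    congr 1
    exact MonoidalCategory.id_tensorHom_id (DCob.obj α u m).X (DCob.obj α u n).X)

theorem gen_tensor {m n : ℕ} {X Y : DCob α u} (hX : Gen α u m X) (hY : Gen α u n Y) :
    Gen α u (m + n) (X ⊗ Y) := by
  induction hX with
  | zero X h => exact .zero _ (Filtration.zero_tensor h)
  | sum X X' Z h _ _ h₁ h₂ => exact .sum _ _ _ (h.tensor_right Y) h₁ h₂
  | summand X X' h _ h₁ => exact .summand _ _ ⟨h.some.map (tensorRight Y)⟩ h₁
  | obj a ha =>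
    induction hY with
    | zero X h => exact .zero _ (Filtration.tensor_zero h)
    | sum X X' Z h _ _ h₁ h₂ => exact .sum _ _ _ (h.tensor_left _) h₁ h₂
    | summand X X' h _ h₁ => exact .summand _ _ ⟨h.some.map (tensorLeft _)⟩ h₁
    | obj b hb => exact .summand _ _ ⟨(objTensor α u a b).retract⟩ (.obj _ (Nat.add_le_add ha hb))

variable (α u) in
/-- The filtration by the subcategories generated by `[0], …, [n]`. -/
noncomputable def filtration : Filtration (DCob α u) where
  D := Gen α u
  mono h := gen_mono h
  retract r h := .summand _ _ ⟨r⟩ h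
  zero h := .zero _ h
  sum s h h' := .sum _ _ _ s h h'
  unit := .obj 0 le_rfl
  tensor := gen_tensor

end DCob

end DCobFiltration

/-! ### Grothendieck rings and associated graded rings -/

section Grothendieck

variable (C : Type u) [Category.{v} C] [Preadditive C] [MonoidalCategory C]

/-- The relations `[Z] = [X] + [Y]` for a direct sum `Z` of `X` and `Y`. -/
inductive K0Rel : FreeAbelianGroup (Skeleton C) → FreeAbelianGroup (Skeleton C) → Prop
  | sum (X Y Z : C) : IsDirectSum X Y Z →
      K0Rel (.of (toSkeleton Z)) (.of (toSkeleton X) + .of (toSkeleton Y))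

/-- The Grothendieck ring of an additive monoidal category: the free abelian group on the
isomorphism classes of objects, with the product induced by the tensor product, modulo the
relations `[X ⊕ Y] = [X] + [Y]`. -/
abbrev K0 : Type u := RingQuot (K0Rel C)

variable {C}

/-- The class of an object. -/
noncomputable def K0.cls (X : C) : K0 C :=
  RingQuot.mkRingHom (K0Rel C) (FreeAbelianGroup.of (toSkeleton X))

/-- The subgroup spanned by the classes of the objects with a given property. -/
noncomputable def K0.span (P : ObjectProperty C) : AddSubgroup (K0 C) :=
  AddSubgroup.closure {x | ∃ X, P X ∧ K0.cls X = x}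

theorem K0.cls_mul (X Y : C) : K0.cls X * K0.cls Y = K0.cls (X ⊗ Y) := by
  rw [K0.cls, K0.cls, K0.cls, ← map_mul, Skeleton.toSkeleton_tensorObj, ← FreeAbelianGroup.of_mul_of]

theorem K0.cls_unit : K0.cls (𝟙_ C) = 1 := by
  rw [K0.cls, ← Skeleton.one_eq, FreeAbelianGroup.of_one, map_one]

end Grothendieck

section AssociatedGraded

/-- An increasing filtration of a ring by additive subgroups. -/
structure RingFiltration (A : Type u) [Ring A] where
  F : ℕ → AddSubgroup A
  mono {m n : ℕ} : m ≤ n → F m ≤ F n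
  one_mem : 1 ∈ F 0
  mul_mem {m n : ℕ} {x y : A} : x ∈ F m → y ∈ F n → x * y ∈ F (m + n)

namespace RingFiltration

variable {A : Type u} [Ring A] (F : RingFiltration A)

/-- The previous step of the filtration, with `F (-1) = 0`. -/
def lower : ℕ → AddSubgroup A
  | 0 => ⊥
  | n + 1 => F.F n

/-- The graded piece `F n / F (n - 1)`. -/
abbrev piece (n : ℕ) : Type u := F.F n ⧸ (F.lower n).addSubgroupOf (F.F n)

/-- The class of an element. -/
def cls {n : ℕ} {x : A} (hx : x ∈ F.F n) : F.piece n := QuotientAddGroup.mk ⟨x, hx⟩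

theorem cls_eq {n : ℕ} {x y : A} (hx : x ∈ F.F n) (hy : y ∈ F.F n) :
    F.cls hx = F.cls hy ↔ -x + y ∈ F.lower n := QuotientAddGroup.eq

theorem lower_mul {m n : ℕ} {x y : A} (hx : x ∈ F.lower m) (hy : y ∈ F.F n) :
    x * y ∈ F.lower (m + n) := by
  cases m with
  | zero =>
    rw [(AddSubgroup.mem_bot).1 hx, zero_mul]
    exact AddSubgroup.zero_mem _
  | succ m =>
    rw [Nat.succ_add]
    exact F.mul_mem (m := m) hx hy

theorem mul_lower {m n : ℕ} {x y : A} (hx : x ∈ F.F m) (hy : y ∈ F.lower n) :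
    x * y ∈ F.lower (m + n) := by
  cases n with
  | zero =>
    rw [(AddSubgroup.mem_bot).1 hy, mul_zero]
    exact AddSubgroup.zero_mem _
  | succ n => exact F.mul_mem (n := n) hx hy

theorem cls_surj {n : ℕ} (x : F.piece n) : ∃ (y : A) (hy : y ∈ F.F n), F.cls hy = x := by
  obtain ⟨⟨y, hy⟩, rfl⟩ := QuotientAddGroup.mk_surjective x
  exact ⟨y, hy, rfl⟩

theorem cls_add {n : ℕ} {x y : A} (hx : x ∈ F.F n) (hy : y ∈ F.F n) :
    F.cls hx + F.cls hy = F.cls (add_mem hx hy) := rfl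

theorem cls_zero {n : ℕ} : F.cls (zero_mem (F.F n)) = 0 := rfl

theorem cls_congr {n : ℕ} {x y : A} (hx : x ∈ F.F n) (h : x = y) :
    F.cls hx = F.cls (h ▸ hx : y ∈ F.F n) := by subst h; rfl

/-- The product of graded pieces. -/
def pieceMul {m n : ℕ} (x : F.piece m) (y : F.piece n) : F.piece (m + n) :=
  Quotient.liftOn₂' x y (fun x y => F.cls (F.mul_mem x.2 y.2)) (by
    intro x y x' y' h h'
    have h₁ : -x.1 + x'.1 ∈ F.lower m :=
      AddSubgroup.mem_addSubgroupOf.1 (QuotientAddGroup.leftRel_apply.1 h)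
    have h₂ : -y.1 + y'.1 ∈ F.lower n :=
      AddSubgroup.mem_addSubgroupOf.1 (QuotientAddGroup.leftRel_apply.1 h')
    rw [cls_eq]
    have : -(x.1 * y.1) + x'.1 * y'.1 = (-x.1 + x'.1) * y'.1 + x.1 * (-y.1 + y'.1) := by noncomm_ring
    rw [this]
    exact add_mem (F.lower_mul h₁ y'.2) (F.mul_lower x.2 h₂))

theorem pieceMul_cls {m n : ℕ} {x y : A} (hx : x ∈ F.F m) (hy : y ∈ F.F n) :
    F.pieceMul (F.cls hx) (F.cls hy) = F.cls (F.mul_mem hx hy) := rfl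

/-- The class of `1`. -/
def pieceOne : F.piece 0 := F.cls F.one_mem

theorem sigma_eq {m n : ℕ} (h : m = n) {x y : A} (hx : x ∈ F.F m) (hy : y ∈ F.F n) (e : x = y) :
    (⟨m, F.cls hx⟩ : GradedMonoid F.piece) = ⟨n, F.cls hy⟩ := by
  subst h e; rfl

instance instGOne32 : GradedMonoid.GOne F.piece := ⟨F.pieceOne⟩

instance instGMul33 : GradedMonoid.GMul F.piece := ⟨F.pieceMul⟩

instance instGMonoid34 : GradedMonoid.GMonoid F.piece where
  one_mul := by
    rintro ⟨n, x⟩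
    obtain ⟨x, hx, rfl⟩ := F.cls_surj x
    exact F.sigma_eq (zero_add n) (F.mul_mem F.one_mem hx) hx (one_mul x)
  mul_one := by
    rintro ⟨n, x⟩
    obtain ⟨x, hx, rfl⟩ := F.cls_surj x
    exact F.sigma_eq (add_zero n) (F.mul_mem hx F.one_mem) hx (mul_one x)
  mul_assoc := by
    rintro ⟨l, x⟩ ⟨m, y⟩ ⟨n, z⟩
    obtain ⟨x, hx, rfl⟩ := F.cls_surj x
    obtain ⟨y, hy, rfl⟩ := F.cls_surj y
    obtain ⟨z, hz, rfl⟩ := F.cls_surj z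
    exact F.sigma_eq (add_assoc l m n) (F.mul_mem (F.mul_mem hx hy) hz)
      (F.mul_mem hx (F.mul_mem hy hz)) (mul_assoc x y z)

instance instGRing35 : DirectSum.GRing F.piece where
  mul_zero {i j} x := by
    obtain ⟨x, hx, rfl⟩ := F.cls_surj x
    refine (F.pieceMul_cls hx (zero_mem (F.F j))).trans ?_
    exact (F.cls_congr _ (mul_zero x)).trans F.cls_zero
  zero_mul {i j} x := by
    obtain ⟨x, hx, rfl⟩ := F.cls_surj x
    refine (F.pieceMul_cls (zero_mem (F.F i)) hx).trans ?_
    exact (F.cls_congr _ (zero_mul x)).trans F.cls_zero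
  mul_add x y z := by
    obtain ⟨x, hx, rfl⟩ := F.cls_surj x
    obtain ⟨y, hy, rfl⟩ := F.cls_surj y
    obtain ⟨z, hz, rfl⟩ := F.cls_surj z
    exact F.cls_congr _ (mul_add x y z)
  add_mul x y z := by
    obtain ⟨x, hx, rfl⟩ := F.cls_surj x
    obtain ⟨y, hy, rfl⟩ := F.cls_surj y
    obtain ⟨z, hz, rfl⟩ := F.cls_surj z
    exact F.cls_congr _ (add_mul x y z)
  natCast n := n • F.pieceOne
  natCast_zero := zero_nsmul _
  natCast_succ n := succ_nsmul _ n
  intCast n := n • F.pieceOne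
  intCast_ofNat n := natCast_zsmul _ n
  intCast_negSucc_ofNat n := negSucc_zsmul _ n

/-- The associated graded ring `⨁ n, F n / F (n - 1)`. -/
abbrev gr : Type u := DirectSum ℕ F.piece

open Classical in
/-- The homogeneous elements of degree `n`. -/
noncomputable def grDeg (n : ℕ) : AddSubgroup F.gr := (DirectSum.of F.piece n).range

end RingFiltration

end AssociatedGraded

section K0Filtration

variable {C : Type u} [Category.{v} C] [Preadditive C] [HasFiniteBiproducts C]
    [MonoidalCategory C]

/-- The filtration of the Grothendieck ring by the subgroups spanned by the classes of objects of
the steps of a filtration. -/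
noncomputable def Filtration.k0 (F : Filtration C) : RingFiltration (K0 C) where
  F n := K0.span (F.D n)
  mono h := AddSubgroup.closure_mono (by
    rintro _ ⟨X, hX, rfl⟩
    exact ⟨X, F.mono h hX, rfl⟩)
  one_mem := AddSubgroup.subset_closure ⟨_, F.unit, K0.cls_unit⟩
  mul_mem := by
    intro m n x y hx hy
    induction hx using AddSubgroup.closure_induction with
    | zero => rw [zero_mul]; exact zero_mem _
    | add a b _ _ ha hb => rw [add_mul]; exact add_mem ha hb
    | neg a _ ha => rw [neg_mul]; exact neg_mem ha
    | mem x hx =>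
      induction hy using AddSubgroup.closure_induction with
      | zero => rw [mul_zero]; exact zero_mem _
      | add a b _ _ ha hb => rw [mul_add]; exact add_mem ha hb
      | neg a _ ha => rw [mul_neg]; exact neg_mem ha
      | mem y hy =>
        obtain ⟨X, hX, rfl⟩ := hx
        obtain ⟨Y, hY, rfl⟩ := hy
        rw [K0.cls_mul]
        exact AddSubgroup.subset_closure ⟨_, F.tensor hX hY, rfl⟩

end K0Filtration

/-! ### Graded modules over a tower of rings -/

section Tower

/-- A tower of rings: unital ring homomorphisms `A i ⊗ A j → A (i + j)`, written as biadditive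
maps, that are associative and unital. -/
structure Tower (A : ℕ → Type u) [∀ n, Ring (A n)] where
  φ {i j n : ℕ} (h : i + j = n) : A i → A j → A n
  add_left {i j n : ℕ} (h : i + j = n) (a a' : A i) (b : A j) : φ h (a + a') b = φ h a b + φ h a' b
  add_right {i j n : ℕ} (h : i + j = n) (a : A i) (b b' : A j) :
    φ h a (b + b') = φ h a b + φ h a b'
  mul {i j n : ℕ} (h : i + j = n) (a a' : A i) (b b' : A j) :
    φ h (a * a') (b * b') = φ h a b * φ h a' b'
  one {i j n : ℕ} (h : i + j = n) : φ h 1 1 = 1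
  assoc {i j c l m n : ℕ} (h₁ : i + j = l) (h₂ : l + c = n) (h₃ : j + c = m) (h₄ : i + m = n)
    (a : A i) (b : A j) (d : A c) : φ h₂ (φ h₁ a b) d = φ h₄ a (φ h₃ b d)
  one_left {n : ℕ} (a : A n) : φ (Nat.zero_add n) 1 a = a
  one_right {n : ℕ} (a : A n) : φ (Nat.add_zero n) a 1 = a

variable {A : ℕ → Type u} [∀ n, Ring (A n)]

/-- A sequence of modules over the rings of a tower. -/
structure GrMod (T : Tower A) where
  M : ℕ → Type u
  [grp : ∀ n, AddCommGroup (M n)]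
  [mod : ∀ n, Module (A n) (M n)]

attribute [instance] GrMod.grp GrMod.mod

namespace GrMod

variable {T : Tower A}

instance instCategory36 : Category (GrMod T) where
  Hom X Y := ∀ n, X.M n →ₗ[A n] Y.M n
  id X n := LinearMap.id
  comp f g n := (g n).comp (f n)

theorem comp_apply {X Y Z : GrMod T} (f : X ⟶ Y) (g : Y ⟶ Z) (n : ℕ) (x : X.M n) :
    (f ≫ g) n x = g n (f n x) := rfl

theorem id_apply {X : GrMod T} (n : ℕ) (x : X.M n) : (𝟙 X : X ⟶ X) n x = x := rfl

theorem hom_ext {X Y : GrMod T} {f g : X ⟶ Y} (h : ∀ n (x : X.M n), f n x = g n x) : f = g :=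
  funext fun n => LinearMap.ext (h n)

instance instPreadditive37 : Preadditive (GrMod T) where
  homGroup X Y := inferInstanceAs (AddCommGroup (∀ n, X.M n →ₗ[A n] Y.M n))
  add_comp _ _ _ f g h := hom_ext fun n x => map_add (h n) (f n x) (g n x)
  comp_add _ _ _ _ _ _ := hom_ext fun _ _ => rfl

theorem add_apply {X Y : GrMod T} (f g : X ⟶ Y) (n : ℕ) (x : X.M n) :
    (f + g) n x = f n x + g n x := rfl

theorem zero_apply {X Y : GrMod T} (n : ℕ) (x : X.M n) : (0 : X ⟶ Y) n x = 0 := rfl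

section Linear

variable {k : Type w} [CommRing k] [∀ n, Algebra k (A n)]

/-- The scalars act on morphisms through the values. -/
def smulHom {X Y : GrMod T} (r : k) (f : X ⟶ Y) : X ⟶ Y := fun n =>
  { toFun := fun x => algebraMap k (A n) r • f n x
    map_add' := fun x y => by rw [map_add, smul_add]
    map_smul' := fun a x => by
      rw [map_smul, ← mul_smul, Algebra.commutes, mul_smul, RingHom.id_apply] }

theorem smulHom_apply {X Y : GrMod T} (r : k) (f : X ⟶ Y) (n : ℕ) (x : X.M n) :
    smulHom r f n x = algebraMap k (A n) r • f n x := rfl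

instance instLinear38 : Linear k (GrMod T) where
  homModule X Y :=
    { smul := smulHom
      one_smul := fun f => hom_ext fun n x =>
        (smulHom_apply (1 : k) f n x).trans (by rw [map_one, one_smul])
      mul_smul := fun r s f => hom_ext fun n x =>
        (smulHom_apply (r * s) f n x).trans (by rw [map_mul, mul_smul]; rfl)
      smul_zero := fun r => hom_ext fun n x => smul_zero (algebraMap k (A n) r)
      smul_add := fun r f g => hom_ext fun n x => smul_add (algebraMap k (A n) r) (f n x) (g n x)
      add_smul := fun r s f => hom_ext fun n x =>
        (smulHom_apply (r + s) f n x).trans (by rw [map_add, add_smul]; rfl)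
      zero_smul := fun f => hom_ext fun n x =>
        (smulHom_apply (0 : k) f n x).trans (by rw [map_zero, zero_smul]; rfl) }
  smul_comp X Y Z r f g := hom_ext fun n x => map_smul (g n) (algebraMap k (A n) r) (f n x)
  comp_smul X Y Z f r g := hom_ext fun n x => rfl

end Linear

/-- The generators of the degree `n` part of the tensor product. -/
def TGen (X Y : GrMod T) (n : ℕ) : Type u :=
  Σ p : {p : ℕ × ℕ // p.1 + p.2 = n}, X.M p.1.1 × Y.M p.1.2

/-- A generator. -/
def TGen.mk {X Y : GrMod T} {i j n : ℕ} (h : i + j = n) (x : X.M i) (y : Y.M j) : TGen X Y n :=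
  ⟨⟨(i, j), h⟩, (x, y)⟩

/-- The relations of the tensor product. -/
inductive TRel (X Y : GrMod T) (n : ℕ) : (TGen X Y n →₀ A n) → Prop
  | add_left {i j : ℕ} (h : i + j = n) (x x' : X.M i) (y : Y.M j) :
      TRel X Y n (.single (.mk h (x + x') y) 1 - .single (.mk h x y) 1 - .single (.mk h x' y) 1)
  | add_right {i j : ℕ} (h : i + j = n) (x : X.M i) (y y' : Y.M j) :
      TRel X Y n (.single (.mk h x (y + y')) 1 - .single (.mk h x y) 1 - .single (.mk h x y') 1)
  | smul {i j : ℕ} (h : i + j = n) (a : A i) (b : A j) (x : X.M i) (y : Y.M j) :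
      TRel X Y n (.single (.mk h (a • x) (b • y)) 1 - .single (.mk h x y) (T.φ h a b))

/-- The degree `n` part `⨁ i + j = n, A n ⊗ (X i ⊠ Y j)` (tensor product over `A i ⊗ A j`) of the
tensor product, presented by generators `x ⊠ y` and relations. -/
def Tens (X Y : GrMod T) (n : ℕ) : Type u :=
  (TGen X Y n →₀ A n) ⧸ Submodule.span (A n) {v | TRel X Y n v}

noncomputable instance instAddCommGroup39 (X Y : GrMod T) (n : ℕ) : AddCommGroup (Tens X Y n) :=
  inferInstanceAs (AddCommGroup ((TGen X Y n →₀ A n) ⧸ Submodule.span (A n) {v | TRel X Y n v}))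

noncomputable instance instModule40 (X Y : GrMod T) (n : ℕ) : Module (A n) (Tens X Y n) :=
  inferInstanceAs (Module (A n)
    ((TGen X Y n →₀ A n) ⧸ Submodule.span (A n) {v | TRel X Y n v}))

/-- The quotient map. -/
noncomputable def Tens.mk (X Y : GrMod T) (n : ℕ) : (TGen X Y n →₀ A n) →ₗ[A n] Tens X Y n :=
  Submodule.mkQ (Submodule.span (A n) {v | TRel X Y n v})

theorem Tens.mk_rel {X Y : GrMod T} {n : ℕ} {v : TGen X Y n →₀ A n} (h : TRel X Y n v) :
    Tens.mk X Y n v = 0 :=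
  (Submodule.Quotient.mk_eq_zero _).2 (Submodule.subset_span h)

/-- The class of a generator. -/
noncomputable def tmul {X Y : GrMod T} {i j n : ℕ} (h : i + j = n) (x : X.M i) (y : Y.M j) :
    Tens X Y n :=
  Tens.mk X Y n (Finsupp.single (TGen.mk h x y) 1)

section
variable {X Y : GrMod T} {i j n : ℕ} (h : i + j = n)

theorem mk_single (a : A n) (x : X.M i) (y : Y.M j) :
    Tens.mk X Y n (Finsupp.single (TGen.mk h x y) a) = a • tmul h x y := by
  rw [tmul, ← map_smul, Finsupp.smul_single, smul_eq_mul, mul_one]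

theorem add_tmul (x x' : X.M i) (y : Y.M j) :
    tmul h (x + x') y = tmul h x y + tmul h x' y := by
  have := Tens.mk_rel (TRel.add_left h x x' y)
  rwa [map_sub, map_sub, sub_sub, sub_eq_zero] at this

theorem tmul_add (x : X.M i) (y y' : Y.M j) :
    tmul h x (y + y') = tmul h x y + tmul h x y' := by
  have := Tens.mk_rel (TRel.add_right h x y y')
  rwa [map_sub, map_sub, sub_sub, sub_eq_zero] at this

theorem smul_tmul_smul (a : A i) (b : A j) (x : X.M i) (y : Y.M j) :
    tmul h (a • x) (b • y) = T.φ h a b • tmul h x y := by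
  have := Tens.mk_rel (TRel.smul h a b x y)
  rwa [map_sub, mk_single, mk_single, one_smul, sub_eq_zero] at this

theorem smul_tmul (a : A i) (x : X.M i) (y : Y.M j) :
    tmul h (a • x) y = T.φ h a 1 • tmul h x y := by
  rw [← smul_tmul_smul, one_smul]

theorem tmul_smul (b : A j) (x : X.M i) (y : Y.M j) :
    tmul h x (b • y) = T.φ h 1 b • tmul h x y := by
  rw [← smul_tmul_smul, one_smul]

theorem zero_tmul (y : Y.M j) : tmul h (0 : X.M i) y = 0 := by
  have := add_tmul h (0 : X.M i) 0 y
  rwa [add_zero, left_eq_add] at this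

theorem tmul_zero (x : X.M i) : tmul h x (0 : Y.M j) = 0 := by
  have := tmul_add h x (0 : Y.M j) 0
  rwa [add_zero, left_eq_add] at this

end

theorem tens_induction {X Y : GrMod T} {n : ℕ} {P : Tens X Y n → Prop} (h0 : P 0)
    (hadd : ∀ s t, P s → P t → P (s + t))
    (hmul : ∀ (i j : ℕ) (h : i + j = n) (a : A n) (x : X.M i) (y : Y.M j), P (a • tmul h x y))
    (t : Tens X Y n) : P t := by
  obtain ⟨v, rfl⟩ := Submodule.mkQ_surjective (Submodule.span (A n) {v | TRel X Y n v}) t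
  change P (Tens.mk X Y n v)
  induction v using Finsupp.induction_linear with
  | zero => rwa [map_zero]
  | add v w hv hw => rw [map_add]; exact hadd _ _ hv hw
  | single g a =>
    obtain ⟨⟨⟨i, j⟩, h⟩, x, y⟩ := g
    have := hmul i j h a x y
    rwa [← mk_single] at this

section
variable {X Y : GrMod T} {n : ℕ} {B : Type u} [Ring B] {L : Type u} [AddCommGroup L] [Module B L]
  (σ : A n →+* B) (f : ∀ i j : ℕ, i + j = n → X.M i → Y.M j → L)

/-- Balanced biadditive maps. -/
structure Balanced : Prop where
  add_left : ∀ {i j : ℕ} (h : i + j = n) (x x' : X.M i) (y : Y.M j),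
    f i j h (x + x') y = f i j h x y + f i j h x' y
  add_right : ∀ {i j : ℕ} (h : i + j = n) (x : X.M i) (y y' : Y.M j),
    f i j h x (y + y') = f i j h x y + f i j h x y'
  smul : ∀ {i j : ℕ} (h : i + j = n) (a : A i) (b : A j) (x : X.M i) (y : Y.M j),
    f i j h (a • x) (b • y) = σ (T.φ h a b) • f i j h x y

/-- The semilinear extension of a map of generators. -/
noncomputable def preLift : (TGen X Y n →₀ A n) →ₛₗ[σ] L where
  toFun v := v.sum fun g a => σ a • f g.1.1.1 g.1.1.2 g.1.2 g.2.1 g.2.2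
  map_add' v w := Finsupp.sum_add_index' (fun _ => by rw [map_zero, zero_smul])
    (fun _ _ _ => by rw [map_add, add_smul])
  map_smul' a v := by
    rw [Finsupp.sum_smul_index (fun _ => by rw [map_zero, zero_smul]), Finsupp.smul_sum]
    simp only [map_mul, mul_smul]

theorem preLift_single {i j : ℕ} (h : i + j = n) (x : X.M i) (y : Y.M j) (a : A n) :
    preLift σ f (Finsupp.single (TGen.mk h x y) a) = σ a • f i j h x y :=
  Finsupp.sum_single_index (a := TGen.mk h x y)
    (h := fun g a => σ a • f g.1.1.1 g.1.1.2 g.1.2 g.2.1 g.2.2) (by rw [map_zero, zero_smul])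

variable {σ f}

/-- The universal property of the tensor product. -/
noncomputable def lift (hf : Balanced σ f) : Tens X Y n →ₛₗ[σ] L :=
  (Submodule.span (A n) {v | TRel X Y n v}).liftQ (preLift σ f) (by
    rw [Submodule.span_le]
    intro v hv
    rw [SetLike.mem_coe, LinearMap.mem_ker]
    cases hv with
    | add_left h x x' y =>
      rw [map_sub, map_sub, preLift_single, preLift_single, preLift_single, map_one, one_smul,
        one_smul, one_smul, sub_sub, sub_eq_zero, hf.add_left]
    | add_right h x y y' =>
      rw [map_sub, map_sub, preLift_single, preLift_single, preLift_single, map_one, one_smul,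
        one_smul, one_smul, sub_sub, sub_eq_zero, hf.add_right]
    | smul h a b x y =>
      rw [map_sub, preLift_single, preLift_single, map_one, one_smul, sub_eq_zero, hf.smul])

theorem lift_tmul (hf : Balanced σ f) {i j : ℕ} (h : i + j = n) (x : X.M i) (y : Y.M j) :
    lift hf (tmul h x y) = f i j h x y :=
  (preLift_single σ f h x y 1).trans (by rw [map_one, one_smul])

theorem tens_ext {f g : Tens X Y n →ₛₗ[σ] L}
    (H : ∀ (i j : ℕ) (h : i + j = n) (x : X.M i) (y : Y.M j), f (tmul h x y) = g (tmul h x y)) :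
    f = g := by
  refine LinearMap.ext fun t => ?_
  induction t using tens_induction with
  | h0 => rw [map_zero, map_zero]
  | hadd s t hs ht => rw [map_add, map_add, hs, ht]
  | hmul i j h' a x y => rw [LinearMap.map_smulₛₗ, LinearMap.map_smulₛₗ, H]

end

end GrMod

end Tower

section TowerMonoidal

variable {A : ℕ → Type u} [∀ n, Ring (A n)]

namespace Tower

variable (T : Tower A)

/-- The left embedding `A i → A n`. -/
def φL {i j n : ℕ} (h : i + j = n) : A i →+* A n where
  toFun a := T.φ h a 1
  map_one' := T.one h
  map_mul' a b := by rw [← T.mul, one_mul]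
  map_zero' := by
    have := T.add_left h 0 0 1
    rwa [add_zero, left_eq_add] at this
  map_add' a b := T.add_left h a b 1

/-- The right embedding `A j → A n`. -/
def φR {i j n : ℕ} (h : i + j = n) : A j →+* A n where
  toFun b := T.φ h 1 b
  map_one' := T.one h
  map_mul' a b := by rw [← T.mul, one_mul]
  map_zero' := by
    have := T.add_right h 1 0 0
    rwa [add_zero, left_eq_add] at this
  map_add' a b := T.add_right h 1 a b

theorem φL_apply {i j n : ℕ} (h : i + j = n) (a : A i) : T.φL h a = T.φ h a 1 := rfl

theorem φR_apply {i j n : ℕ} (h : i + j = n) (b : A j) : T.φR h b = T.φ h 1 b := rfl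

end Tower

namespace GrMod

variable {T : Tower A}

/-- Tensor product of objects. -/
noncomputable abbrev tObj (X Y : GrMod T) : GrMod T where
  M n := Tens X Y n

theorem bal_map {X X' Y Y' : GrMod T} (f : X ⟶ X') (g : Y ⟶ Y') (n : ℕ) :
    Balanced (RingHom.id (A n))
      (fun i j h (x : X.M i) (y : Y.M j) => (tmul h (f i x) (g j y) : Tens X' Y' n)) where
  add_left h x x' y := by rw [map_add, add_tmul]
  add_right h x y y' := by rw [map_add, tmul_add]
  smul h a b x y := by rw [map_smul, map_smul, smul_tmul_smul]; rfl

/-- Tensor product of morphisms. -/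
noncomputable def tMap {X X' Y Y' : GrMod T} (f : X ⟶ X') (g : Y ⟶ Y') : tObj X Y ⟶ tObj X' Y' :=
  fun n => lift (bal_map f g n)

theorem tMap_tmul {X X' Y Y' : GrMod T} (f : X ⟶ X') (g : Y ⟶ Y') {i j n : ℕ} (h : i + j = n)
    (x : X.M i) (y : Y.M j) : tMap f g n (tmul h x y) = (tmul h (f i x) (g j y) : Tens X' Y' n) :=
  lift_tmul (bal_map f g n) h x y

theorem tObj_ext {X Y Z : GrMod T} {f g : tObj X Y ⟶ Z}
    (H : ∀ (i j n : ℕ) (h : i + j = n) (x : X.M i) (y : Y.M j),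
      f n (tmul h x y : Tens X Y n) = g n (tmul h x y : Tens X Y n)) : f = g :=
  funext fun n => tens_ext fun i j h x y => H i j n h x y

theorem tObj_ext₂ {X Y Z W : GrMod T} {f g : tObj (tObj X Y) Z ⟶ W}
    (H : ∀ (i j l c n : ℕ) (h' : i + j = l) (h : l + c = n) (x : X.M i) (y : Y.M j) (z : Z.M c),
      f n (tmul (X := tObj X Y) h (tmul h' x y : Tens X Y l) z : Tens (tObj X Y) Z n) =
      g n (tmul (X := tObj X Y) h (tmul h' x y : Tens X Y l) z : Tens (tObj X Y) Z n)) : f = g := by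
  refine tObj_ext fun l c n h t z => ?_
  change Tens X Y l at t
  induction t using tens_induction with
  | h0 => exact (congrArg (f n) (zero_tmul h z)).trans <|
      ((map_zero (f n)).trans (map_zero (g n)).symm).trans (congrArg (g n) (zero_tmul h z)).symm
  | hadd s t hs ht =>
    have := add_tmul (X := tObj X Y) h s t z
    erw [this, map_add, map_add, hs, ht]
  | hmul i j h' a x y =>
    have := smul_tmul (X := tObj X Y) h a (tmul h' x y : Tens X Y l) z
    erw [this, map_smul, map_smul, H]

theorem tObj_ext₂' {X Y Z W : GrMod T} {f g : tObj X (tObj Y Z) ⟶ W}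
    (H : ∀ (i j m c n : ℕ) (h' : j + c = m) (h : i + m = n) (x : X.M i) (y : Y.M j) (z : Z.M c),
      f n (tmul (Y := tObj Y Z) h x (tmul h' y z : Tens Y Z m) : Tens X (tObj Y Z) n) =
      g n (tmul (Y := tObj Y Z) h x (tmul h' y z : Tens Y Z m) : Tens X (tObj Y Z) n)) :
    f = g := by
  refine tObj_ext fun i m n h x t => ?_
  change Tens Y Z m at t
  induction t using tens_induction with
  | h0 => exact (congrArg (f n) (tmul_zero h x)).trans <|
      ((map_zero (f n)).trans (map_zero (g n)).symm).trans (congrArg (g n) (tmul_zero h x)).symm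
  | hadd s t hs ht =>
    have := tmul_add (Y := tObj Y Z) h x s t
    erw [this, map_add, map_add, hs, ht]
  | hmul i j h' a y z =>
    have := tmul_smul (Y := tObj Y Z) h a x (tmul h' y z : Tens Y Z m)
    erw [this, map_smul, map_smul, H]

section Assoc

variable (X Y Z : GrMod T)

theorem bal_a₁ {l c n : ℕ} (h : l + c = n) (z : Z.M c) :
    Balanced (T.φL h) (fun i j h' (x : X.M i) (y : Y.M j) =>
      (tmul (Y := tObj Y Z) (by omega : i + (j + c) = n) x (tmul rfl y z : Tens Y Z (j + c)) :
        Tens X (tObj Y Z) n)) where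
  add_left h' x x' y := add_tmul _ x x' _
  add_right h' x y y' := by
    rw [add_tmul]
    exact tmul_add (Y := tObj Y Z) _ x _ _
  smul {i j} h' a b x y := by
    rw [smul_tmul rfl b y z, T.φL_apply, T.assoc h' h (rfl : j + c = j + c) (by omega)]
    exact smul_tmul_smul (Y := tObj Y Z) _ a _ x _

/-- The associator with fixed third entry. -/
noncomputable def aHom₁ {l c n : ℕ} (h : l + c = n) (z : Z.M c) :
    Tens X Y l →ₛₗ[T.φL h] Tens X (tObj Y Z) n :=
  lift (bal_a₁ X Y Z h z)

theorem aHom₁_tmul {i j l c n : ℕ} (h' : i + j = l) (h : l + c = n) (h'' : i + (j + c) = n)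
    (x : X.M i) (y : Y.M j) (z : Z.M c) : aHom₁ X Y Z h z (tmul h' x y) =
      (tmul (Y := tObj Y Z) h'' x (tmul rfl y z : Tens Y Z (j + c)) : Tens X (tObj Y Z) n) :=
  lift_tmul (bal_a₁ X Y Z h z) h' x y

theorem aHom₁_add {l c n : ℕ} (h : l + c = n) (z z' : Z.M c) :
    aHom₁ X Y Z h (z + z') = aHom₁ X Y Z h z + aHom₁ X Y Z h z' :=
  tens_ext fun i j h' x y => by
    have h'' : i + (j + c) = n := by omega
    rw [LinearMap.add_apply, aHom₁_tmul X Y Z h' h h'', aHom₁_tmul X Y Z h' h h'',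
      aHom₁_tmul X Y Z h' h h'', tmul_add]
    exact tmul_add (Y := tObj Y Z) _ x _ _

theorem aHom₁_smul {l c n : ℕ} (h : l + c = n) (b : A c) (z : Z.M c) (t : Tens X Y l) :
    aHom₁ X Y Z h (b • z) t = T.φ h 1 b • aHom₁ X Y Z h z t := by
  induction t using tens_induction with
  | h0 => rw [map_zero, map_zero, smul_zero]
  | hadd s t hs ht => rw [map_add, map_add, smul_add, hs, ht]
  | hmul i j h' a x y =>
    have h'' : i + (j + c) = n := by omega
    rw [LinearMap.map_smulₛₗ, LinearMap.map_smulₛₗ, aHom₁_tmul X Y Z h' h h'',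
      aHom₁_tmul X Y Z h' h h'', tmul_smul]
    have := tmul_smul (Y := tObj Y Z) h'' (T.φ rfl 1 b) x (tmul rfl y z : Tens Y Z (j + c))
    erw [this]
    rw [← mul_smul, ← mul_smul, T.φL_apply, ← T.mul, mul_one, one_mul,
      ← T.assoc h' h rfl h'', T.one, ← T.mul, mul_one, one_mul]

theorem bal_a (n : ℕ) : Balanced (X := tObj X Y) (RingHom.id (A n))
    (fun l c h (t : Tens X Y l) (z : Z.M c) => aHom₁ X Y Z h z t) where
  add_left h t t' z := map_add (aHom₁ X Y Z h z) t t'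
  add_right h t z z' := by rw [aHom₁_add, LinearMap.add_apply]
  smul {l c} h a b t z := by
    refine (map_smulₛₗ (aHom₁ X Y Z h (b • z)) a t).trans ?_
    rw [aHom₁_smul, ← mul_smul, T.φL_apply, ← T.mul, mul_one, one_mul, RingHom.id_apply]

theorem bal_b₁ {i m n : ℕ} (h : i + m = n) (x : X.M i) :
    Balanced (T.φR h) (fun j c h' (y : Y.M j) (z : Z.M c) =>
      (tmul (X := tObj X Y) (by omega : (i + j) + c = n) (tmul rfl x y : Tens X Y (i + j)) z :
        Tens (tObj X Y) Z n)) where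
  add_left h' y y' z := by
    rw [tmul_add]
    exact add_tmul (X := tObj X Y) _ _ _ z
  add_right h' y z z' := tmul_add _ _ z z'
  smul {j c} h' a b y z := by
    rw [tmul_smul rfl a x y, T.φR_apply, ← T.assoc (rfl : i + j = i + j) (by omega) h' h]
    exact smul_tmul_smul (X := tObj X Y) _ _ b _ z

/-- The inverse of the associator with fixed first entry. -/
noncomputable def aInv₁ {i m n : ℕ} (h : i + m = n) (x : X.M i) :
    Tens Y Z m →ₛₗ[T.φR h] Tens (tObj X Y) Z n :=
  lift (bal_b₁ X Y Z h x)

theorem aInv₁_tmul {i j m c n : ℕ} (h' : j + c = m) (h : i + m = n) (h'' : (i + j) + c = n)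
    (x : X.M i) (y : Y.M j) (z : Z.M c) : aInv₁ X Y Z h x (tmul h' y z) =
      (tmul (X := tObj X Y) h'' (tmul rfl x y : Tens X Y (i + j)) z : Tens (tObj X Y) Z n) :=
  lift_tmul (bal_b₁ X Y Z h x) h' y z

theorem aInv₁_add {i m n : ℕ} (h : i + m = n) (x x' : X.M i) :
    aInv₁ X Y Z h (x + x') = aInv₁ X Y Z h x + aInv₁ X Y Z h x' :=
  tens_ext fun j c h' y z => by
    have h'' : (i + j) + c = n := by omega
    rw [LinearMap.add_apply, aInv₁_tmul X Y Z h' h h'', aInv₁_tmul X Y Z h' h h'',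
      aInv₁_tmul X Y Z h' h h'', add_tmul]
    exact add_tmul (X := tObj X Y) _ _ _ z

theorem aInv₁_smul {i m n : ℕ} (h : i + m = n) (a : A i) (x : X.M i) (t : Tens Y Z m) :
    aInv₁ X Y Z h (a • x) t = T.φ h a 1 • aInv₁ X Y Z h x t := by
  induction t using tens_induction with
  | h0 => rw [map_zero, map_zero, smul_zero]
  | hadd s t hs ht => rw [map_add, map_add, smul_add, hs, ht]
  | hmul j c h' b y z =>
    have h'' : (i + j) + c = n := by omega
    rw [LinearMap.map_smulₛₗ, LinearMap.map_smulₛₗ, aInv₁_tmul X Y Z h' h h'',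
      aInv₁_tmul X Y Z h' h h'', smul_tmul]
    have := smul_tmul (X := tObj X Y) h'' (T.φ rfl a 1) (tmul rfl x y : Tens X Y (i + j)) z
    erw [this]
    rw [← mul_smul, ← mul_smul, T.φR_apply, ← T.mul, mul_one, one_mul,
      T.assoc rfl h'' h' h, T.one, ← T.mul, mul_one, one_mul]

theorem bal_b (n : ℕ) : Balanced (Y := tObj Y Z) (RingHom.id (A n))
    (fun i m h (x : X.M i) (t : Tens Y Z m) => aInv₁ X Y Z h x t) where
  add_left h x x' t := by rw [aInv₁_add, LinearMap.add_apply]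
  add_right h x t t' := map_add (aInv₁ X Y Z h x) t t'
  smul {i m} h a b x t := by
    refine (map_smulₛₗ (aInv₁ X Y Z h (a • x)) b t).trans ?_
    rw [aInv₁_smul, ← mul_smul, T.φR_apply, ← T.mul, mul_one, one_mul, RingHom.id_apply]

/-- The associator. -/
noncomputable def aHom : tObj (tObj X Y) Z ⟶ tObj X (tObj Y Z) := fun n => lift (bal_a X Y Z n)

/-- The inverse of the associator. -/
noncomputable def aInv : tObj X (tObj Y Z) ⟶ tObj (tObj X Y) Z := fun n => lift (bal_b X Y Z n)

variable {X Y Z}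

theorem aHom_tmul {i j l c m n : ℕ} (h' : i + j = l) (h : l + c = n) (h₁ : j + c = m)
    (h₂ : i + m = n) (x : X.M i) (y : Y.M j) (z : Z.M c) :
    aHom X Y Z n (tmul (X := tObj X Y) h (tmul h' x y : Tens X Y l) z : Tens (tObj X Y) Z n) =
      (tmul (Y := tObj Y Z) h₂ x (tmul h₁ y z : Tens Y Z m) : Tens X (tObj Y Z) n) := by
  subst h₁
  exact (lift_tmul (bal_a X Y Z n) h _ z).trans (aHom₁_tmul X Y Z h' h h₂ x y z)

theorem aInv_tmul {i j l c m n : ℕ} (h' : i + j = l) (h : l + c = n) (h₁ : j + c = m)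
    (h₂ : i + m = n) (x : X.M i) (y : Y.M j) (z : Z.M c) :
    aInv X Y Z n (tmul (Y := tObj Y Z) h₂ x (tmul h₁ y z : Tens Y Z m) : Tens X (tObj Y Z) n) =
      (tmul (X := tObj X Y) h (tmul h' x y : Tens X Y l) z : Tens (tObj X Y) Z n) := by
  subst h'
  exact (lift_tmul (bal_b X Y Z n) h₂ x _).trans (aInv₁_tmul X Y Z h₁ h₂ h x y z)

variable (X Y Z) in
/-- The associator. -/
noncomputable def aIso : tObj (tObj X Y) Z ≅ tObj X (tObj Y Z) where
  hom := aHom X Y Z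
  inv := aInv X Y Z
  hom_inv_id := tObj_ext₂ fun i j l c n h' h x y z => by
    have h₂ : i + (j + c) = n := by omega
    rw [comp_apply, aHom_tmul h' h rfl h₂, aInv_tmul h' h rfl h₂, id_apply]
  inv_hom_id := tObj_ext₂' fun i j m c n h₁ h₂ x y z => by
    have h : (i + j) + c = n := by omega
    rw [comp_apply, aInv_tmul rfl h h₁ h₂, aHom_tmul rfl h h₁ h₂, id_apply]

end Assoc

end GrMod

end TowerMonoidal

section TowerUnit

variable {A : ℕ → Type u} [∀ n, Ring (A n)]

namespace GrMod

/-- The unit: the ring `A 0` in degree `0`. -/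
def UnitM (A : ℕ → Type u) : ℕ → Type u
  | 0 => A 0
  | _ + 1 => PUnit

instance unitM_grp : ∀ n, AddCommGroup (UnitM A n)
  | 0 => inferInstanceAs (AddCommGroup (A 0))
  | _ + 1 => inferInstanceAs (AddCommGroup PUnit)

instance unitM_mod : ∀ n, Module (A n) (UnitM A n)
  | 0 => inferInstanceAs (Module (A 0) (A 0))
  | _ + 1 =>
    { smul := fun _ x => x
      one_smul := fun _ => rfl
      mul_smul := fun _ _ _ => rfl
      smul_zero := fun _ => rfl
      smul_add := fun _ _ _ => rfl
      add_smul := fun _ _ _ => Subsingleton.elim (α := PUnit) _ _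
      zero_smul := fun _ => Subsingleton.elim (α := PUnit) _ _ }

instance unitM_sub (n : ℕ) : Subsingleton (UnitM A (n + 1)) := inferInstanceAs (Subsingleton PUnit)

variable {T : Tower A}

variable (T) in
/-- The unit object. -/
abbrev tUnit : GrMod T where
  M n := UnitM A n

/-- The generator of the unit object. -/
def uOne : (tUnit T).M 0 := (1 : A 0)

theorem smul_uOne (c : (tUnit T).M 0) : (show A 0 from c) • (uOne : (tUnit T).M 0) = c :=
  mul_one (show A 0 from c)

/-- The left action of the unit object. -/
def lFun {Y : GrMod T} {n : ℕ} : ∀ i j : ℕ, i + j = n → UnitM A i → Y.M j → Y.M n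
  | 0, j, h, c, y => T.φ h (show A 0 from c) 1 •
      cast (congrArg Y.M ((Nat.zero_add j).symm.trans h)) y
  | _ + 1, _, _, _, _ => 0

theorem lFun_zero {Y : GrMod T} {n : ℕ} (c : A 0) (y : Y.M n) :
    lFun 0 n (Nat.zero_add n) c y = T.φ (Nat.zero_add n) c 1 • y := rfl

/-- The right action of the unit object. -/
def rFun {X : GrMod T} {n : ℕ} : ∀ i j : ℕ, i + j = n → X.M i → UnitM A j → X.M n
  | i, 0, h, x, c => T.φ h 1 (show A 0 from c) •
      cast (congrArg X.M ((Nat.add_zero i).symm.trans h)) x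
  | _, _ + 1, _, _, _ => 0

theorem rFun_zero {X : GrMod T} {n : ℕ} (x : X.M n) (c : A 0) :
    rFun n 0 (Nat.add_zero n) x c = T.φ (Nat.add_zero n) 1 c • x := rfl

theorem bal_l (Y : GrMod T) (n : ℕ) :
    Balanced (X := tUnit T) (Y := Y) (RingHom.id (A n)) (lFun (Y := Y) (n := n)) where
  add_left {i j} h c c' y := by
    cases i with
    | succ i => exact (add_zero _).symm
    | zero =>
      obtain rfl : n = j := by omega
      change A 0 at c c'
      exact (congrArg (· • y) (T.add_left h c c' 1)).trans (add_smul _ _ _)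
  add_right {i j} h c y y' := by
    cases i with
    | succ i => exact (add_zero _).symm
    | zero =>
      obtain rfl : n = j := by omega
      exact smul_add _ _ _
  smul {i j} h a b c y := by
    cases i with
    | succ i => exact (smul_zero _).symm
    | zero =>
      obtain rfl : n = j := by omega
      change A 0 at c
      change T.φ h (a * c) 1 • (b • y) = T.φ h a b • (T.φ h c 1 • y)
      conv_lhs => rw [← T.one_left b]
      rw [← mul_smul, ← mul_smul, ← T.mul, ← T.mul, mul_one, one_mul, mul_one]

theorem bal_r (X : GrMod T) (n : ℕ) :
    Balanced (X := X) (Y := tUnit T) (RingHom.id (A n)) (rFun (X := X) (n := n)) where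
  add_left {i j} h x x' c := by
    cases j with
    | succ j => exact (add_zero _).symm
    | zero =>
      obtain rfl : n = i := by omega
      exact smul_add _ _ _
  add_right {i j} h x c c' := by
    cases j with
    | succ j => exact (add_zero _).symm
    | zero =>
      obtain rfl : n = i := by omega
      change A 0 at c c'
      exact (congrArg (· • x) (T.add_right h 1 c c')).trans (add_smul _ _ _)
  smul {i j} h a b x c := by
    cases j with
    | succ j => exact (smul_zero _).symm
    | zero =>
      obtain rfl : n = i := by omega
      change A 0 at c
      change T.φ h 1 (b * c) • (a • x) = T.φ h a b • (T.φ h 1 c • x)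
      conv_lhs => rw [← T.one_right a]
      rw [← mul_smul, ← mul_smul, ← T.mul, ← T.mul, mul_one, one_mul, mul_one]

/-- The left unitor. -/
noncomputable def lHom (Y : GrMod T) : tObj (tUnit T) Y ⟶ Y := fun n => lift (bal_l Y n)

/-- The right unitor. -/
noncomputable def rHom (X : GrMod T) : tObj X (tUnit T) ⟶ X := fun n => lift (bal_r X n)

theorem lHom_tmul {Y : GrMod T} {n : ℕ} (c : A 0) (y : Y.M n) :
    lHom Y n (tmul (X := tUnit T) (Nat.zero_add n) (c : UnitM A 0) y : Tens (tUnit T) Y n) =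
      T.φ (Nat.zero_add n) c 1 • y :=
  lift_tmul (X := tUnit T) (bal_l Y n) (Nat.zero_add n) _ y

theorem rHom_tmul {X : GrMod T} {n : ℕ} (x : X.M n) (c : A 0) :
    rHom X n (tmul (Y := tUnit T) (Nat.add_zero n) x (c : UnitM A 0) : Tens X (tUnit T) n) =
      T.φ (Nat.add_zero n) 1 c • x :=
  lift_tmul (Y := tUnit T) (bal_r X n) (Nat.add_zero n) x _

/-- The inverse of the left unitor. -/
noncomputable def lInv (Y : GrMod T) : Y ⟶ tObj (tUnit T) Y := fun n =>
  { toFun := fun y => tmul (X := tUnit T) (Nat.zero_add n) uOne y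
    map_add' := fun y y' => tmul_add _ _ y y'
    map_smul' := fun a y => by rw [tmul_smul, T.one_left]; rfl }

/-- The inverse of the right unitor. -/
noncomputable def rInv (X : GrMod T) : X ⟶ tObj X (tUnit T) := fun n =>
  { toFun := fun x => tmul (Y := tUnit T) (Nat.add_zero n) x uOne
    map_add' := fun x x' => add_tmul _ x x' _
    map_smul' := fun a y => by rw [smul_tmul, T.one_right]; rfl }

theorem lUnit_ext {Y Z : GrMod T} {f g : tObj (tUnit T) Y ⟶ Z}
    (H : ∀ (n : ℕ) (y : Y.M n),
      f n (tmul (X := tUnit T) (Nat.zero_add n) uOne y : Tens (tUnit T) Y n) =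
      g n (tmul (X := tUnit T) (Nat.zero_add n) uOne y : Tens (tUnit T) Y n)) : f = g := by
  refine tObj_ext fun i j n h c y => ?_
  cases i with
  | succ i =>
    rw [Subsingleton.elim c 0, zero_tmul, map_zero, map_zero]
  | zero =>
    obtain rfl : n = j := by omega
    rw [← smul_uOne c, smul_tmul, map_smul, map_smul, H]

theorem rUnit_ext {X Z : GrMod T} {f g : tObj X (tUnit T) ⟶ Z}
    (H : ∀ (n : ℕ) (x : X.M n),
      f n (tmul (Y := tUnit T) (Nat.add_zero n) x uOne : Tens X (tUnit T) n) =
      g n (tmul (Y := tUnit T) (Nat.add_zero n) x uOne : Tens X (tUnit T) n)) : f = g := by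
  refine tObj_ext fun i j n h x c => ?_
  cases j with
  | succ j =>
    rw [Subsingleton.elim c 0, tmul_zero, map_zero, map_zero]
  | zero =>
    obtain rfl : n = i := by omega
    rw [← smul_uOne c, tmul_smul, map_smul, map_smul, H]

theorem lHom_uOne {Y : GrMod T} {n : ℕ} (y : Y.M n) :
    lHom Y n (tmul (X := tUnit T) (Nat.zero_add n) uOne y : Tens (tUnit T) Y n) = y :=
  (lHom_tmul 1 y).trans (by rw [T.one, one_smul])

theorem rHom_uOne {X : GrMod T} {n : ℕ} (x : X.M n) :
    rHom X n (tmul (Y := tUnit T) (Nat.add_zero n) x uOne : Tens X (tUnit T) n) = x :=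
  (rHom_tmul x 1).trans (by rw [T.one, one_smul])

/-- The left unitor. -/
noncomputable def lIso (Y : GrMod T) : tObj (tUnit T) Y ≅ Y where
  hom := lHom Y
  inv := lInv Y
  hom_inv_id := lUnit_ext fun n y => congrArg (lInv Y n) (lHom_uOne y)
  inv_hom_id := hom_ext fun _ y => lHom_uOne y

/-- The right unitor. -/
noncomputable def rIso (X : GrMod T) : tObj X (tUnit T) ≅ X where
  hom := rHom X
  inv := rInv X
  hom_inv_id := rUnit_ext fun n x => congrArg (rInv X n) (rHom_uOne x)
  inv_hom_id := hom_ext fun _ x => rHom_uOne x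

theorem tObj_ext₃ {W X Y Z V : GrMod T} {f g : tObj (tObj (tObj W X) Y) Z ⟶ V}
    (H : ∀ (i j l c m d n : ℕ) (h₁ : i + j = l) (h₂ : l + c = m) (h₃ : m + d = n)
      (w : W.M i) (x : X.M j) (y : Y.M c) (z : Z.M d),
      f n (tmul (X := tObj (tObj W X) Y) h₃ (tmul (X := tObj W X) h₂ (tmul h₁ w x) y) z) =
      g n (tmul (X := tObj (tObj W X) Y) h₃ (tmul (X := tObj W X) h₂ (tmul h₁ w x) y) z)) :
    f = g := by
  refine tObj_ext₂ fun l c m d n h₂ h₃ t y z => ?_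
  change Tens W X l at t
  induction t using tens_induction with
  | h0 => rw [zero_tmul (X := tObj W X), zero_tmul (X := tObj (tObj W X) Y), map_zero, map_zero]
  | hadd s t hs ht =>
    rw [add_tmul (X := tObj W X), add_tmul (X := tObj (tObj W X) Y), map_add, map_add, hs, ht]
  | hmul i j h' a x y =>
    rw [smul_tmul (X := tObj W X), smul_tmul (X := tObj (tObj W X) Y), map_smul, map_smul, H]

noncomputable instance monStruct : MonoidalCategoryStruct (GrMod T) where
  tensorObj X Y := tObj X Y
  tensorHom f g := tMap f g
  whiskerLeft X _ _ f := tMap (𝟙 X) f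
  whiskerRight f Y := tMap f (𝟙 Y)
  tensorUnit := tUnit T
  associator X Y Z := aIso X Y Z
  leftUnitor Y := lIso Y
  rightUnitor X := rIso X

theorem tMap_comp {X X' X'' Y Y' Y'' : GrMod T} (f : X ⟶ X') (f' : X' ⟶ X'') (g : Y ⟶ Y')
    (g' : Y' ⟶ Y'') : tMap (f ≫ f') (g ≫ g') = tMap f g ≫ tMap f' g' :=
  tObj_ext fun i j n h x y => by
    rw [tMap_tmul, comp_apply, comp_apply, comp_apply, tMap_tmul, tMap_tmul]

theorem tMap_id (X Y : GrMod T) : tMap (𝟙 X) (𝟙 Y) = 𝟙 (tObj X Y) :=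
  tObj_ext fun i j n h x y => by rw [tMap_tmul, id_apply, id_apply, id_apply]

theorem aHom_nat {X X' Y Y' Z Z' : GrMod T} (f : X ⟶ X') (g : Y ⟶ Y') (h : Z ⟶ Z') :
    tMap (tMap f g) h ≫ aHom X' Y' Z' = aHom X Y Z ≫ tMap f (tMap g h) :=
  tObj_ext₂ fun i j l c n h' h x y z => by
    have h₂ : i + (j + c) = n := by omega
    rw [comp_apply, comp_apply, tMap_tmul, tMap_tmul, aHom_tmul h' h rfl h₂,
      aHom_tmul h' h rfl h₂, tMap_tmul, tMap_tmul]

noncomputable instance mon : MonoidalCategory (GrMod T) :=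
  ofWhisker monStruct
    (hom := fun {X₁ Y₁ X₂ Y₂} f g => by
      change tMap f g = tMap f (𝟙 X₂) ≫ tMap (𝟙 Y₁) g
      rw [← tMap_comp, Category.comp_id, Category.id_comp])
    (wl_id := fun X Y => tMap_id X Y)
    (wr_id := fun X Y => tMap_id X Y)
    (wl_comp := fun X _ _ _ f g =>
      (congrArg (fun e => tMap e (f ≫ g)) (Category.id_comp (𝟙 X)).symm).trans
        (tMap_comp (𝟙 X) (𝟙 X) f g))
    (wr_comp := fun f g X =>
      (congrArg (fun e => tMap (f ≫ g) e) (Category.id_comp (𝟙 X)).symm).trans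
        (tMap_comp f g (𝟙 X) (𝟙 X)))
    (exch := fun {W X Y Z} f g => by
      change tMap (𝟙 W) g ≫ tMap f (𝟙 Z) = tMap f (𝟙 Y) ≫ tMap (𝟙 X) g
      rw [← tMap_comp, ← tMap_comp, Category.comp_id, Category.id_comp, Category.comp_id,
        Category.id_comp])
    (nat₁ := fun f Y Z => (aHom_nat f (𝟙 Y) (𝟙 Z)).trans (by rw [tMap_id]; rfl))
    (nat₂ := fun X _ _ f Z => aHom_nat (𝟙 X) f (𝟙 Z))
    (nat₃ := fun X Y _ _ f => Eq.trans (by rw [tMap_id]; rfl) (aHom_nat (𝟙 X) (𝟙 Y) f))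
    (natl := fun {X Y} f => lUnit_ext fun n y => by
      change lHom Y n (tMap (𝟙 (tUnit T)) f n (tmul (X := tUnit T) _ uOne y)) =
        f n (lHom X n (tmul (X := tUnit T) _ uOne y))
      rw [tMap_tmul, id_apply, lHom_uOne, lHom_uOne])
    (natr := fun {X Y} f => rUnit_ext fun n y => by
      change rHom Y n (tMap f (𝟙 (tUnit T)) n (tmul (Y := tUnit T) _ y uOne)) =
        f n (rHom X n (tmul (Y := tUnit T) _ y uOne))
      rw [tMap_tmul, id_apply, rHom_uOne, rHom_uOne])
    (pent := fun W X Y Z => tObj_ext₃ fun i j l c m d n h₁ h₂ h₃ w x y z => by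
      change tMap (𝟙 W) (aHom X Y Z) n (aHom W (tObj X Y) Z n (tMap (aHom W X Y) (𝟙 Z) n
          (tmul (X := tObj (tObj W X) Y) h₃ (tmul (X := tObj W X) h₂ (tmul h₁ w x) y) z))) =
        aHom W X (tObj Y Z) n (aHom (tObj W X) Y Z n
          (tmul (X := tObj (tObj W X) Y) h₃ (tmul (X := tObj W X) h₂ (tmul h₁ w x) y) z))
      have e₁ : i + (j + c) = m := by omega
      have e₂ : j + c + d = j + (c + d) := by omega
      have e₃ : i + (j + (c + d)) = n := by omega
      have e₄ : l + (c + d) = n := by omega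
      rw [tMap_tmul, aHom_tmul h₁ h₂ rfl e₁, aHom_tmul e₁ h₃ e₂ e₃, tMap_tmul,
        aHom_tmul rfl e₂ rfl rfl, aHom_tmul h₂ h₃ rfl e₄, aHom_tmul h₁ e₄ rfl e₃, id_apply,
        id_apply])
    (tri := fun X Y => tObj_ext₂ fun i j l c n h' h x u y => by
      change tMap (𝟙 X) (lHom Y) n (aHom X (tUnit T) Y n
          (tmul (X := tObj X (tUnit T)) h (tmul (Y := tUnit T) h' x u) y)) =
        tMap (rHom X) (𝟙 Y) n (tmul (X := tObj X (tUnit T)) h (tmul (Y := tUnit T) h' x u) y)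
      have h₂ : i + (j + c) = n := by omega
      change UnitM A j at u
      cases j with
      | succ j =>
        rw [Subsingleton.elim u 0, tmul_zero (Y := tUnit T), zero_tmul (X := tObj X (tUnit T)),
          map_zero, map_zero, map_zero]
      | zero =>
        obtain rfl : l = i := by omega
        rw [← smul_uOne u, tmul_smul (Y := tUnit T), smul_tmul (X := tObj X (tUnit T)), map_smul,
          map_smul, map_smul]
        congr 1
        rw [aHom_tmul h' h (Nat.zero_add c) (by omega), tMap_tmul, tMap_tmul, lHom_uOne, rHom_uOne,
          id_apply, id_apply])

theorem tMap_add_left {X X' Y Y' : GrMod T} (f f' : X ⟶ X') (g : Y ⟶ Y') :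
    tMap (f + f') g = tMap f g + tMap f' g :=
  tObj_ext fun i j n h x y => by
    rw [tMap_tmul, add_apply, add_apply, tMap_tmul, tMap_tmul, add_tmul]

theorem tMap_add_right {X X' Y Y' : GrMod T} (f : X ⟶ X') (g g' : Y ⟶ Y') :
    tMap f (g + g') = tMap f g + tMap f g' :=
  tObj_ext fun i j n h x y => by
    rw [tMap_tmul, add_apply, add_apply, tMap_tmul, tMap_tmul, tmul_add]

theorem tMap_zero_left {X X' Y Y' : GrMod T} (g : Y ⟶ Y') :
    tMap (0 : X ⟶ X') g = 0 := by
  have := tMap_add_left (0 : X ⟶ X') 0 g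
  rwa [add_zero, left_eq_add] at this

theorem tMap_zero_right {X X' Y Y' : GrMod T} (f : X ⟶ X') :
    tMap f (0 : Y ⟶ Y') = 0 := by
  have := tMap_add_right f (0 : Y ⟶ Y') 0
  rwa [add_zero, left_eq_add] at this

instance monPre : MonoidalPreadditive (GrMod T) where
  whiskerLeft_zero {X _ _} := tMap_zero_right (𝟙 X)
  zero_whiskerRight {X _ _} := tMap_zero_left (𝟙 X)
  whiskerLeft_add {X _ _} f g := tMap_add_right (𝟙 X) f g
  add_whiskerRight {X _ _} f g := tMap_add_left f g (𝟙 X)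

end GrMod

end TowerUnit

section FinProj

variable {R : Type u} [Ring R] {M : Type u} [AddCommGroup M] [Module R M]

theorem exists_dual [Module.Finite R M] [Module.Projective R M] :
    ∃ (r : ℕ) (x : Fin r → M) (f : Fin r → (M →ₗ[R] R)), ∀ m, ∑ s, f s m • x s = m := by
  obtain ⟨r, p, hp⟩ := Module.Finite.exists_fin' R M
  obtain ⟨s, hs⟩ := Module.projective_lifting_property p LinearMap.id hp
  refine ⟨r, fun i => p (Pi.single i 1), fun i => (LinearMap.proj i).comp s, fun m => ?_⟩
  have h₁ := LinearMap.pi_apply_eq_sum_univ p (s m)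
  have h₂ : p (s m) = m := LinearMap.congr_fun hs m
  rw [h₂] at h₁
  conv_rhs => rw [h₁]
  refine Finset.sum_congr rfl fun i _ => ?_
  congr 1
  refine congrArg p ?_
  funext j
  rw [Pi.single_apply]
  simp only [eq_comm]

theorem finite_proj_of_dual {ι : Type*} [Finite ι] (x : ι → M) (f : ι → (M →ₗ[R] R))
    (h : ∀ m, ∑ᶠ s, f s m • x s = m) : Module.Finite R M ∧ Module.Projective R M := by
  classical
  have := Fintype.ofFinite ι
  have hs : (Fintype.linearCombination R x).comp (LinearMap.pi f) = LinearMap.id :=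
    LinearMap.ext fun m => by
      have := h m
      rw [finsum_eq_sum_of_fintype] at this
      exact this
  exact ⟨Module.Finite.of_surjective (Fintype.linearCombination R x) fun m =>
      ⟨_, LinearMap.congr_fun hs m⟩, Module.Projective.of_split _ _ hs⟩

end FinProj

section TowerProj

variable {A : ℕ → Type u} [∀ n, Ring (A n)] {T : Tower A}

namespace GrMod

/-- Finitely generated projective modules, almost all of which are zero. -/
def proj (T : Tower A) : ObjectProperty (GrMod T) := fun X =>
  (∀ n, Module.Finite (A n) (X.M n) ∧ Module.Projective (A n) (X.M n)) ∧
    ∃ N, ∀ n, N ≤ n → Subsingleton (X.M n)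

theorem bal_f {X Y : GrMod T} (f : ∀ i, X.M i →ₗ[A i] A i) (g : ∀ j, Y.M j →ₗ[A j] A j) (n : ℕ) :
    Balanced (RingHom.id (A n))
      (fun i j h (x : X.M i) (y : Y.M j) => (T.φ h (f i x) (g j y) : A n)) where
  add_left h x x' y := by rw [map_add, T.add_left]
  add_right h x y y' := by rw [map_add, T.add_right]
  smul h a b x y := by
    rw [map_smul, map_smul, smul_eq_mul, smul_eq_mul, smul_eq_mul, T.mul]; rfl

theorem tens_subsingleton {X Y : GrMod T} {N N' : ℕ} (hX : ∀ n, N ≤ n → Subsingleton (X.M n))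
    (hY : ∀ n, N' ≤ n → Subsingleton (Y.M n)) (n : ℕ) (hn : N + N' ≤ n) :
    Subsingleton (Tens X Y n) := by
  refine subsingleton_of_forall_eq 0 fun t => ?_
  induction t using tens_induction with
  | h0 => rfl
  | hadd s t hs ht => rw [hs, ht, add_zero]
  | hmul i j h a x y =>
    by_cases hi : N ≤ i
    · have := hX i hi
      rw [Subsingleton.elim x 0, zero_tmul, smul_zero]
    · have := hY j (by omega)
      rw [Subsingleton.elim y 0, tmul_zero, smul_zero]

theorem tmul_sum {X Y : GrMod T} {i j n : ℕ} (h : i + j = n) (x : X.M i) {ι : Type} (s : Finset ι)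
    (y : ι → Y.M j) : tmul h x (∑ t ∈ s, y t) = ∑ t ∈ s, tmul h x (y t) := by
  classical
  induction s using Finset.induction_on with
  | empty => rw [Finset.sum_empty, Finset.sum_empty, tmul_zero]
  | insert a s ha ih => rw [Finset.sum_insert ha, Finset.sum_insert ha, tmul_add, ih]

theorem sum_tmul {X Y : GrMod T} {i j n : ℕ} (h : i + j = n) (y : Y.M j) {ι : Type} (s : Finset ι)
    (x : ι → X.M i) : tmul h (∑ t ∈ s, x t) y = ∑ t ∈ s, tmul h (x t) y := by
  classical
  induction s using Finset.induction_on with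
  | empty => rw [Finset.sum_empty, Finset.sum_empty, zero_tmul]
  | insert a s ha ih => rw [Finset.sum_insert ha, Finset.sum_insert ha, add_tmul, ih]

theorem φ_zero_left {i j n : ℕ} (h : i + j = n) (b : A j) : T.φ h 0 b = 0 := by
  have := T.add_left h 0 0 b
  rwa [add_zero, left_eq_add] at this

theorem φ_zero_right {i j n : ℕ} (h : i + j = n) (a : A i) : T.φ h a 0 = 0 := by
  have := T.add_right h a 0 0
  rwa [add_zero, left_eq_add] at this

theorem proj_tens {X Y : GrMod T} (hX : proj T X) (hY : proj T Y) : proj T (tObj X Y) := by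
  classical
  obtain ⟨hX, N, hN⟩ := hX
  obtain ⟨hY, N', hN'⟩ := hY
  refine ⟨fun n => ?_, N + N', tens_subsingleton hN hN'⟩
  have hX' := fun i => @exists_dual _ _ _ _ _ (hX i).1 (hX i).2
  have hY' := fun i => @exists_dual _ _ _ _ _ (hY i).1 (hY i).2
  choose r x f hf using hX'
  choose r' y g hg using hY'
  let ι := Σ p : Finset.HasAntidiagonal.antidiagonal n, Fin (r p.1.1) × Fin (r' p.1.2)
  have hp : ∀ p : Finset.HasAntidiagonal.antidiagonal n, p.1.1 + p.1.2 = n := fun p =>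
    Finset.HasAntidiagonal.mem_antidiagonal.1 p.2
  refine finite_proj_of_dual (ι := ι)
    (fun s => (tmul (hp s.1) (x s.1.1.1 s.2.1) (y s.1.1.2 s.2.2) : Tens X Y n))
    (fun s => lift (bal_f (T := T) (Pi.single s.1.1.1 (f s.1.1.1 s.2.1))
      (Pi.single s.1.1.2 (g s.1.1.2 s.2.2)) n)) fun t => ?_
  rw [finsum_eq_sum_of_fintype]
  change Tens X Y n at t
  induction t using tens_induction with
  | h0 => simp only [map_zero, zero_smul, Finset.sum_const_zero]
  | hadd s t hs ht =>
    simp only [map_add, add_smul, Finset.sum_add_distrib]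
    rw [hs, ht]
  | hmul i j h a m m' =>
    simp only [map_smul, smul_assoc]
    rw [← Finset.smul_sum]
    congr 1
    rw [Fintype.sum_sigma, Finset.sum_eq_single ⟨(i, j), Finset.HasAntidiagonal.mem_antidiagonal.2 h⟩]
    · simp only [lift_tmul, Pi.single_eq_same]
      simp only [← smul_tmul_smul]
      rw [Fintype.sum_prod_type]
      simp only [← tmul_sum, ← sum_tmul]
      rw [hf, hg]
    · rintro ⟨⟨i', j'⟩, hp'⟩ _ hne
      refine Finset.sum_eq_zero fun s _ => ?_
      have hne' : i ≠ i' := by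
        rintro rfl
        refine hne (Subtype.ext (Prod.ext rfl ?_))
        have := Finset.HasAntidiagonal.mem_antidiagonal.1 hp'
        change i + j' = n at this
        change j' = j
        omega
      rw [lift_tmul, Pi.single_eq_of_ne hne', LinearMap.zero_apply, φ_zero_left, zero_smul]
    · intro h'
      exact (h' (Finset.mem_univ _)).elim

theorem proj_unit : proj T (tUnit T) := by
  refine ⟨fun n => ?_, 1, fun n hn => ?_⟩
  · cases n with
    | zero =>
      exact ⟨inferInstanceAs (Module.Finite (A 0) (A 0)),
        inferInstanceAs (Module.Projective (A 0) (A 0))⟩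
    | succ n =>
      exact finite_proj_of_dual (ι := Empty) (fun e => e.elim) (fun e => e.elim) fun m =>
        Subsingleton.elim (α := UnitM A (n + 1)) _ _
  · obtain ⟨n, rfl⟩ : ∃ m, n = m + 1 := ⟨n - 1, by omega⟩
    exact unitM_sub (A := A) n

instance proj_mon (T : Tower A) : (proj T).IsMonoidal where
  prop_unit := proj_unit
  prop_tensor _ _ := proj_tens

end GrMod

/-- The category of sequences of finitely generated projective modules over the rings of a tower,
almost all of which are zero, with the tensor product given by induction. -/
abbrev ProjMod (T : Tower A) : Type (u + 1) := (GrMod.proj T).FullSubcategory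

/-- The objects that are concentrated in degree `i`. -/
def ProjMod.deg (T : Tower A) (i : ℕ) : ObjectProperty (ProjMod T) := fun X =>
  ∀ j, j ≠ i → Subsingleton (X.obj.M j)

end TowerProj

/-- The opposite of a tower. Left modules over it are right modules over the original tower. -/
def Tower.op {R : ℕ → Type u} [∀ n, Ring (R n)] (T : Tower R) : Tower fun n => (R n)ᵐᵒᵖ where
  φ h a b := MulOpposite.op (T.φ h a.unop b.unop)
  add_left h a a' b := congrArg MulOpposite.op (T.add_left h a.unop a'.unop b.unop)
  add_right h a b b' := congrArg MulOpposite.op (T.add_right h a.unop b.unop b'.unop)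
  mul h a a' b b' := congrArg MulOpposite.op (T.mul h a'.unop a.unop b'.unop b.unop)
  one h := congrArg MulOpposite.op (T.one h)
  assoc h₁ h₂ h₃ h₄ a b d :=
    congrArg MulOpposite.op (T.assoc h₁ h₂ h₃ h₄ a.unop b.unop d.unop)
  one_left a := congrArg MulOpposite.op (T.one_left a.unop)
  one_right a := congrArg MulOpposite.op (T.one_right a.unop)

section SymmetricTower

open Polynomial

variable {k : Type u} [Field k]

/-- The algebra `k[x₁, …, xₙ] / (u(x₁), …, u(xₙ))`. -/
abbrev TruncPoly (v : k[X]) (n : ℕ) : Type u :=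
  MvPolynomial (Fin n) k ⧸
    Ideal.span (Set.range fun i : Fin n => aeval (MvPolynomial.X i : MvPolynomial (Fin n) k) v)

namespace TruncPoly

variable {v : k[X]}

/-- Renaming the variables. -/
noncomputable def map {i n : ℕ} (f : Fin i → Fin n) : TruncPoly v i →ₐ[k] TruncPoly v n :=
  Ideal.quotientMapₐ _ (MvPolynomial.rename f) (by
    rw [Ideal.span_le]
    rintro _ ⟨a, rfl⟩
    refine Ideal.subset_span ⟨f a, ?_⟩
    change _ = MvPolynomial.rename f _
    rw [← aeval_algHom_apply, MvPolynomial.rename_X])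

theorem map_mk {i n : ℕ} (f : Fin i → Fin n) (p : MvPolynomial (Fin i) k) :
    map (v := v) f (Ideal.Quotient.mk _ p) = Ideal.Quotient.mk _ (MvPolynomial.rename f p) := rfl

theorem map_id {n : ℕ} (p : TruncPoly v n) : map id p = p := by
  obtain ⟨p, rfl⟩ := Ideal.Quotient.mk_surjective p
  rw [map_mk, MvPolynomial.rename_id_apply]

theorem map_map {i j n : ℕ} (f : Fin i → Fin j) (g : Fin j → Fin n) (p : TruncPoly v i) :
    map g (map f p) = map (g ∘ f) p := by
  obtain ⟨p, rfl⟩ := Ideal.Quotient.mk_surjective p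
  rw [map_mk, map_mk, map_mk, MvPolynomial.rename_rename]

/-- The symmetric group permutes the variables. -/
noncomputable instance action (n : ℕ) : MulSemiringAction (Equiv.Perm (Fin n)) (TruncPoly v n) where
  smul σ p := map σ p
  one_smul p := map_id p
  mul_smul σ τ p := (map_map τ σ p).symm
  smul_zero σ := map_zero (map σ)
  smul_add σ := map_add (map σ)
  smul_one σ := map_one (map σ)
  smul_mul σ := map_mul (map σ)

theorem smul_def {n : ℕ} (σ : Equiv.Perm (Fin n)) (p : TruncPoly v n) : σ • p = map σ p := rfl

instance action_comm (n : ℕ) : SMulCommClass (Equiv.Perm (Fin n)) k (TruncPoly v n) where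
  smul_comm σ r p := map_smul (map (v := v) σ) r p

end TruncPoly

/-- The skew group algebra `k[x₁, …, xₙ] / (u(x₁), …, u(xₙ)) ⋊ k[Sₙ]`. -/
def SkewSym (v : k[X]) (n : ℕ) : Type u :=
  SkewMonoidAlgebra (TruncPoly v n) (Equiv.Perm (Fin n))

namespace SkewSym

variable {v : k[X]}

noncomputable instance ring (n : ℕ) : Ring (SkewSym v n) :=
  inferInstanceAs (Ring (SkewMonoidAlgebra (TruncPoly v n) (Equiv.Perm (Fin n))))

noncomputable instance algebra (n : ℕ) : Algebra k (SkewSym v n) :=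
  inferInstanceAs (Algebra k (SkewMonoidAlgebra (TruncPoly v n) (Equiv.Perm (Fin n))))

/-- The element `p ⊗ σ`. -/
noncomputable def single {n : ℕ} (σ : Equiv.Perm (Fin n)) (p : TruncPoly v n) : SkewSym v n :=
  SkewMonoidAlgebra.single σ p

theorem single_mul_single {n : ℕ} (σ τ : Equiv.Perm (Fin n)) (p q : TruncPoly v n) :
    single σ p * single τ q = single (σ * τ) (p * σ • q) :=
  SkewMonoidAlgebra.single_mul_single

theorem induction {n : ℕ} {P : SkewSym v n → Prop} (h0 : P 0) (hadd : ∀ r s, P r → P s → P (r + s))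
    (hsingle : ∀ σ p, P (single σ p)) (r : SkewSym v n) : P r :=
  SkewMonoidAlgebra.induction_on r h0 hsingle fun r s => hadd r s

open Equiv.Perm in
theorem via_apply {i n : ℕ} (ι : Fin i ↪ Fin n) (σ : Equiv.Perm (Fin i)) :
    ⇑(viaEmbeddingHom ι σ) ∘ ι = ι ∘ σ :=
  funext fun a => viaEmbedding_apply σ ι a

open Equiv.Perm in
theorem via_disj {i j n : ℕ} (ι : Fin i ↪ Fin n) (κ : Fin j ↪ Fin n) (h : ∀ a b, ι a ≠ κ b)
    (σ : Equiv.Perm (Fin i)) : ⇑(viaEmbeddingHom ι σ) ∘ κ = κ :=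
  funext fun b => viaEmbedding_apply_of_notMem σ ι (κ b) fun ⟨a, ha⟩ => h a b ha

open Equiv.Perm in
/-- The embedding of skew group algebras given by an embedding of the sets of indices. -/
noncomputable def emb {i n : ℕ} (ι : Fin i ↪ Fin n) : SkewSym v i →+* SkewSym v n :=
  SkewMonoidAlgebra.liftNCRingHom (k := TruncPoly v i) (G := Equiv.Perm (Fin i))
    (R := SkewSym v n)
    { toFun := fun p => single 1 (TruncPoly.map ι p)
      map_zero' := by rw [map_zero]; exact SkewMonoidAlgebra.single_zero _
      map_one' := by rw [map_one]; rfl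
      map_add' := fun p q => by rw [map_add]; exact SkewMonoidAlgebra.single_add _ _ _
      map_mul' := fun p q => by rw [map_mul, single_mul_single, one_smul, one_mul] }
    { toFun := fun σ => single (viaEmbeddingHom ι σ) 1
      map_one' := by rw [map_one]; rfl
      map_mul' := fun σ τ => by rw [map_mul, single_mul_single, smul_one, one_mul] }
    (by
      intro p σ
      change single 1 (TruncPoly.map ι (σ • p)) * single (viaEmbeddingHom ι σ) 1 =
        single (viaEmbeddingHom ι σ) 1 * single 1 (TruncPoly.map ι p)
      rw [single_mul_single, single_mul_single, one_mul,
        mul_one, smul_one, mul_one, one_mul, TruncPoly.smul_def, TruncPoly.smul_def,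
        TruncPoly.map_map, TruncPoly.map_map, via_apply])

open Equiv.Perm in
theorem emb_single {i n : ℕ} (ι : Fin i ↪ Fin n) (σ : Equiv.Perm (Fin i)) (p : TruncPoly v i) :
    emb ι (single σ p) = single (viaEmbeddingHom ι σ) (TruncPoly.map ι p) := by
  refine (SkewMonoidAlgebra.liftNC_single _ _ σ p).trans ?_
  change single 1 (TruncPoly.map ι p) * single (viaEmbeddingHom ι σ) 1 = _
  rw [single_mul_single, one_mul, smul_one, mul_one]

theorem ringHom_ext {n : ℕ} {B : Type u} [Ring B] {f g : SkewSym v n →+* B}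
    (h : ∀ σ p, f (single σ p) = g (single σ p)) : f = g :=
  RingHom.ext fun r => by
    induction r using induction with
    | h0 => rw [map_zero, map_zero]
    | hadd r s hr hs => rw [map_add, map_add, hr, hs]
    | hsingle σ p => exact h σ p

open Equiv.Perm in
theorem emb_emb {i j n : ℕ} (ι : Fin i ↪ Fin j) (κ : Fin j ↪ Fin n) (r : SkewSym v i) :
    emb κ (emb ι r) = emb (ι.trans κ) r := by
  refine RingHom.congr_fun (f := (emb κ).comp (emb ι)) (g := emb (ι.trans κ)) (ringHom_ext fun σ p => ?_) r
  rw [RingHom.comp_apply, emb_single, emb_single, emb_single, TruncPoly.map_map]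
  congr 1
  ext a : 1
  by_cases ha : a ∈ Set.range κ
  · obtain ⟨b, rfl⟩ := ha
    refine (viaEmbedding_apply _ κ b).trans ?_
    by_cases hb : b ∈ Set.range ι
    · obtain ⟨c, rfl⟩ := hb
      refine (congrArg κ (viaEmbedding_apply σ ι c)).trans ?_
      exact (viaEmbedding_apply σ (ι.trans κ) c).symm
    · refine (congrArg κ (viaEmbedding_apply_of_notMem σ ι b hb)).trans ?_
      refine (viaEmbedding_apply_of_notMem σ (ι.trans κ) (κ b) ?_).symm
      rintro ⟨c, hc⟩
      exact hb ⟨c, κ.injective hc⟩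
  · refine (viaEmbedding_apply_of_notMem _ κ a ha).trans ?_
    refine (viaEmbedding_apply_of_notMem σ (ι.trans κ) a ?_).symm
    rintro ⟨c, hc⟩
    exact ha ⟨ι c, hc⟩

open Equiv.Perm in
theorem emb_eq_self {n : ℕ} (ι : Fin n ↪ Fin n) (hι : ∀ a, ι a = a) (r : SkewSym v n) :
    emb ι r = r := by
  refine RingHom.congr_fun (f := emb ι) (g := RingHom.id _) (ringHom_ext fun σ p => ?_) r
  have h : ⇑ι = id := funext hι
  have hσ : viaEmbeddingHom ι σ = σ := by
    ext a : 1
    have := viaEmbedding_apply σ ι a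
    rwa [hι, hι] at this
  rw [emb_single, RingHom.id_apply, h, TruncPoly.map_id, hσ]

open Equiv.Perm in
theorem emb_comm {i j n : ℕ} (ι : Fin i ↪ Fin n) (κ : Fin j ↪ Fin n) (h : ∀ a b, ι a ≠ κ b)
    (r : SkewSym v i) (s : SkewSym v j) : emb ι r * emb κ s = emb κ s * emb ι r := by
  induction r using induction with
  | h0 => rw [map_zero, zero_mul, mul_zero]
  | hadd r r' hr hr' => rw [map_add, add_mul, mul_add, hr, hr']
  | hsingle σ p =>
    induction s using induction with
    | h0 => rw [map_zero, zero_mul, mul_zero]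
    | hadd r r' hr hr' => rw [map_add, add_mul, mul_add, hr, hr']
    | hsingle τ q =>
      rw [emb_single, emb_single, single_mul_single,
        single_mul_single, TruncPoly.smul_def, TruncPoly.smul_def,
        TruncPoly.map_map, TruncPoly.map_map, via_disj ι κ h, via_disj κ ι fun b a => (h a b).symm,
        mul_comm (TruncPoly.map ι p)]
      congr 1
      refine Equiv.Perm.Disjoint.commute fun a => ?_
      by_cases ha : a ∈ Set.range ι
      · refine .inr (viaEmbedding_apply_of_notMem τ κ a ?_)
        rintro ⟨b, rfl⟩
        obtain ⟨c, hc⟩ := ha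
        exact h c b hc
      · exact .inl (viaEmbedding_apply_of_notMem σ ι a ha)

/-- The first `i` indices. -/
def embL {i j n : ℕ} (h : i + j = n) : Fin i ↪ Fin n where
  toFun a := ⟨a, by omega⟩
  inj' a b hab := Fin.ext (by simpa using hab)

/-- The last `j` indices. -/
def embR {i j n : ℕ} (h : i + j = n) : Fin j ↪ Fin n where
  toFun b := ⟨i + b, by omega⟩
  inj' a b hab := Fin.ext (by simpa using hab)

theorem embL_ne_embR {i j n : ℕ} (h : i + j = n) (a : Fin i) (b : Fin j) :
    embL h a ≠ embR h b := fun hab => by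
  have : (a : ℕ) = i + b := congrArg Fin.val hab
  omega

variable (v) in
/-- The tower of the skew group algebras: the first factor acts on the first indices and the second
factor acts on the last indices. -/
noncomputable def tower : Tower (SkewSym v) where
  φ h r s := emb (embL h) r * emb (embR h) s
  add_left h r r' s := by rw [map_add, add_mul]
  add_right h r s s' := by rw [map_add, mul_add]
  mul h r r' s s' := by
    rw [map_mul, map_mul, mul_assoc, mul_assoc, ← mul_assoc (emb _ r'),
      emb_comm _ _ (embL_ne_embR h), mul_assoc]
  one h := by rw [map_one, map_one, one_mul]
  assoc {i j c l m n} h₁ h₂ h₃ h₄ r s t := by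
    have e₁ : (embL h₁).trans (embL h₂) = embL h₄ := rfl
    have e₂ : (embR h₁).trans (embL h₂) = (embL h₃).trans (embR h₄) := rfl
    have e₃ : embR h₂ = (embR h₃).trans (embR h₄) :=
      Function.Embedding.ext fun b => Fin.ext (by
        change l + (b : ℕ) = i + (j + b)
        omega)
    rw [map_mul, map_mul, emb_emb, emb_emb, emb_emb, emb_emb, e₁, e₂, e₃, mul_assoc]
  one_left r := by
    rw [map_one, one_mul]
    exact emb_eq_self _ (fun a => Fin.ext (Nat.zero_add a)) r
  one_right r := by
    rw [map_one, mul_one]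
    exact emb_eq_self _ (fun a => rfl) r

theorem tower_single {i j n : ℕ} (h : i + j = n) (σ : Equiv.Perm (Fin i)) (τ : Equiv.Perm (Fin j))
    (p : TruncPoly v i) (q : TruncPoly v j) :
    (tower v).φ h (single σ p) (single τ q) =
      single (σ.viaEmbedding (embL h) * τ.viaEmbedding (embR h))
        (TruncPoly.map (embL h) p * TruncPoly.map (embR h) q) := by
  change emb _ _ * emb _ _ = _
  rw [emb_single, emb_single, single_mul_single, TruncPoly.smul_def,
    TruncPoly.map_map, via_disj _ _ (embL_ne_embR h)]
  rfl

end SkewSym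

/-- The category `⨁ n, proj(Pₙ ⋊ k[Sₙ])` of finitely generated projective right modules over the
skew group algebras, with the tensor product given by induction. -/
abbrev SymProj (v : k[X]) : Type (u + 1) := ProjMod (SkewSym.tower v).op

/-- The objects of `⨁ n, proj(Pₙ ⋊ k[Sₙ])` that are concentrated in degree `i`. -/
abbrev SymProj.deg (v : k[X]) (i : ℕ) : ObjectProperty (SymProj v) :=
  ProjMod.deg (SkewSym.tower v).op i

/-- The filtration of the category `DCob` of the rational power series `α = p / q` by the
subcategories generated by `[0], …, [n]`. -/
noncomputable abbrev skeinFiltration (p q : k[X]) (α : PowerSeries k) :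
    Filtration (DCob (fun i => PowerSeries.coeff i α) (uPoly p q)) :=
  DCob.filtration (fun i => PowerSeries.coeff i α) (uPoly p q)

end SymmetricTower

end KhovanovSazdanovic

/-! ### Handles and closed components under gluing and disjoint union -/

namespace KhovanovSazdanovic

/-! The topological heart is that the endomorphisms of [n], modulo those that factor through fewer
circles, form the algebra R_n. A cobordism without closed components factors through as many circles
as it has components meeting both ends. If that number is not smaller than n for an endomorphism of
[n], the cobordism is a union of n cylinders along a permutation σ with m_b handles on the cylinder
ending at b, and it corresponds to x^m ⊗ σ (`Surface.cases_endo`). Closed components are scalars.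
Hence R_n acts on [n] by cylinders with handles (`SCob.skewHom`), and it maps onto the quotient
(`SCob.sub_skewHom_symbol_mem`).

Injectivity comes from an inverse, the symbol. It sends a union of cylinders with handles and closed
components to the corresponding multiple of x^m ⊗ σ, and every other cobordism to zero. It has to
respect the skein relations. The tensor ideal that they generate lies in the span of explicit
relations between surfaces (`generated_mem_skeinSpan`): raise the genus of one component according
to the polynomial u, or replace a closed component by its value. On a cylinder the first relation
holds because u(x_b) = 0 in P_n. On a closed component of genus g it demands ∑ u_i α_{g+i} = 0, and
this is the vanishing of the coefficients of qα = p in the degrees ≥ K (`sum_uPoly`). The symbol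
kills composites through m < n circles, because each of the n components would need a circle of its
own in the middle (`Surface.not_isTwist_glue`).

The rest is formal and is carried out for a `Filtration.Model`: objects G n that generate D_n up to
D_{n-1}, with a homomorphism ρ from A_n to End(G n) that splits the quotient by the negligible
endomorphisms, those that factor through D_{n-1}. An object X of D_n goes to Hom(G n, X) modulo
negligible morphisms, a right A_n-module by precomposition. Dual bases modulo negligible morphisms
make this module finitely generated projective and the functor full and faithful. As ρ is a genuine
homomorphism, an idempotent matrix over A_n is a genuine idempotent of a power of G n, and splitting
it gives essential surjectivity. The tensor product of morphisms is a balanced map, and it induces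
an isomorphism from the induced module because tensor products of dual bases are dual bases.

For Grothendieck rings, the map [X] ↦ [Hom(G n, X)/negligible] has to be well defined on
F_n/F_{n-1}, although equality in K_0 only means X ⊕ V ≅ Y ⊕ V with V in some high step. Such a V
can be pushed down one step at a time. Up to lower objects it may be taken to be a power of G N. The
corner of the isomorphism at this power is invertible modulo negligible morphisms, so its lift
through ρ is an honest isomorphism that differs from it by a map through a lower object Z. After
adding Z, Gaussian elimination removes the power (`Model.exists_cancel_power`). The inverse map
takes the classes of the components of a sequence. It is well defined because objects that are
isomorphic modulo negligible morphisms become isomorphic after adding lower objects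
(`exists_lower_iso`).

In the lemmas about skein categories the letter `p` stands for the polynomial u. -/

open Classical in
/-- The function with the value `i` at `v` and `0` elsewhere. -/
noncomputable def bumpFn {V : Type} (v : V) (i : ℕ) (w : V) : ℕ := if w = v then i else 0

theorem bumpFn_self {V : Type} (v : V) (i : ℕ) : bumpFn v i v = i := if_pos rfl

theorem bumpFn_ne {V : Type} {v w : V} (h : w ≠ v) (i : ℕ) : bumpFn v i w = 0 := if_neg h

theorem bumpFn_map {V Z : Type} (f : V → Z) (hf : Function.Injective f) (v : V) (i : ℕ) (w : V) :
    bumpFn (f v) i (f w) = bumpFn v i w := by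
  by_cases h : w = v
  · rw [h, bumpFn_self, bumpFn_self]
  · rw [bumpFn_ne h, bumpFn_ne fun h' => h (hf h')]

theorem push_bumpFn {V Z : Type} [Finite V] (f : V → Z) (v : V) (i : ℕ) :
    push f (fun w => (bumpFn v i w : ℤ)) = fun z => (bumpFn (f v) i z : ℤ) := by
  classical
  funext z
  simp only [push]
  let _ := Fintype.ofFinite V
  rw [Finset.sum_eq_single v]
  · by_cases h : f v = z
    · rw [if_pos h, ← h, bumpFn_self, bumpFn_self]
    · rw [if_neg h, bumpFn_ne (Ne.symm h)]; rfl
  · intro b _ hb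
    rw [bumpFn_ne hb]; simp
  · simp

namespace Surface

variable {A B D A' B' : Type}

/-- The genus of the component `v` is raised by `i`. -/
noncomputable abbrev bump (c : Surface A B) (v : c.Comp) (i : ℕ) : Surface A B :=
  ⟨c.Comp, c.finite, c.inn, c.out, fun w => c.genus w + bumpFn v i w⟩

theorem bump_wt (c : Surface A B) (v : c.Comp) (i : ℕ) :
    (c.bump v i).wt = c.wt + fun w => (bumpFn v i w : ℤ) := by
  funext w
  simp only [wt, Pi.add_apply]
  push_cast
  ring

/-- The Euler characteristic is additive, so extra handles on a piece end up on the component of the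
glued surface that contains it. This makes the handle relation stable under composition. -/
theorem glue_bump_left [Finite B] (c : Surface A B) (d : Surface B D) (v : c.Comp) (i : ℕ) :
    Iso (glue (c.bump v i) d) ((glue c d).bump (glueL c d v) i) := by
  refine glue_iso (c.bump v i) d _ (glueL c d) (glueR c d) (fun z => z) (glue_condition c d)
    (fun _ => rfl) (fun _ => rfl) ?_ (fun _ => rfl) (fun _ => rfl) ?_
  · rintro ⟨v | v⟩
    · exact Or.inl ⟨v, rfl⟩
    · exact Or.inr ⟨v, rfl⟩
  · rw [bump_wt, glue_wt, bump_wt, glueWt]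
    have h := push_add (glueL c d) c.wt fun w => (bumpFn v i w : ℤ)
    rw [push_bumpFn] at h
    refine Eq.trans ?_ (congrArg (fun w => w + push (glueR c d) d.wt +
      push (fun b => glueL c d (c.out b)) fun _ => 1) h).symm
    funext z
    simp only [Pi.add_apply]
    ring

theorem glue_bump_right [Finite B] (c : Surface A B) (d : Surface B D) (v : d.Comp) (i : ℕ) :
    Iso (glue c (d.bump v i)) ((glue c d).bump (glueR c d v) i) := by
  refine glue_iso c (d.bump v i) _ (glueL c d) (glueR c d) (fun z => z) (glue_condition c d)
    (fun _ => rfl) (fun _ => rfl) ?_ (fun _ => rfl) (fun _ => rfl) ?_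
  · rintro ⟨v | v⟩
    · exact Or.inl ⟨v, rfl⟩
    · exact Or.inr ⟨v, rfl⟩
  · rw [bump_wt, glue_wt, bump_wt, glueWt]
    have h := push_add (glueR c d) d.wt fun w => (bumpFn v i w : ℤ)
    rw [push_bumpFn] at h
    refine Eq.trans ?_ (congrArg (fun w => push (glueL c d) c.wt + w +
      push (fun b => glueL c d (c.out b)) fun _ => 1) h).symm
    funext z
    simp only [Pi.add_apply]
    ring

theorem disj_bump_left (c : Surface A B) (d : Surface A' B') (v : c.Comp) (i : ℕ) :
    Iso (disj (c.bump v i) d) ((disj c d).bump (Sum.inl v) i) := by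
  refine ⟨Equiv.refl _, ?_, ?_, ?_⟩
  · rintro (a | a) <;> rfl
  · rintro (a | a) <;> rfl
  · rintro (a | a)
    · exact congrArg (c.genus a + ·) (bumpFn_map Sum.inl Sum.inl_injective v i a)
    · exact congrArg (d.genus a + ·) (bumpFn_ne (by simp) i)

theorem disj_bump_right (c : Surface A B) (d : Surface A' B') (v : d.Comp) (i : ℕ) :
    Iso (disj c (d.bump v i)) ((disj c d).bump (Sum.inr v) i) := by
  refine ⟨Equiv.refl _, ?_, ?_, ?_⟩
  · rintro (a | a) <;> rfl
  · rintro (a | a) <;> rfl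
  · rintro (a | a)
    · exact congrArg (c.genus a + ·) (bumpFn_ne (by simp) i)
    · exact congrArg (d.genus a + ·) (bumpFn_map Sum.inr Sum.inr_injective v i a)

/-- The disjoint union with a closed surface of genus `i`. -/
abbrev addClosed (c : Surface A B) (i : ℕ) : Surface A B :=
  ⟨c.Comp ⊕ Unit, inferInstance, fun a => Sum.inl (c.inn a), fun b => Sum.inl (c.out b),
    Sum.elim c.genus fun _ => i⟩

theorem addClosed_congr {c d : Surface A B} (h : Iso c d) (i : ℕ) :
    Iso (c.addClosed i) (d.addClosed i) := by
  obtain ⟨e, h₁, h₂, h₃⟩ := h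
  refine ⟨Equiv.sumCongr e (Equiv.refl _), fun a => ?_, fun b => ?_, ?_⟩
  · exact congrArg Sum.inl (h₁ a)
  · exact congrArg Sum.inl (h₂ b)
  · rintro (v | v)
    · exact h₃ v
    · rfl

theorem addClosed_wt (c : Surface A B) (i : ℕ) :
    (c.addClosed i).wt = Sum.elim c.wt fun _ => (i : ℤ) - 1 := by
  funext v
  rcases v with v | v <;> rfl

theorem push_inl_comp {V Z : Type} [Finite V] (f : V → Z) (w : V → ℤ) :
    push (fun v => (Sum.inl (f v) : Z ⊕ Unit)) w = Sum.elim (push f w) fun _ => 0 := by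
  funext z
  rcases z with z | z
  · exact push_inj f Sum.inl Sum.inl_injective w z
  · exact push_out _ _ _ (by simp)

theorem push_map_unit {V Z : Type} [Finite V] (f : V → Z) (w : V ⊕ Unit → ℤ) :
    push (Sum.map f (id : Unit → Unit)) w =
      Sum.elim (push f (w ∘ Sum.inl)) fun _ => w (Sum.inr ()) := by
  classical
  rw [push_sum]
  have h₁ : push (Sum.map f id ∘ Sum.inl) (w ∘ Sum.inl) = _ := push_inl_comp f (w ∘ Sum.inl)
  rw [h₁]
  funext z
  rcases z with z | z <;> simp [push]

theorem glue_addClosed_left [Finite B] (c : Surface A B) (d : Surface B D) (i : ℕ) :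
    Iso (glue (c.addClosed i) d) ((glue c d).addClosed i) := by
  refine glue_iso (c.addClosed i) d _ (Sum.map (glueL c d) id) (fun v => Sum.inl (glueR c d v))
    (Sum.elim (Quot.lift (Sum.elim (fun v => glueL (c.addClosed i) d (Sum.inl v))
      (fun v => glueR (c.addClosed i) d v)) ?_) fun _ => glueL (c.addClosed i) d (Sum.inr ()))
    (fun b => congrArg Sum.inl (glue_condition c d b)) ?_
    (fun _ => rfl) ?_ (fun _ => rfl) (fun _ => rfl) ?_
  · rintro _ _ ⟨b, rfl, rfl⟩
    exact glue_condition (c.addClosed i) d b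
  · rintro (v | v) <;> rfl
  · rintro (v | v)
    · obtain ⟨v | v, rfl⟩ := Quot.exists_rep v
      · exact Or.inl ⟨Sum.inl v, rfl⟩
      · exact Or.inr ⟨v, rfl⟩
    · exact Or.inl ⟨Sum.inr v, rfl⟩
  · rw [addClosed_wt, addClosed_wt, glue_wt, glueWt]
    erw [push_map_unit, push_inl_comp, push_inl_comp]
    funext z
    rcases z with z | z
    · rfl
    · simp

theorem glue_addClosed_right [Finite B] (c : Surface A B) (d : Surface B D) (i : ℕ) :
    Iso (glue c (d.addClosed i)) ((glue c d).addClosed i) := by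
  refine glue_iso c (d.addClosed i) _ (fun v => Sum.inl (glueL c d v)) (Sum.map (glueR c d) id)
    (Sum.elim (Quot.lift (Sum.elim (fun v => glueL c (d.addClosed i) v)
      (fun v => glueR c (d.addClosed i) (Sum.inl v))) ?_)
      fun _ => glueR c (d.addClosed i) (Sum.inr ()))
    (fun b => congrArg Sum.inl (glue_condition c d b)) (fun _ => rfl)
    ?_ ?_ (fun _ => rfl) (fun _ => rfl) ?_
  · rintro _ _ ⟨b, rfl, rfl⟩
    exact glue_condition c (d.addClosed i) b
  · rintro (v | v) <;> rfl
  · rintro (v | v)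
    · obtain ⟨v | v, rfl⟩ := Quot.exists_rep v
      · exact Or.inl ⟨v, rfl⟩
      · exact Or.inr ⟨Sum.inl v, rfl⟩
    · exact Or.inr ⟨Sum.inr v, rfl⟩
  · rw [addClosed_wt, addClosed_wt, glue_wt, glueWt]
    erw [push_map_unit, push_inl_comp, push_inl_comp]
    funext z
    rcases z with z | z
    · rfl
    · simp

theorem disj_addClosed_left (c : Surface A B) (d : Surface A' B') (i : ℕ) :
    Iso (disj (c.addClosed i) d) ((disj c d).addClosed i) := by
  refine ⟨⟨Sum.elim (Sum.elim (fun v => Sum.inl (Sum.inl v)) Sum.inr) (fun v => Sum.inl (Sum.inr v)),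
    Sum.elim (Sum.elim (fun v => Sum.inl (Sum.inl v)) Sum.inr) (fun v => Sum.inl (Sum.inr v)),
    ?_, ?_⟩, ?_, ?_, ?_⟩
  · rintro ((v | v) | v) <;> rfl
  · rintro ((v | v) | v) <;> rfl
  · rintro (a | a) <;> rfl
  · rintro (a | a) <;> rfl
  · rintro ((v | v) | v) <;> rfl

theorem disj_addClosed_right (c : Surface A B) (d : Surface A' B') (i : ℕ) :
    Iso (disj c (d.addClosed i)) ((disj c d).addClosed i) := by
  refine ⟨(Equiv.sumAssoc _ _ _).symm, ?_, ?_, ?_⟩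
  · rintro (a | a) <;> rfl
  · rintro (a | a) <;> rfl
  · rintro (v | (v | v)) <;> rfl

/-- The union of cylinders of genus `m b` connecting `a` to `e a = b`. -/
abbrev twist [Finite B] (e : A ≃ B) (m : B → ℕ) : Surface A B :=
  ⟨B, inferInstance, e, fun b => b, m⟩

theorem twist_glue_twist [Finite B] [Finite D] (e : A ≃ B) (m : B → ℕ) (f : B ≃ D) (m' : D → ℕ) :
    Iso (glue (twist e m) (twist f m')) (twist (e.trans f) fun d => m (f.symm d) + m' d) := by
  refine glue_iso (twist e m) (twist f m') _ f (fun d => d) (glueR (twist e m) (twist f m'))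
    (fun _ => rfl) (fun v => (glue_condition (twist e m) (twist f m') v).symm) (fun _ => rfl)
    (fun s => Or.inr ⟨s, rfl⟩) (fun _ => rfl) (fun _ => rfl) ?_
  funext d
  have h₁ := push_equiv f (twist e m).wt d
  have h₂ := push_equiv f (fun _ => 1) d
  have h₃ := congrFun (push_id (twist f m').wt) d
  refine Eq.trans ?_ (congrArg₂ (· + ·) (congrArg₂ (· + ·) h₁ h₃) h₂).symm
  simp only [wt]
  push_cast
  ring

theorem disj_twist [Finite B] [Finite B'] (e : A ≃ B) (m : B → ℕ) (f : A' ≃ B') (m' : B' → ℕ) :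
    Iso (disj (twist e m) (twist f m')) (twist (Equiv.sumCongr e f) (Sum.elim m m')) := by
  refine ⟨Equiv.refl _, ?_, ?_, ?_⟩ <;> rintro (a | a) <;> rfl

/-- A connected cobordism of genus `g`. -/
abbrev conn (A B : Type) (g : ℕ) : Surface A B :=
  ⟨Unit, inferInstance, fun _ => (), fun _ => (), fun _ => g⟩

/-- Two connected pieces joined along |B| circles form a graph with two vertices and |B| edges. It
has |B| - 1 independent loops, each of which adds a handle. With B empty the result would be
disconnected. -/
theorem conn_glue_conn [Finite B] [Nonempty B] (g g' : ℕ) :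
    Iso (glue (conn A B g) (conn B D g')) (conn A D (g + g' + (Nat.card B - 1))) := by
  classical
  have h : ∀ v, glueR (conn A B g) (conn B D g') v = glueL (conn A B g) (conn B D g') () := fun _ =>
    (glue_condition (conn A B g) (conn B D g') (Classical.arbitrary B)).symm
  refine glue_iso (conn A B g) (conn B D g') _ (fun _ => ()) (fun _ => ())
    (fun _ => glueL (conn A B g) (conn B D g') ())
    (fun _ => rfl) (fun v => rfl) (fun v => (h v).symm)
    (fun s => Or.inr ⟨s, rfl⟩) (fun _ => rfl) (fun _ => rfl) ?_
  funext z
  have h1 : 1 ≤ Nat.card B := Nat.card_pos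
  let _ := Fintype.ofFinite B
  simp [push, wt, Nat.card_eq_fintype_card] at h1 ⊢
  rw [Nat.cast_sub h1]
  push_cast
  ring

/-- A component of a glued surface with pieces on both sides contains one of the circles along
which the surfaces are glued. -/
theorem exists_circle (c : Surface A B) (d : Surface B D) {v : c.Comp} {w : d.Comp}
    (h : glueL c d v = glueR c d w) : ∃ b, glueL c d (c.out b) = glueL c d v := by
  by_contra! hb
  -- If no gluing circle lies over this component, then over it the property of being a piece of `c`
  -- is invariant under the gluing relation. The predicate descends to the quotient, where `v`
  -- satisfies it and `w` does not.
  let φ : c.Comp ⊕ d.Comp → Prop := fun x =>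
    (Quot.mk (GlueRel c d) x = glueL c d v) → x.isLeft = true
  have hφ : ∀ x y, GlueRel c d x y → φ x = φ y := by
    rintro _ _ ⟨b, rfl, rfl⟩
    refine propext ⟨fun _ h => ?_, fun _ h => rfl⟩
    exact absurd ((glue_condition c d b).trans h) (hb b)
  have h₁ : Quot.lift φ hφ (glueL c d v) := fun _ => rfl
  rw [h] at h₁
  have h₂ : φ (Sum.inr w) := h₁
  exact absurd (h₂ h.symm) (by simp)

end Surface

end KhovanovSazdanovic

/-! ### Factoring cobordisms through few circles -/

namespace KhovanovSazdanovic

theorem push_injective {V Z : Type} [Finite V] (f : V → Z) (hf : Function.Injective f) (w : V → ℤ)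
    (v : V) : push f w (f v) = w v := by
  have h := push_inj (fun v : V => v) f hf w v
  rw [push_id] at h
  exact h

namespace Surface

variable {A B D : Type}

/-- The number of components is the measure for the induction in `SCob.sub_skewHom_symbol_mem`,
where closed components are stripped off one at a time. -/
theorem iso_addClosed_of_closed (c : Surface A B) (v : c.Comp) (h₁ : ∀ a, c.inn a ≠ v)
    (h₂ : ∀ b, c.out b ≠ v) :
    ∃ c' : Surface A B, Nat.card c'.Comp < Nat.card c.Comp ∧ Iso c (c'.addClosed (c.genus v)) := by
  classical
  refine ⟨⟨{w // w ≠ v}, inferInstance, fun a => ⟨c.inn a, h₁ a⟩, fun b => ⟨c.out b, h₂ b⟩,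
    fun w => c.genus w⟩, ?_, ?_⟩
  · exact Finite.card_subtype_lt (x := v) (by simp)
  · refine Iso.symm ⟨⟨Sum.elim Subtype.val fun _ => v,
      fun w => if h : w = v then Sum.inr () else Sum.inl ⟨w, h⟩, ?_, ?_⟩, ?_, ?_, ?_⟩
    · rintro (w | w)
      · simp [w.2]
      · simp
    · intro w
      by_cases h : w = v <;> simp [h]
    · intro a; rfl
    · intro a; rfl
    · rintro (w | w) <;> rfl

open Classical in
/-- A cobordism without closed components factors through a disjoint union of circles, one for
each component that has both incoming and outgoing circles. -/
theorem exists_glue (c : Surface A B) (hc : ∀ v, (∃ a, c.inn a = v) ∨ ∃ b, c.out b = v)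
    {J : Type} [Finite J] (e : J ≃ {v // (∃ a, c.inn a = v) ∧ ∃ b, c.out b = v}) :
    ∃ (a : Surface A J) (b : Surface J B), Iso (glue a b) c := by
  -- The left factor takes every component with an incoming circle together with its whole genus. In
  -- the right factor such a component continues with genus 0, and only the components without
  -- incoming circles keep their genus.
  let a : Surface A J := ⟨{v // ∃ a, c.inn a = v}, inferInstance, fun a => ⟨c.inn a, a, rfl⟩,
    fun j => ⟨(e j).1, (e j).2.1⟩, fun v => c.genus v⟩
  let b : Surface J B := ⟨{v // ∃ b, c.out b = v}, inferInstance, fun j => ⟨(e j).1, (e j).2.2⟩,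
    fun b => ⟨c.out b, b, rfl⟩, fun v => if ∃ a, c.inn a = v then 0 else c.genus v⟩
  refine ⟨a, b, glue_iso a b c Subtype.val Subtype.val (fun v =>
    if h : ∃ a, c.inn a = v then glueL a b ⟨v, h⟩ else
      if h : ∃ b, c.out b = v then glueR a b ⟨v, h⟩ else
        absurd (hc v) (not_or_intro ‹_› h)) (fun _ => rfl) ?_ ?_ ?_ (fun _ => rfl) (fun _ => rfl) ?_⟩
  · intro v
    rw [dif_pos v.2]
  · intro v
    by_cases h : ∃ a, c.inn a = v.1
    · rw [dif_pos h]
      have h' := glue_condition a b (e.symm ⟨v.1, h, v.2⟩)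
      simpa [a, b] using h'
    · rw [dif_neg h, dif_pos v.2]
  · intro v
    rcases hc v with h | h
    · exact Or.inl ⟨⟨v, h⟩, rfl⟩
    · exact Or.inr ⟨⟨v, h⟩, rfl⟩
  -- Count genus minus one. A component meeting both ends contributes (g - 1) + (0 - 1) from its two
  -- pieces and 1 from the single circle between them. Any other component has only one piece and no
  -- gluing circle.
  · funext v
    have hJ : Function.Injective fun j => (e j).1 := Subtype.val_injective.comp e.injective
    change (c.genus v : ℤ) - 1 = push Subtype.val a.wt v + push Subtype.val b.wt v +
      push (fun j => (e j).1) (fun _ => 1) v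
    by_cases h : ∃ a, c.inn a = v
    · have e₁ := push_injective Subtype.val Subtype.val_injective a.wt ⟨v, h⟩
      rw [show push Subtype.val a.wt v = (c.genus v : ℤ) - 1 from e₁]
      by_cases h' : ∃ b, c.out b = v
      · have e₂ := push_injective Subtype.val Subtype.val_injective b.wt ⟨v, h'⟩
        have e₃ := push_injective _ hJ (fun _ => 1) (e.symm ⟨v, h, h'⟩)
        rw [show push Subtype.val b.wt v = -1 from e₂.trans (by simp [b, wt, h])]
        simp only [e.apply_symm_apply] at e₃
        rw [e₃]; ring
      · rw [push_out _ b.wt v fun w hw => h' (hw ▸ w.2),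
          push_out _ _ v fun j hj => h' (hj ▸ (e j).2.2)]
        ring
    · have h' := (hc v).resolve_left h
      have e₂ := push_injective Subtype.val Subtype.val_injective b.wt ⟨v, h'⟩
      rw [show push Subtype.val b.wt v = (c.genus v : ℤ) - 1 from e₂.trans (by simp [b, wt, h]),
        push_out _ a.wt v fun w hw => h (hw ▸ w.2),
        push_out _ _ v fun j hj => h (hj ▸ (e j).2.1)]
      ring

/-- A cobordism between `n` circles has a closed component, factors through fewer circles, or is
a union of cylinders with handles. -/
theorem cases_endo {n : ℕ} (c : Surface (Fin n) (Fin n)) :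
    (∃ (i : ℕ) (c' : Surface (Fin n) (Fin n)),
        Nat.card c'.Comp < Nat.card c.Comp ∧ Iso c (c'.addClosed i)) ∨
      (∃ m < n, ∃ (a : Surface (Fin n) (Fin m)) (b : Surface (Fin m) (Fin n)), Iso (glue a b) c) ∨
      ∃ (σ : Equiv.Perm (Fin n)) (m : Fin n → ℕ), Iso c (twist σ m) := by
  classical
  by_cases hc : ∀ v, (∃ a, c.inn a = v) ∨ ∃ b, c.out b = v
  swap
  · push Not at hc
    obtain ⟨v, h₁, h₂⟩ := hc
    exact Or.inl ⟨_, iso_addClosed_of_closed c v h₁ h₂⟩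
  refine Or.inr ?_
  let J := {v // (∃ a, c.inn a = v) ∧ ∃ b, c.out b = v}
  by_cases hJ : Nat.card J < n
  · exact Or.inl ⟨_, hJ, exists_glue c hc (Finite.equivFin J).symm⟩
  refine Or.inr ?_
  -- Choosing one circle on each component in `J` injects `J` into the n circles. As `J` has at
  -- least n elements, the choice is a bijection, so each of these components has exactly one circle
  -- and no circle lies elsewhere. This is applied to both ends.
  have key : ∀ f : Fin n → c.Comp, (∀ v : J, ∃ a, f a = v.1) →
      Function.Injective f ∧ ∀ a, ∃ v : J, v.1 = f a := by
    intro f hf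
    choose g hg using hf
    have hgi : Function.Injective g := fun v w h => Subtype.ext (by rw [← hg, ← hg, h])
    have hgb : Function.Bijective g := by
      have := Fintype.ofFinite J
      refine (Fintype.bijective_iff_injective_and_card g).2 ⟨hgi, ?_⟩
      rw [Fintype.card_fin, ← Nat.card_eq_fintype_card]
      refine le_antisymm ?_ (not_lt.1 hJ)
      have h := Nat.card_le_card_of_injective g hgi
      rwa [Nat.card_fin] at h
    have hfg : ∀ a, ∃ v : J, g v = a ∧ f a = v.1 := fun a => by
      obtain ⟨v, rfl⟩ := hgb.2 a
      exact ⟨v, rfl, hg v⟩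
    refine ⟨fun a b hab => ?_, fun a => ?_⟩
    · obtain ⟨v, rfl, hv⟩ := hfg a
      obtain ⟨w, rfl, hw⟩ := hfg b
      rw [Subtype.ext (hv.symm.trans (hab.trans hw))]
    · obtain ⟨v, -, hv⟩ := hfg a
      exact ⟨v, hv.symm⟩
  obtain ⟨hi₁, hr₁⟩ := key c.inn fun v => v.2.1
  obtain ⟨hi₂, hr₂⟩ := key c.out fun v => v.2.2
  have hs : Function.Surjective c.out := fun v => by
    rcases hc v with ⟨a, rfl⟩ | h
    · obtain ⟨v, hv⟩ := hr₁ a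
      rw [← hv]
      exact v.2.2
    · exact h
  have hs' : Function.Surjective c.inn := fun v => by
    obtain ⟨b, rfl⟩ := hs v
    obtain ⟨v, hv⟩ := hr₂ b
    rw [← hv]
    exact v.2.1
  let eo := Equiv.ofBijective c.out ⟨hi₂, hs⟩
  refine ⟨(Equiv.ofBijective c.inn ⟨hi₁, hs'⟩).trans eo.symm, fun b => c.genus (c.out b),
    eo.symm, fun a => rfl, fun b => eo.symm_apply_apply b, fun v => ?_⟩
  exact congrArg c.genus (eo.apply_symm_apply v)

/-- The cobordism is, up to closed components, a union of cylinders with handles along `σ`. -/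
def IsTwist {n : ℕ} (c : Surface (Fin n) (Fin n)) (σ : Equiv.Perm (Fin n)) : Prop :=
  Function.Injective c.out ∧ ∀ a, c.out (σ a) = c.inn a

theorem IsTwist.unique {n : ℕ} {c : Surface (Fin n) (Fin n)} {σ τ : Equiv.Perm (Fin n)}
    (h : c.IsTwist σ) (h' : c.IsTwist τ) : σ = τ :=
  Equiv.ext fun a => h.1 ((h.2 a).trans (h'.2 a).symm)

/-- Each of the n cylinders meets both ends, so it contains one of the m circles in the middle by
`exists_circle`. Different cylinders contain different ones, and n ≤ m would follow. -/
theorem not_isTwist_glue {m n : ℕ} (hmn : m < n) (a : Surface (Fin n) (Fin m))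
    (b : Surface (Fin m) (Fin n)) (σ : Equiv.Perm (Fin n)) : ¬ (glue a b).IsTwist σ := by
  rintro ⟨hi, hσ⟩
  have h : ∀ i, ∃ j, glueL a b (a.out j) = glueL a b (a.inn i) := fun i =>
    exists_circle a b (w := b.out (σ i)) (hσ i).symm
  choose f hf using h
  have hinj : Function.Injective f := fun i j hij => by
    refine σ.injective (hi ((hσ i).trans (Eq.trans ?_ (hσ j).symm)))
    exact (hf i).symm.trans ((congrArg (fun j => glueL a b (a.out j)) hij).trans (hf j))
  have := Fintype.card_le_of_injective f hinj
  simp only [Fintype.card_fin] at this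
  omega

theorem Iso.isTwist {n : ℕ} {c d : Surface (Fin n) (Fin n)} (h : Iso c d)
    {σ : Equiv.Perm (Fin n)} (hc : c.IsTwist σ) : d.IsTwist σ := by
  obtain ⟨e, h₁, h₂, -⟩ := h
  refine ⟨fun a b hab => hc.1 (e.injective ?_), fun a => ?_⟩
  · rw [h₂, h₂, hab]
  · rw [← h₁, ← h₂, hc.2]

end Surface

end KhovanovSazdanovic

/-! ### The symbol of a cobordism in the skew group algebra -/

namespace KhovanovSazdanovic

open Polynomial

variable {k : Type u} [Field k]

namespace TruncPoly

variable (p : k[X]) {n : ℕ}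

/-- The class of a monomial. -/
noncomputable def mono (m : Fin n → ℕ) : TruncPoly p n :=
  Ideal.Quotient.mk _ (∏ b, MvPolynomial.X b ^ m b)

theorem mono_zero : mono p (fun _ : Fin n => 0) = 1 := by
  simp [mono]

theorem mono_add (m m' : Fin n → ℕ) : mono p (fun b => m b + m' b) = mono p m * mono p m' := by
  rw [mono, mono, mono, ← map_mul, ← Finset.prod_mul_distrib]
  simp only [pow_add]

theorem mono_bumpFn (b : Fin n) (i : ℕ) :
    mono p (bumpFn b i) = Ideal.Quotient.mk _ (MvPolynomial.X b ^ i) := by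
  rw [mono, Finset.prod_eq_single b]
  · rw [bumpFn_self]
  · intro c _ hc
    rw [bumpFn_ne hc, pow_zero]
  · simp

theorem map_mono {j : ℕ} (f : Fin n → Fin j) (m : Fin n → ℕ) :
    map f (mono p m) = Ideal.Quotient.mk _ (∏ b, MvPolynomial.X (f b) ^ m b) := by
  rw [mono, map_mk, map_prod]
  simp

theorem map_mono_equiv (e : Equiv.Perm (Fin n)) (m : Fin n → ℕ) :
    map e (mono p m) = mono p fun b => m (e.symm b) := by
  rw [map_mono, mono, ← Equiv.prod_comp e.symm]
  simp

theorem span_mono : Submodule.span k (Set.range (mono (n := n) p)) = ⊤ := by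
  rw [eq_top_iff]
  rintro x -
  obtain ⟨x, rfl⟩ := Ideal.Quotient.mk_surjective x
  induction x using MvPolynomial.induction_on'' with
  | C a =>
    have : (Ideal.Quotient.mk _ (MvPolynomial.C a) : TruncPoly p n) = a • mono p fun _ => 0 := by
      rw [mono_zero]
      exact (Algebra.algebraMap_eq_smul_one (A := TruncPoly p n) a)
    rw [this]
    exact Submodule.smul_mem _ _ (Submodule.subset_span ⟨_, rfl⟩)
  | monomial_add a b f _ _ h h' =>
    rw [map_add]
    exact add_mem h' h
  | mul_X q i h =>
    rw [map_mul]
    generalize (Ideal.Quotient.mk _ q : TruncPoly p n) = y at h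
    induction h using Submodule.span_induction with
    | mem x hx =>
      obtain ⟨m, rfl⟩ := hx
      refine Submodule.subset_span ⟨fun b => m b + bumpFn i 1 b, ?_⟩
      rw [mono_add, mono_bumpFn, pow_one]
    | zero => rw [zero_mul]; exact zero_mem _
    | add x y _ _ hx hy => rw [add_mul]; exact add_mem hx hy
    | smul a x _ hx => rw [smul_mul_assoc]; exact Submodule.smul_mem _ _ hx

/-- The defining relation. -/
theorem sum_mono_bumpFn (b : Fin n) : (p.sum fun i a => a • mono p (bumpFn b i)) = 0 := by
  have h : (p.sum fun i a => a • mono p (bumpFn b i)) =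
      Ideal.Quotient.mk _ (aeval (MvPolynomial.X b : MvPolynomial (Fin n) k) p) := by
    rw [aeval_eq_sum_range, map_sum, sum_over_range _ (by simp)]
    refine Finset.sum_congr rfl fun i _ => ?_
    rw [mono_bumpFn]
    rfl
  rw [h]
  exact Ideal.Quotient.eq_zero_iff_mem.2 (Ideal.subset_span ⟨b, rfl⟩)

end TruncPoly

namespace SkewSym

variable {p : k[X]} {n : ℕ}

theorem single_zero (σ : Equiv.Perm (Fin n)) : single σ (0 : TruncPoly p n) = 0 :=
  SkewMonoidAlgebra.single_zero σ

theorem single_add (σ : Equiv.Perm (Fin n)) (x y : TruncPoly p n) :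
    single σ (x + y) = single σ x + single σ y :=
  SkewMonoidAlgebra.single_add σ x y

theorem smul_single (a : k) (σ : Equiv.Perm (Fin n)) (x : TruncPoly p n) :
    a • single σ x = single σ (a • x) :=
  SkewMonoidAlgebra.smul_single a σ x

/-- `single` as a linear map. -/
noncomputable def lsingle (σ : Equiv.Perm (Fin n)) : TruncPoly p n →ₗ[k] SkewSym p n where
  toFun := single σ
  map_add' := single_add σ
  map_smul' a x := (smul_single a σ x).symm

theorem lsingle_apply (σ : Equiv.Perm (Fin n)) (x : TruncPoly p n) : lsingle σ x = single σ x := rfl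

end SkewSym

namespace Surface

variable (α : ℕ → k) (p : k[X]) {n : ℕ}

open Classical in
/-- The value of a component that has no outgoing circles. -/
noncomputable def closedValue {A B : Type} (c : Surface A B) (v : c.Comp) : k :=
  if ∃ b, c.out b = v then 1 else α (c.genus v)

theorem closedValue_out {A B : Type} (c : Surface A B) {v : c.Comp} (h : ∃ b, c.out b = v) :
    c.closedValue α v = 1 := if_pos h

theorem closedValue_not_out {A B : Type} (c : Surface A B) {v : c.Comp} (h : ¬ ∃ b, c.out b = v) :
    c.closedValue α v = α (c.genus v) := if_neg h

theorem closedValue_congr {A B A' B' : Type} (c : Surface A B) (d : Surface A' B') {v : c.Comp}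
    {w : d.Comp} (h : (∃ b, c.out b = v) ↔ ∃ b, d.out b = w) (h' : c.genus v = d.genus w) :
    c.closedValue α v = d.closedValue α w := by
  by_cases hv : ∃ b, c.out b = v
  · rw [closedValue_out α c hv, closedValue_out α d (h.1 hv)]
  · rw [closedValue_not_out α c hv, closedValue_not_out α d (fun h' => hv (h.2 h')), h']

/-- The product of the values of the closed components. -/
noncomputable def closedFactor {A B : Type} (c : Surface A B) : k :=
  ∏ᶠ v, c.closedValue α v

open Classical in
/-- The value of a cobordism in the skew group algebra: zero unless the cobordism is, up to closed
components, a union of cylinders with handles. -/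
noncomputable def symbol (c : Surface (Fin n) (Fin n)) : SkewSym p n :=
  if h : ∃ σ, c.IsTwist σ then
    -- For a twist every incoming circle lies on a component that also has an outgoing one. The
    -- components without outgoing circles, on which `closedValue` is the value of α, are therefore
    -- exactly the closed ones.
    c.closedFactor α • SkewSym.single h.choose (TruncPoly.mono p fun b => c.genus (c.out b))
  else 0

theorem symbol_eq {c : Surface (Fin n) (Fin n)} {σ : Equiv.Perm (Fin n)} (h : c.IsTwist σ) :
    c.symbol α p =
      c.closedFactor α • SkewSym.single σ (TruncPoly.mono p fun b => c.genus (c.out b)) := by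
  have h' : ∃ σ, c.IsTwist σ := ⟨σ, h⟩
  rw [symbol, dif_pos h', h'.choose_spec.unique h]

theorem symbol_eq_zero {c : Surface (Fin n) (Fin n)} (h : ∀ σ, ¬ c.IsTwist σ) :
    c.symbol α p = 0 :=
  dif_neg fun ⟨σ, hσ⟩ => h σ hσ

theorem symbol_congr {c d : Surface (Fin n) (Fin n)} (h : Iso c d) :
    c.symbol α p = d.symbol α p := by
  classical
  by_cases hc : ∃ σ, c.IsTwist σ
  · obtain ⟨σ, hσ⟩ := hc
    rw [symbol_eq α p hσ, symbol_eq α p (h.isTwist hσ)]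
    obtain ⟨e, h₁, h₂, h₃⟩ := h
    have h₄ : c.closedFactor α = d.closedFactor α := by
      refine finprod_eq_of_bijective e e.bijective fun v => ?_
      refine closedValue_congr α c d ⟨?_, ?_⟩ (h₃ v).symm
      · rintro ⟨b, rfl⟩
        exact ⟨b, (h₂ b).symm⟩
      · rintro ⟨b, hb⟩
        exact ⟨b, e.injective ((h₂ b).trans hb)⟩
    have h₅ : (fun b => c.genus (c.out b)) = fun b => d.genus (d.out b) :=
      funext fun b => by rw [← h₂, h₃]
    rw [h₄, h₅]
  · push Not at hc
    rw [symbol_eq_zero α p hc, symbol_eq_zero α p fun σ hσ => hc σ (h.symm.isTwist hσ)]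

theorem symbol_addClosed (c : Surface (Fin n) (Fin n)) (i : ℕ) :
    (c.addClosed i).symbol α p = α i • c.symbol α p := by
  classical
  by_cases hc : ∃ σ, c.IsTwist σ
  · obtain ⟨σ, hσ⟩ := hc
    have hσ' : (c.addClosed i).IsTwist σ :=
      ⟨fun a b h => hσ.1 (Sum.inl_injective h), fun a => congrArg Sum.inl (hσ.2 a)⟩
    rw [symbol_eq α p hσ, symbol_eq α p hσ', smul_smul]
    congr 1
    let _ := Fintype.ofFinite c.Comp
    rw [closedFactor, closedFactor, finprod_eq_prod_of_fintype, finprod_eq_prod_of_fintype]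
    refine (Fintype.prod_sum_type _).trans ?_
    rw [mul_comm (α i)]
    congr 1
    · refine Finset.prod_congr rfl fun v _ => closedValue_congr α _ _ ⟨?_, ?_⟩ rfl
      · rintro ⟨b, hb⟩
        exact ⟨b, Sum.inl_injective hb⟩
      · rintro ⟨b, hb⟩
        exact ⟨b, congrArg Sum.inl hb⟩
    · exact (Fintype.prod_unique _).trans
        (closedValue_not_out α (c.addClosed i) (v := Sum.inr ()) (by simp))
  · push Not at hc
    rw [symbol_eq_zero α p hc, symbol_eq_zero α p, smul_zero]
    exact fun σ hσ => hc σ ⟨fun a b h => hσ.1 (congrArg Sum.inl h),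
      fun a => Sum.inl_injective (hσ.2 a)⟩

theorem symbol_twist (σ : Equiv.Perm (Fin n)) (m : Fin n → ℕ) :
    (twist σ m).symbol α p = SkewSym.single σ (TruncPoly.mono p m) := by
  have h : (twist σ m).IsTwist σ := ⟨fun a b h => h, fun a => rfl⟩
  rw [symbol_eq α p h]
  have h' : (twist σ m).closedFactor α = 1 := by
    rw [closedFactor]
    refine finprod_eq_one_of_forall_eq_one fun v => ?_
    exact closedValue_out α _ ⟨v, rfl⟩
  rw [h', one_smul]

/-- The symbol respects the handle relation, for two different reasons. On the cylinder ending at b,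
i extra handles multiply the monomial by x_b^i, and the sum contains the factor p(x_b) = 0. On a
closed component of genus g they replace α_g by α_{g+i}, and the sum vanishes by the recurrence for
α. -/
theorem sum_symbol_bump (hα : ∀ g, (p.sum fun i a => a * α (g + i)) = 0)
    (c : Surface (Fin n) (Fin n)) (v : c.Comp) :
    (p.sum fun i a => a • (c.bump v i).symbol α p) = 0 := by
  classical
  by_cases hc : ∃ σ, c.IsTwist σ
  · obtain ⟨σ, hσ⟩ := hc
    have h₁ : ∀ i, (c.bump v i).symbol α p = (c.bump v i).closedFactor α •
        SkewSym.lsingle σ (TruncPoly.mono p (fun b => c.genus (c.out b)) *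
          TruncPoly.mono p fun b => bumpFn v i (c.out b)) := fun i => by
      rw [symbol_eq α p (c := c.bump v i) hσ, SkewSym.lsingle_apply, ← TruncPoly.mono_add]
    simp only [h₁]
    by_cases hv : ∃ b, c.out b = v
    · obtain ⟨b, rfl⟩ := hv
      have h₂ : ∀ i, (c.bump (c.out b) i).closedFactor α = c.closedFactor α := fun i => by
        rw [closedFactor, closedFactor]
        refine finprod_congr fun w => ?_
        by_cases hw : ∃ b, c.out b = w
        · rw [closedValue_out α _ hw]
          exact closedValue_out α _ hw
        · refine closedValue_congr α _ _ Iff.rfl (congrArg (c.genus w + ·) (bumpFn_ne ?_ i))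
          rintro rfl
          exact hw ⟨b, rfl⟩
      simp only [h₂, bumpFn_map c.out hσ.1]
      have h₃ := congrArg (fun x => c.closedFactor α • SkewSym.lsingle σ
        (TruncPoly.mono p (fun b => c.genus (c.out b)) * x)) (TruncPoly.sum_mono_bumpFn p b)
      simp only [mul_zero, map_zero, smul_zero] at h₃
      rw [← h₃, Polynomial.sum, Polynomial.sum, Finset.mul_sum, map_sum, Finset.smul_sum]
      refine Finset.sum_congr rfl fun i _ => ?_
      rw [mul_smul_comm, map_smul, smul_comm]
    · have h₂ : ∀ i, (fun b => bumpFn v i (c.out b)) = fun _ => 0 := fun i => funext fun b =>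
        bumpFn_ne (fun h => hv ⟨b, h⟩) i
      simp only [h₂]
      let _ := Fintype.ofFinite c.Comp
      -- The factor of the closed component `v` is separated from the product; the other factors do
      -- not depend on i.
      have h₃ : ∀ i, (c.bump v i).closedFactor α = α (c.genus v + i) *
          ∏ w ∈ Finset.univ.erase v, c.closedValue α w := fun i => by
        rw [closedFactor, finprod_eq_prod_of_fintype,
          ← Finset.mul_prod_erase _ _ (Finset.mem_univ v), closedValue_not_out α (c.bump v i) hv]
        congr 1
        · exact congrArg (fun j => α (c.genus v + j)) (bumpFn_self v i)
        · exact Finset.prod_congr rfl fun w hw => closedValue_congr α _ _ Iff.rfl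
            (congrArg (c.genus w + ·) (bumpFn_ne (Finset.ne_of_mem_erase hw) i))
      simp only [h₃, smul_smul, ← mul_assoc]
      rw [Polynomial.sum, ← Finset.sum_smul, ← Finset.sum_mul]
      have h₄ := hα (c.genus v)
      rw [Polynomial.sum] at h₄
      rw [h₄, zero_mul, zero_smul]
  · push Not at hc
    have : ∀ i, (c.bump v i).symbol α p = 0 := fun i =>
      symbol_eq_zero α p fun σ hσ => hc σ hσ
    simp [this, Polynomial.sum]

end Surface

/-- With K = `kdeg f g`, reversal of the coefficients gives u_i = g_{K-i}, so the sum is the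
coefficient of t^(d+K) in g α = f. It is zero because deg f < K. This is where the rationality of
the power series enters. -/
theorem sum_uPoly (f g : k[X]) (α : PowerSeries k)
    (hα : (g : PowerSeries k) * α = (f : PowerSeries k)) (d : ℕ) :
    ((uPoly f g).sum fun i a => a * PowerSeries.coeff (d + i) α) = 0 := by
  classical
  have hK : (uPoly f g).natDegree ≤ kdeg f g := by
    rw [uPoly]
    refine (Polynomial.natDegree_reflect_le).trans ?_
    simp [kdeg]
  rw [Polynomial.sum_over_range' _ (by simp) (kdeg f g + 1) (by omega)]
  have h := congrArg (PowerSeries.coeff (d + kdeg f g)) hα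
  rw [Polynomial.coeff_coe, PowerSeries.coeff_mul] at h
  have h₀ : f.coeff (d + kdeg f g) = 0 := by
    by_cases hf : f = 0
    · rw [hf, coeff_zero]
    · refine coeff_eq_zero_of_natDegree_lt ?_
      have : f.natDegree + 1 ≤ kdeg f g := by
        simp [kdeg, hf]
      omega
  rw [h₀, Finset.Nat.sum_antidiagonal_eq_sum_range_succ_mk] at h
  rw [← h, ← Finset.sum_range_reflect]
  symm
  -- The convolution has d + K + 1 terms, but those with index above K vanish because deg g ≤ K. The
  -- others match the terms of the reflected sum.
  have hsub : Finset.range (kdeg f g + 1) ⊆ Finset.range (d + kdeg f g).succ :=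
    Finset.range_mono (by omega)
  rw [← Finset.sum_subset hsub]
  · refine Finset.sum_congr rfl fun i hi => ?_
    have hi' : i ≤ kdeg f g := by simpa [Nat.lt_succ_iff] using hi
    rw [Polynomial.coeff_coe, uPoly, coeff_reflect, revAt_le (by omega)]
    congr 3 <;> omega
  · intro i _ hi
    have hi' : kdeg f g < i := by simpa [Nat.lt_succ_iff] using hi
    rw [Polynomial.coeff_coe, coeff_eq_zero_of_natDegree_lt, zero_mul]
    refine lt_of_le_of_lt ?_ hi'
    simp [kdeg]

end KhovanovSazdanovic

/-! ### Cobordisms between numbered circles and the skein ideal -/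

namespace KhovanovSazdanovic

open Polynomial

namespace Surface

variable {A B A' B' : Type}

/-- Renaming of the boundary circles. -/
abbrev relabel (c : Surface A B) (e : A' ≃ A) (f : B' ≃ B) : Surface A' B' :=
  ⟨c.Comp, c.finite, fun a => c.inn (e a), fun b => c.out (f b), c.genus⟩

theorem Iso.relabel {c d : Surface A B} (h : Iso c d) (e : A' ≃ A) (f : B' ≃ B) :
    Iso (c.relabel e f) (d.relabel e f) := by
  obtain ⟨g, h₁, h₂, h₃⟩ := h
  exact ⟨g, fun a => h₁ _, fun b => h₂ _, h₃⟩

theorem relabel_twist [Finite B] [Finite B'] (g : A ≃ B) (m : B → ℕ) (e : A' ≃ A) (f : B' ≃ B) :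
    Iso ((twist g m).relabel e f) (twist ((e.trans g).trans f.symm) (m ∘ f)) :=
  ⟨f.symm, fun _ => rfl, fun b => f.symm_apply_apply b, fun v => congrArg m (f.apply_symm_apply v)⟩

end Surface

namespace Cob

open Surface

/-- The class of a cobordism. -/
noncomputable def ofSurface {m n : ℕ} (c : Surface (Fin m) (Fin n)) : obj m ⟶ obj n :=
  InducedCategory.homMk (Circles.cls c)

theorem exists_ofSurface {m n : ℕ} (f : obj m ⟶ obj n) : ∃ c, ofSurface c = f := by
  obtain ⟨c, hc⟩ := Circles.cls_surj f.hom
  exact ⟨c, InducedCategory.hom_ext hc⟩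

theorem ofSurface_eq {m n : ℕ} {c d : Surface (Fin m) (Fin n)} (h : Surface.Iso c d) :
    ofSurface c = ofSurface d :=
  InducedCategory.hom_ext (Quotient.sound h)

theorem ofSurface_comp {l m n : ℕ} (c : Surface (Fin l) (Fin m)) (d : Surface (Fin m) (Fin n)) :
    ofSurface c ≫ ofSurface d = ofSurface (glue c d) := rfl

theorem ofSurface_id (n : ℕ) : ofSurface (twist (Equiv.refl (Fin n)) fun _ => 0) = 𝟙 (obj n) := rfl

/-- The disjoint union of cobordisms between finite sets of circles. -/
abbrev sumSurface {m n m' n' : ℕ} (c : Surface (Fin m) (Fin n)) (d : Surface (Fin m') (Fin n')) :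
    Surface (Fin (m + m')) (Fin (n + n')) :=
  (disj c d).relabel finSumFinEquiv.symm finSumFinEquiv.symm

theorem ofSurface_tensor {m n m' n' : ℕ} (c : Surface (Fin m) (Fin n))
    (d : Surface (Fin m') (Fin n')) :
    (ofSurface c ⊗ₘ ofSurface d : obj (m + m') ⟶ obj (n + n')) = ofSurface (sumSurface c d) := by
  refine InducedCategory.hom_ext ?_
  change Circles.eqv (A := ⟨Fin (m + m')⟩) (B := ⟨Fin m ⊕ Fin m'⟩) finSumFinEquiv.symm ≫
    Circles.cls (A := ⟨Fin m ⊕ Fin m'⟩) (B := ⟨Fin n ⊕ Fin n'⟩) (disj c d) ≫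
    Circles.eqv (B := ⟨Fin (n + n')⟩) finSumFinEquiv = _
  rw [Circles.cls_comp_eqv, Circles.eqv_comp_cls]
  rfl

theorem whiskerLeft_ofSurface (l : ℕ) {m n : ℕ} (c : Surface (Fin m) (Fin n)) :
    (obj l ◁ ofSurface c : obj (l + m) ⟶ obj (l + n)) =
      ofSurface (sumSurface (twist (Equiv.refl (Fin l)) fun _ => 0) c) :=
  (id_tensorHom _ _).symm.trans (ofSurface_tensor _ _)

theorem ofSurface_whiskerRight (l : ℕ) {m n : ℕ} (c : Surface (Fin m) (Fin n)) :
    (ofSurface c ▷ obj l : obj (m + l) ⟶ obj (n + l)) =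
      ofSurface (sumSurface c (twist (Equiv.refl (Fin l)) fun _ => 0)) :=
  (tensorHom_id _ _).symm.trans (ofSurface_tensor _ _)

theorem connected_eq (m n : ℕ) : connected m n = ofSurface (conn (Fin m) (Fin n) 0) := rfl

/-- Gluing the two pairs of pants along two circles creates genus 2 - 1 = 1. Further gluing along
one circle just adds the genera. -/
theorem handle_pow (i : ℕ) :
    (handle ^ i : End (obj 1)) = ofSurface (conn (Fin 1) (Fin 1) i) := by
  induction i with
  | zero =>
    rw [pow_zero, End.one_def, ← ofSurface_id]
    exact ofSurface_eq ⟨Equiv.ofUnique _ _, fun _ => rfl, fun _ => rfl, fun _ => rfl⟩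
  | succ i ih =>
    have h : handle = ofSurface (conn (Fin 1) (Fin 1) 1) := by
      change connected 1 2 ≫ connected 2 1 = _
      rw [connected_eq, connected_eq, ofSurface_comp]
      refine ofSurface_eq ?_
      have := conn_glue_conn (A := Fin 1) (B := Fin 2) (D := Fin 1) 0 0
      rwa [Nat.card_fin] at this
    rw [pow_succ, ih, End.mul_def, h]
    erw [ofSurface_comp]
    refine ofSurface_eq ?_
    have := conn_glue_conn (A := Fin 1) (B := Fin 1) (D := Fin 1) 1 i
    rw [Nat.card_fin] at this
    rw [add_comm i 1]
    exact this

theorem closed_eq (i : ℕ) : closed i = ofSurface (conn (Fin 0) (Fin 0) i) := by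
  change connected 0 1 ≫ (handle ^ i : End (obj 1)) ≫ connected 1 0 = _
  rw [handle_pow, connected_eq, connected_eq]
  erw [ofSurface_comp]
  have h₁ := conn_glue_conn (A := Fin 1) (B := Fin 1) (D := Fin 0) i 0
  have h₂ := conn_glue_conn (A := Fin 0) (B := Fin 1) (D := Fin 0) 0 i
  rw [Nat.card_fin, Nat.sub_self, add_zero] at h₁ h₂
  rw [zero_add] at h₂
  exact ofSurface_eq ((glue_congr (Iso.refl (conn (Fin 0) (Fin 1) 0)) h₁).trans h₂)

end Cob

section SkeinSpan

open Surface Linearization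

variable {k : Type u} [Field k] (α : ℕ → k) (p : k[X])

/-- The basis vector given by a cobordism. -/
noncomputable def LinCob.ofSurface {m n : ℕ} (c : Surface (Fin m) (Fin n)) :
    LinCob.obj k m ⟶ LinCob.obj k n :=
  lin (Cob.ofSurface c)

theorem LinCob.ofSurface_eq {m n : ℕ} {c d : Surface (Fin m) (Fin n)} (h : Surface.Iso c d) :
    LinCob.ofSurface (k := k) c = LinCob.ofSurface d :=
  congrArg lin (Cob.ofSurface_eq h)

theorem LinCob.ofSurface_comp {l m n : ℕ} (c : Surface (Fin l) (Fin m))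
    (d : Surface (Fin m) (Fin n)) :
    LinCob.ofSurface (k := k) c ≫ LinCob.ofSurface d = LinCob.ofSurface (glue c d) :=
  lin_comp _ _

theorem LinCob.induction {m n : ℕ} {P : (LinCob.obj k m ⟶ LinCob.obj k n) → Prop} (h0 : P 0)
    (hadd : ∀ f g, P f → P g → P (f + g)) (hsmul : ∀ (r : k) f, P f → P (r • f))
    (hsurf : ∀ c, P (LinCob.ofSurface c)) (f : LinCob.obj k m ⟶ LinCob.obj k n) : P f := by
  induction f using lin_induction with
  | h0 => exact h0
  | hadd f g hf hg => exact hadd f g hf hg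
  | hlin r f =>
    obtain ⟨c, rfl⟩ := Cob.exists_ofSurface f
    exact hsmul r _ (hsurf c)

/-- The span of the consequences of the skein relations on the cobordisms. -/
noncomputable def skeinSpan (m n : ℕ) : Submodule k (LinCob.obj k m ⟶ LinCob.obj k n) :=
  Submodule.span k
    ({f | ∃ (c : Surface (Fin m) (Fin n)) (v : c.Comp),
        f = p.sum fun i a => a • LinCob.ofSurface (c.bump v i)} ∪
      {f | ∃ (c : Surface (Fin m) (Fin n)) (i : ℕ),
        f = LinCob.ofSurface (c.addClosed i) - α i • LinCob.ofSurface c})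

variable {α p}

/-- Composition and whiskering with a fixed cobordism are operations on surfaces. They preserve the
span as soon as they commute with raising the genus of a component and with adding a closed
component, and in this form the four closure properties of an ideal are proved at once. -/
theorem map_skeinSpan {m n m' n' : ℕ}
    (φ : (LinCob.obj k m ⟶ LinCob.obj k n) →ₗ[k] (LinCob.obj k m' ⟶ LinCob.obj k n'))
    (Φ : Surface (Fin m) (Fin n) → Surface (Fin m') (Fin n'))
    (h : ∀ c, φ (LinCob.ofSurface c) = LinCob.ofSurface (Φ c))
    (h₁ : ∀ c (v : c.Comp), ∃ w : (Φ c).Comp, ∀ i, Surface.Iso (Φ (c.bump v i)) ((Φ c).bump w i))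
    (h₂ : ∀ c i, Surface.Iso (Φ (c.addClosed i)) ((Φ c).addClosed i))
    {f : LinCob.obj k m ⟶ LinCob.obj k n} (hf : f ∈ skeinSpan α p m n) :
    φ f ∈ skeinSpan α p m' n' := by
  induction hf using Submodule.span_induction with
  | mem f hf =>
    rcases hf with ⟨c, v, rfl⟩ | ⟨c, i, rfl⟩
    · obtain ⟨w, hw⟩ := h₁ c v
      refine Submodule.subset_span (Or.inl ⟨Φ c, w, ?_⟩)
      rw [Polynomial.sum, Polynomial.sum, map_sum]
      refine Finset.sum_congr rfl fun i _ => ?_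
      rw [map_smul, h, LinCob.ofSurface_eq (hw i)]
    · refine Submodule.subset_span (Or.inr ⟨Φ c, i, ?_⟩)
      rw [map_sub, map_smul, h, h, LinCob.ofSurface_eq (h₂ c i)]
  | zero => rw [map_zero]; exact zero_mem _
  | add f g _ _ hf hg => rw [map_add]; exact add_mem hf hg
  | smul r f _ hf => rw [map_smul]; exact Submodule.smul_mem _ _ hf

theorem skeinSpan_comp_left {l m n : ℕ} (f : LinCob.obj k l ⟶ LinCob.obj k m)
    {g : LinCob.obj k m ⟶ LinCob.obj k n} (hg : g ∈ skeinSpan α p m n) :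
    f ≫ g ∈ skeinSpan α p l n := by
  induction f using LinCob.induction with
  | h0 => rw [Limits.zero_comp]; exact zero_mem _
  | hadd f f' hf hf' => rw [Preadditive.add_comp]; exact add_mem hf hf'
  | hsmul r f hf => rw [Linear.smul_comp]; exact Submodule.smul_mem _ _ hf
  | hsurf c =>
    exact map_skeinSpan (Linear.leftComp k _ (LinCob.ofSurface c)) (fun d => glue c d)
      (fun d => LinCob.ofSurface_comp c d) (fun d v => ⟨_, glue_bump_right c d v⟩)
      (fun d => glue_addClosed_right c d) hg

theorem skeinSpan_comp_right {l m n : ℕ} {f : LinCob.obj k l ⟶ LinCob.obj k m}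
    (g : LinCob.obj k m ⟶ LinCob.obj k n) (hf : f ∈ skeinSpan α p l m) :
    f ≫ g ∈ skeinSpan α p l n := by
  induction g using LinCob.induction with
  | h0 => rw [Limits.comp_zero]; exact zero_mem _
  | hadd f f' hf hf' => rw [Preadditive.comp_add]; exact add_mem hf hf'
  | hsmul r f hf => rw [Linear.comp_smul]; exact Submodule.smul_mem _ _ hf
  | hsurf c =>
    exact map_skeinSpan (Linear.rightComp k _ (LinCob.ofSurface c)) (fun d => glue d c)
      (fun d => LinCob.ofSurface_comp d c) (fun d v => ⟨_, glue_bump_left d c v⟩)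
      (fun d => glue_addClosed_left d c) hf

theorem skeinSpan_whiskerLeft (l : ℕ) {m n : ℕ} {f : LinCob.obj k m ⟶ LinCob.obj k n}
    (hf : f ∈ skeinSpan α p m n) :
    (LinCob.obj k l ◁ f : LinCob.obj k (l + m) ⟶ LinCob.obj k (l + n)) ∈
      skeinSpan α p (l + m) (l + n) :=
  map_skeinSpan (m := m) (n := n) (m' := l + m) (n' := l + n)
    ((tensoringLeft (LinCob k)).obj (LinCob.obj k l) |>.mapLinearMap k)
    (fun c => Cob.sumSurface (twist (Equiv.refl (Fin l)) fun _ => 0) c)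
    (fun c => (wl_lin _).trans (congrArg lin (Cob.whiskerLeft_ofSurface l c)))
    (fun c v => ⟨_, fun i => (disj_bump_right _ c v i).relabel _ _⟩)
    (fun c i => (disj_addClosed_right _ c i).relabel _ _) hf

theorem skeinSpan_whiskerRight (l : ℕ) {m n : ℕ} {f : LinCob.obj k m ⟶ LinCob.obj k n}
    (hf : f ∈ skeinSpan α p m n) :
    (f ▷ LinCob.obj k l : LinCob.obj k (m + l) ⟶ LinCob.obj k (n + l)) ∈
      skeinSpan α p (m + l) (n + l) :=
  map_skeinSpan (m := m) (n := n) (m' := m + l) (n' := n + l)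
    ((tensoringRight (LinCob k)).obj (LinCob.obj k l) |>.mapLinearMap k)
    (fun c => Cob.sumSurface c (twist (Equiv.refl (Fin l)) fun _ => 0))
    (fun c => (wr_lin _).trans (congrArg lin (Cob.ofSurface_whiskerRight l c)))
    (fun c v => ⟨_, fun i => (disj_bump_left c _ v i).relabel _ _⟩)
    (fun c i => (disj_addClosed_left c _ i).relabel _ _) hf

/-- The span contains the generating relations and is stable under all operations of a tensor ideal.
A linear map defined on surfaces thus descends to the skein category as soon as it kills the two
explicit families that define `skeinSpan`. -/
theorem generated_mem_skeinSpan {X Y : LinCob k} {f : X ⟶ Y}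
    (hf : TensorIdeal.Generated k (SkeinRel α p) f) : f ∈ skeinSpan α p X.as Y.as := by
  induction hf with
  | of f hf =>
    cases hf with
    | closed i =>
      -- The identity of [0] is the empty surface, and a closed surface is the empty surface with
      -- one closed component added.
      refine Submodule.subset_span (Or.inr ⟨twist (Equiv.refl (Fin 0)) fun _ => 0, i, ?_⟩)
      congr 1
      refine congrArg lin ((Cob.closed_eq i).trans (Cob.ofSurface_eq ?_))
      exact ⟨(Equiv.emptySum (Fin 0) Unit).symm, fun a => a.elim0, fun a => a.elim0, fun _ => rfl⟩
    | handle =>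
      refine Submodule.subset_span (Or.inl ⟨conn (Fin 1) (Fin 1) 0, (), ?_⟩)
      rw [Polynomial.sum, Polynomial.sum]
      refine Finset.sum_congr rfl fun i _ => ?_
      congr 1
      refine congrArg lin ((Cob.handle_pow i).trans (Cob.ofSurface_eq ?_))
      refine ⟨Equiv.refl _, fun _ => rfl, fun _ => rfl, fun _ => ?_⟩
      exact (congrArg (0 + ·) (bumpFn_self () i)).trans (zero_add i)
  | zero X Y => exact zero_mem _
  | add f g _ _ hf hg => exact add_mem hf hg
  | smul r f _ hf => exact Submodule.smul_mem _ _ hf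
  | comp_left f g _ hg => exact skeinSpan_comp_left f hg
  | comp_right f g _ hf => exact skeinSpan_comp_right g hf
  | whisker_left X f _ hf => exact skeinSpan_whiskerLeft X.as hf
  | whisker_right f X _ hf => exact skeinSpan_whiskerRight X.as hf

end SkeinSpan

end KhovanovSazdanovic

/-! ### Consequences of the relations in the skein category -/

namespace KhovanovSazdanovic

open Polynomial Surface

variable {k : Type u} [Field k] {α : ℕ → k} {p : k[X]}

namespace SCob

/-- The morphism given by a cobordism. -/
noncomputable def ofSurface {m n : ℕ} (c : Surface (Fin m) (Fin n)) :
    SCob.obj α p m ⟶ SCob.obj α p n :=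
  TensorIdeal.Quot.cls (LinCob.ofSurface c)

theorem ofSurface_eq {m n : ℕ} {c d : Surface (Fin m) (Fin n)} (h : Surface.Iso c d) :
    ofSurface (α := α) (p := p) c = ofSurface d :=
  congrArg TensorIdeal.Quot.cls (LinCob.ofSurface_eq h)

theorem ofSurface_comp {l m n : ℕ} (c : Surface (Fin l) (Fin m)) (d : Surface (Fin m) (Fin n)) :
    ofSurface (α := α) (p := p) c ≫ ofSurface d = ofSurface (glue c d) :=
  congrArg TensorIdeal.Quot.cls (LinCob.ofSurface_comp c d)

theorem whiskerLeft_ofSurface (l : ℕ) {m n : ℕ} (c : Surface (Fin m) (Fin n)) :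
    (SCob.obj α p l ◁ ofSurface c : SCob.obj α p (l + m) ⟶ SCob.obj α p (l + n)) =
      ofSurface (Cob.sumSurface (twist (Equiv.refl (Fin l)) fun _ => 0) c) :=
  congrArg TensorIdeal.Quot.cls
    ((Linearization.wl_lin _).trans (congrArg Linearization.lin (Cob.whiskerLeft_ofSurface l c)))

theorem ofSurface_whiskerRight (l : ℕ) {m n : ℕ} (c : Surface (Fin m) (Fin n)) :
    (ofSurface c ▷ SCob.obj α p l : SCob.obj α p (m + l) ⟶ SCob.obj α p (n + l)) =
      ofSurface (Cob.sumSurface c (twist (Equiv.refl (Fin l)) fun _ => 0)) :=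
  congrArg TensorIdeal.Quot.cls
    ((Linearization.wr_lin _).trans (congrArg Linearization.lin (Cob.ofSurface_whiskerRight l c)))

theorem induction {m n : ℕ} {P : (SCob.obj α p m ⟶ SCob.obj α p n) → Prop} (h0 : P 0)
    (hadd : ∀ f g, P f → P g → P (f + g)) (hsmul : ∀ (r : k) f, P f → P (r • f))
    (hsurf : ∀ c, P (ofSurface c)) (f : SCob.obj α p m ⟶ SCob.obj α p n) : P f := by
  obtain ⟨f, rfl⟩ := TensorIdeal.Quot.cls_surj f
  induction f using LinCob.induction with
  | h0 => exact h0
  | hadd f g hf hg => exact hadd _ _ hf hg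
  | hsmul r f hf => exact hsmul r _ hf
  | hsurf c => exact hsurf c

theorem cls_eq_zero {m n : ℕ} {f : LinCob.obj k m ⟶ LinCob.obj k n}
    (hf : TensorIdeal.Generated k (SkeinRel α p) f) :
    (TensorIdeal.Quot.cls f : SCob.obj α p m ⟶ SCob.obj α p n) = 0 :=
  (TensorIdeal.Quot.cls_eq f 0).2 (by rw [sub_zero]; exact hf)

theorem ofSurface_closed (i : ℕ) :
    (ofSurface (conn (Fin 0) (Fin 0) i) : SCob.obj α p 0 ⟶ SCob.obj α p 0) = α i • 𝟙 _ := by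
  have h := cls_eq_zero (TensorIdeal.Generated.of _ (SkeinRel.closed (α := α) (u := p) i))
  have h' : (TensorIdeal.Quot.cls (Linearization.lin (k := k) (X := LinCob.obj k 0)
      (Y := LinCob.obj k 0) (Cob.closed i)) : SCob.obj α p 0 ⟶ SCob.obj α p 0) - α i • 𝟙 _ = 0 := h
  rw [sub_eq_zero, Cob.closed_eq] at h'
  exact h'

/-- Tensoring the relation for a closed surface with the identity of [m] gives the case of an
identity. Composing with `c` gives the general case, since the closed component passes through the
gluing. -/
theorem ofSurface_addClosed {m n : ℕ} (c : Surface (Fin m) (Fin n)) (i : ℕ) :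
    (ofSurface (c.addClosed i) : SCob.obj α p m ⟶ SCob.obj α p n) = α i • ofSurface c := by
  have h : (ofSurface ((twist (Equiv.refl (Fin m)) fun _ => 0).addClosed i) :
      SCob.obj α p m ⟶ SCob.obj α p m) = α i • 𝟙 _ := by
    have h₁ := congrArg (fun f => (SCob.obj α p m ◁ f : SCob.obj α p (m + 0) ⟶ SCob.obj α p (m + 0)))
      (ofSurface_closed (α := α) (p := p) i)
    have h₂ : (SCob.obj α p m ◁ (α i • 𝟙 (SCob.obj α p 0)) :
        SCob.obj α p (m + 0) ⟶ SCob.obj α p (m + 0)) = α i • 𝟙 (SCob.obj α p (m + 0)) :=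
      (MonoidalLinear.whiskerLeft_smul _ _ _).trans
        (congrArg (α i • ·) (MonoidalCategory.whiskerLeft_id (SCob.obj α p m) (SCob.obj α p 0)))
    refine Eq.trans ?_ (h₁.trans h₂)
    refine Eq.trans (ofSurface_eq (m := m + 0) (n := m + 0) ?_)
      (whiskerLeft_ofSurface (m := 0) (n := 0) m (conn (Fin 0) (Fin 0) i)).symm
    refine ⟨Equiv.refl _, fun a => ?_, fun a => ?_, ?_⟩
    · change _ = Sum.map _ _ (finSumFinEquiv.symm (Fin.castAdd 0 a))
      rw [finSumFinEquiv_symm_apply_castAdd]; rfl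
    · change _ = Sum.map _ _ (finSumFinEquiv.symm (Fin.castAdd 0 a))
      rw [finSumFinEquiv_symm_apply_castAdd]; rfl
    · rintro (a | a) <;> rfl
  rw [← Category.id_comp (ofSurface c), ← Linear.smul_comp, ← h, ofSurface_comp]
  refine ofSurface_eq (Surface.Iso.trans (addClosed_congr ?_ i) (glue_addClosed_left _ c i).symm)
  exact (ofEquiv_glue (Equiv.refl (Fin m)) c).symm

theorem sum_ofSurface_conn :
    (p.sum fun i a => a • (ofSurface (conn (Fin 1) (Fin 1) i) :
      SCob.obj α p 1 ⟶ SCob.obj α p 1)) = 0 := by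
  have h := cls_eq_zero (TensorIdeal.Generated.of _ (SkeinRel.handle (α := α) (u := p)))
  refine Eq.trans ?_ h
  simp only [Polynomial.sum, Cob.handle_pow]
  exact (map_sum (Submodule.mkQ ((TensorIdeal.generate k (SkeinRel α p)).sub
    (LinCob.obj k 1) (LinCob.obj k 1))) (fun i => p.coeff i • LinCob.ofSurface _) _).symm

theorem conn_iso_twist (i : ℕ) :
    Surface.Iso (conn (Fin 1) (Fin 1) i) (twist (Equiv.refl (Fin 1)) fun _ => i) :=
  ⟨Equiv.ofUnique _ _, fun _ => Subsingleton.elim _ _, fun _ => Subsingleton.elim _ _, fun _ => rfl⟩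

/-- The relation for one circle is tensored with the identity of [n] on the left, which places it on
the last of n + 1 circles. -/
theorem sum_ofSurface_last (n : ℕ) :
    (p.sum fun i a => a • (ofSurface (twist (Equiv.refl (Fin (n + 1))) (bumpFn (Fin.last n) i)) :
      SCob.obj α p (n + 1) ⟶ SCob.obj α p (n + 1))) = 0 := by
  have h := congrArg ((tensoringLeft (SCob α p)).obj (SCob.obj α p n) |>.mapLinearMap k)
    (sum_ofSurface_conn (α := α) (p := p))
  rw [map_zero, Polynomial.sum, map_sum] at h
  refine Eq.trans ?_ h
  rw [Polynomial.sum]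
  refine Finset.sum_congr rfl fun i _ => ?_
  rw [map_smul]
  congr 1
  refine Eq.trans (ofSurface_eq (Iso.symm ?_)) (whiskerLeft_ofSurface n _).symm
  refine (((disj_congr (Iso.refl _) (conn_iso_twist i)).trans
    (disj_twist _ _ _ _)).relabel _ _).trans ((relabel_twist _ _ _ _).trans ?_)
  have h₁ : (finSumFinEquiv.symm.trans (Equiv.sumCongr (Equiv.refl (Fin n)) (Equiv.refl (Fin 1)))).trans
      finSumFinEquiv.symm.symm = Equiv.refl (Fin (n + 1)) := by
    ext a; simp
  have h₂ : (Sum.elim (fun _ => 0) fun _ => i) ∘ finSumFinEquiv.symm = bumpFn (Fin.last n) i := by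
    funext a
    refine Fin.lastCases ?_ (fun a => ?_) a
    · exact (congrArg (Sum.elim (fun _ => 0) fun _ => i)
        (finSumFinEquiv_symm_apply_natAdd (m := n) (0 : Fin 1))).trans (bumpFn_self _ i).symm
    · exact (congrArg (Sum.elim (fun _ => 0) fun _ => i)
        (finSumFinEquiv_symm_apply_castAdd (n := 1) a)).trans
        (bumpFn_ne (Fin.castSucc_lt_last a).ne i).symm
  rw [h₁, h₂]
  exact Iso.refl _

/-- Any circle can be moved to the last position, so the previous relation is conjugated by a
transposition. This relation is what lets P_n, and not just the polynomial ring, act on [n]. -/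
theorem sum_ofSurface_bumpFn {n : ℕ} (b : Fin n) :
    (p.sum fun i a => a • (ofSurface (twist (Equiv.refl (Fin n)) (bumpFn b i)) :
      SCob.obj α p n ⟶ SCob.obj α p n)) = 0 := by
  cases n with
  | zero => exact b.elim0
  | succ n =>
    let τ := Equiv.swap b (Fin.last n)
    have h := congrArg (fun f => ofSurface (twist τ fun _ => 0) ≫ f ≫ ofSurface (twist τ fun _ => 0))
      (sum_ofSurface_last (α := α) (p := p) n)
    simp only [Limits.zero_comp, Limits.comp_zero] at h
    rw [← h, Polynomial.sum, Polynomial.sum, Preadditive.sum_comp, Preadditive.comp_sum]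
    refine Finset.sum_congr rfl fun i _ => ?_
    rw [Linear.smul_comp, Linear.comp_smul, ofSurface_comp, ofSurface_comp]
    congr 1
    refine ofSurface_eq (Iso.symm ?_)
    refine (glue_congr (Iso.refl _) (twist_glue_twist _ _ _ _)).trans
      ((twist_glue_twist _ _ _ _).trans ?_)
    have h₁ : τ.trans ((Equiv.refl (Fin (n + 1))).trans τ) = Equiv.refl _ := by
      ext a; simp [τ]
    have h₂ : (fun d => (fun _ => 0) (((Equiv.refl (Fin (n + 1))).trans τ).symm d) +
        (bumpFn (Fin.last n) i (τ.symm d) + 0)) = bumpFn b i := by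
      funext d
      have h₃ := bumpFn_map τ τ.injective (Fin.last n) i (τ.symm d)
      rw [τ.apply_symm_apply, Equiv.swap_apply_right] at h₃
      rw [h₃]
      simp
    rw [h₁, h₂]
    exact Iso.refl _

end SCob

end KhovanovSazdanovic

/-! ### The skew group algebra acting on n circles, and the inverse modulo fewer circles -/

namespace KhovanovSazdanovic

open Polynomial Surface

variable {k : Type u} [Field k] (α : ℕ → k) (p : k[X])

namespace SCob

/-- Cylinders along `σ` with handles. -/
noncomputable def twistEnd {n : ℕ} (σ : Equiv.Perm (Fin n)) (m : Fin n → ℕ) :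
    End (SCob.obj α p n) := ofSurface (twist σ m)

/-- In `End` the product f * g is g followed by f. The handles of the factor with τ therefore sit
before the cylinders of σ, and they are carried along σ to the outgoing circles. -/
theorem twistEnd_mul {n : ℕ} (σ τ : Equiv.Perm (Fin n)) (m m' : Fin n → ℕ) :
    twistEnd α p σ m * twistEnd α p τ m' =
      twistEnd α p (σ * τ) fun b => m b + m' (σ.symm b) := by
  rw [End.mul_def, twistEnd, twistEnd, twistEnd]
  refine (ofSurface_comp _ _).trans ((ofSurface_eq (twist_glue_twist _ _ _ _)).trans ?_)
  have h : (fun d => m' (σ.symm d) + m d) = fun b => m b + m' (σ.symm b) :=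
    funext fun d => add_comm _ _
  rw [h]
  rfl

theorem twistEnd_one {n : ℕ} : twistEnd α p (1 : Equiv.Perm (Fin n)) (fun _ => 0) = 1 := rfl

/-- The action of polynomials by handles. -/
noncomputable def polyHom (n : ℕ) : MvPolynomial (Fin n) k →ₐ[k] End (SCob.obj α p n) :=
  AddMonoidAlgebra.lift k (End (SCob.obj α p n)) (Fin n →₀ ℕ)
    { toFun := fun m => twistEnd α p 1 m.toAdd
      map_one' := twistEnd_one α p
      map_mul' := fun m m' => (twistEnd_mul α p 1 1 m.toAdd m'.toAdd).symm }

theorem polyHom_monomial {n : ℕ} (m : Fin n →₀ ℕ) :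
    polyHom α p n (MvPolynomial.monomial m 1) = twistEnd α p 1 m :=
  (AddMonoidAlgebra.lift_single _ _ _).trans (one_smul _ _)

theorem polyHom_prod {n : ℕ} (m : Fin n → ℕ) :
    polyHom α p n (∏ b, MvPolynomial.X b ^ m b) = twistEnd α p 1 m := by
  have h := polyHom_monomial α p (Finsupp.equivFunOnFinite.symm m)
  rw [MvPolynomial.monomial_eq, Finsupp.prod_fintype _ _ (by simp), map_one, one_mul] at h
  exact h

theorem polyHom_aeval {n : ℕ} (b : Fin n) :
    polyHom α p n (aeval (MvPolynomial.X b : MvPolynomial (Fin n) k) p) = 0 := by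
  refine Eq.trans ?_ (sum_ofSurface_bumpFn (α := α) (p := p) b)
  rw [aeval_eq_sum_range, map_sum, sum_over_range _ (by simp)]
  refine Finset.sum_congr rfl fun i _ => ?_
  rw [map_smul]
  congr 1
  refine Eq.trans ?_ (polyHom_prod α p (bumpFn b i))
  congr 1
  rw [Finset.prod_eq_single b]
  · rw [bumpFn_self]
  · intro c _ hc
    rw [bumpFn_ne hc, pow_zero]
  · simp

/-- The action of truncated polynomials by handles. -/
noncomputable def truncHom (n : ℕ) : TruncPoly p n →ₐ[k] End (SCob.obj α p n) :=
  Ideal.Quotient.liftₐ _ (polyHom α p n) fun a ha => by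
    have h : Ideal.span (Set.range fun i : Fin n =>
        aeval (MvPolynomial.X i : MvPolynomial (Fin n) k) p) ≤ RingHom.ker (polyHom α p n) := by
      rw [Ideal.span_le]
      rintro _ ⟨b, rfl⟩
      exact polyHom_aeval α p b
    exact h ha

theorem truncHom_mono {n : ℕ} (m : Fin n → ℕ) :
    truncHom α p n (TruncPoly.mono p m) = twistEnd α p 1 m :=
  polyHom_prod α p m

/-- The action of permutations. -/
noncomputable def permHom (n : ℕ) : Equiv.Perm (Fin n) →* End (SCob.obj α p n) where
  toFun σ := twistEnd α p σ fun _ => 0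
  map_one' := rfl
  map_mul' σ τ := (twistEnd_mul α p σ τ (fun _ => 0) fun _ => 0).symm

/-- This is the commutation rule of the skew group algebra: handles slide along the cylinders of σ.
By linearity it is enough to check monomials. -/
theorem truncHom_smul_mul {n : ℕ} (x : TruncPoly p n) (σ : Equiv.Perm (Fin n)) :
    truncHom α p n (σ • x) * permHom α p n σ = permHom α p n σ * truncHom α p n x := by
  have hx : x ∈ Submodule.span k (Set.range (TruncPoly.mono (n := n) p)) := by
    rw [TruncPoly.span_mono]; trivial
  induction hx using Submodule.span_induction with
  | mem x hx =>
    obtain ⟨m, rfl⟩ := hx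
    rw [TruncPoly.smul_def, TruncPoly.map_mono_equiv, truncHom_mono, truncHom_mono]
    refine (twistEnd_mul α p 1 σ _ fun _ => 0).trans
      (Eq.trans ?_ (twistEnd_mul α p σ 1 (fun _ => 0) m).symm)
    rw [one_mul, mul_one]
    congr 1
    funext b
    rw [zero_add, add_zero]
  | zero => rw [smul_zero, map_zero, zero_mul, mul_zero]
  | add x y _ _ hx hy => rw [smul_add, map_add, map_add, add_mul, mul_add, hx, hy]
  | smul a x _ hx =>
    rw [smul_comm σ a x, map_smul (truncHom α p n) a, map_smul (truncHom α p n) a,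
      smul_mul_assoc, mul_smul_comm, hx]

/-- The action of the skew group algebra on `[n]`. -/
noncomputable def skewHom (n : ℕ) : SkewSym p n →ₐ[k] End (SCob.obj α p n) :=
  SkewMonoidAlgebra.liftNCAlgHom (truncHom α p n) (permHom α p n)
    fun {x y} => truncHom_smul_mul α p x y

theorem skewHom_single {n : ℕ} (σ : Equiv.Perm (Fin n)) (m : Fin n → ℕ) :
    skewHom α p n (SkewSym.single σ (TruncPoly.mono p m)) = twistEnd α p σ m := by
  refine (SkewMonoidAlgebra.liftNC_single _ _ σ (TruncPoly.mono p m)).trans ?_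
  refine (congrArg (· * permHom α p n σ) (truncHom_mono α p m)).trans ?_
  refine (twistEnd_mul α p 1 σ m fun _ => 0).trans ?_
  rw [one_mul]
  rfl

/-- The action of the skew group algebra, as a linear map to the morphisms. -/
noncomputable def skewMap (n : ℕ) : SkewSym p n →ₗ[k] (SCob.obj α p n ⟶ SCob.obj α p n) where
  toFun := skewHom α p n
  map_add' := map_add (skewHom α p n)
  map_smul' := map_smul (skewHom α p n)

theorem skew_induction {n : ℕ} {P : SkewSym p n → Prop} (h0 : P 0)
    (hadd : ∀ r s, P r → P s → P (r + s)) (hsmul : ∀ (a : k) r, P r → P (a • r))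
    (hmono : ∀ σ m, P (SkewSym.single σ (TruncPoly.mono p m))) (r : SkewSym p n) : P r := by
  induction r using SkewSym.induction with
  | h0 => exact h0
  | hadd r s hr hs => exact hadd r s hr hs
  | hsingle σ x =>
    have hx : x ∈ Submodule.span k (Set.range (TruncPoly.mono (n := n) p)) := by
      rw [TruncPoly.span_mono]; trivial
    induction hx using Submodule.span_induction with
    | mem x hx =>
      obtain ⟨m, rfl⟩ := hx
      exact hmono σ m
    | zero => rwa [SkewSym.single_zero]
    | add x y _ _ hx hy => rw [SkewSym.single_add]; exact hadd _ _ hx hy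
    | smul a x _ hx => rw [← SkewSym.smul_single]; exact hsmul _ _ hx

section Symbol

variable {α p} (hα : ∀ g, (p.sum fun i a => a * α (g + i)) = 0)

/-- The value of a morphism of the linearized cobordism category in the skew group algebra. -/
noncomputable def linSymbol (α : ℕ → k) (p : k[X]) (n : ℕ) :
    (LinCob.obj k n ⟶ LinCob.obj k n) →ₗ[k] SkewSym p n :=
  Finsupp.linearCombination k fun f : Cob.obj n ⟶ Cob.obj n =>
    Quotient.lift (Surface.symbol α p) (fun _ _ h => symbol_congr α p h) f.hom

theorem linSymbol_ofSurface {n : ℕ} (c : Surface (Fin n) (Fin n)) :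
    linSymbol α p n (LinCob.ofSurface c) = c.symbol α p :=
  (Finsupp.linearCombination_single _ _ _).trans (one_smul _ _)

theorem skeinSpan_le_ker (hα : ∀ g, (p.sum fun i a => a * α (g + i)) = 0) (n : ℕ) :
    skeinSpan α p n n ≤ LinearMap.ker (linSymbol α p n) := by
  rw [skeinSpan, Submodule.span_le]
  rintro f (⟨c, v, rfl⟩ | ⟨c, i, rfl⟩)
  · rw [SetLike.mem_coe, LinearMap.mem_ker, Polynomial.sum, map_sum]
    refine Eq.trans ?_ (sum_symbol_bump α p hα c v)
    refine Finset.sum_congr rfl fun i _ => ?_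
    rw [map_smul, linSymbol_ofSurface]
  · rw [SetLike.mem_coe, LinearMap.mem_ker, map_sub, map_smul, linSymbol_ofSurface,
      linSymbol_ofSurface, symbol_addClosed, sub_self]

/-- The value of an endomorphism of `[n]` in the skew group algebra. -/
noncomputable def symbol (n : ℕ) : (SCob.obj α p n ⟶ SCob.obj α p n) →ₗ[k] SkewSym p n :=
  Submodule.liftQ _ (linSymbol α p n) fun _ hf =>
    skeinSpan_le_ker hα n (generated_mem_skeinSpan hf)

theorem symbol_ofSurface {n : ℕ} (c : Surface (Fin n) (Fin n)) :
    symbol hα n (ofSurface c) = c.symbol α p :=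
  linSymbol_ofSurface c

/-- The symbol splits the action. Since it also kills the composites through fewer circles
(`symbol_comp_eq_zero`), the skew group algebra embeds in the endomorphisms of [n] modulo such
composites. -/
theorem symbol_skewHom {n : ℕ} (r : SkewSym p n) : symbol hα n (skewHom α p n r) = r := by
  induction r using skew_induction with
  | h0 => rw [map_zero]; exact map_zero _
  | hadd r s hr hs => rw [map_add]; exact (map_add (symbol hα n) _ _).trans (by rw [hr, hs])
  | hsmul a r hr => rw [map_smul]; exact (map_smul (symbol hα n) _ _).trans (by rw [hr])
  | hmono σ m =>
    rw [skewHom_single]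
    exact (symbol_ofSurface hα _).trans (symbol_twist α p σ m)

/-- By bilinearity only composites of two surfaces matter, and such a glued surface is never a union
of n cylinders up to closed components. -/
theorem symbol_comp_eq_zero {m n : ℕ} (hmn : m < n) (f : SCob.obj α p n ⟶ SCob.obj α p m)
    (g : SCob.obj α p m ⟶ SCob.obj α p n) : symbol hα n (f ≫ g) = 0 := by
  induction f using SCob.induction with
  | h0 => rw [Limits.zero_comp, map_zero]
  | hadd f f' hf hf' => rw [Preadditive.add_comp, map_add, hf, hf', add_zero]
  | hsmul r f hf => rw [Linear.smul_comp, map_smul, hf, smul_zero]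
  | hsurf c =>
    induction g using SCob.induction with
    | h0 => rw [Limits.comp_zero, map_zero]
    | hadd f f' hf hf' => rw [Preadditive.comp_add, map_add, hf, hf', add_zero]
    | hsmul r f hf => rw [Linear.comp_smul, map_smul, hf, smul_zero]
    | hsurf d =>
      rw [ofSurface_comp, symbol_ofSurface]
      exact symbol_eq_zero α p fun σ => not_isTwist_glue hmn c d σ

/-- Every endomorphism of `[n]` is given by an element of the skew group algebra, up to morphisms
that factor through fewer circles. -/
theorem sub_skewHom_symbol_mem {n : ℕ} (S : Submodule k (SCob.obj α p n ⟶ SCob.obj α p n))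
    (hS : ∀ m < n, ∀ (f : SCob.obj α p n ⟶ SCob.obj α p m) (g : SCob.obj α p m ⟶ SCob.obj α p n),
      f ≫ g ∈ S) (f : SCob.obj α p n ⟶ SCob.obj α p n) :
    f - skewMap α p n (symbol hα n f) ∈ S := by
  induction f using SCob.induction with
  | h0 => rw [map_zero, map_zero]; rw [sub_zero]; exact zero_mem S
  | hadd f g hf hg =>
    rw [map_add, map_add]
    have := add_mem hf hg
    rwa [sub_add_sub_comm] at this
  | hsmul r f hf =>
    rw [map_smul, map_smul]
    have := Submodule.smul_mem S r hf
    rwa [smul_sub] at this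
  | hsurf c =>
    rw [symbol_ofSurface]
    -- Induction on the number of components. A closed component contributes the same scalar to the
    -- surface and to its symbol and can be removed; a surface that factors through fewer circles
    -- lies in `S` and has symbol zero; for cylinders with handles the difference is zero.
    induction hN : Nat.card c.Comp using Nat.strong_induction_on generalizing c with
    | _ N ih =>
      rcases cases_endo c with ⟨i, c', hc, h⟩ | ⟨m, hm, a, b, h⟩ | ⟨σ, m, h⟩
      · have h₁ := Submodule.smul_mem S (α i) (ih _ (hN ▸ hc) c' rfl)
        rwa [smul_sub, ← ofSurface_addClosed, ← ofSurface_eq h, ← map_smul, ← symbol_addClosed,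
          ← symbol_congr α p h] at h₁
      · rw [← ofSurface_eq h, ← symbol_congr α p h,
          symbol_eq_zero α p fun σ => not_isTwist_glue hm a b σ, map_zero, ← ofSurface_comp,
          sub_zero]
        exact hS m hm _ _
      · rw [ofSurface_eq h, symbol_congr α p h, symbol_twist]
        rw [show skewMap α p n (SkewSym.single σ (TruncPoly.mono p m)) = ofSurface (twist σ m) from
          skewHom_single α p σ m, sub_self]
        exact zero_mem S

end Symbol

end SCob

end KhovanovSazdanovic

/-! ### Compatibility of the action with tensor products -/

namespace KhovanovSazdanovic

open Polynomial Surface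

namespace Cob

/-- Renumbering the circles. -/
noncomputable def cast {m n : ℕ} (h : m = n) : obj m ⟶ obj n :=
  ofSurface (twist (finCongr h) fun _ => 0)

/-- In the linearization and in the skein category, the tensor product of morphisms is by definition
a composite of two whiskerings. This identity turns that composite back into a single disjoint
union. -/
theorem ofSurface_sumSurface {m n m' n' : ℕ} (c : Surface (Fin m) (Fin n))
    (d : Surface (Fin m') (Fin n')) :
    ofSurface (glue (sumSurface c (twist (Equiv.refl (Fin m')) fun _ => 0))
      (sumSurface (twist (Equiv.refl (Fin n)) fun _ => 0) d)) = ofSurface (sumSurface c d) := by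
  rw [← ofSurface_comp, ← ofSurface_whiskerRight, ← whiskerLeft_ofSurface, ← ofSurface_tensor]
  exact (MonoidalCategory.tensorHom_def _ _).symm

/-- All structure isomorphisms are cylinders along bijections. The composite bijection preserves the
values of the indices, because both ways of numbering three blocks in a row agree. -/
theorem associator_hom (a b c : ℕ) :
    ((α_ (obj a) (obj b) (obj c)).hom : obj (a + b + c) ⟶ obj (a + (b + c))) =
      cast (add_assoc a b c) := by
  refine InducedCategory.hom_ext ?_
  change ((Circles.eqv (A := ⟨Fin (a + b + c)⟩) (B := ⟨Fin (a + b) ⊕ Fin c⟩)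
      finSumFinEquiv.symm ≫ Circles.unionHom (A := ⟨Fin (a + b)⟩) (A' := ⟨Fin c⟩)
        (B := ⟨Fin a ⊕ Fin b⟩) (B' := ⟨Fin c⟩) (Circles.eqv finSumFinEquiv.symm)
        (Circles.eqv (Equiv.refl _))) ≫
      Circles.eqv (A := ⟨(Fin a ⊕ Fin b) ⊕ Fin c⟩) (B := ⟨Fin a ⊕ (Fin b ⊕ Fin c)⟩)
        (Equiv.sumAssoc _ _ _) ≫
      (Circles.unionHom (A := ⟨Fin a⟩) (A' := ⟨Fin b ⊕ Fin c⟩) (B := ⟨Fin a⟩) (B' := ⟨Fin (b + c)⟩)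
        (Circles.eqv (Equiv.refl _)) (Circles.eqv finSumFinEquiv) ≫
      Circles.eqv (A := ⟨Fin a ⊕ Fin (b + c)⟩) (B := ⟨Fin (a + (b + c))⟩) finSumFinEquiv)) =
    Circles.eqv (A := ⟨Fin (a + b + c)⟩) (B := ⟨Fin (a + (b + c))⟩) (finCongr (add_assoc a b c))
  rw [Circles.unionHom_eqv, Circles.unionHom_eqv, Circles.eqv_comp_eqv, Circles.eqv_comp_eqv,
    Circles.eqv_comp_eqv, Circles.eqv_comp_eqv]
  congr 1
  refine Equiv.ext fun x => ?_
  obtain ⟨x | x, rfl⟩ := finSumFinEquiv.surjective x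
  · obtain ⟨x | x, rfl⟩ := finSumFinEquiv.surjective x
    · ext
      simp
    · ext
      simp
  · ext
    simp [add_assoc]

theorem leftUnitor_hom (a : ℕ) :
    ((λ_ (obj a)).hom : obj (0 + a) ⟶ obj a) = cast (zero_add a) := by
  refine InducedCategory.hom_ext ?_
  change ((Circles.eqv (A := ⟨Fin (0 + a)⟩) (B := ⟨Fin 0 ⊕ Fin a⟩) finSumFinEquiv.symm ≫
      Circles.unionHom (A := ⟨Fin 0⟩) (A' := ⟨Fin a⟩) (B := ⟨Empty⟩) (B' := ⟨Fin a⟩)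
        (Circles.eqv finZeroEquiv) (Circles.eqv (Equiv.refl _))) ≫
      Circles.eqv (A := ⟨Empty ⊕ Fin a⟩) (B := ⟨Fin a⟩) (Equiv.emptySum Empty _)) =
    Circles.eqv (A := ⟨Fin (0 + a)⟩) (B := ⟨Fin a⟩) (finCongr (zero_add a))
  rw [Circles.unionHom_eqv, Circles.eqv_comp_eqv, Circles.eqv_comp_eqv]
  congr 1
  refine Equiv.ext fun x => ?_
  obtain ⟨x | x, rfl⟩ := finSumFinEquiv.surjective x
  · exact x.elim0
  · ext
    rw [Equiv.trans_apply, Equiv.trans_apply, Equiv.symm_apply_apply]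
    simp

theorem rightUnitor_hom (a : ℕ) :
    ((ρ_ (obj a)).hom : obj (a + 0) ⟶ obj a) = cast (add_zero a) := by
  refine InducedCategory.hom_ext ?_
  change ((Circles.eqv (A := ⟨Fin (a + 0)⟩) (B := ⟨Fin a ⊕ Fin 0⟩) finSumFinEquiv.symm ≫
      Circles.unionHom (A := ⟨Fin a⟩) (A' := ⟨Fin 0⟩) (B := ⟨Fin a⟩) (B' := ⟨Empty⟩)
        (Circles.eqv (Equiv.refl _)) (Circles.eqv finZeroEquiv)) ≫
      Circles.eqv (A := ⟨Fin a ⊕ Empty⟩) (B := ⟨Fin a⟩) (Equiv.sumEmpty _ Empty)) =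
    Circles.eqv (A := ⟨Fin (a + 0)⟩) (B := ⟨Fin a⟩) (finCongr (add_zero a))
  rw [Circles.unionHom_eqv, Circles.eqv_comp_eqv, Circles.eqv_comp_eqv]
  congr 1
  refine Equiv.ext fun x => ?_
  obtain ⟨x | x, rfl⟩ := finSumFinEquiv.surjective x
  · ext
    rw [Equiv.trans_apply, Equiv.trans_apply, Equiv.symm_apply_apply]
    rfl
  · exact x.elim0

end Cob

section Tower

variable {k : Type u} [Field k] {p : k[X]}

theorem TruncPoly.map_mono_mul {i j : ℕ} (m : Fin i → ℕ) (m' : Fin j → ℕ) :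
    TruncPoly.map (SkewSym.embL (rfl : i + j = i + j)) (TruncPoly.mono p m) *
        TruncPoly.map (SkewSym.embR rfl) (TruncPoly.mono p m') =
      TruncPoly.mono p (Sum.elim m m' ∘ finSumFinEquiv.symm) := by
  rw [map_mono, map_mono, mono, ← map_mul, ← Equiv.prod_comp finSumFinEquiv, Fintype.prod_sum_type]
  congr 2
  · refine Finset.prod_congr rfl fun b _ => ?_
    simp
    rfl
  · refine Finset.prod_congr rfl fun b _ => ?_
    simp
    rfl

theorem SkewSym.via_mul_via {i j : ℕ} (σ : Equiv.Perm (Fin i)) (τ : Equiv.Perm (Fin j)) :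
    σ.viaEmbedding (embL (rfl : i + j = i + j)) * τ.viaEmbedding (embR rfl) =
      (finSumFinEquiv.symm.trans (Equiv.sumCongr σ τ)).trans finSumFinEquiv := by
  refine Equiv.ext fun x => ?_
  obtain ⟨x | x, rfl⟩ := finSumFinEquiv.surjective x
  · have h₁ : ∀ y : Fin i, (finSumFinEquiv (Sum.inl y) : Fin (i + j)) = embL rfl y := fun y => rfl
    rw [Equiv.trans_apply, Equiv.trans_apply, Equiv.symm_apply_apply, h₁, Equiv.Perm.mul_apply]
    have h₂ := congrFun (via_disj _ _ (fun a b h => embL_ne_embR rfl b a h.symm) τ) x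
    exact (congrArg _ h₂).trans (congrFun (via_apply (embL rfl) σ) x)
  · have h₁ : ∀ y : Fin j, (finSumFinEquiv (Sum.inr y) : Fin (i + j)) = embR rfl y := fun y => rfl
    rw [Equiv.trans_apply, Equiv.trans_apply, Equiv.symm_apply_apply, h₁, Equiv.Perm.mul_apply]
    have h₂ := congrFun (via_apply (embR (rfl : i + j = i + j)) τ) x
    exact (congrArg _ h₂).trans (congrFun (via_disj _ _ (embL_ne_embR rfl) σ) (τ x))

theorem SkewSym.emb_smul {i n : ℕ} (ι : Fin i ↪ Fin n) (c : k) (r : SkewSym p i) :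
    emb ι (c • r) = c • emb ι r := by
  induction r using SkewSym.induction with
  | h0 => rw [smul_zero, map_zero, smul_zero]
  | hadd r s hr hs => rw [smul_add, map_add, map_add, smul_add, hr, hs]
  | hsingle σ x => rw [smul_single, emb_single, emb_single, map_smul, smul_single]

theorem SkewSym.tower_smul_left {i j n : ℕ} (h : i + j = n) (c : k) (r : SkewSym p i)
    (s : SkewSym p j) : (tower p).φ h (c • r) s = c • (tower p).φ h r s :=
  (congrArg (· * emb (embR h) s) (emb_smul _ c r)).trans (smul_mul_assoc _ _ _)

theorem SkewSym.tower_smul_right {i j n : ℕ} (h : i + j = n) (c : k) (r : SkewSym p i)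
    (s : SkewSym p j) : (tower p).φ h r (c • s) = c • (tower p).φ h r s :=
  (congrArg (emb (embL h) r * ·) (emb_smul _ c s)).trans (mul_smul_comm _ _ _)

end Tower

variable {k : Type u} [Field k] (α : ℕ → k) (p : k[X])

namespace SCob

theorem ofSurface_tensor {m n m' n' : ℕ} (c : Surface (Fin m) (Fin n))
    (d : Surface (Fin m') (Fin n')) :
    (ofSurface c ⊗ₘ ofSurface d :
      SCob.obj α p m ⊗ SCob.obj α p m' ⟶ SCob.obj α p n ⊗ SCob.obj α p n') =
      ofSurface (α := α) (p := p) (m := m + m') (n := n + n') (Cob.sumSurface c d) := by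
  rw [MonoidalCategory.tensorHom_def]
  refine (congrArg₂ (· ≫ ·) (ofSurface_whiskerRight m' c) (whiskerLeft_ofSurface n d)).trans ?_
  exact (ofSurface_comp _ _).trans
    (congrArg TensorIdeal.Quot.cls (congrArg Linearization.lin (Cob.ofSurface_sumSurface c d)))

/-- Both sides are bilinear, and on monomials they are unions of cylinders with handles. A disjoint
union of such unions is again one, for the block permutation and the product monomial. -/
theorem skewMap_tower {i j : ℕ} (a : SkewSym p i) (b : SkewSym p j) :
    (skewMap α p (i + j) ((SkewSym.tower p).φ rfl a b) :
      SCob.obj α p i ⊗ SCob.obj α p j ⟶ SCob.obj α p i ⊗ SCob.obj α p j) =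
      skewMap α p i a ⊗ₘ skewMap α p j b := by
  induction a using skew_induction with
  | h0 =>
    rw [GrMod.φ_zero_left, map_zero, map_zero, MonoidalPreadditive.zero_tensor]
    rfl
  | hadd r s hr hs =>
    rw [Tower.add_left, map_add, map_add, MonoidalPreadditive.add_tensor, ← hr, ← hs]
    rfl
  | hsmul c r hr =>
    rw [SkewSym.tower_smul_left, map_smul, map_smul, MonoidalCategory.tensorHom_def,
      MonoidalLinear.smul_whiskerRight, Linear.smul_comp, ← MonoidalCategory.tensorHom_def, ← hr]
    rfl
  | hmono σ m =>
    induction b using skew_induction with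
    | h0 =>
      rw [GrMod.φ_zero_right, map_zero, map_zero, MonoidalPreadditive.tensor_zero]
      rfl
    | hadd r s hr hs =>
      rw [Tower.add_right, map_add, map_add, MonoidalPreadditive.tensor_add, ← hr, ← hs]
      rfl
    | hsmul c r hr =>
      rw [SkewSym.tower_smul_right, map_smul, map_smul, MonoidalCategory.tensorHom_def,
        MonoidalLinear.whiskerLeft_smul, Linear.comp_smul, ← MonoidalCategory.tensorHom_def, ← hr]
      rfl
    | hmono τ m' =>
      rw [SkewSym.tower_single]
      erw [SkewSym.via_mul_via, TruncPoly.map_mono_mul]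
      have h₁ := skewHom_single α p
        ((finSumFinEquiv.symm.trans (Equiv.sumCongr σ τ)).trans finSumFinEquiv)
        (Sum.elim m m' ∘ finSumFinEquiv.symm)
      have h₂ := ofSurface_tensor α p (twist σ m) (twist τ m')
      have h₃ := ofSurface_eq (α := α) (p := p)
        (((disj_twist σ m τ m').relabel finSumFinEquiv.symm finSumFinEquiv.symm).trans
          (relabel_twist _ _ _ _))
      have h₄ : skewMap α p i (SkewSym.single σ (TruncPoly.mono p m)) = ofSurface (twist σ m) :=
        skewHom_single α p σ m
      have h₅ : skewMap α p j (SkewSym.single τ (TruncPoly.mono p m')) = ofSurface (twist τ m') :=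
        skewHom_single α p τ m'
      rw [h₄, h₅]
      exact h₁.trans (h₃.symm.trans h₂.symm)

/-- Renumbering the circles. -/
noncomputable def cast {m n : ℕ} (h : m = n) : SCob.obj α p m ⟶ SCob.obj α p n :=
  ofSurface (twist (finCongr h) fun _ => 0)

theorem cast_comp {l m n : ℕ} (h : l = m) (h' : m = n) :
    cast α p h ≫ cast α p h' = cast α p (h.trans h') := by
  subst h h'
  exact Category.comp_id _

theorem associator_hom (a b c : ℕ) :
    (α_ (SCob.obj α p a) (SCob.obj α p b) (SCob.obj α p c)).hom = cast α p (add_assoc a b c) :=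
  congrArg TensorIdeal.Quot.cls (congrArg Linearization.lin (Cob.associator_hom a b c))

theorem leftUnitor_hom (a : ℕ) :
    (λ_ (SCob.obj α p a)).hom = cast α p (zero_add a) :=
  congrArg TensorIdeal.Quot.cls (congrArg Linearization.lin (Cob.leftUnitor_hom a))

theorem rightUnitor_hom (a : ℕ) :
    (ρ_ (SCob.obj α p a)).hom = cast α p (add_zero a) :=
  congrArg TensorIdeal.Quot.cls (congrArg Linearization.lin (Cob.rightUnitor_hom a))

/-- `[n] ≅ [i] ⊗ [j]` for `i + j = n`. -/
noncomputable def split {i j n : ℕ} (h : i + j = n) :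
    SCob.obj α p n ≅ SCob.obj α p i ⊗ SCob.obj α p j where
  hom := cast α p h.symm
  inv := cast α p h
  hom_inv_id := cast_comp α p _ _
  inv_hom_id := cast_comp α p _ _

theorem split_natural {i j n : ℕ} (h : i + j = n) (a : SkewSym p i) (b : SkewSym p j) :
    skewMap α p n ((SkewSym.tower p).φ h a b) ≫ (split α p h).hom =
      (split α p h).hom ≫ (skewMap α p i a ⊗ₘ skewMap α p j b) := by
  subst h
  rw [← skewMap_tower]
  exact (Category.comp_id _).trans (Category.id_comp _).symm

theorem split_assoc {i j c l m n : ℕ} (h₁ : i + j = l) (h₂ : l + c = n) (h₃ : j + c = m)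
    (h₄ : i + m = n) :
    (split α p h₂).hom ≫ (split α p h₁).hom ▷ SCob.obj α p c ≫
        (α_ (SCob.obj α p i) (SCob.obj α p j) (SCob.obj α p c)).hom =
      (split α p h₄).hom ≫ SCob.obj α p i ◁ (split α p h₃).hom := by
  -- After the substitution the renumberings along `h₁`, `h₂` and `h₃` are identities. What remains
  -- is that the associator is the renumbering along `h₄`.
  subst h₁ h₂ h₃
  refine Eq.trans (b := (α_ (SCob.obj α p i) (SCob.obj α p j) (SCob.obj α p c)).hom) ?_
    (Eq.trans (b := (split α p h₄).hom) ?_ ?_)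
  · refine (Category.id_comp _).trans ?_
    refine Eq.trans (congrArg (· ≫ _) (MonoidalCategory.id_whiskerRight _ _)) (Category.id_comp _)
  · exact associator_hom α p i j c
  · exact ((congrArg (_ ≫ ·) (MonoidalCategory.whiskerLeft_id _ _)).trans (Category.comp_id _)).symm

theorem split_leftUnitor (n : ℕ) :
    (split α p (zero_add n)).hom ≫ (λ_ (SCob.obj α p n)).hom = 𝟙 _ := by
  rw [leftUnitor_hom]
  exact cast_comp α p _ _

theorem split_rightUnitor (n : ℕ) :
    (split α p (add_zero n)).hom ≫ (ρ_ (SCob.obj α p n)).hom = 𝟙 _ := by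
  rw [rightUnitor_hom]
  exact cast_comp α p _ _

end SCob

end KhovanovSazdanovic

/-! ### The embeddings into the additive and idempotent completions are monoidal -/

namespace KhovanovSazdanovic

section Completion

variable {C : Type u} [Category.{v} C]

namespace Mat

variable [Preadditive C]

/-- The tuples in the image of the embedding, and their tensor products, have length one. With this,
each identity between matrices becomes an identity between single morphisms of the original
category. -/
theorem comp_entry {M N K : Mat_ C} (f : M ⟶ N) (g : N ⟶ K) (l : N.ι) (h : ∀ l', l' = l) (i : M.ι)
    (j : K.ι) : (f ≫ g) i j = f i l ≫ g l j := by
  rw [Mat_.comp_apply]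
  exact Fintype.sum_eq_single l fun l' hl => (hl (h l')).elim

theorem id_entry (X : C) (i j : PUnit) :
    (𝟙 ((Mat_.embedding C).obj X) : (Mat_.embedding C).obj X ⟶ _) i j = 𝟙 X :=
  Mat_.id_apply_self ((Mat_.embedding C).obj X) PUnit.unit

variable [MonoidalCategory C] [MonoidalPreadditive C]

/-- The tensorator of the embedding in the additive envelope. -/
def embeddingμ (X Y : C) :
    (Mat_.embedding C).obj X ⊗ (Mat_.embedding C).obj Y ≅ (Mat_.embedding C).obj (X ⊗ Y) where
  hom := fun _ _ => 𝟙 (X ⊗ Y)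
  inv := fun _ _ => 𝟙 (X ⊗ Y)
  hom_inv_id := by
    ext i j
    refine (comp_entry _ _ PUnit.unit (fun _ => rfl) i j).trans ?_
    exact (Category.comp_id _).trans (Mat_.id_apply_self (tObj ((Mat_.embedding C).obj X)
      ((Mat_.embedding C).obj Y)) (PUnit.unit, PUnit.unit)).symm
  inv_hom_id := by
    ext i j
    refine (comp_entry _ _ (PUnit.unit, PUnit.unit) (fun _ => rfl) i j).trans ?_
    exact (Category.comp_id _).trans (id_entry (X ⊗ Y) i j).symm

theorem associator_entry (X Y Z : C) (i j) : (α_ ((Mat_.embedding C).obj X)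
    ((Mat_.embedding C).obj Y) ((Mat_.embedding C).obj Z)).hom i j = (α_ X Y Z).hom :=
  mono_self (M := tObj (tObj ((Mat_.embedding C).obj X) ((Mat_.embedding C).obj Y))
    ((Mat_.embedding C).obj Z)) (N := tObj ((Mat_.embedding C).obj X)
      (tObj ((Mat_.embedding C).obj Y) ((Mat_.embedding C).obj Z)))
    (fun i => (i.1.1, (i.1.2, i.2))) (fun _ => (α_ X Y Z).hom) i

/-- The embedding in the additive envelope is monoidal. -/
noncomputable def embeddingCore : (Mat_.embedding C).CoreMonoidal where
  εIso := Iso.refl _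
  μIso := embeddingμ
  μIso_hom_natural_left {X Y} f Z := by
    ext i j
    refine (comp_entry _ _ (PUnit.unit, PUnit.unit) (fun _ => rfl) i j).trans
      (Eq.trans ?_ (comp_entry _ _ PUnit.unit (fun _ => rfl) i j).symm)
    refine (Category.comp_id _).trans (Eq.trans ?_ (Category.id_comp (f ▷ Z)).symm)
    exact (congrArg (f ⊗ₘ ·) (id_entry Z _ _)).trans (tensorHom_id _ _)
  μIso_hom_natural_right {X Y} Z f := by
    ext i j
    refine (comp_entry _ _ (PUnit.unit, PUnit.unit) (fun _ => rfl) i j).trans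
      (Eq.trans ?_ (comp_entry _ _ PUnit.unit (fun _ => rfl) i j).symm)
    refine (Category.comp_id _).trans (Eq.trans ?_ (Category.id_comp (Z ◁ f)).symm)
    exact (congrArg (· ⊗ₘ f) (id_entry Z _ _)).trans (id_tensorHom _ _)
  associativity X Y Z := by
    ext i j
    refine (comp_entry _ _ (PUnit.unit, PUnit.unit) (fun _ => rfl) i j).trans
      (Eq.trans ?_ (comp_entry _ _ (PUnit.unit, (PUnit.unit, PUnit.unit)) (fun _ => rfl) i j).symm)
    refine (congrArg₂ (· ≫ ·) (congrArg (𝟙 (X ⊗ Y) ⊗ₘ ·) (id_entry Z _ _))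
      (comp_entry _ _ PUnit.unit (fun _ => rfl) _ j)).trans
      (Eq.trans ?_ (congrArg₂ (· ≫ ·) (associator_entry X Y Z _ _)
        ((comp_entry _ _ (PUnit.unit, PUnit.unit) (fun _ => rfl) _ j).trans
          (congrArg₂ (· ≫ ·) (congrArg (· ⊗ₘ 𝟙 (Y ⊗ Z)) (id_entry X _ _)) rfl))).symm)
    change (𝟙 (X ⊗ Y) ⊗ₘ 𝟙 Z) ≫ 𝟙 ((X ⊗ Y) ⊗ Z) ≫ (α_ X Y Z).hom =
      (α_ X Y Z).hom ≫ (𝟙 X ⊗ₘ 𝟙 (Y ⊗ Z)) ≫ 𝟙 (X ⊗ Y ⊗ Z)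
    simp
  left_unitality X := by
    ext i j
    refine Eq.trans ?_ (comp_entry _ _ (PUnit.unit, PUnit.unit) (fun _ => rfl) i j).symm
    refine (mono_self (M := tObj (tUnit C) ((Mat_.embedding C).obj X))
      (N := (Mat_.embedding C).obj X) (fun i => i.2) (fun _ => (λ_ X).hom) i).trans
      (Eq.trans ?_ (congrArg₂ (· ≫ ·) (congrArg₂ (· ⊗ₘ ·) (id_entry (𝟙_ C) _ _) (id_entry X _ _))
        (comp_entry _ _ PUnit.unit (fun _ => rfl) _ j)).symm)
    change (λ_ X).hom = (𝟙 (𝟙_ C) ⊗ₘ 𝟙 X) ≫ 𝟙 (𝟙_ C ⊗ X) ≫ (λ_ X).hom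
    simp
  right_unitality X := by
    ext i j
    refine Eq.trans ?_ (comp_entry _ _ (PUnit.unit, PUnit.unit) (fun _ => rfl) i j).symm
    refine (mono_self (M := tObj ((Mat_.embedding C).obj X) (tUnit C))
      (N := (Mat_.embedding C).obj X) (fun i => i.1) (fun _ => (ρ_ X).hom) i).trans
      (Eq.trans ?_ (congrArg₂ (· ≫ ·) (congrArg₂ (· ⊗ₘ ·) (id_entry X _ _) (id_entry (𝟙_ C) _ _))
        (comp_entry _ _ PUnit.unit (fun _ => rfl) _ j)).symm)
    change (ρ_ X).hom = (𝟙 X ⊗ₘ 𝟙 (𝟙_ C)) ≫ 𝟙 (X ⊗ 𝟙_ C) ≫ (ρ_ X).hom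
    simp

noncomputable instance : (Mat_.embedding C).Monoidal := embeddingCore.toMonoidal

end Mat

namespace Kar

open Idempotents

variable [MonoidalCategory C]

/-- The embedding in the idempotent completion is monoidal. -/
def toKaroubiCore : (toKaroubi C).CoreMonoidal where
  εIso := Iso.refl _
  μIso X Y := isoOf (P := tObj ((toKaroubi C).obj X) ((toKaroubi C).obj Y))
    (Q := (toKaroubi C).obj (X ⊗ Y)) (Iso.refl _) (by
      change (𝟙 X ⊗ₘ 𝟙 Y) ≫ 𝟙 (X ⊗ Y) = 𝟙 (X ⊗ Y) ≫ 𝟙 (X ⊗ Y)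
      simp)
  μIso_hom_natural_left {X Y} f Z := by
    ext
    change (f ⊗ₘ 𝟙 Z) ≫ (𝟙 Y ⊗ₘ 𝟙 Z) ≫ 𝟙 (Y ⊗ Z) = ((𝟙 X ⊗ₘ 𝟙 Z) ≫ 𝟙 (X ⊗ Z)) ≫ (f ▷ Z)
    simp
  μIso_hom_natural_right {X Y} Z f := by
    ext
    change (𝟙 Z ⊗ₘ f) ≫ (𝟙 Z ⊗ₘ 𝟙 Y) ≫ 𝟙 (Z ⊗ Y) = ((𝟙 Z ⊗ₘ 𝟙 X) ≫ 𝟙 (Z ⊗ X)) ≫ (Z ◁ f)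
    simp
  associativity X Y Z := by
    ext
    change (((𝟙 X ⊗ₘ 𝟙 Y) ≫ 𝟙 (X ⊗ Y)) ⊗ₘ 𝟙 Z) ≫ ((𝟙 (X ⊗ Y) ⊗ₘ 𝟙 Z) ≫ 𝟙 ((X ⊗ Y) ⊗ Z)) ≫
      (α_ X Y Z).hom = (((𝟙 X ⊗ₘ 𝟙 Y) ⊗ₘ 𝟙 Z) ≫ (α_ X Y Z).hom) ≫
        (𝟙 X ⊗ₘ ((𝟙 Y ⊗ₘ 𝟙 Z) ≫ 𝟙 (Y ⊗ Z))) ≫ ((𝟙 X ⊗ₘ 𝟙 (Y ⊗ Z)) ≫ 𝟙 (X ⊗ Y ⊗ Z))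
    simp
  left_unitality X := by
    ext
    change (𝟙 (𝟙_ C) ⊗ₘ 𝟙 X) ≫ (λ_ X).hom = (𝟙 (𝟙_ C) ⊗ₘ 𝟙 X) ≫ ((𝟙 (𝟙_ C) ⊗ₘ 𝟙 X) ≫
      𝟙 (𝟙_ C ⊗ X)) ≫ (λ_ X).hom
    simp
  right_unitality X := by
    ext
    change (𝟙 X ⊗ₘ 𝟙 (𝟙_ C)) ≫ (ρ_ X).hom = (𝟙 X ⊗ₘ 𝟙 (𝟙_ C)) ≫ ((𝟙 X ⊗ₘ 𝟙 (𝟙_ C)) ≫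
      𝟙 (X ⊗ 𝟙_ C)) ≫ (ρ_ X).hom
    simp

instance : (toKaroubi C).Monoidal := toKaroubiCore.toMonoidal

end Kar

end Completion

end KhovanovSazdanovic

/-! ### Negligible morphisms, models of a filtration, and their modules -/

namespace KhovanovSazdanovic

namespace Filtration

section Negl

variable {C : Type w} [Category.{v} C] [Preadditive C] [HasFiniteBiproducts C]
  [MonoidalCategory C] (F : Filtration C)

/-- The morphisms that factor through an object of the previous step of the filtration. -/
def negl (n : ℕ) (X Y : C) : AddSubgroup (X ⟶ Y) where
  carrier := {f | ∃ (Z : C) (a : X ⟶ Z) (b : Z ⟶ Y), F.lower n Z ∧ a ≫ b = f}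
  zero_mem' := by
    have : HasZeroObject C := hasZeroObject_of_hasFiniteBiproducts C
    exact ⟨_, 0, 0, F.lower_zero (isZero_zero C), Limits.comp_zero⟩
  add_mem' := by
    rintro f g ⟨Z, a, b, hZ, rfl⟩ ⟨Z', a', b', hZ', rfl⟩
    have : HasBinaryBiproducts C := hasBinaryBiproducts_of_finite_biproducts C
    exact ⟨Z ⊞ Z', biprod.lift a a', biprod.desc b b',
      F.lower_sum (isDirectSum_biprod _ _) hZ hZ', biprod.lift_desc⟩
  neg_mem' := by
    rintro f ⟨Z, a, b, hZ, rfl⟩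
    exact ⟨Z, -a, b, hZ, Preadditive.neg_comp _ _⟩

variable {F} {n : ℕ} {X Y Z : C}

theorem negl_comp {f : X ⟶ Y} (hf : f ∈ F.negl n X Y) (g : Y ⟶ Z) : f ≫ g ∈ F.negl n X Z := by
  obtain ⟨W, a, b, hW, rfl⟩ := hf
  exact ⟨W, a, b ≫ g, hW, (Category.assoc _ _ _).symm⟩

theorem comp_negl (f : X ⟶ Y) {g : Y ⟶ Z} (hg : g ∈ F.negl n Y Z) : f ≫ g ∈ F.negl n X Z := by
  obtain ⟨W, a, b, hW, rfl⟩ := hg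
  exact ⟨W, f ≫ a, b, hW, Category.assoc _ _ _⟩

theorem mem_negl_of_lower (hY : F.lower n Y) (f : X ⟶ Y) (g : Y ⟶ Z) : f ≫ g ∈ F.negl n X Z :=
  ⟨Y, f, g, hY, rfl⟩

/-- A factorization of the identity exhibits X as a retract of a lower object, and the lower steps
are closed under retracts. -/
theorem id_mem_negl_iff : 𝟙 X ∈ F.negl n X X ↔ F.lower n X :=
  ⟨fun ⟨_, a, b, hW, h⟩ => F.lower_retract ⟨a, b, h⟩ hW,
    fun h => ⟨X, 𝟙 X, 𝟙 X, h, Category.comp_id _⟩⟩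

variable [MonoidalPreadditive C]

/-- The middle object is W ⊗ Y with W lower, so only the source of the second factor has to lie in
its step of the filtration. -/
theorem negl_tensor {m n : ℕ} {X X' Y Y' : C} {f : X ⟶ X'} (hf : f ∈ F.negl m X X')
    (g : Y ⟶ Y') (hY : F.D n Y) : f ⊗ₘ g ∈ F.negl (m + n) (X ⊗ Y) (X' ⊗ Y') := by
  obtain ⟨W, a, b, hW, rfl⟩ := hf
  rw [MonoidalCategory.tensorHom_def]
  refine negl_comp ⟨W ⊗ Y, a ▷ Y, b ▷ Y, F.lower_tensor hW hY, ?_⟩ _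
  rw [← MonoidalCategory.comp_whiskerRight]

theorem tensor_negl {m n : ℕ} {X X' Y Y' : C} (f : X ⟶ X') {g : Y ⟶ Y'}
    (hg : g ∈ F.negl n Y Y') (hX : F.D m X') : f ⊗ₘ g ∈ F.negl (m + n) (X ⊗ Y) (X' ⊗ Y') := by
  obtain ⟨W, a, b, hW, rfl⟩ := hg
  rw [MonoidalCategory.tensorHom_def]
  refine comp_negl _ ⟨X' ⊗ W, X' ◁ a, X' ◁ b, F.tensor_lower hX hW, ?_⟩
  rw [← MonoidalCategory.whiskerLeft_comp]

end Negl

section Model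

variable {C : Type w} [Category.{v} C] [Preadditive C] [HasFiniteBiproducts C]
  [MonoidalCategory C] {A : ℕ → Type u} [∀ n, Ring (A n)]

/-- Objects `G n` such that the step `D n` of a filtration is generated, up to lower steps, by `G n`
and such that the endomorphisms of `G n` are, up to lower steps, the rings of a tower. -/
structure Model (F : Filtration C) (T : Tower A) where
  G : ℕ → C
  G_mem (n : ℕ) : F.D n (G n)
  -- `ρ` is a genuine ring homomorphism, not only one modulo negligible morphisms, and `Λ` is the
  -- quotient map that it splits. The splitting allows idempotents and isomorphisms over A n to be
  -- lifted to the category itself. Products are in the order of `End`.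
  ρ (n : ℕ) : A n →+ (G n ⟶ G n)
  ρ_one (n : ℕ) : ρ n 1 = 𝟙 (G n)
  ρ_mul {n : ℕ} (a b : A n) : ρ n (a * b) = ρ n b ≫ ρ n a
  Λ (n : ℕ) : (G n ⟶ G n) →+ A n
  Λ_ρ {n : ℕ} (a : A n) : Λ n (ρ n a) = a
  Λ_negl {n : ℕ} {f : G n ⟶ G n} : f ∈ F.negl n (G n) (G n) → Λ n f = 0
  sub_mem {n : ℕ} (f : G n ⟶ G n) : f - ρ n (Λ n f) ∈ F.negl n (G n) (G n)
  -- A dual basis modulo negligible morphisms: up to lower steps, X is a direct summand of a power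
  -- of G n.
  exists_dual {n : ℕ} {X : C} : F.D n X → ∃ (r : ℕ) (a : Fin r → (X ⟶ G n)) (b : Fin r → (G n ⟶ X)),
    𝟙 X - ∑ s, a s ≫ b s ∈ F.negl n X X
  exhaust (X : C) : ∃ n, F.D n X
  ν {i j n : ℕ} (h : i + j = n) : G n ≅ G i ⊗ G j
  ν_natural {i j n : ℕ} (h : i + j = n) (a : A i) (b : A j) :
    ρ n (T.φ h a b) ≫ (ν h).hom = (ν h).hom ≫ (ρ i a ⊗ₘ ρ j b)
  ν_assoc {i j c l m n : ℕ} (h₁ : i + j = l) (h₂ : l + c = n) (h₃ : j + c = m) (h₄ : i + m = n) :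
    (ν h₂).hom ≫ (ν h₁).hom ▷ G c ≫ (α_ (G i) (G j) (G c)).hom =
      (ν h₄).hom ≫ G i ◁ (ν h₃).hom
  η : G 0 ≅ 𝟙_ C
  ν_left (n : ℕ) : (ν (zero_add n)).hom ≫ η.hom ▷ G n ≫ (λ_ (G n)).hom = 𝟙 (G n)
  ν_right (n : ℕ) : (ν (add_zero n)).hom ≫ G n ◁ η.hom ≫ (ρ_ (G n)).hom = 𝟙 (G n)

namespace Model

variable {F : Filtration C} {T : Tower A} (M : F.Model T) {n : ℕ}

theorem Λ_eq_of_sub_mem {f g : M.G n ⟶ M.G n} (h : f - g ∈ F.negl n (M.G n) (M.G n)) :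
    M.Λ n f = M.Λ n g := by
  rw [← sub_eq_zero, ← map_sub, M.Λ_negl h]

theorem Λ_id : M.Λ n (𝟙 _) = 1 := by rw [← M.ρ_one, M.Λ_ρ]

/-- Each endomorphism may be replaced by its lift `ρ (Λ f)`, from which it differs by a negligible
morphism, and on lifts multiplicativity is that of `ρ`. -/
theorem Λ_comp (f g : M.G n ⟶ M.G n) : M.Λ n (f ≫ g) = M.Λ n g * M.Λ n f := by
  rw [← M.Λ_ρ (M.Λ n g * M.Λ n f), M.ρ_mul]
  refine M.Λ_eq_of_sub_mem ?_
  have h : f ≫ g - M.ρ n (M.Λ n f) ≫ M.ρ n (M.Λ n g) =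
      (f - M.ρ n (M.Λ n f)) ≫ g + M.ρ n (M.Λ n f) ≫ (g - M.ρ n (M.Λ n g)) := by
    rw [Preadditive.sub_comp, Preadditive.comp_sub, sub_add_sub_cancel]
  rw [h]
  exact add_mem (negl_comp (M.sub_mem f) g) (comp_negl _ (M.sub_mem g))

/-- The morphisms from `G n` up to lower steps. -/
def Quo (n : ℕ) (X : C) : Type v := (M.G n ⟶ X) ⧸ F.negl n (M.G n) X

instance (n : ℕ) (X : C) : AddCommGroup (M.Quo n X) :=
  inferInstanceAs (AddCommGroup ((M.G n ⟶ X) ⧸ F.negl n (M.G n) X))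

/-- The quotient map. -/
def toQuo (n : ℕ) (X : C) : (M.G n ⟶ X) →+ M.Quo n X := QuotientAddGroup.mk' _

theorem toQuo_surjective (X : C) : Function.Surjective (M.toQuo n X) :=
  QuotientAddGroup.mk'_surjective _

theorem toQuo_eq_zero {X : C} {g : M.G n ⟶ X} : M.toQuo n X g = 0 ↔ g ∈ F.negl n (M.G n) X :=
  QuotientAddGroup.eq_zero_iff _

theorem toQuo_eq {X : C} {g g' : M.G n ⟶ X} (h : g - g' ∈ F.negl n (M.G n) X) :
    M.toQuo n X g = M.toQuo n X g' := by
  rw [← sub_eq_zero, ← map_sub, M.toQuo_eq_zero]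
  exact h

/-- The action by composition. -/
def actQuo (n : ℕ) (X : C) (f : M.G n ⟶ M.G n) : M.Quo n X →+ M.Quo n X :=
  QuotientAddGroup.map _ _ (Preadditive.leftComp X f) fun _ hg => comp_negl f hg

theorem actQuo_mk {X : C} (f : M.G n ⟶ M.G n) (g : M.G n ⟶ X) :
    M.actQuo n X f (M.toQuo n X g) = M.toQuo n X (f ≫ g) := rfl

/-- Precomposition is a right action. It is written as a left action of the opposite ring, in
accordance with `Tower.op`. -/
instance (n : ℕ) (X : C) : Module (A n)ᵐᵒᵖ (M.Quo n X) where
  smul a := M.actQuo n X (M.ρ n a.unop)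
  one_smul x := by
    obtain ⟨g, rfl⟩ := M.toQuo_surjective X x
    refine (M.actQuo_mk _ g).trans ?_
    rw [MulOpposite.unop_one, M.ρ_one, Category.id_comp]
  mul_smul a b x := by
    obtain ⟨g, rfl⟩ := M.toQuo_surjective X x
    refine (M.actQuo_mk _ g).trans ?_
    rw [MulOpposite.unop_mul, M.ρ_mul, Category.assoc]
    rfl
  smul_zero a := map_zero _
  smul_add a := map_add _
  add_smul a b x := by
    obtain ⟨g, rfl⟩ := M.toQuo_surjective X x
    refine (M.actQuo_mk _ g).trans ?_
    rw [MulOpposite.unop_add, map_add, Preadditive.add_comp, map_add]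
    rfl
  zero_smul x := by
    obtain ⟨g, rfl⟩ := M.toQuo_surjective X x
    refine (M.actQuo_mk _ g).trans ?_
    rw [MulOpposite.unop_zero, map_zero, Limits.zero_comp, map_zero]

theorem smul_toQuo {X : C} (a : (A n)ᵐᵒᵖ) (g : M.G n ⟶ X) :
    a • M.toQuo n X g = M.toQuo n X (M.ρ n a.unop ≫ g) := rfl

theorem toQuo_comp {X : C} (f : M.G n ⟶ M.G n) (g : M.G n ⟶ X) :
    M.toQuo n X (f ≫ g) = MulOpposite.op (M.Λ n f) • M.toQuo n X g := by
  rw [smul_toQuo]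
  refine M.toQuo_eq ?_
  rw [← Preadditive.sub_comp]
  exact negl_comp (M.sub_mem f) g

/-- Composing `g` with the dual basis relation expresses it through the `b s`, and each coefficient
g ≫ a s may be replaced by its value under `Λ`. -/
theorem toQuo_sum {X : C} {ι : Type*} [Fintype ι] {a : ι → (X ⟶ M.G n)} {b : ι → (M.G n ⟶ X)}
    (h : 𝟙 X - ∑ s, a s ≫ b s ∈ F.negl n X X) (g : M.G n ⟶ X) :
    M.toQuo n X g = ∑ s, MulOpposite.op (M.Λ n (g ≫ a s)) • M.toQuo n X (b s) := by
  simp only [← toQuo_comp]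
  rw [← map_sum]
  refine M.toQuo_eq ?_
  simp only [Category.assoc]
  rw [← Preadditive.comp_sum, ← Category.comp_id g, Category.assoc, Category.id_comp,
    ← Preadditive.comp_sub]
  exact comp_negl g h

/-- Additive maps from the quotient. -/
def quoDesc {X : C} {B : Type*} [AddCommGroup B] (f : (M.G n ⟶ X) →+ B)
    (hf : ∀ g ∈ F.negl n (M.G n) X, f g = 0) : M.Quo n X →+ B :=
  QuotientAddGroup.lift _ f fun g hg => hf g hg

/-- The morphisms of C live in another universe than the rings. A dual basis shows that the quotient
is a finitely generated module, hence an image of a finite power of A n, so it can be transported to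
the universe of the rings. -/
theorem small_quo {X : C} (hX : F.D n X) : Small.{u} (M.Quo n X) := by
  obtain ⟨r, a, b, h⟩ := M.exists_dual hX
  refine small_of_surjective (α := Fin r → A n)
    (f := fun c => ∑ s, MulOpposite.op (c s) • M.toQuo n X (b s)) fun x => ?_
  obtain ⟨g, rfl⟩ := M.toQuo_surjective X x
  exact ⟨fun s => M.Λ n (g ≫ a s), (M.toQuo_sum h g).symm⟩

/-- The module of an object of `D n`. -/
def H {X : C} (hX : F.D n X) : Type u :=
  have := M.small_quo hX
  Shrink.{u} (M.Quo n X)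

section
variable {X : C} (hX : F.D n X)

noncomputable instance : AddCommGroup (M.H hX) :=
  have := M.small_quo hX
  inferInstanceAs (AddCommGroup (Shrink.{u} (M.Quo n X)))

noncomputable instance : Module (A n)ᵐᵒᵖ (M.H hX) :=
  have := M.small_quo hX
  inferInstanceAs (Module (A n)ᵐᵒᵖ (Shrink.{u} (M.Quo n X)))

/-- The comparison of the two models of the module of an object. -/
noncomputable def quoEquiv : M.H hX ≃ₗ[(A n)ᵐᵒᵖ] M.Quo n X :=
  have := M.small_quo hX
  Shrink.linearEquiv (A n)ᵐᵒᵖ (M.Quo n X)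

/-- The class of a morphism. -/
noncomputable def toH : (M.G n ⟶ X) →+ M.H hX :=
  ((M.quoEquiv hX).symm : _ →+ _).comp (M.toQuo n X)

theorem toH_surjective : Function.Surjective (M.toH hX) :=
  (M.quoEquiv hX).symm.surjective.comp (M.toQuo_surjective X)

theorem toH_eq_zero {g : M.G n ⟶ X} : M.toH hX g = 0 ↔ g ∈ F.negl n (M.G n) X :=
  (LinearEquiv.map_eq_zero_iff (M.quoEquiv hX).symm).trans M.toQuo_eq_zero

theorem toH_eq {g g' : M.G n ⟶ X} (h : g - g' ∈ F.negl n (M.G n) X) : M.toH hX g = M.toH hX g' := by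
  rw [← sub_eq_zero, ← map_sub, M.toH_eq_zero]
  exact h

theorem smul_toH (a : (A n)ᵐᵒᵖ) (g : M.G n ⟶ X) : a • M.toH hX g = M.toH hX (M.ρ n a.unop ≫ g) :=
  ((M.quoEquiv hX).symm.map_smul a (M.toQuo n X g)).symm

theorem toH_comp (f : M.G n ⟶ M.G n) (g : M.G n ⟶ X) :
    M.toH hX (f ≫ g) = MulOpposite.op (M.Λ n f) • M.toH hX g := by
  rw [smul_toH]
  refine M.toH_eq hX ?_
  rw [← Preadditive.sub_comp]
  exact negl_comp (M.sub_mem f) g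

theorem toH_sum {ι : Type*} [Fintype ι] {a : ι → (X ⟶ M.G n)} {b : ι → (M.G n ⟶ X)}
    (h : 𝟙 X - ∑ s, a s ≫ b s ∈ F.negl n X X) (g : M.G n ⟶ X) :
    ∑ s, MulOpposite.op (M.Λ n (g ≫ a s)) • M.toH hX (b s) = M.toH hX g := by
  have := congrArg (M.quoEquiv hX).symm (M.toQuo_sum h g)
  rw [map_sum] at this
  simp only [map_smul] at this
  exact this.symm

variable {hX}

/-- Linear maps from the module of an object. -/
noncomputable def desc {B : Type*} [AddCommGroup B] [Module (A n)ᵐᵒᵖ B] (f : (M.G n ⟶ X) →+ B)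
    (hf : ∀ g ∈ F.negl n (M.G n) X, f g = 0)
    (hs : ∀ (a : A n) g, f (M.ρ n a ≫ g) = MulOpposite.op a • f g) : M.H hX →ₗ[(A n)ᵐᵒᵖ] B where
  toFun x := M.quoDesc f hf (M.quoEquiv hX x)
  map_add' x y := by rw [map_add, map_add]
  map_smul' a x := by
    rw [map_smul]
    obtain ⟨g, hg⟩ := M.toQuo_surjective X (M.quoEquiv hX x)
    rw [← hg]
    exact hs a.unop g

theorem desc_toH {B : Type*} [AddCommGroup B] [Module (A n)ᵐᵒᵖ B] (f : (M.G n ⟶ X) →+ B)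
    (hf : ∀ g ∈ F.negl n (M.G n) X, f g = 0)
    (hs : ∀ (a : A n) g, f (M.ρ n a ≫ g) = MulOpposite.op a • f g) (g : M.G n ⟶ X) :
    M.desc (hX := hX) f hf hs (M.toH hX g) = f g :=
  congrArg (M.quoDesc f hf) ((M.quoEquiv hX).apply_symm_apply (M.toQuo n X g))

variable (hX)

/-- The functional given by a morphism to `G n`. -/
noncomputable def coord (a : X ⟶ M.G n) : M.H hX →ₗ[(A n)ᵐᵒᵖ] (A n)ᵐᵒᵖ :=
  M.desc (MulOpposite.opAddEquiv.toAddMonoidHom.comp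
      ((M.Λ n).comp (Preadditive.rightComp (M.G n) a)))
    (fun g hg => by
      change MulOpposite.op (M.Λ n (g ≫ a)) = 0
      rw [M.Λ_negl (negl_comp hg a), MulOpposite.op_zero])
    (fun b g => by
      change MulOpposite.op (M.Λ n ((M.ρ n b ≫ g) ≫ a)) =
        MulOpposite.op b * MulOpposite.op (M.Λ n (g ≫ a))
      rw [Category.assoc, M.Λ_comp, M.Λ_ρ, MulOpposite.op_mul])

theorem coord_toH (a : X ⟶ M.G n) (g : M.G n ⟶ X) :
    M.coord hX a (M.toH hX g) = MulOpposite.op (M.Λ n (g ≫ a)) :=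
  M.desc_toH _ _ _ g

/-- The dual basis modulo negligible morphisms becomes an honest dual basis of the module, and so
the module is finitely generated projective. -/
theorem coord_sum {ι : Type*} [Fintype ι] {a : ι → (X ⟶ M.G n)} {b : ι → (M.G n ⟶ X)}
    (h : 𝟙 X - ∑ s, a s ≫ b s ∈ F.negl n X X) (x : M.H hX) :
    ∑ s, M.coord hX (a s) x • M.toH hX (b s) = x := by
  obtain ⟨g, rfl⟩ := M.toH_surjective hX x
  simp only [coord_toH]
  exact M.toH_sum hX h g

theorem finite_projective_H : Module.Finite (A n)ᵐᵒᵖ (M.H hX) ∧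
    Module.Projective (A n)ᵐᵒᵖ (M.H hX) := by
  obtain ⟨r, a, b, h⟩ := M.exists_dual hX
  refine finite_proj_of_dual (fun s => M.toH hX (b s)) (fun s => M.coord hX (a s)) fun x => ?_
  rw [finsum_eq_sum_of_fintype]
  exact M.coord_sum hX h x

/-- If the module vanishes, all the `b s` of a dual basis are negligible. Then so is the identity of
X, and X is lower. This handles the degrees in the theorem. -/
theorem subsingleton_H_iff : Subsingleton (M.H hX) ↔ F.lower n X := by
  constructor
  · intro hs
    obtain ⟨r, a, b, h⟩ := M.exists_dual hX
    rw [← id_mem_negl_iff, ← sub_add_cancel (𝟙 X) (∑ s, a s ≫ b s)]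
    exact add_mem h (sum_mem fun s _ => comp_negl _ ((M.toH_eq_zero hX).1 (Subsingleton.elim _ _)))
  · intro h
    refine subsingleton_of_forall_eq 0 fun x => ?_
    obtain ⟨g, rfl⟩ := M.toH_surjective hX x
    rw [M.toH_eq_zero, ← Category.comp_id g]
    exact mem_negl_of_lower h _ _

variable {Y : C} (hY : F.D n Y)

/-- The linear map given by a morphism. -/
noncomputable def mapH (f : X ⟶ Y) : M.H hX →ₗ[(A n)ᵐᵒᵖ] M.H hY :=
  M.desc ((M.toH hY).comp (Preadditive.rightComp (M.G n) f))
    (fun _ hg => (M.toH_eq_zero hY).2 (negl_comp hg f))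
    (fun a g => by
      change M.toH hY ((M.ρ n a ≫ g) ≫ f) = MulOpposite.op a • M.toH hY (g ≫ f)
      rw [smul_toH, Category.assoc, MulOpposite.unop_op])

theorem mapH_toH (f : X ⟶ Y) (g : M.G n ⟶ X) : M.mapH hX hY f (M.toH hX g) = M.toH hY (g ≫ f) :=
  M.desc_toH _ _ _ g

/-- Modulo negligible morphisms f is ∑ a s ≫ b s ≫ f, and b s ≫ f represents the image of a basis
element. If all these images vanish, f is negligible. This gives faithfulness. -/
theorem mapH_eq_zero_iff (f : X ⟶ Y) : M.mapH hX hY f = 0 ↔ f ∈ F.negl n X Y := by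
  constructor
  · intro hf
    obtain ⟨r, a, b, h⟩ := M.exists_dual hX
    have e : f = (𝟙 X - ∑ s, a s ≫ b s) ≫ f + ∑ s, a s ≫ b s ≫ f := by
      rw [Preadditive.sub_comp, Preadditive.sum_comp, Category.id_comp]
      simp
    rw [e]
    refine add_mem (negl_comp h f) (sum_mem fun s _ => comp_negl _ ?_)
    rw [← M.toH_eq_zero hY, ← M.mapH_toH hX hY, hf, LinearMap.zero_apply]
  · intro hf
    refine LinearMap.ext fun x => ?_
    obtain ⟨g, rfl⟩ := M.toH_surjective hX x
    rw [mapH_toH, LinearMap.zero_apply, M.toH_eq_zero]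
    exact comp_negl g hf

/-- A linear map is determined by the images of the classes of the `b s`. If the `y s` represent
these images, ∑ a s ≫ y s induces the map. This gives fullness. -/
theorem mapH_surjective : Function.Surjective (M.mapH hX hY) := by
  intro φ
  obtain ⟨r, a, b, h⟩ := M.exists_dual hX
  choose y hy using fun s => M.toH_surjective hY (φ (M.toH hX (b s)))
  refine ⟨∑ s, a s ≫ y s, LinearMap.ext fun x => ?_⟩
  obtain ⟨g, rfl⟩ := M.toH_surjective hX x
  rw [mapH_toH, Preadditive.comp_sum, map_sum]
  conv_rhs => rw [← M.toH_sum hX h g, map_sum]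
  refine Finset.sum_congr rfl fun s _ => ?_
  rw [← Category.assoc, toH_comp, hy, map_smul]

end

end Model

end Model

end Filtration

end KhovanovSazdanovic

/-! ### The functor from the associated graded category to sequences of modules -/

namespace KhovanovSazdanovic

namespace Filtration

namespace Model

section Functor

variable {k : Type u} [Field k] {C : Type w} [Category.{v} C] [Preadditive C]
  [HasFiniteBiproducts C] [MonoidalCategory C] [MonoidalPreadditive C] [Linear k C]
  {A : ℕ → Type u} [∀ n, Ring (A n)] {F : Filtration C} {T : Tower A} (M : F.Model T)

/-- The lower objects for the different degrees can be chosen independently, so membership in the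
ideal of sequences is a condition on each component. -/
theorem gr_cls_eq_iff {X Y : F.gr k} {f g : X.as ⟶ Y.as} :
    (TensorIdeal.Quot.cls f : X ⟶ Y) = TensorIdeal.Quot.cls g ↔
      ∀ n, f.hom n - g.hom n ∈ F.negl n (X.as.obj n) (Y.as.obj n) := by
  rw [TensorIdeal.Quot.cls_eq]
  constructor
  · rintro ⟨Z, a, b, hZ, h⟩ n
    exact ⟨Z n, a n, b n, hZ n, congrFun h n⟩
  · intro h
    choose Z a b hZ h using h
    exact ⟨Z, a, b, hZ, funext h⟩

theorem gr_D (X : F.gr k) (n : ℕ) : F.D n (X.as.obj n) := X.as.property.1 n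

/-- The sequence of modules of an object of the associated graded category. -/
noncomputable abbrev grObj (X : F.gr k) : GrMod T.op where
  M n := M.H (gr_D X n)

/-- The class of a morphism. -/
noncomputable def toGr (X : F.gr k) (n : ℕ) : (M.G n ⟶ X.as.obj n) →+ (M.grObj X).M n :=
  M.toH (gr_D X n)

theorem toGr_surjective (X : F.gr k) (n : ℕ) : Function.Surjective (M.toGr X n) :=
  M.toH_surjective _

theorem toGr_eq {X : F.gr k} {n : ℕ} {g g' : M.G n ⟶ X.as.obj n}
    (h : g - g' ∈ F.negl n (M.G n) (X.as.obj n)) : M.toGr X n g = M.toGr X n g' :=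
  M.toH_eq _ h

theorem smul_toGr {X : F.gr k} {n : ℕ} (a : (A n)ᵐᵒᵖ) (g : M.G n ⟶ X.as.obj n) :
    a • M.toGr X n g = M.toGr X n (M.ρ n a.unop ≫ g) :=
  M.smul_toH _ a g

/-- The linear maps given by a sequence of morphisms. -/
noncomputable def grMapAux {X Y : F.gr k} (f : X.as ⟶ Y.as) : M.grObj X ⟶ M.grObj Y :=
  fun n => M.mapH (gr_D X n) (gr_D Y n) (f.hom n)

theorem grMapAux_apply {X Y : F.gr k} (f : X.as ⟶ Y.as) (n : ℕ) (g : M.G n ⟶ X.as.obj n) :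
    M.grMapAux f n (M.toGr X n g) = M.toGr Y n (g ≫ f.hom n) :=
  M.mapH_toH _ _ _ _

/-- The linear maps given by a morphism of the associated graded category. -/
noncomputable def grMap {X Y : F.gr k} (f : X ⟶ Y) : M.grObj X ⟶ M.grObj Y :=
  Quotient.liftOn' f M.grMapAux fun f g h => by
    have h₁ := gr_cls_eq_iff.1 (Quotient.sound' h : (TensorIdeal.Quot.cls f : X ⟶ Y) = _)
    refine GrMod.hom_ext fun n x => ?_
    obtain ⟨x, rfl⟩ := M.toGr_surjective _ _ x
    rw [grMapAux_apply, grMapAux_apply]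
    refine M.toGr_eq ?_
    rw [← Preadditive.comp_sub]
    exact comp_negl x (h₁ n)

theorem grMap_cls {X Y : F.gr k} (f : X.as ⟶ Y.as) (n : ℕ) (g : M.G n ⟶ X.as.obj n) :
    M.grMap (TensorIdeal.Quot.cls f : X ⟶ Y) n (M.toGr X n g) =
      M.toGr Y n (g ≫ f.hom n) :=
  M.grMapAux_apply f n g

theorem gr_hom_ext {X : F.gr k} {N : GrMod T.op} {f g : M.grObj X ⟶ N}
    (h : ∀ n (x : M.G n ⟶ X.as.obj n),
      f n (M.toGr X n x) = g n (M.toGr X n x)) : f = g :=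
  GrMod.hom_ext fun n x => by
    obtain ⟨x, rfl⟩ := M.toGr_surjective _ _ x
    exact h n x

variable (k) in
/-- The functor to the sequences of modules. -/
noncomputable def toGrMod : F.gr k ⥤ GrMod T.op where
  obj := M.grObj
  map := M.grMap
  map_id X := M.gr_hom_ext fun n x => (M.grMap_cls (𝟙 X.as) n x).trans
    (congrArg _ (Category.comp_id x))
  map_comp {X Y Z} f g := by
    obtain ⟨f, rfl⟩ := TensorIdeal.Quot.cls_surj f
    obtain ⟨g, rfl⟩ := TensorIdeal.Quot.cls_surj g
    refine M.gr_hom_ext fun n x => ?_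
    refine (M.grMap_cls (f ≫ g) n x).trans ?_
    rw [GrMod.comp_apply, grMap_cls, grMap_cls]
    exact congrArg _ (Category.assoc _ _ _).symm

theorem proj_grObj (X : F.gr k) : GrMod.proj T.op (M.grObj X) := by
  refine ⟨fun n => M.finite_projective_H _, ?_⟩
  obtain ⟨N, hN⟩ := X.as.property.2
  exact ⟨N, fun n hn => (M.subsingleton_H_iff (gr_D X n)).2 (hN n hn)⟩

variable (k) in
/-- The functor to the sequences of finitely generated projective modules. -/
noncomputable def toProj : F.gr k ⥤ ProjMod T.op :=
  (GrMod.proj T.op).lift (M.toGrMod k) M.proj_grObj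

theorem toProj_map_hom {X Y : F.gr k} (f : X ⟶ Y) : ((M.toProj k).map f).hom = M.grMap f := rfl

instance : (M.toProj k).Faithful where
  map_injective {X Y} f g h := by
    obtain ⟨f, rfl⟩ := TensorIdeal.Quot.cls_surj f
    obtain ⟨g, rfl⟩ := TensorIdeal.Quot.cls_surj g
    refine gr_cls_eq_iff.2 fun n => ?_
    rw [← M.mapH_eq_zero_iff (gr_D X n) (gr_D Y n)]
    have h₁ : M.grMap (TensorIdeal.Quot.cls f : X ⟶ Y) = M.grMap (TensorIdeal.Quot.cls g) :=
      congrArg (fun φ : (M.toProj k).obj X ⟶ (M.toProj k).obj Y => φ.hom) h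
    refine LinearMap.ext fun x => ?_
    obtain ⟨x, rfl⟩ := M.toGr_surjective _ _ x
    have h₂ := LinearMap.congr_fun (congrFun h₁ n) (M.toGr X n x)
    rw [grMap_cls, grMap_cls] at h₂
    refine (M.mapH_toH _ _ _ _).trans ?_
    change M.toGr Y n _ = _
    rw [Preadditive.comp_sub, map_sub, h₂, sub_self, LinearMap.zero_apply]

instance : (M.toProj k).Full where
  map_surjective {X Y} φ := by
    choose f hf using fun n =>
      M.mapH_surjective (gr_D X n) (gr_D Y n) (φ.hom n)
    refine ⟨TensorIdeal.Quot.cls (ObjectProperty.homMk f), ObjectProperty.hom_ext _ ?_⟩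
    rw [toProj_map_hom]
    exact funext hf

instance : (M.toProj k).Additive where
  map_add {X Y f g} := by
    obtain ⟨f, rfl⟩ := TensorIdeal.Quot.cls_surj f
    obtain ⟨g, rfl⟩ := TensorIdeal.Quot.cls_surj g
    refine ObjectProperty.hom_ext _ (M.gr_hom_ext fun n x => ?_)
    rw [← TensorIdeal.Quot.cls_add]
    refine (M.grMap_cls _ n x).trans (Eq.trans ?_
      (congrArg₂ (· + ·) (M.grMap_cls f n x) (M.grMap_cls g n x)).symm)
    rw [← map_add, ← Preadditive.comp_add]
    rfl

theorem deg_iff (i : ℕ) (X : F.gr k) :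
    F.grDeg k i X ↔ ProjMod.deg T.op i ((M.toProj k).obj X) :=
  forall₂_congr fun n _ => (M.subsingleton_H_iff (gr_D X n)).symm

/-- On modules a scalar acts through A n, hence by precomposition with `ρ`, whereas on morphisms it
acts by the linear structure of C. The hypothesis `hM` identifies the two. -/
theorem toProj_linear [∀ n, Algebra k (A n)]
    (hM : ∀ n (r : k), M.ρ n (algebraMap k (A n) r) = r • 𝟙 (M.G n)) : (M.toProj k).Linear k where
  map_smul {X Y} f r := by
    obtain ⟨f, rfl⟩ := TensorIdeal.Quot.cls_surj f
    refine ObjectProperty.hom_ext _ (M.gr_hom_ext fun n x => ?_)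
    rw [← TensorIdeal.Quot.cls_smul]
    refine (M.grMap_cls _ n x).trans (Eq.trans ?_
      (congrArg (algebraMap k (A n)ᵐᵒᵖ r • ·) (M.grMap_cls f n x)).symm)
    rw [smul_toGr, MulOpposite.algebraMap_apply, MulOpposite.unop_op, hM, Linear.smul_comp,
      Category.id_comp, ← Linear.comp_smul]
    rfl

end Functor

end Model

end Filtration

end KhovanovSazdanovic

/-! ### The functor and the tensor product: dual bases of induced modules -/

namespace KhovanovSazdanovic

/-- A morphism with bijective components is an isomorphism. -/
noncomputable def GrMod.isoOfBijective {A : ℕ → Type u} [∀ n, Ring (A n)] {T : Tower A}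
    {X Y : GrMod T} (f : X ⟶ Y) (h : ∀ n, Function.Bijective (f n)) : X ≅ Y where
  hom := f
  inv n := (LinearEquiv.ofBijective (f n) (h n)).symm.toLinearMap
  hom_inv_id := GrMod.hom_ext fun n x => (LinearEquiv.ofBijective (f n) (h n)).symm_apply_apply x
  inv_hom_id := GrMod.hom_ext fun n x => (LinearEquiv.ofBijective (f n) (h n)).apply_symm_apply x

/-- The functionals `c` play the role of the products of the coordinates of the two factors, carried
over to L. Expanding an element of L in these coordinates and the tensors of basis elements defines
an inverse of μ: on generators it is the identity by the dual bases of the factors, and on L by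
`hμ`. -/
theorem GrMod.bijective_of_dual {A : ℕ → Type u} [∀ n, Ring (A n)] {T : Tower A} {X Y : GrMod T}
    {n : ℕ} {L : Type*} [AddCommGroup L] [Module (A n) L] (μ : Tens X Y n →ₗ[A n] L)
    {r r' : ℕ → ℕ} (x : ∀ i, Fin (r i) → X.M i) (f : ∀ i, Fin (r i) → X.M i → A i)
    (y : ∀ i, Fin (r' i) → Y.M i) (g : ∀ i, Fin (r' i) → Y.M i → A i)
    (hf : ∀ i m, ∑ s, f i s m • x i s = m) (hg : ∀ i m, ∑ s, g i s m • y i s = m)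
    (c : ∀ p : Finset.HasAntidiagonal.antidiagonal n,
      Fin (r p.1.1) × Fin (r' p.1.2) → (L →ₗ[A n] A n))
    (hp : ∀ p : Finset.HasAntidiagonal.antidiagonal n, p.1.1 + p.1.2 = n)
    (hc : ∀ p s m m', c p s (μ (tmul (hp p) m m')) = T.φ (hp p) (f _ s.1 m) (g _ s.2 m'))
    (hc' : ∀ (i j : ℕ) (h : i + j = n) (p s) (m : X.M i) (m' : Y.M j), i ≠ p.1.1 →
      c p s (μ (tmul h m m')) = 0)
    (hμ : ∀ l, ∑ p, ∑ s, c p s l • μ (tmul (hp p) (x _ s.1) (y _ s.2)) = l) :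
    Function.Bijective μ := by
  constructor
  · refine Function.LeftInverse.injective
      (g := fun l => ∑ p, ∑ s, c p s l • tmul (hp p) (x _ s.1) (y _ s.2)) fun t => ?_
    change ∑ p, ∑ s, c p s (μ t) • (tmul (hp p) (x _ s.1) (y _ s.2) : Tens X Y n) = t
    induction t using tens_induction with
    | h0 => simp only [map_zero, zero_smul, Finset.sum_const_zero]
    | hadd s t hs ht =>
      simp only [map_add, add_smul, Finset.sum_add_distrib]
      rw [hs, ht]
    | hmul i j h e m m' =>
      simp only [map_smul, smul_assoc]
      simp only [← Finset.smul_sum]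
      congr 1
      -- A generator of bidegree (i, j) has nonzero coordinates only in that bidegree, where the two
      -- dual bases recover its factors one after the other.
      rw [Finset.sum_eq_single ⟨(i, j), Finset.HasAntidiagonal.mem_antidiagonal.2 h⟩]
      · have e₁ := hc ⟨(i, j), Finset.HasAntidiagonal.mem_antidiagonal.2 h⟩
        simp only [e₁]
        simp only [← smul_tmul_smul]
        rw [Fintype.sum_prod_type]
        simp only [← tmul_sum, ← sum_tmul]
        rw [hf, hg]
      · rintro ⟨⟨i', j'⟩, hp'⟩ _ hne
        refine Finset.sum_eq_zero fun s _ => ?_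
        have hne' : i ≠ i' := by
          rintro rfl
          refine hne (Subtype.ext (Prod.ext rfl ?_))
          have := Finset.HasAntidiagonal.mem_antidiagonal.1 hp'
          change i + j' = n at this
          change j' = j
          omega
        rw [hc' i j h ⟨(i', j'), hp'⟩ s m m' hne', zero_smul]
      · intro h'
        exact (h' (Finset.mem_univ _)).elim
  · intro l
    refine ⟨∑ p, ∑ s, c p s l • tmul (hp p) (x _ s.1) (y _ s.2), ?_⟩
    simp only [map_sum, map_smul]
    exact hμ l

namespace Filtration

namespace Model

open GradedObject.Monoidal

section Monoidal

variable {k : Type u} [Field k] {C : Type w} [Category.{v} C] [Preadditive C]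
  [HasFiniteBiproducts C] [MonoidalCategory C] [MonoidalPreadditive C] [Linear k C]
  {A : ℕ → Type u} [∀ n, Ring (A n)] {F : Filtration C} {T : Tower A} (M : F.Model T)

theorem tensor_sub_mem {m n l : ℕ} (hl : m + n = l) {X X' Y Y' : C} (hX : F.D m X') (hY : F.D n Y)
    {f f' : X ⟶ X'} {g g' : Y ⟶ Y'} (hf : f - f' ∈ F.negl m X X') (hg : g - g' ∈ F.negl n Y Y') :
    (f ⊗ₘ g) - (f' ⊗ₘ g') ∈ F.negl l (X ⊗ Y) (X' ⊗ Y') := by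
  subst hl
  have h : (f ⊗ₘ g) - (f' ⊗ₘ g') = ((f - f') ⊗ₘ g) + (f' ⊗ₘ (g - g')) := by
    have h₁ : (f ⊗ₘ g) = ((f - f') ⊗ₘ g) + (f' ⊗ₘ g) := by
      rw [← MonoidalPreadditive.add_tensor, sub_add_cancel]
    have h₂ : (f' ⊗ₘ g) = (f' ⊗ₘ (g - g')) + (f' ⊗ₘ g') := by
      rw [← MonoidalPreadditive.tensor_add, sub_add_cancel]
    rw [h₁, h₂, ← add_assoc, add_sub_cancel_right]
  rw [h]
  exact add_mem (negl_tensor hf g hY) (tensor_negl f' hg hX)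

/-- For lifts f = ρ a and g = ρ b this is the naturality of `ν`. Passing to the lifts changes the
tensor product only by a negligible morphism. -/
theorem Λ_tensor {i j n : ℕ} (h : i + j = n) (f : M.G i ⟶ M.G i) (g : M.G j ⟶ M.G j) :
    M.Λ n ((M.ν h).hom ≫ (f ⊗ₘ g) ≫ (M.ν h).inv) = T.φ h (M.Λ i f) (M.Λ j g) := by
  have h₁ : M.ρ n (T.φ h (M.Λ i f) (M.Λ j g)) =
      (M.ν h).hom ≫ (M.ρ i (M.Λ i f) ⊗ₘ M.ρ j (M.Λ j g)) ≫ (M.ν h).inv := by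
    rw [← Category.assoc, ← M.ν_natural, Category.assoc, Iso.hom_inv_id, Category.comp_id]
  rw [← M.Λ_ρ (T.φ h (M.Λ i f) (M.Λ j g)), h₁]
  refine M.Λ_eq_of_sub_mem ?_
  rw [← Preadditive.comp_sub, ← Preadditive.sub_comp]
  exact comp_negl _ (negl_comp
    (tensor_sub_mem h (M.G_mem i) (M.G_mem j) (M.sub_mem f) (M.sub_mem g)) _)

/-- The inclusion of a summand of a tensor product. -/
noncomputable def inj (X Y : F.gr k) {i j n : ℕ} (h : i + j = n) :
    X.as.obj i ⊗ Y.as.obj j ⟶ (X ⊗ Y).as.obj n :=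
  ιTensorObj X.as.obj Y.as.obj i j n h

theorem inj_ext {X Y : F.gr k} {n : ℕ} {Z : C} {f g : (X ⊗ Y).as.obj n ⟶ Z}
    (H : ∀ (i j : ℕ) (h : i + j = n), inj X Y h ≫ f = inj X Y h ≫ g) : f = g :=
  tensorObj_ext (X₁ := X.as.obj) (X₂ := Y.as.obj) f g H

/-- The projection to a summand of a tensor product. -/
noncomputable def prj (X Y : F.gr k) {i j n : ℕ} (h : i + j = n) :
    (X ⊗ Y).as.obj n ⟶ X.as.obj i ⊗ Y.as.obj j :=
  tensorObjDesc (X₁ := X.as.obj) (X₂ := Y.as.obj) fun i' j' h' =>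
    if e : i' = i then
      eqToHom (by subst e; obtain rfl : j' = j := (by omega); rfl)
    else 0

theorem inj_prj_self (X Y : F.gr k) {i j n : ℕ} (h : i + j = n) :
    inj X Y h ≫ prj X Y h = 𝟙 _ := by
  refine (ι_tensorObjDesc (X₁ := X.as.obj) (X₂ := Y.as.obj) _ i j h).trans ?_
  rw [dif_pos rfl, eqToHom_refl]

theorem inj_prj_ne (X Y : F.gr k) {i j i' j' n : ℕ} (h : i + j = n) (h' : i' + j' = n)
    (hi : i ≠ i') : inj X Y h ≫ prj X Y h' = 0 := by
  refine (ι_tensorObjDesc (X₁ := X.as.obj) (X₂ := Y.as.obj) _ i j h).trans ?_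
  rw [dif_neg hi]

theorem antidiagonal_add {n : ℕ} (p : Finset.HasAntidiagonal.antidiagonal n) :
    p.1.1 + p.1.2 = n :=
  Finset.HasAntidiagonal.mem_antidiagonal.1 p.2

theorem sum_prj_inj (X Y : F.gr k) (n : ℕ) :
    ∑ p : Finset.HasAntidiagonal.antidiagonal n,
      prj X Y (antidiagonal_add p) ≫ inj X Y (antidiagonal_add p) = 𝟙 _ := by
  refine inj_ext fun i j h => ?_
  rw [Preadditive.comp_sum,
    Finset.sum_eq_single ⟨(i, j), Finset.HasAntidiagonal.mem_antidiagonal.2 h⟩]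
  · rw [← Category.assoc, inj_prj_self, Category.id_comp, Category.comp_id]
  · rintro ⟨⟨i', j'⟩, hp'⟩ _ hne
    have hne' : i ≠ i' := by
      rintro rfl
      refine hne (Subtype.ext (Prod.ext rfl ?_))
      have := Finset.HasAntidiagonal.mem_antidiagonal.1 hp'
      change i + j' = n at this
      change j' = j
      omega
    rw [← Category.assoc, inj_prj_ne X Y h _ hne', Limits.zero_comp]
  · intro h'
    exact (h' (Finset.mem_univ _)).elim

variable {X Y Z : F.gr k}

/-- The tensor product of two morphisms from the objects `G i` and `G j`. -/
noncomputable def pair {i j n : ℕ} (h : i + j = n) (x : M.G i ⟶ X.as.obj i)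
    (y : M.G j ⟶ Y.as.obj j) : M.G n ⟶ (X ⊗ Y).as.obj n :=
  (M.ν h).hom ≫ (x ⊗ₘ y) ≫ inj X Y h

/-- The tensor product on the modules. -/
noncomputable def pairH {i j n : ℕ} (h : i + j = n) (x : (M.grObj X).M i) (y : (M.grObj Y).M j) :
    (M.grObj (X ⊗ Y)).M n :=
  M.toGr (X ⊗ Y) n (M.pair h (Function.surjInv (M.toGr_surjective X i) x)
    (Function.surjInv (M.toGr_surjective Y j) y))

/-- The representatives chosen in `pairH` do not matter, because negligible changes of the factors
change the tensor product by a negligible morphism. -/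
theorem pairH_toGr {i j n : ℕ} (h : i + j = n) (x : M.G i ⟶ X.as.obj i)
    (y : M.G j ⟶ Y.as.obj j) :
    M.pairH h (M.toGr X i x) (M.toGr Y j y) = M.toGr (X ⊗ Y) n (M.pair h x y) := by
  refine M.toGr_eq ?_
  rw [pair, pair, ← Preadditive.comp_sub, ← Preadditive.sub_comp]
  refine comp_negl _ (negl_comp (tensor_sub_mem h (gr_D X i) (M.G_mem j) ?_ ?_) _)
  · refine (M.toH_eq_zero (gr_D X i)).1 ?_
    rw [map_sub, sub_eq_zero]
    exact Function.surjInv_eq (M.toGr_surjective X i) _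
  · refine (M.toH_eq_zero (gr_D Y j)).1 ?_
    rw [map_sub, sub_eq_zero]
    exact Function.surjInv_eq (M.toGr_surjective Y j) _

/-- Compatibility with scalars is the naturality of `ν`: acting on both factors before tensoring is
acting by the image in A n under the tower. -/
theorem bal_pair (X Y : F.gr k) (n : ℕ) :
    GrMod.Balanced (T := T.op) (X := M.grObj X) (Y := M.grObj Y) (n := n) (RingHom.id (A n)ᵐᵒᵖ)
      (fun _ _ h x y => M.pairH (X := X) (Y := Y) h x y) where
  add_left {i j} h x x' y := by
    obtain ⟨x, rfl⟩ := M.toGr_surjective _ _ x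
    obtain ⟨x', rfl⟩ := M.toGr_surjective _ _ x'
    obtain ⟨y, rfl⟩ := M.toGr_surjective _ _ y
    rw [← map_add, pairH_toGr, pairH_toGr, pairH_toGr, ← map_add, pair, pair, pair,
      MonoidalPreadditive.add_tensor, Preadditive.add_comp, Preadditive.comp_add]
  add_right {i j} h x y y' := by
    obtain ⟨x, rfl⟩ := M.toGr_surjective _ _ x
    obtain ⟨y, rfl⟩ := M.toGr_surjective _ _ y
    obtain ⟨y', rfl⟩ := M.toGr_surjective _ _ y'
    rw [← map_add, pairH_toGr, pairH_toGr, pairH_toGr, ← map_add, pair, pair, pair,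
      MonoidalPreadditive.tensor_add, Preadditive.add_comp, Preadditive.comp_add]
  smul {i j} h a b x y := by
    obtain ⟨x, rfl⟩ := M.toGr_surjective _ _ x
    obtain ⟨y, rfl⟩ := M.toGr_surjective _ _ y
    rw [smul_toGr, smul_toGr, pairH_toGr, pairH_toGr, RingHom.id_apply, smul_toGr, pair, pair]
    congr 1
    change _ = M.ρ n (T.φ h a.unop b.unop) ≫ _
    rw [← Category.assoc (M.ρ n _), M.ν_natural, Category.assoc, ← Category.assoc (_ ⊗ₘ _),
      MonoidalCategory.tensorHom_comp_tensorHom]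

/-- The comparison of the tensor products. -/
noncomputable def muHom (X Y : F.gr k) : M.grObj X ⊗ M.grObj Y ⟶ M.grObj (X ⊗ Y) :=
  fun n => GrMod.lift (M.bal_pair X Y n)

theorem muHom_tmul {i j n : ℕ} (h : i + j = n) (x : M.G i ⟶ X.as.obj i)
    (y : M.G j ⟶ Y.as.obj j) :
    M.muHom X Y n (GrMod.tmul (X := M.grObj X) (Y := M.grObj Y) h (M.toGr X i x) (M.toGr Y j y)) =
      M.toGr (X ⊗ Y) n (M.pair h x y) :=
  (GrMod.lift_tmul (M.bal_pair X Y n) h _ _).trans (M.pairH_toGr h x y)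

/-- The component of degree n is the direct sum of the X i ⊗ Y j with i + j = n. On each summand the
tensor products of two dual bases sum to the tensor product of two morphisms that differ from the
identities by negligible ones, hence to the identity modulo negligible morphisms. -/
theorem dual_tensor (X Y : F.gr k) (n : ℕ) {r r' : ℕ → ℕ}
    {a : ∀ i, Fin (r i) → (X.as.obj i ⟶ M.G i)} {b : ∀ i, Fin (r i) → (M.G i ⟶ X.as.obj i)}
    {a' : ∀ i, Fin (r' i) → (Y.as.obj i ⟶ M.G i)} {b' : ∀ i, Fin (r' i) → (M.G i ⟶ Y.as.obj i)}
    (h : ∀ i, 𝟙 _ - ∑ s, a i s ≫ b i s ∈ F.negl i _ _)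
    (h' : ∀ i, 𝟙 _ - ∑ s, a' i s ≫ b' i s ∈ F.negl i _ _) :
    𝟙 ((X ⊗ Y).as.obj n) - ∑ s : (Σ p : Finset.HasAntidiagonal.antidiagonal n,
      Fin (r p.1.1) × Fin (r' p.1.2)), (prj X Y (antidiagonal_add s.1) ≫
        (a _ s.2.1 ⊗ₘ a' _ s.2.2) ≫ (M.ν (antidiagonal_add s.1)).inv) ≫
          M.pair (antidiagonal_add s.1) (b _ s.2.1) (b' _ s.2.2) ∈ F.negl n _ _ := by
  rw [← sum_prj_inj, Fintype.sum_sigma, ← Finset.sum_sub_distrib]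
  refine sum_mem fun p _ => ?_
  have e : ∑ s : Fin (r p.1.1) × Fin (r' p.1.2), (prj X Y (antidiagonal_add p) ≫
        (a _ s.1 ⊗ₘ a' _ s.2) ≫ (M.ν (antidiagonal_add p)).inv) ≫
          M.pair (antidiagonal_add p) (b _ s.1) (b' _ s.2) =
      prj X Y (antidiagonal_add p) ≫
        ((∑ s, a p.1.1 s ≫ b p.1.1 s) ⊗ₘ (∑ s, a' p.1.2 s ≫ b' p.1.2 s)) ≫
          inj X Y (antidiagonal_add p) := by
    rw [Fintype.sum_prod_type, sum_tensor, Preadditive.sum_comp, Preadditive.comp_sum]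
    refine Finset.sum_congr rfl fun s _ => ?_
    rw [tensor_sum, Preadditive.sum_comp, Preadditive.comp_sum]
    refine Finset.sum_congr rfl fun t _ => ?_
    rw [pair, ← MonoidalCategory.tensorHom_comp_tensorHom]
    simp only [Category.assoc, Iso.inv_hom_id_assoc]
  have e' : prj X Y (antidiagonal_add p) ≫ inj X Y (antidiagonal_add p) =
      prj X Y (antidiagonal_add p) ≫ (𝟙 _ ⊗ₘ 𝟙 _) ≫ inj X Y (antidiagonal_add p) := by
    rw [MonoidalCategory.id_tensorHom_id, Category.id_comp]
  rw [e, e', ← Preadditive.comp_sub, ← Preadditive.sub_comp]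
  exact comp_negl _ (negl_comp (tensor_sub_mem (antidiagonal_add p) (gr_D X _) (gr_D Y _)
    (h _) (h' _)) _)

theorem Λ_pair {i j n i' j' : ℕ} (h : i + j = n) (h' : i' + j' = n) (x : M.G i ⟶ X.as.obj i)
    (y : M.G j ⟶ Y.as.obj j) (a : X.as.obj i' ⟶ M.G i') (a' : Y.as.obj j' ⟶ M.G j')
    (hi : i ≠ i') :
    M.Λ n (M.pair h x y ≫ prj X Y h' ≫ (a ⊗ₘ a') ≫ (M.ν h').inv) = 0 := by
  rw [pair, Category.assoc, Category.assoc, ← Category.assoc (inj X Y h), inj_prj_ne X Y h h' hi,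
    Limits.zero_comp, Limits.comp_zero, Limits.comp_zero, map_zero]

theorem Λ_pair_self {i j n : ℕ} (h : i + j = n) (x : M.G i ⟶ X.as.obj i)
    (y : M.G j ⟶ Y.as.obj j) (a : X.as.obj i ⟶ M.G i) (a' : Y.as.obj j ⟶ M.G j) :
    M.Λ n (M.pair h x y ≫ prj X Y h ≫ (a ⊗ₘ a') ≫ (M.ν h).inv) =
      T.φ h (M.Λ i (x ≫ a)) (M.Λ j (y ≫ a')) := by
  rw [← M.Λ_tensor h, pair, Category.assoc, Category.assoc, ← Category.assoc (inj X Y h),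
    inj_prj_self, Category.id_comp, ← MonoidalCategory.tensorHom_comp_tensorHom, Category.assoc]

/-- The coordinates on the module of X ⊗ Y are those of the dual basis in `dual_tensor`. On a tensor
in the matching bidegree they are the products of the coordinates of its factors (`Λ_pair_self`),
and in the other bidegrees they vanish (`Λ_pair`). -/
theorem muHom_bijective (X Y : F.gr k) (n : ℕ) : Function.Bijective (M.muHom X Y n) := by
  choose r a b h using fun i => M.exists_dual (gr_D X i)
  choose r' a' b' h' using fun i => M.exists_dual (gr_D Y i)
  refine GrMod.bijective_of_dual (T := T.op) (X := M.grObj X) (Y := M.grObj Y) (M.muHom X Y n)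
    (fun i s => M.toGr X i (b i s)) (fun i s m => M.coord (gr_D X i) (a i s) m)
    (fun i s => M.toGr Y i (b' i s)) (fun i s m => M.coord (gr_D Y i) (a' i s) m)
    (fun i m => M.coord_sum _ (h i) m) (fun i m => M.coord_sum _ (h' i) m)
    (fun p s => M.coord (gr_D (X ⊗ Y) n) (prj X Y (antidiagonal_add p) ≫
        (a _ s.1 ⊗ₘ a' _ s.2) ≫ (M.ν (antidiagonal_add p)).inv))
    antidiagonal_add (fun p s m m' => ?_) (fun i j hij p s m m' hne => ?_) (fun l => ?_)
  · obtain ⟨m, rfl⟩ := M.toGr_surjective _ _ m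
    obtain ⟨m', rfl⟩ := M.toGr_surjective _ _ m'
    rw [muHom_tmul]
    refine (M.coord_toH _ _ _).trans ((congrArg MulOpposite.op
      (M.Λ_pair_self _ m m' _ _)).trans ?_)
    exact (congrArg₂ (T.op.φ _) (M.coord_toH _ _ _) (M.coord_toH _ _ _)).symm
  · obtain ⟨m, rfl⟩ := M.toGr_surjective _ _ m
    obtain ⟨m', rfl⟩ := M.toGr_surjective _ _ m'
    rw [muHom_tmul]
    exact (M.coord_toH _ _ _).trans ((congrArg MulOpposite.op
      (M.Λ_pair hij _ m m' _ _ hne)).trans MulOpposite.op_zero)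
  · have e := M.coord_sum (gr_D (X ⊗ Y) n) (M.dual_tensor X Y n h h') l
    rw [Fintype.sum_sigma] at e
    exact (Finset.sum_congr rfl fun p _ => Finset.sum_congr rfl fun s _ =>
      congrArg _ (M.muHom_tmul _ _ _)).trans e

/-- The comparison of the tensor products is an isomorphism. -/
noncomputable def muIso (X Y : F.gr k) : M.grObj X ⊗ M.grObj Y ≅ M.grObj (X ⊗ Y) :=
  GrMod.isoOfBijective (M.muHom X Y) (M.muHom_bijective X Y)

end Monoidal

end Model

end Filtration

end KhovanovSazdanovic

/-! ### Coherence of the comparison maps -/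

namespace KhovanovSazdanovic

namespace Filtration

namespace Model

open GradedObject.Monoidal

section MonoidalFunctor

variable {k : Type u} [Field k] {C : Type w} [Category.{v} C] [Preadditive C]
  [HasFiniteBiproducts C] [MonoidalCategory C] [MonoidalPreadditive C] [Linear k C]
  {A : ℕ → Type u} [∀ n, Ring (A n)] {F : Filtration C} {T : Tower A} (M : F.Model T)

theorem inj_tensorHom {X X' Y Y' : F.gr k} (f : X.as ⟶ X'.as) (g : Y.as ⟶ Y'.as) {i j n : ℕ}
    (h : i + j = n) :
    inj X Y h ≫ GradedObject.Monoidal.tensorHom f.hom g.hom n =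
      (f.hom i ⊗ₘ g.hom j) ≫ inj X' Y' h :=
  ι_tensorHom f.hom g.hom i j n h

theorem muHom_natural_left {X X' : F.gr k} (f : X ⟶ X') (Y : F.gr k) :
    M.grMap f ▷ M.grObj Y ≫ M.muHom X' Y = M.muHom X Y ≫ M.grMap (f ▷ Y) := by
  obtain ⟨f, rfl⟩ := TensorIdeal.Quot.cls_surj f
  refine GrMod.tObj_ext fun i j n h x y => ?_
  obtain ⟨x, rfl⟩ := M.toGr_surjective _ _ x
  obtain ⟨y, rfl⟩ := M.toGr_surjective _ _ y
  refine (congrArg (M.muHom X' Y n) ((GrMod.tMap_tmul _ _ h _ _).trans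
    (congrArg (fun e => GrMod.tmul h e _) (M.grMap_cls f i x)))).trans
      ((M.muHom_tmul h _ _).trans ?_)
  refine Eq.symm ((congrArg (M.grMap _ n) (M.muHom_tmul h x y)).trans
    ((M.grMap_cls (X := X ⊗ Y) (Y := X' ⊗ Y) (f ▷ Y.as) n _).trans ?_))
  congr 1
  rw [pair, pair, Category.assoc, Category.assoc]
  refine congrArg _ ?_
  refine (congrArg _ (inj_tensorHom f (𝟙 Y.as) h)).trans ?_
  rw [← Category.assoc, MonoidalCategory.tensorHom_comp_tensorHom]
  congr 2
  exact Category.comp_id _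

theorem muHom_natural_right (X : F.gr k) {Y Y' : F.gr k} (f : Y ⟶ Y') :
    M.grObj X ◁ M.grMap f ≫ M.muHom X Y' = M.muHom X Y ≫ M.grMap (X ◁ f) := by
  obtain ⟨f, rfl⟩ := TensorIdeal.Quot.cls_surj f
  refine GrMod.tObj_ext fun i j n h x y => ?_
  obtain ⟨x, rfl⟩ := M.toGr_surjective _ _ x
  obtain ⟨y, rfl⟩ := M.toGr_surjective _ _ y
  refine (congrArg (M.muHom X Y' n) ((GrMod.tMap_tmul _ _ h _ _).trans
    (congrArg (fun e => GrMod.tmul h _ e) (M.grMap_cls f j y)))).trans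
      ((M.muHom_tmul h _ _).trans ?_)
  refine Eq.symm ((congrArg (M.grMap _ n) (M.muHom_tmul h x y)).trans
    ((M.grMap_cls (X := X ⊗ Y) (Y := X ⊗ Y') (X.as ◁ f) n _).trans ?_))
  congr 1
  rw [pair, pair, Category.assoc, Category.assoc]
  refine congrArg _ ?_
  refine (congrArg _ (inj_tensorHom (𝟙 X.as) f h)).trans ?_
  rw [← Category.assoc, MonoidalCategory.tensorHom_comp_tensorHom]
  congr 2
  exact Category.comp_id _

theorem inj_associator (X Y Z : F.gr k) {i j c l m n : ℕ} (h₁ : i + j = l) (h₂ : l + c = n)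
    (h₃ : j + c = m) (h₄ : i + m = n) :
    (inj X Y h₁ ▷ Z.as.obj c) ≫ inj (X ⊗ Y) Z h₂ ≫
        (GradedObject.Monoidal.associator X.as.obj Y.as.obj Z.as.obj).hom n =
      (α_ _ _ _).hom ≫ (X.as.obj i ◁ inj Y Z h₃) ≫ inj X (Y ⊗ Z) h₄ := by
  have h : i + j + c = n := by omega
  have e := ιTensorObj₃'_associator_hom X.as.obj Y.as.obj Z.as.obj i j c n h
  rw [ιTensorObj₃'_eq _ _ _ i j c n h l h₁, ιTensorObj₃_eq _ _ _ i j c n h m h₃,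
    Category.assoc] at e
  exact e

/-- It suffices to follow classes x, y, z. Both paths lead to the class of an iterated tensor
product of morphisms, precomposed with an iterated splitting of G n, and these agree by the
naturality of the associator and `ν_assoc`. -/
theorem muHom_assoc (X Y Z : F.gr k) :
    M.muHom X Y ▷ M.grObj Z ≫ M.muHom (X ⊗ Y) Z ≫ M.grMap (α_ X Y Z).hom =
      (α_ (M.grObj X) (M.grObj Y) (M.grObj Z)).hom ≫ M.grObj X ◁ M.muHom Y Z ≫
        M.muHom X (Y ⊗ Z) := by
  refine GrMod.tObj_ext₂ fun i j l c n h₁ h₂ x y z => ?_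
  have h₄ : i + (j + c) = n := by omega
  obtain ⟨x, rfl⟩ := M.toGr_surjective _ _ x
  obtain ⟨y, rfl⟩ := M.toGr_surjective _ _ y
  obtain ⟨z, rfl⟩ := M.toGr_surjective _ _ z
  refine Eq.trans (b := M.toGr (X ⊗ Y ⊗ Z) n (M.pair h₂ (M.pair h₁ x y) z ≫
    (GradedObject.Monoidal.associator X.as.obj Y.as.obj Z.as.obj).hom n)) ?_
    (Eq.trans (b := M.toGr (X ⊗ Y ⊗ Z) n (M.pair h₄ x (M.pair rfl y z))) ?_ ?_)
  · refine Eq.trans (congrArg (fun e => M.grMap (α_ X Y Z).hom n (M.muHom (X ⊗ Y) Z n e))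
      ((GrMod.tMap_tmul _ _ h₂ _ _).trans
        (congrArg (fun e => GrMod.tmul h₂ e _) (M.muHom_tmul h₁ x y)))) ?_
    refine Eq.trans (congrArg (M.grMap (α_ X Y Z).hom n) (M.muHom_tmul h₂ _ _)) ?_
    exact M.grMap_cls (X := (X ⊗ Y) ⊗ Z) (Y := X ⊗ Y ⊗ Z) (α_ X.as Y.as Z.as).hom n _
  · have e₁ : (M.pair h₁ x y ⊗ₘ z) = (M.ν h₁).hom ▷ M.G c ≫ ((x ⊗ₘ y) ⊗ₘ z) ≫
        inj X Y h₁ ▷ Z.as.obj c := by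
      rw [pair, ← MonoidalCategory.tensorHom_id, ← MonoidalCategory.tensorHom_id,
        MonoidalCategory.tensorHom_comp_tensorHom, MonoidalCategory.tensorHom_comp_tensorHom,
        Category.comp_id, Category.id_comp]
    have e₂ : (x ⊗ₘ M.pair rfl y z) = M.G i ◁ (M.ν rfl).hom ≫ (x ⊗ₘ (y ⊗ₘ z)) ≫
        X.as.obj i ◁ inj Y Z rfl := by
      rw [pair, ← MonoidalCategory.id_tensorHom, ← MonoidalCategory.id_tensorHom,
        MonoidalCategory.tensorHom_comp_tensorHom, MonoidalCategory.tensorHom_comp_tensorHom,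
        Category.comp_id, Category.id_comp]
    change M.toGr _ n (((M.ν h₂).hom ≫ (M.pair h₁ x y ⊗ₘ z) ≫ inj (X ⊗ Y) Z h₂) ≫ _) =
      M.toGr _ n ((M.ν h₄).hom ≫ (x ⊗ₘ M.pair rfl y z) ≫ inj X (Y ⊗ Z) h₄)
    rw [e₁, e₂]
    simp only [Category.assoc]
    refine congrArg (M.toGr _ n) ?_
    refine (congrArg (fun e => (M.ν h₂).hom ≫ (M.ν h₁).hom ▷ M.G c ≫ ((x ⊗ₘ y) ⊗ₘ z) ≫ e)
      (inj_associator X Y Z h₁ h₂ rfl h₄)).trans ?_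
    rw [← Category.assoc ((x ⊗ₘ y) ⊗ₘ z), MonoidalCategory.associator_naturality, Category.assoc,
      ← Category.assoc ((M.ν h₁).hom ▷ M.G c), ← Category.assoc (M.ν h₂).hom, M.ν_assoc h₁ h₂ rfl h₄,
      Category.assoc]
  · refine Eq.symm ?_
    refine Eq.trans (congrArg (fun e => M.muHom X (Y ⊗ Z) n
      (GrMod.tMap (𝟙 (M.grObj X)) (M.muHom Y Z) n e)) (GrMod.aHom_tmul h₁ h₂ rfl h₄ _ _ _)) ?_
    refine Eq.trans (congrArg (M.muHom X (Y ⊗ Z) n) ((GrMod.tMap_tmul _ _ h₄ _ _).trans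
        (congrArg (fun e => GrMod.tmul h₄ _ e) (M.muHom_tmul rfl y z)))) ?_
    exact M.muHom_tmul h₄ _ _

variable (k) in
/-- The generator of the degree zero part of the unit object. -/
noncomputable def unitIso : M.G 0 ≅ (𝟙_ (F.gr k)).as.obj 0 :=
  M.η ≪≫ (tensorUnit₀ (I := ℕ) (C := C)).symm

variable (k) in
/-- The comparison of the unit objects. -/
noncomputable def epsHom : 𝟙_ (GrMod T.op) ⟶ M.grObj (𝟙_ (F.gr k))
  | 0 => LinearMap.toSpanSingleton (A 0)ᵐᵒᵖ _ (M.toGr (𝟙_ (F.gr k)) 0 (M.unitIso k).hom)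
  | _ + 1 => 0

theorem epsHom_uOne :
    M.epsHom k 0 (GrMod.uOne (T := T.op)) = M.toGr (𝟙_ (F.gr k)) 0 (M.unitIso k).hom :=
  one_smul (A 0)ᵐᵒᵖ (M.toGr (𝟙_ (F.gr k)) 0 (M.unitIso k).hom)

/-- In degree 0 the unit object is isomorphic to G 0, so its module is free on the class of that
isomorphism. In positive degrees both sides are zero. -/
theorem epsHom_bijective : ∀ n, Function.Bijective (M.epsHom k n)
  | 0 => by
    constructor
    · refine Function.LeftInverse.injective
        (g := M.coord (gr_D (𝟙_ (F.gr k)) 0) (M.unitIso k).inv) fun c => ?_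
      change (A 0)ᵐᵒᵖ at c
      change M.coord _ _ (c • M.toGr (𝟙_ (F.gr k)) 0 (M.unitIso k).hom) = c
      rw [map_smul]
      refine (congrArg (c • ·) (M.coord_toH _ _ _)).trans ?_
      rw [Iso.hom_inv_id, M.Λ_id, MulOpposite.op_one, smul_eq_mul, mul_one]
    · intro y
      obtain ⟨y, rfl⟩ := M.toGr_surjective _ _ y
      refine ⟨(MulOpposite.op (M.Λ 0 (y ≫ (M.unitIso k).inv)) : (A 0)ᵐᵒᵖ), ?_⟩
      refine (M.toH_comp _ _ _).symm.trans (congrArg _ ?_)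
      rw [Category.assoc, Iso.inv_hom_id, Category.comp_id]
  | n + 1 => by
    have h₁ : Subsingleton ((M.grObj (𝟙_ (F.gr k))).M (n + 1)) := by
      refine (M.subsingleton_H_iff (gr_D (𝟙_ (F.gr k)) (n + 1))).2 (F.lower_zero ?_)
      have : HasZeroObject C := hasZeroObject_of_hasFiniteBiproducts C
      exact IsZero.of_iso (isZero_zero C) ((isInitialTensorUnitApply (I := ℕ) (C := C)
        (n + 1) (Nat.succ_ne_zero n)).uniqueUpToIso (isZero_zero C).isInitial)
    exact ⟨fun x y _ => Subsingleton.elim (α := GrMod.UnitM (fun n => (A n)ᵐᵒᵖ) (n + 1)) x y,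
      fun y => ⟨0, Subsingleton.elim _ _⟩⟩

variable (k) in
/-- The comparison of the unit objects is an isomorphism. -/
noncomputable def epsIso : 𝟙_ (GrMod T.op) ≅ M.grObj (𝟙_ (F.gr k)) :=
  GrMod.isoOfBijective (M.epsHom k) M.epsHom_bijective

/-- An explicit formula is at hand for the inverse of the unitor of graded objects. The formula for
the unitor itself is read off from the fact that the two compose to the identity. -/
theorem inj_leftUnitor (X : F.gr k) (n : ℕ) :
    ((M.unitIso k).hom ▷ X.as.obj n) ≫ inj (𝟙_ (F.gr k)) X (zero_add n) ≫
      (GradedObject.Monoidal.leftUnitor X.as.obj).hom n =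
        M.η.hom ▷ X.as.obj n ≫ (λ_ (X.as.obj n)).hom := by
  have h : (GradedObject.Monoidal.leftUnitor X.as.obj).inv n ≫
      (GradedObject.Monoidal.leftUnitor X.as.obj).hom n = 𝟙 _ :=
    congrFun (GradedObject.Monoidal.leftUnitor X.as.obj).inv_hom_id n
  rw [GradedObject.Monoidal.leftUnitor_inv_apply, Category.assoc, Category.assoc] at h
  rw [unitIso, Iso.trans_hom, Iso.symm_hom, MonoidalCategory.comp_whiskerRight, Category.assoc]
  refine congrArg _ ((Iso.inv_comp_eq _).1 h |>.trans (Category.comp_id _))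

theorem inj_rightUnitor (X : F.gr k) (n : ℕ) :
    (X.as.obj n ◁ (M.unitIso k).hom) ≫ inj X (𝟙_ (F.gr k)) (add_zero n) ≫
      (GradedObject.Monoidal.rightUnitor X.as.obj).hom n =
        X.as.obj n ◁ M.η.hom ≫ (ρ_ (X.as.obj n)).hom := by
  have h : (GradedObject.Monoidal.rightUnitor X.as.obj).inv n ≫
      (GradedObject.Monoidal.rightUnitor X.as.obj).hom n = 𝟙 _ :=
    congrFun (GradedObject.Monoidal.rightUnitor X.as.obj).inv_hom_id n
  rw [GradedObject.Monoidal.rightUnitor_inv_apply, Category.assoc, Category.assoc] at h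
  rw [unitIso, Iso.trans_hom, Iso.symm_hom, MonoidalCategory.whiskerLeft_comp, Category.assoc]
  refine congrArg _ ((Iso.inv_comp_eq _).1 h |>.trans (Category.comp_id _))

theorem muHom_left_unit (X : F.gr k) :
    (λ_ (M.grObj X)).hom = M.epsHom k ▷ M.grObj X ≫ M.muHom (𝟙_ (F.gr k)) X ≫
      M.grMap (λ_ X).hom := by
  refine GrMod.lUnit_ext fun n x => ?_
  obtain ⟨x, rfl⟩ := M.toGr_surjective _ _ x
  refine (GrMod.lHom_uOne _).trans (Eq.symm ?_)
  refine Eq.trans (congrArg (fun e => M.grMap (λ_ X).hom n (M.muHom (𝟙_ (F.gr k)) X n e))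
      ((GrMod.tMap_tmul _ _ (zero_add n) _ _).trans
        (congrArg (fun e => GrMod.tmul (zero_add n) e _) M.epsHom_uOne))) ?_
  refine Eq.trans (congrArg (M.grMap (λ_ X).hom n) (M.muHom_tmul (zero_add n) _ x)) ?_
  refine (M.grMap_cls (X := 𝟙_ (F.gr k) ⊗ X) (Y := X) (λ_ X.as).hom n _).trans ?_
  congr 1
  rw [pair, MonoidalCategory.tensorHom_def', Category.assoc, Category.assoc, Category.assoc]
  refine (congrArg (fun e => (M.ν (zero_add n)).hom ≫ M.G 0 ◁ x ≫ e)
    (M.inj_leftUnitor X n)).trans ?_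
  rw [← Category.assoc (M.G 0 ◁ x), MonoidalCategory.whisker_exchange, Category.assoc,
    MonoidalCategory.leftUnitor_naturality, ← Category.assoc (M.η.hom ▷ _), ← Category.assoc,
    M.ν_left, Category.id_comp]

theorem muHom_right_unit (X : F.gr k) :
    (ρ_ (M.grObj X)).hom = M.grObj X ◁ M.epsHom k ≫ M.muHom X (𝟙_ (F.gr k)) ≫
      M.grMap (ρ_ X).hom := by
  refine GrMod.rUnit_ext fun n x => ?_
  obtain ⟨x, rfl⟩ := M.toGr_surjective _ _ x
  refine (GrMod.rHom_uOne _).trans (Eq.symm ?_)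
  refine Eq.trans (congrArg (fun e => M.grMap (ρ_ X).hom n (M.muHom X (𝟙_ (F.gr k)) n e))
      ((GrMod.tMap_tmul _ _ (add_zero n) _ _).trans
        (congrArg (fun e => GrMod.tmul (add_zero n) _ e) M.epsHom_uOne))) ?_
  refine Eq.trans (congrArg (M.grMap (ρ_ X).hom n) (M.muHom_tmul (add_zero n) x _)) ?_
  refine (M.grMap_cls (X := X ⊗ 𝟙_ (F.gr k)) (Y := X) (ρ_ X.as).hom n _).trans ?_
  congr 1
  rw [pair, MonoidalCategory.tensorHom_def, Category.assoc, Category.assoc, Category.assoc]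
  refine (congrArg (fun e => (M.ν (add_zero n)).hom ≫ x ▷ M.G 0 ≫ e)
    (M.inj_rightUnitor X n)).trans ?_
  rw [← Category.assoc (x ▷ M.G 0), ← MonoidalCategory.whisker_exchange, Category.assoc,
    MonoidalCategory.rightUnitor_naturality, ← Category.assoc (_ ◁ M.η.hom), ← Category.assoc,
    M.ν_right, Category.id_comp]

variable (k) in
/-- The functor to the sequences of projective modules is monoidal. -/
noncomputable def toProjCore : (M.toProj k).CoreMonoidal where
  εIso := ObjectProperty.isoMk _ (M.epsIso k)
  μIso X Y := ObjectProperty.isoMk _ (M.muIso X Y)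
  μIso_hom_natural_left f Y := ObjectProperty.hom_ext _ (M.muHom_natural_left f Y)
  μIso_hom_natural_right X f := ObjectProperty.hom_ext _ (M.muHom_natural_right X f)
  associativity X Y Z := ObjectProperty.hom_ext _ (M.muHom_assoc X Y Z)
  left_unitality X := ObjectProperty.hom_ext _ (M.muHom_left_unit X)
  right_unitality X := ObjectProperty.hom_ext _ (M.muHom_right_unit X)

noncomputable instance : (M.toProj k).Monoidal := (M.toProjCore k).toMonoidal

end MonoidalFunctor

end Model

end Filtration

end KhovanovSazdanovic

/-! ### Essential surjectivity -/

namespace KhovanovSazdanovic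

namespace Filtration

section Biproducts

variable {C : Type w} [Category.{v} C] [Preadditive C] [HasFiniteBiproducts C]
  [MonoidalCategory C] (F : Filtration C)

theorem D_biproduct {n : ℕ} {ι : Type} [Finite ι] (X : ι → C) (h : ∀ i, F.D n (X i)) :
    F.D n (⨁ X) :=
  have : (F.D n).IsClosedUnderFiniteCoproducts := closed_coproducts F.zero F.sum F.retract
  (F.D n).prop_of_isColimit_cofan (biproduct.isColimit X) h

end Biproducts

namespace Model

variable {C : Type w} [Category.{v} C] [Preadditive C] [HasFiniteBiproducts C]
  [MonoidalCategory C] {A : ℕ → Type u} [∀ n, Ring (A n)] {F : Filtration C} {T : Tower A}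
  (M : F.Model T)

/-- Because `ρ` is a genuine homomorphism, an idempotent matrix over A n is sent to a genuine
idempotent of a power of G n, with no lifting modulo negligible morphisms, and this idempotent
splits. The order of the factors in `he` is that of composition. -/
theorem exists_retract [IsIdempotentComplete C] (n r : ℕ) (e : Fin r → Fin r → A n)
    (he : ∀ s u, ∑ t, e t u * e s t = e s u) :
    ∃ (X : C) (_ : F.D n X) (a : Fin r → (X ⟶ M.G n)) (b : Fin r → (M.G n ⟶ X)),
      ∑ s, a s ≫ b s = 𝟙 X ∧ ∀ s t, b s ≫ a t = M.ρ n (e s t) := by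
  let E : (⨁ fun _ : Fin r => M.G n) ⟶ ⨁ fun _ : Fin r => M.G n :=
    biproduct.matrix fun s t => M.ρ n (e s t)
  have hE : E ≫ E = E := by
    refine biproduct.hom_ext' _ _ fun s => biproduct.hom_ext _ _ fun u => ?_
    simp only [E, Category.assoc, biproduct.matrix_π, biproduct.ι_matrix_assoc,
      biproduct.ι_desc, biproduct.lift_desc]
    rw [← he, map_sum]
    exact Finset.sum_congr rfl fun t _ => (M.ρ_mul _ _).symm
  obtain ⟨X, i, p, hip, hpi⟩ := IsIdempotentComplete.idempotents_split _ E hE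
  refine ⟨X, F.retract ⟨i, p, hip⟩ (F.D_biproduct _ fun _ => M.G_mem n),
    fun s => i ≫ biproduct.π _ s, fun s => biproduct.ι (fun _ : Fin r => M.G n) s ≫ p, ?_,
    fun s t => ?_⟩
  · have h : ∑ s, biproduct.π (fun _ : Fin r => M.G n) s ≫ biproduct.ι (fun _ : Fin r => M.G n) s = 𝟙 _ :=
      biproduct.total (f := fun _ : Fin r => M.G n)
    calc _ = i ≫ (∑ s, biproduct.π (fun _ : Fin r => M.G n) s ≫ biproduct.ι (fun _ : Fin r => M.G n) s) ≫ p := by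
          rw [Preadditive.sum_comp, Preadditive.comp_sum]
          simp only [Category.assoc]
      _ = 𝟙 X := by rw [h, Category.id_comp, hip]
  · rw [Category.assoc, ← Category.assoc p, hpi, ← Category.assoc, biproduct.ι_matrix,
      biproduct.lift_π]

/-- A dual basis (x, f) of P gives the idempotent matrix f t (x s), whose image is P. The retract X
of a power of G n that belongs to this matrix has a dual basis with the same matrix, and matching
the two bases is an isomorphism. -/
theorem exists_H_equiv [IsIdempotentComplete C] (n : ℕ) (P : Type u) [AddCommGroup P]
    [Module (A n)ᵐᵒᵖ P] [Module.Finite (A n)ᵐᵒᵖ P] [Module.Projective (A n)ᵐᵒᵖ P] :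
    ∃ (X : C) (hX : F.D n X), Nonempty (M.H hX ≃ₗ[(A n)ᵐᵒᵖ] P) := by
  obtain ⟨r, x, f, hx⟩ := KhovanovSazdanovic.exists_dual (R := (A n)ᵐᵒᵖ) (M := P)
  obtain ⟨X, hX, a, b, hab, hba⟩ := M.exists_retract n r (fun s t => (f t (x s)).unop) fun s u => by
    conv_rhs => rw [← hx (x s), map_sum, Finset.unop_sum]
    refine Finset.sum_congr rfl fun t _ => ?_
    rw [map_smul, smul_eq_mul, MulOpposite.unop_mul]
  have hab' : 𝟙 X - ∑ s, a s ≫ b s ∈ F.negl n X X := by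
    rw [hab, sub_self]
    exact zero_mem _
  refine ⟨X, hX, ⟨LinearEquiv.ofLinearMap (∑ s, (M.coord hX (a s)).smulRight (x s))
    (∑ s, (f s).smulRight (M.toH hX (b s))) (LinearMap.ext fun m => ?_)
    (LinearMap.ext fun m => ?_)⟩⟩
  · simp only [LinearMap.comp_apply, LinearMap.sum_apply, LinearMap.smulRight_apply, map_sum,
      map_smul, LinearMap.id_apply]
    conv_rhs => rw [← hx m]
    refine Finset.sum_congr rfl fun s _ => congrArg _ ?_
    conv_rhs => rw [← hx (x s)]
    refine Finset.sum_congr rfl fun t _ => ?_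
    rw [coord_toH, hba, M.Λ_ρ, MulOpposite.op_unop]
  · simp only [LinearMap.comp_apply, LinearMap.sum_apply, LinearMap.smulRight_apply, map_sum,
      map_smul, LinearMap.id_apply]
    conv_rhs => rw [← M.coord_sum hX hab' m]
    refine Finset.sum_congr rfl fun s _ => congrArg _ ?_
    conv_rhs => rw [← Category.comp_id (b s), ← hab, Preadditive.comp_sum, map_sum]
    refine Finset.sum_congr rfl fun t _ => ?_
    rw [smul_toH, ← hba, Category.assoc]

section EssSurj

variable {k : Type u} [Field k] [MonoidalPreadditive C] [Linear k C]

instance [IsIdempotentComplete C] : (M.toProj k).EssSurj where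
  mem_essImage N := by
    let (n : ℕ) : Module (A n)ᵐᵒᵖ (N.obj.M n) := N.obj.mod n
    have h : ∀ n, ∃ (X : C) (hX : F.D n X), Nonempty (M.H hX ≃ₗ[(A n)ᵐᵒᵖ] N.obj.M n) := fun n =>
      have := (N.property.1 n).1
      have := (N.property.1 n).2
      M.exists_H_equiv n (N.obj.M n)
    choose X hX e using h
    obtain ⟨m, hm⟩ := N.property.2
    refine ⟨⟨⟨X, hX, m, fun n hn => ?_⟩⟩, ⟨ObjectProperty.isoMk _
      (GrMod.isoOfBijective (fun n => (e n).some.toLinearMap) fun n => (e n).some.bijective)⟩⟩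
    have := hm n hn
    exact (M.subsingleton_H_iff (hX n)).1 (e n).some.injective.subsingleton

noncomputable instance [IsIdempotentComplete C] : (M.toProj k).IsEquivalence where

end EssSurj

end Model

end Filtration

end KhovanovSazdanovic

/-! ### The completed skein category as a model -/

namespace KhovanovSazdanovic

open Polynomial

-- Coassociativity of splittings is transported along an oplax monoidal functor. It is needed for
-- the passage from the splittings of the objects [n] in the skein category to those in its
-- completion.
open Functor.OplaxMonoidal in
theorem oplax_assoc {D : Type*} [Category* D] [MonoidalCategory D] {E : Type*} [Category* E]
    [MonoidalCategory E] (F : D ⥤ E) [F.OplaxMonoidal] {X Y Z V W U : D} {s₂ : U ⟶ V ⊗ Z}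
    {s₁ : V ⟶ X ⊗ Y} {s₄ : U ⟶ X ⊗ W} {s₃ : W ⟶ Y ⊗ Z}
    (h : s₂ ≫ s₁ ▷ Z ≫ (α_ X Y Z).hom = s₄ ≫ X ◁ s₃) :
    (F.map s₂ ≫ δ F V Z) ≫ (F.map s₁ ≫ δ F X Y) ▷ F.obj Z ≫
        (α_ (F.obj X) (F.obj Y) (F.obj Z)).hom =
      (F.map s₄ ≫ δ F X W) ≫ F.obj X ◁ (F.map s₃ ≫ δ F Y Z) := by
  rw [MonoidalCategory.comp_whiskerRight, MonoidalCategory.whiskerLeft_comp]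
  simp only [Category.assoc]
  rw [δ_natural_left_assoc, associativity, δ_natural_right_assoc]
  simp only [← Functor.map_comp_assoc]
  rw [h]

namespace DCob

variable {k : Type u} [Field k] (α : ℕ → k) (p : k[X])

/-- The embedding of the skein category in its completion. -/
noncomputable abbrev embed : SCob α p ⥤ DCob α p :=
  Mat_.embedding (SCob α p) ⋙ Idempotents.toKaroubi _

theorem embed_map_smul {X Y : SCob α p} (r : k) (f : X ⟶ Y) :
    (embed α p).map (r • f) = r • (embed α p).map f := rfl

/-- The endomorphism of an object given by an endomorphism of a skein object. -/
noncomputable def preHom (X : SCob α p) :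
    ((embed α p).obj X ⟶ (embed α p).obj X) →+ (X ⟶ X) where
  toFun := (embed α p).preimage
  map_zero' := (embed α p).map_injective (by rw [Functor.map_preimage, Functor.map_zero])
  map_add' f g := (embed α p).map_injective (by
    rw [Functor.map_add, Functor.map_preimage, Functor.map_preimage, Functor.map_preimage])

theorem preHom_map {X : SCob α p} (f : X ⟶ X) : preHom α p X ((embed α p).map f) = f :=
  (embed α p).preimage_map f

variable {α p}

theorem lower_obj {m n : ℕ} (h : m < n) : (filtration α p).lower n (DCob.obj α p m) := by
  obtain ⟨n, rfl⟩ : ∃ l, n = l + 1 := ⟨n - 1, by omega⟩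
  exact Gen.obj m (by omega)

theorem negl_smul {n : ℕ} {X Y : DCob α p} (r : k) {f : X ⟶ Y}
    (hf : f ∈ (filtration α p).negl n X Y) : r • f ∈ (filtration α p).negl n X Y := by
  obtain ⟨Z, a, b, hZ, rfl⟩ := hf
  exact ⟨Z, r • a, b, hZ, Linear.smul_comp _ _ _ _ _ _⟩

/-- The objects Z for which all endomorphisms of [n] through Z have symbol zero contain the [m] with
m < n, by `SCob.symbol_comp_eq_zero`, and are closed under direct sums and summands. For n = 0 the
lower objects are just the zero objects. -/
theorem symbol_negl (hα : ∀ g, (p.sum fun i a => a * α (g + i)) = 0) {n : ℕ} {Z : DCob α p}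
    (hZ : (filtration α p).lower n Z) (a : DCob.obj α p n ⟶ Z) (b : Z ⟶ DCob.obj α p n) :
    SCob.symbol hα n (preHom α p _ (a ≫ b)) = 0 := by
  cases n with
  | zero => rw [IsZero.eq_of_tgt hZ a 0, Limits.zero_comp, map_zero, map_zero]
  | succ n =>
    change Gen α p n Z at hZ
    induction hZ with
    | obj m h =>
      obtain ⟨a, rfl⟩ := (embed α p).map_surjective a
      obtain ⟨b, rfl⟩ := (embed α p).map_surjective b
      rw [← Functor.map_comp, preHom_map]
      exact SCob.symbol_comp_eq_zero hα (by omega) a b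
    | zero X h => rw [IsZero.eq_of_tgt h a 0, Limits.zero_comp, map_zero, map_zero]
    | sum X Y Z h _ _ h₁ h₂ =>
      obtain ⟨i, j, q, r, -, -, -, -, e⟩ := h
      have e' : a ≫ b = (a ≫ q) ≫ (i ≫ b) + (a ≫ r) ≫ (j ≫ b) := by
        rw [Category.assoc, Category.assoc, ← Preadditive.comp_add, ← Category.assoc q,
          ← Category.assoc r, ← Preadditive.add_comp, e, Category.id_comp]
      rw [e', map_add, map_add, h₁, h₂, add_zero]
    | summand X Y h _ h₁ =>
      obtain ⟨i, r, e⟩ := h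
      have e' : a ≫ b = (a ≫ i) ≫ (r ≫ b) := by
        rw [Category.assoc, ← Category.assoc i, e, Category.id_comp]
      rw [e', h₁]

/-- Dual bases modulo negligible morphisms are inherited by direct sums and summands. For [n] the
identity is one, and for lower objects the empty family is one. -/
theorem exists_dual {n : ℕ} {X : DCob α p} (hX : Gen α p n X) :
    ∃ (ι : Type) (_ : Fintype ι) (a : ι → (X ⟶ DCob.obj α p n)) (b : ι → (DCob.obj α p n ⟶ X)),
      𝟙 X - ∑ s, a s ≫ b s ∈ (filtration α p).negl n X X := by
  induction hX with
  | obj m h =>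
    rcases h.lt_or_eq with h | rfl
    · refine ⟨Empty, inferInstance, fun s => s.elim, fun s => s.elim, ?_⟩
      rw [Fintype.sum_empty, sub_zero]
      exact Filtration.id_mem_negl_iff.2 (lower_obj h)
    · refine ⟨Unit, inferInstance, fun _ => 𝟙 _, fun _ => 𝟙 _, ?_⟩
      rw [Fintype.sum_unique, Category.comp_id, sub_self]
      exact zero_mem _
  | zero X h =>
    refine ⟨Empty, inferInstance, fun s => s.elim, fun s => s.elim, ?_⟩
    rw [Fintype.sum_empty, sub_zero]
    exact Filtration.id_mem_negl_iff.2 (Filtration.lower_zero _ h)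
  | sum X Y Z h _ _ h₁ h₂ =>
    obtain ⟨i, j, q, r, -, -, -, -, e⟩ := h
    obtain ⟨ι, _, a, b, h₁⟩ := h₁
    obtain ⟨ι', _, a', b', h₂⟩ := h₂
    refine ⟨ι ⊕ ι', inferInstance, Sum.elim (fun s => q ≫ a s) (fun s => r ≫ a' s),
      Sum.elim (fun s => b s ≫ i) (fun s => b' s ≫ j), ?_⟩
    have e' : 𝟙 Z - (∑ s, (q ≫ a s) ≫ (b s ≫ i) + ∑ s, (r ≫ a' s) ≫ (b' s ≫ j)) =
        q ≫ (𝟙 X - ∑ s, a s ≫ b s) ≫ i + r ≫ (𝟙 Y - ∑ s, a' s ≫ b' s) ≫ j := by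
      simp only [Preadditive.sub_comp, Preadditive.comp_sub, Preadditive.sum_comp,
        Preadditive.comp_sum, Category.id_comp, Category.assoc]
      rw [← e]
      abel
    rw [Fintype.sum_sum_type]
    simp only [Sum.elim_inl, Sum.elim_inr]
    rw [e']
    exact add_mem (Filtration.comp_negl _ (Filtration.negl_comp h₁ _))
      (Filtration.comp_negl _ (Filtration.negl_comp h₂ _))
  | summand X Y h _ h₁ =>
    obtain ⟨i, r, e⟩ := h
    obtain ⟨ι, _, a, b, h₁⟩ := h₁
    refine ⟨ι, inferInstance, fun s => i ≫ a s, fun s => b s ≫ r, ?_⟩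
    have e' : 𝟙 X - ∑ s, (i ≫ a s) ≫ (b s ≫ r) = i ≫ (𝟙 Y - ∑ s, a s ≫ b s) ≫ r := by
      simp only [Preadditive.sub_comp, Preadditive.comp_sub, Preadditive.sum_comp,
        Preadditive.comp_sum, Category.id_comp, Category.assoc, e]
    rw [e']
    exact Filtration.comp_negl _ (Filtration.negl_comp h₁ _)

/-- An object of the completion is a direct summand of a finite tuple of objects [m], and the
largest m that occurs bounds its step. -/
theorem exhaust (X : DCob α p) : ∃ n, Gen α p n X := by
  let Y := X.X
  let N := Finset.univ.sup fun i : Y.ι => (show ℕ from (Y.X i).as.as)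
  have h : (filtration α p).D N (⨁ fun i : Y.ι => (embed α p).obj (Y.X i)) :=
    (filtration α p).D_biproduct _ fun i =>
      Gen.obj _ (Finset.le_sup (f := fun i : Y.ι => (show ℕ from (Y.X i).as.as)) (Finset.mem_univ i))
  have h₁ : Gen α p N ((Idempotents.toKaroubi _).obj Y) :=
    .summand _ _ ⟨(((Idempotents.toKaroubi _).mapIso (Mat_.isoBiproductEmbedding Y)) ≪≫
      (Idempotents.toKaroubi _).mapBiproduct _).retract⟩ h
  exact ⟨N, .summand _ _ ⟨⟨X.decompId_i, X.decompId_p, X.decompId.symm⟩⟩ h₁⟩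

variable (α p) in
/-- `[n] ≅ [i] ⊗ [j]` for `i + j = n`. -/
noncomputable def split {i j n : ℕ} (h : i + j = n) :
    DCob.obj α p n ≅ DCob.obj α p i ⊗ DCob.obj α p j :=
  (embed α p).mapIso (SCob.split α p h) ≪≫
    (Functor.Monoidal.μIso (embed α p) (SCob.obj α p i) (SCob.obj α p j)).symm

theorem split_hom {i j n : ℕ} (h : i + j = n) : (split α p h).hom =
    (embed α p).map (SCob.split α p h).hom ≫
      Functor.OplaxMonoidal.δ (embed α p) (SCob.obj α p i) (SCob.obj α p j) := rfl

open Functor.OplaxMonoidal in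
/-- The objects `[n]` and the skew group algebras. -/
noncomputable def model (hα : ∀ g, (p.sum fun i a => a * α (g + i)) = 0) :
    (filtration α p).Model (SkewSym.tower p) where
  G := DCob.obj α p
  G_mem n := .obj n le_rfl
  ρ n := (embed α p).mapAddHom.comp (SCob.skewMap α p n).toAddMonoidHom
  ρ_one n := (congrArg (embed α p).map (map_one (SCob.skewHom α p n))).trans
    ((embed α p).map_id _)
  ρ_mul {n} a b := (congrArg (embed α p).map (map_mul (SCob.skewHom α p n) a b)).trans
    ((embed α p).map_comp _ _)
  Λ n := (SCob.symbol hα n).toAddMonoidHom.comp (preHom α p _)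
  Λ_ρ {n} a := (congrArg (SCob.symbol hα n) (preHom_map α p _)).trans (SCob.symbol_skewHom hα a)
  Λ_negl {n f} := by
    rintro ⟨Z, a, b, hZ, rfl⟩
    exact symbol_negl hα hZ a b
  sub_mem {n} f := by
    obtain ⟨f, rfl⟩ := (embed α p).map_surjective f
    -- The endomorphisms of [n] in the skein category that become negligible in the completion. They
    -- contain every composite through fewer circles, so the spanning argument for surfaces applies
    -- to them.
    let S : Submodule k (SCob.obj α p n ⟶ SCob.obj α p n) :=
      { ((filtration α p).negl n (DCob.obj α p n) (DCob.obj α p n)).comap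
          (embed α p).mapAddHom with
        smul_mem' := fun r f hf => negl_smul r hf }
    have h := SCob.sub_skewHom_symbol_mem hα S (fun m hm f g => by
      change (embed α p).map (f ≫ g) ∈ (filtration α p).negl n _ _
      rw [Functor.map_comp]
      exact Filtration.mem_negl_of_lower (lower_obj hm) _ _) f
    change (embed α p).map (_ - _) ∈ (filtration α p).negl n _ _ at h
    rw [Functor.map_sub] at h
    change (embed α p).map f - (embed α p).map (SCob.skewMap α p n (SCob.symbol hα n
      (preHom α p _ ((embed α p).map f)))) ∈ _
    rwa [preHom_map]
  exists_dual {n X} hX := by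
    obtain ⟨ι, _, a, b, h⟩ := exists_dual hX
    refine ⟨Fintype.card ι, fun s => a ((Fintype.equivFin ι).symm s),
      fun s => b ((Fintype.equivFin ι).symm s), ?_⟩
    rwa [(Fintype.equivFin ι).symm.sum_comp fun s => a s ≫ b s]
  exhaust := exhaust
  ν := split α p
  ν_natural {i j n} h a b := by
    change (embed α p).map _ ≫ _ = _ ≫ ((embed α p).map _ ⊗ₘ (embed α p).map _)
    rw [split_hom, ← Category.assoc, ← Functor.map_comp]
    erw [SCob.split_natural]
    rw [Functor.map_comp, Category.assoc, Category.assoc, δ_natural]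
    rfl
  ν_assoc {i j c l m n} h₁ h₂ h₃ h₄ :=
    oplax_assoc (embed α p) (SCob.split_assoc α p h₁ h₂ h₃ h₄)
  η := (Functor.Monoidal.εIso (embed α p)).symm
  ν_left n := by
    rw [split_hom, Category.assoc]
    refine Eq.trans (congrArg ((embed α p).map (SCob.split α p (zero_add n)).hom ≫ ·)
      (left_unitality_hom (embed α p) (SCob.obj α p n))) ?_
    rw [← Functor.map_comp]
    exact (congrArg (embed α p).map (SCob.split_leftUnitor α p n)).trans ((embed α p).map_id _)
  ν_right n := by
    rw [split_hom, Category.assoc]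
    refine Eq.trans (congrArg ((embed α p).map (SCob.split α p (add_zero n)).hom ≫ ·)
      (right_unitality_hom (embed α p) (SCob.obj α p n))) ?_
    rw [← Functor.map_comp]
    exact (congrArg (embed α p).map (SCob.split_rightUnitor α p n)).trans ((embed α p).map_id _)

theorem model_algebraMap (hα : ∀ g, (p.sum fun i a => a * α (g + i)) = 0) (n : ℕ) (r : k) :
    (model hα).ρ n (algebraMap k (SkewSym p n) r) = r • 𝟙 ((model hα).G n) := by
  refine (congrArg (embed α p).map ((SCob.skewHom α p n).commutes r)).trans ?_
  refine (embed_map_smul α p r (𝟙 _)).trans (congrArg (r • ·) ((embed α p).map_id _))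

end DCob

end KhovanovSazdanovic

/-! ### The universal property of the Grothendieck group and stable isomorphism -/

namespace KhovanovSazdanovic

section DirectSum

variable {C : Type u} [Category.{v} C] [Preadditive C] {X Y Z : C}

theorem IsDirectSum.map {D : Type*} [Category* D] [Preadditive D] (F : C ⥤ D) [F.Additive]
    (h : IsDirectSum X Y Z) : IsDirectSum (F.obj X) (F.obj Y) (F.obj Z) := by
  obtain ⟨i, j, p, q, h₁, h₂, h₃, h₄, h₅⟩ := h
  refine ⟨F.map i, F.map j, F.map p, F.map q, ?_, ?_, ?_, ?_, ?_⟩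
  · rw [← F.map_comp, h₁, F.map_id]
  · rw [← F.map_comp, h₂, F.map_id]
  · rw [← F.map_comp, h₃, F.map_zero]
  · rw [← F.map_comp, h₄, F.map_zero]
  · rw [← F.map_comp, ← F.map_comp, ← F.map_add, h₅, F.map_id]

theorem IsDirectSum.nonempty_iso [HasBinaryBiproducts C] (h : IsDirectSum X Y Z) :
    Nonempty (Z ≅ X ⊞ Y) := by
  obtain ⟨i, j, p, q, h₁, h₂, h₃, h₄, h₅⟩ := h
  refine ⟨⟨biprod.lift p q, biprod.desc i j, ?_, ?_⟩⟩
  · rw [biprod.lift_desc, h₅]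
  · apply biprod.hom_ext' <;> apply biprod.hom_ext <;> simp [h₁, h₂, h₃, h₄]

end DirectSum

namespace K0

variable {C : Type u} [Category.{v} C] [Preadditive C] [MonoidalCategory C]

theorem cls_iso {X Y : C} (e : X ≅ Y) : cls X = cls Y := by
  rw [cls, cls, congr_toSkeleton_of_iso e]

theorem cls_add {X Y Z : C} (h : IsDirectSum X Y Z) : cls Z = cls X + cls Y := by
  rw [cls, cls, cls, ← map_add]
  exact RingQuot.mkRingHom_rel (.sum X Y Z h)

theorem cls_biprod (X Y : C) [HasBinaryBiproduct X Y] : cls (X ⊞ Y) = cls X + cls Y :=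
  cls_add (isDirectSum_biprod X Y)

theorem cls_isZero {X : C} (h : IsZero X) : cls X = 0 := by
  have e : cls X = cls X + cls X := cls_add ⟨0, 0, 0, 0, h.eq_of_src _ _, h.eq_of_src _ _,
    h.eq_of_src _ _, h.eq_of_src _ _, h.eq_of_src _ _⟩
  rwa [left_eq_add] at e

theorem induction_on {P : K0 C → Prop} (h0 : P 0) (hadd : ∀ x y, P x → P y → P (x + y))
    (hneg : ∀ x, P x → P (-x)) (hcls : ∀ X : C, P (cls X)) (x : K0 C) : P x := by
  obtain ⟨x, rfl⟩ := RingQuot.mkRingHom_surjective _ x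
  induction x using FreeAbelianGroup.induction_on with
  | zero => rwa [map_zero]
  | of X =>
    obtain ⟨X, rfl⟩ : ∃ Y, toSkeleton Y = X := ⟨_, toSkeleton_fromSkeleton_obj X⟩
    exact hcls X
  | neg X h => rw [map_neg]; exact hneg _ h
  | add x y hx hy => rw [map_add]; exact hadd _ _ hx hy

section Lift

variable [MonoidalPreadditive C] {B : Type*} [AddCommGroup B] (f : C → B)

/-- The Grothendieck ring is a quotient by a two-sided ideal, but tensoring with an object preserves
direct sums, so that multiples of the relations are again sums of relations. The factors x and y are
kept arbitrary for the induction over the ring congruence. -/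
theorem mul_rel_mul (φ : FreeAbelianGroup (Skeleton C) →+ B)
    (hφ : ∀ a b, K0Rel C a b → φ a = φ b) {a b : FreeAbelianGroup (Skeleton C)}
    (h : RingQuot.Rel (K0Rel C) a b) (x y : FreeAbelianGroup (Skeleton C)) :
    φ (x * a * y) = φ (x * b * y) := by
  induction h generalizing x y with
  | of h =>
    induction x using FreeAbelianGroup.induction_on with
    | zero => simp only [zero_mul]
    | neg X h => simp only [neg_mul, map_neg, h]
    | add x x' hx hx' => simp only [add_mul, map_add, hx, hx']
    | of S =>
      induction y using FreeAbelianGroup.induction_on with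
      | zero => simp only [mul_zero]
      | neg X h => simp only [mul_neg, map_neg, h]
      | add y y' hy hy' => simp only [mul_add, map_add, hy, hy']
      | of R =>
        obtain ⟨S, rfl⟩ : ∃ Y, toSkeleton Y = S := ⟨_, toSkeleton_fromSkeleton_obj S⟩
        obtain ⟨R, rfl⟩ : ∃ Y, toSkeleton Y = R := ⟨_, toSkeleton_fromSkeleton_obj R⟩
        obtain ⟨X, Y, Z, h⟩ := h
        simp only [mul_add, add_mul, FreeAbelianGroup.of_mul_of, ← Skeleton.toSkeleton_tensorObj]
        exact hφ _ _ (.sum _ _ _ ((h.tensor_left S).tensor_right R))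
  | add_left _ ih => simp only [mul_add, add_mul, map_add, ih]
  | mul_left _ ih => simpa only [mul_assoc] using ih x (_ * y)
  | mul_right _ ih => simpa only [mul_assoc] using ih (x * _) y

/-- Additive maps that respect direct sums factor through the ring quotient. The ideal generated by
the relations is thus no larger than the subgroup generated by them. -/
theorem ker_mkRingHom_le (φ : FreeAbelianGroup (Skeleton C) →+ B)
    (hφ : ∀ a b, K0Rel C a b → φ a = φ b) :
    (RingQuot.mkRingHom (K0Rel C) : _ →+ K0 C).ker ≤ φ.ker := by
  intro a ha
  have h : RingQuot.mkRingHom (K0Rel C) a = RingQuot.mkRingHom (K0Rel C) 0 :=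
    ((AddMonoidHom.mem_ker).1 ha).trans (map_zero _).symm
  simp only [RingQuot.mkRingHom_def] at h
  have h' := Quot.eqvGen_exact (congrArg RingQuot.toQuot h)
  rw [AddMonoidHom.mem_ker, ← map_zero φ]
  generalize (0 : FreeAbelianGroup (Skeleton C)) = b at h'
  clear h ha
  induction h' with
  | rel a b h =>
    have := mul_rel_mul φ hφ h 1 1
    simpa only [one_mul, mul_one] using this
  | refl => rfl
  | symm a b _ ih => exact ih.symm
  | trans a b c _ _ h₁ h₂ => exact h₁.trans h₂

/-- The universal property of the Grothendieck group. -/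
theorem exists_lift (f : C → B) (hf : ∀ X Y, Nonempty (X ≅ Y) → f X = f Y)
    (hs : ∀ X Y Z, IsDirectSum X Y Z → f Z = f X + f Y) :
    ∃ φ : K0 C →+ B, ∀ X, φ (cls X) = f X := by
  let ψ : FreeAbelianGroup (Skeleton C) →+ B :=
    FreeAbelianGroup.lift fun X => f ((fromSkeleton C).obj X)
  have hψ : ∀ X, ψ (.of (toSkeleton X)) = f X := fun X =>
    (FreeAbelianGroup.lift_apply_of _ _).trans (hf _ _ ⟨fromSkeletonToSkeletonIso X⟩)
  have hk := ker_mkRingHom_le ψ (by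
    rintro _ _ ⟨X, Y, Z, h⟩
    rw [map_add, hψ, hψ, hψ, hs _ _ _ h])
  refine ⟨AddMonoidHom.liftOfSurjective (RingQuot.mkRingHom (K0Rel C) : _ →+ K0 C)
    (RingQuot.mkRingHom_surjective _) ⟨ψ, hk⟩, fun X => ?_⟩
  exact (AddMonoidHom.liftOfRightInverse_comp_apply _ _ _ _ _).trans (hψ X)

end Lift

end K0

section Stable

/-- The isomorphism classes of objects. -/
def IsoCls (C : Type u) [Category.{v} C] : Type u := Quotient (isIsomorphicSetoid C)

/-- The isomorphism class of an object. -/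
def IsoCls.mk {C : Type u} [Category.{v} C] (X : C) : IsoCls C := Quotient.mk _ X

theorem IsoCls.mk_eq {C : Type u} [Category.{v} C] {X Y : C} :
    IsoCls.mk X = IsoCls.mk Y ↔ Nonempty (X ≅ Y) := Quotient.eq

variable {C : Type u} [Category.{v} C] [Preadditive C] [HasFiniteBiproducts C]

noncomputable instance : AddCommMonoid (IsoCls C) :=
  have := hasBinaryBiproducts_of_finite_biproducts C
  have := hasZeroObject_of_hasFiniteBiproducts C
  { add := Quotient.map₂ (fun X Y => X ⊞ Y) fun _ _ h _ _ h' => ⟨biprod.mapIso h.some h'.some⟩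
    zero := Quotient.mk _ (HasZeroObject.zero' C).1
    add_zero := by
      rintro ⟨X⟩
      exact IsoCls.mk_eq.2 ⟨(isoBiprodZero (isZero_zero C)).symm⟩
    zero_add := by
      rintro ⟨X⟩
      exact IsoCls.mk_eq.2 ⟨(isoZeroBiprod (isZero_zero C)).symm⟩
    add_assoc := by
      rintro ⟨X⟩ ⟨Y⟩ ⟨Z⟩
      exact IsoCls.mk_eq.2 ⟨biprod.associator X Y Z⟩
    add_comm := by
      rintro ⟨X⟩ ⟨Y⟩
      exact IsoCls.mk_eq.2 ⟨biprod.braiding X Y⟩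
    nsmul := @nsmulRec _ ⟨Quotient.mk _ (HasZeroObject.zero' C).1⟩
      ⟨Quotient.map₂ (fun X Y => X ⊞ Y) fun _ _ h _ _ h' => ⟨biprod.mapIso h.some h'.some⟩⟩ }

/-- The addition was defined with the biproducts that come from finite ones; any other choice is
also a direct sum and therefore isomorphic. -/
theorem IsoCls.mk_add [HasBinaryBiproducts C] (X Y : C) : mk X + mk Y = mk (X ⊞ Y) := by
  have h : IsDirectSum X Y (@biprod C _ _ X Y
      ((hasBinaryBiproducts_of_finite_biproducts C).has_binary_biproduct X Y)) :=
    isDirectSum_biprod X Y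
  exact mk_eq.2 h.nonempty_iso

variable [MonoidalCategory C] [MonoidalPreadditive C]

/-- Objects with the same class in the Grothendieck ring are stably isomorphic. -/
theorem K0.exists_iso [HasBinaryBiproducts C] {X Y : C} (h : cls X = cls Y) :
    ∃ V : C, Nonempty (X ⊞ V ≅ Y ⊞ V) := by
  -- The classes are compared in the group completion of the monoid of isomorphism classes. Two
  -- elements of a commutative monoid agree there exactly when they become equal after adding a
  -- common element.
  obtain ⟨φ, hφ⟩ := K0.exists_lift
    (fun X : C => Algebra.GrothendieckAddGroup.of (IsoCls.mk X))
    (fun X Y e => congrArg _ (IsoCls.mk_eq.2 e)) (fun X Y Z h => by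
      rw [← map_add, IsoCls.mk_add, IsoCls.mk_eq.2 h.nonempty_iso])
  have e : Algebra.GrothendieckAddGroup.of (IsoCls.mk X) =
      Algebra.GrothendieckAddGroup.of (IsoCls.mk Y) := by
    rw [← hφ, ← hφ, h]
  obtain ⟨c, hc⟩ := ((AddLocalization.addMonoidOf (⊤ : AddSubmonoid (IsoCls C))).eq_iff_exists).1 e
  obtain ⟨⟨V⟩, _⟩ := c
  change IsoCls.mk V + IsoCls.mk X = IsoCls.mk V + IsoCls.mk Y at hc
  rw [add_comm, IsoCls.mk_add, add_comm, IsoCls.mk_add, IsoCls.mk_eq] at hc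
  exact ⟨V, hc⟩

end Stable

end KhovanovSazdanovic

/-! ### Cancelling objects of higher filtration degree -/

namespace KhovanovSazdanovic

section Cancellation

variable {C : Type w} [Category.{v} C] [Preadditive C]

/-- The complementary idempotent 1 - r ≫ i splits, and its image completes the retract X to a direct
sum decomposition of Y. -/
theorem exists_complement [IsIdempotentComplete C] {X Y : C} {i : X ⟶ Y} {r : Y ⟶ X}
    (h : i ≫ r = 𝟙 X) : ∃ (X' : C) (j : X' ⟶ Y) (q : Y ⟶ X'),
      j ≫ q = 𝟙 X' ∧ i ≫ q = 0 ∧ j ≫ r = 0 ∧ r ≫ i + q ≫ j = 𝟙 Y := by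
  obtain ⟨X', j, q, h₁, h₂⟩ := IsIdempotentComplete.idempotents_split Y (𝟙 Y - r ≫ i) (by
    simp only [Preadditive.sub_comp, Preadditive.comp_sub, Category.id_comp, Category.comp_id,
      Category.assoc, reassoc_of% h, sub_self, sub_zero])
  refine ⟨X', j, q, h₁, ?_, ?_, ?_⟩
  · calc i ≫ q = i ≫ q ≫ j ≫ q := by rw [h₁, Category.comp_id]
      _ = 0 := by
        rw [reassoc_of% h₂, Preadditive.sub_comp, Preadditive.comp_sub, Category.id_comp,
          Category.assoc, reassoc_of% h, sub_self]
  · calc j ≫ r = (j ≫ q) ≫ j ≫ r := by rw [h₁, Category.id_comp]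
      _ = 0 := by
        rw [Category.assoc, reassoc_of% h₂, Preadditive.sub_comp, Preadditive.comp_sub,
          Category.id_comp, Category.assoc, h, Category.comp_id, sub_self]
  · rw [h₂, add_sub_cancel]

variable [HasBinaryBiproducts C]

/-- The corner of θ at W is f + c ≫ d. It need not be invertible, but the additional summand Z makes
room for elementary operations that subtract c ≫ d. The corner is then the isomorphism f, and
Gaussian elimination cancels W. -/
theorem nonempty_iso_of_sub {W X Y Z : C} (θ : W ⊞ X ≅ W ⊞ Y) (f : W ⟶ W) [IsIso f] (c : W ⟶ Z)
    (d : Z ⟶ W) (h : biprod.inl ≫ θ.hom ≫ biprod.fst - f = c ≫ d) :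
    Nonempty (X ⊞ Z ≅ Y ⊞ Z) := by
  -- The first factor adds c : W → Z, the middle ones apply θ with the identity of Z, and the last
  -- adds -d : Z → W. The path W → Z → W contributes -c ≫ d to the corner.
  let Θ : W ⊞ (X ⊞ Z) ≅ W ⊞ (Y ⊞ Z) := Biprod.unipotentUpper (c ≫ biprod.inr) ≪≫
    (biprod.associator W X Z).symm ≪≫ biprod.mapIso θ (Iso.refl Z) ≪≫ biprod.associator W Y Z ≪≫
      Biprod.unipotentLower (-(biprod.snd ≫ d))
  have e : biprod.inl ≫ Θ.hom ≫ biprod.fst = f := by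
    have h' : f = biprod.inl ≫ θ.hom ≫ biprod.fst - c ≫ d := by rw [← h, sub_sub_cancel]
    have e₁ : (biprod.inl : W ⟶ W ⊞ (X ⊞ Z)) ≫ biprod.lift biprod.fst (biprod.snd ≫ biprod.fst) =
        (biprod.inl : W ⟶ W ⊞ X) := by
      apply biprod.hom_ext <;> simp
    have e₂ : (biprod.inr : Z ⟶ X ⊞ Z) ≫ (biprod.inr : X ⊞ Z ⟶ W ⊞ (X ⊞ Z)) ≫
        biprod.lift biprod.fst (biprod.snd ≫ biprod.fst) = (0 : Z ⟶ W ⊞ X) := by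
      apply biprod.hom_ext <;> simp
    rw [h']
    simp [Θ, Biprod.ofComponents, sub_eq_add_neg, reassoc_of% e₁, reassoc_of% e₂]
  have : IsIso (biprod.inl ≫ Θ.hom ≫ biprod.fst) := by rwa [e]
  exact ⟨Biprod.isoElim Θ⟩

end Cancellation

namespace Filtration

section Negl

variable {C : Type w} [Category.{v} C] [Preadditive C] [HasFiniteBiproducts C]
  [MonoidalCategory C] {F : Filtration C} {n : ℕ}

theorem mem_negl_biproduct {ι : Type} [Fintype ι] {X Y : ι → C} {f : ⨁ X ⟶ ⨁ Y}
    (h : ∀ s t, biproduct.ι X s ≫ f ≫ biproduct.π Y t ∈ F.negl n (X s) (Y t)) :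
    f ∈ F.negl n (⨁ X) (⨁ Y) := by
  classical
  have e : f = ∑ s, ∑ t, biproduct.π X s ≫ (biproduct.ι X s ≫ f ≫ biproduct.π Y t) ≫
      biproduct.ι Y t := by
    calc f = (∑ s, biproduct.π X s ≫ biproduct.ι X s) ≫ f ≫
            ∑ t, biproduct.π Y t ≫ biproduct.ι Y t := by
          rw [biproduct.total, biproduct.total, Category.comp_id, Category.id_comp]
      _ = _ := by
          simp only [Preadditive.sum_comp, Preadditive.comp_sum, Category.assoc]
          exact Finset.sum_comm
  rw [e]
  exact sum_mem fun s _ => sum_mem fun t _ => comp_negl _ (negl_comp (h s t) _)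

/-- Objects that are isomorphic up to lower steps of the filtration are isomorphic up to adding
objects of lower steps. -/
theorem exists_lower_iso [IsIdempotentComplete C] [HasBinaryBiproducts C] {X Y : C} {f : X ⟶ Y}
    {g : Y ⟶ X} (hf : 𝟙 X - f ≫ g ∈ F.negl n X X) (hg : 𝟙 Y - g ≫ f ∈ F.negl n Y Y) :
    ∃ (X' W : C), F.lower n X' ∧ F.lower n W ∧ IsDirectSum X X' (Y ⊞ W) := by
  -- The defect 1 - f ≫ g factors as a ≫ b through a lower object W. Hence X is a retract of Y ⊞ W
  -- by (f, a) and (g, b), and the complement remains to be shown lower.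
  obtain ⟨W, a, b, hW, h⟩ := hf
  have hi : biprod.lift f a ≫ biprod.desc g b = 𝟙 X := by
    rw [biprod.lift_desc, h, add_sub_cancel]
  obtain ⟨X', j, q, h₁, h₂, h₃, h₄⟩ := exists_complement hi
  refine ⟨X', W, ?_, hW, biprod.lift f a, j, biprod.desc g b, q, hi, h₁, h₂, h₃, h₄⟩
  -- The idempotent of the complement is 1 minus the one of X. Its entry from Y to Y is 1 - g ≫ f,
  -- which is negligible, and every other entry starts or ends at W.
  have hE : q ≫ j ∈ F.negl n (Y ⊞ W) (Y ⊞ W) := by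
    have e : q ≫ j = biprod.fst ≫ (𝟙 Y - g ≫ f) ≫ biprod.inl - biprod.fst ≫ (g ≫ a) ≫ biprod.inr +
        (biprod.snd ≫ 𝟙 W ≫ (biprod.inr - b ≫ biprod.lift f a)) := by
      rw [← eq_sub_iff_add_eq'] at h₄
      rw [h₄]
      apply biprod.hom_ext' <;> apply biprod.hom_ext <;> simp
    rw [e]
    refine add_mem (sub_mem (comp_negl _ (negl_comp hg _)) ?_)
      (comp_negl _ (mem_negl_of_lower hW _ _))
    rw [← Category.assoc, ← Category.assoc]
    exact mem_negl_of_lower hW _ _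
  rw [← id_mem_negl_iff]
  have e : 𝟙 X' = j ≫ (q ≫ j) ≫ q := by rw [Category.assoc, h₁, Category.comp_id, h₁]
  rw [e]
  exact comp_negl _ (negl_comp hE _)

end Negl

namespace Model

variable {C : Type w} [Category.{v} C] [Preadditive C] [HasFiniteBiproducts C]
  [MonoidalCategory C] {A : ℕ → Type u} [∀ n, Ring (A n)] {F : Filtration C} {T : Tower A}
  (M : F.Model T) {n r : ℕ}

/-- The part of an endomorphism of a power of `G n` that is given by a matrix over `A n`. -/
noncomputable def hat (f : (⨁ fun _ : Fin r => M.G n) ⟶ ⨁ fun _ : Fin r => M.G n) :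
    (⨁ fun _ : Fin r => M.G n) ⟶ ⨁ fun _ : Fin r => M.G n :=
  biproduct.matrix fun s t => M.ρ n (M.Λ n (biproduct.ι (fun _ : Fin r => M.G n) s ≫ f ≫
    biproduct.π (fun _ : Fin r => M.G n) t))

theorem ι_hat_π (f : (⨁ fun _ : Fin r => M.G n) ⟶ ⨁ fun _ : Fin r => M.G n) (s t : Fin r) :
    biproduct.ι (fun _ : Fin r => M.G n) s ≫ M.hat f ≫ biproduct.π (fun _ : Fin r => M.G n) t =
      M.ρ n (M.Λ n (biproduct.ι (fun _ : Fin r => M.G n) s ≫ f ≫ biproduct.π (fun _ : Fin r => M.G n) t)) := by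
  rw [hat, ← Category.assoc, biproduct.ι_matrix, biproduct.lift_π]

theorem sub_hat_mem (f : (⨁ fun _ : Fin r => M.G n) ⟶ ⨁ fun _ : Fin r => M.G n) :
    f - M.hat f ∈ F.negl n _ _ := by
  refine mem_negl_biproduct fun s t => ?_
  rw [Preadditive.sub_comp, Preadditive.comp_sub, ι_hat_π]
  exact M.sub_mem _

/-- As `Λ` and `ρ` are multiplicative, so is the passage to the lifted matrix. Combined with
`hat_eq_id`, it turns an inverse modulo negligible morphisms into an actual inverse of the lift. -/
theorem hat_comp (f g : (⨁ fun _ : Fin r => M.G n) ⟶ ⨁ fun _ : Fin r => M.G n) :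
    M.hat (f ≫ g) = M.hat f ≫ M.hat g := by
  refine biproduct.hom_ext' _ _ fun s => biproduct.hom_ext _ _ fun u => ?_
  have key : ∀ f' g' : (⨁ fun _ : Fin r => M.G n) ⟶ ⨁ fun _ : Fin r => M.G n,
      biproduct.ι (fun _ : Fin r => M.G n) s ≫ (f' ≫ g') ≫ biproduct.π (fun _ : Fin r => M.G n) u =
        ∑ t, (biproduct.ι (fun _ : Fin r => M.G n) s ≫ f' ≫ biproduct.π (fun _ : Fin r => M.G n) t) ≫
          (biproduct.ι (fun _ : Fin r => M.G n) t ≫ g' ≫ biproduct.π (fun _ : Fin r => M.G n) u) := by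
    intro f' g'
    calc _ = biproduct.ι (fun _ : Fin r => M.G n) s ≫ f' ≫
        (∑ t, biproduct.π (fun _ : Fin r => M.G n) t ≫ biproduct.ι (fun _ : Fin r => M.G n) t) ≫ g' ≫
          biproduct.π (fun _ : Fin r => M.G n) u := by
          rw [biproduct.total (f := fun _ : Fin r => M.G n), Category.id_comp, Category.assoc]
      _ = _ := by simp only [Preadditive.sum_comp, Preadditive.comp_sum, Category.assoc]
  rw [Category.assoc, Category.assoc, ι_hat_π, key f g, key (M.hat f), map_sum,
    map_sum]
  refine Finset.sum_congr rfl fun t _ => ?_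
  rw [ι_hat_π, ι_hat_π, M.Λ_comp, M.ρ_mul]

theorem hat_eq_id {f : (⨁ fun _ : Fin r => M.G n) ⟶ ⨁ fun _ : Fin r => M.G n}
    (h : f - 𝟙 _ ∈ F.negl n _ _) : M.hat f = 𝟙 _ := by
  refine biproduct.hom_ext' _ _ fun s => biproduct.hom_ext _ _ fun t => ?_
  rw [Category.assoc, ι_hat_π, M.Λ_eq_of_sub_mem
    (g := biproduct.ι (fun _ : Fin r => M.G n) s ≫ biproduct.π (fun _ : Fin r => M.G n) t)]
  · rw [Category.comp_id]
    by_cases hst : s = t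
    · subst hst
      rw [biproduct.ι_π_self, M.Λ_id, M.ρ_one]
    · rw [biproduct.ι_π_ne _ hst, map_zero, map_zero]
  · have e : biproduct.ι (fun _ : Fin r => M.G n) s ≫ f ≫ biproduct.π (fun _ : Fin r => M.G n) t -
        biproduct.ι (fun _ : Fin r => M.G n) s ≫ biproduct.π (fun _ : Fin r => M.G n) t =
        biproduct.ι (fun _ : Fin r => M.G n) s ≫ (f - 𝟙 _) ≫ biproduct.π (fun _ : Fin r => M.G n) t := by
      rw [Preadditive.sub_comp, Preadditive.comp_sub, Category.id_comp]
    rw [e]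
    exact comp_negl _ (negl_comp h _)

variable [HasBinaryBiproducts C]

/-- The corner of θ at the power of G n is invertible modulo negligible morphisms, because X and Y
are lower. Its lift `hat` is then an isomorphism and differs from the corner by a morphism through a
lower object Z, which is the situation of `nonempty_iso_of_sub`. -/
theorem exists_cancel_power {X Y : C} (hX : F.lower n X) (hY : F.lower n Y)
    (θ : (⨁ fun _ : Fin r => M.G n) ⊞ X ≅ (⨁ fun _ : Fin r => M.G n) ⊞ Y) :
    ∃ Z, F.lower n Z ∧ Nonempty (X ⊞ Z ≅ Y ⊞ Z) := by
  have key : ∀ {X Y : C} (_ : F.lower n Y)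
      (θ : (⨁ fun _ : Fin r => M.G n) ⊞ X ≅ (⨁ fun _ : Fin r => M.G n) ⊞ Y),
      -- The product of the corners of θ and of its inverse misses the identity only by the path
      -- through the lower summand Y.
      M.hat (biprod.inl ≫ θ.hom ≫ biprod.fst) ≫ M.hat (biprod.inl ≫ θ.inv ≫ biprod.fst) = 𝟙 _ := by
    intro X Y hY θ
    rw [← hat_comp]
    refine M.hat_eq_id ?_
    have e : (biprod.inl ≫ θ.hom ≫ biprod.fst) ≫ (biprod.inl ≫ θ.inv ≫ biprod.fst) - 𝟙 _ =
        (-(biprod.inl ≫ θ.hom ≫ biprod.snd)) ≫ (biprod.inr ≫ θ.inv ≫ biprod.fst) := by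
      rw [sub_eq_iff_eq_add, Preadditive.neg_comp, ← sub_eq_neg_add, eq_sub_iff_add_eq]
      calc _ = biprod.inl ≫ θ.hom ≫ (biprod.fst ≫ biprod.inl + biprod.snd ≫ biprod.inr) ≫
            θ.inv ≫ biprod.fst := by
            simp only [Preadditive.add_comp, Preadditive.comp_add, Category.assoc]
        _ = 𝟙 _ := by
            rw [biprod.total, Category.id_comp, Iso.hom_inv_id_assoc, biprod.inl_fst]
    rw [e]
    exact mem_negl_of_lower hY _ _
  have : IsIso (M.hat (biprod.inl ≫ θ.hom ≫ biprod.fst)) :=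
    ⟨_, key hY θ, key hX θ.symm⟩
  obtain ⟨Z, c, d, hZ, h⟩ := M.sub_hat_mem (biprod.inl ≫ θ.hom ≫ biprod.fst)
  exact ⟨Z, hZ, nonempty_iso_of_sub θ _ c d h.symm⟩

/-- By its dual basis V is a direct summand of the sum of a power of G n and a lower object Z.
Adding a complement of V to both sides replaces V by this sum, and the power of G n can be
cancelled. -/
theorem exists_cancel (M : F.Model T) [IsIdempotentComplete C] {X Y V : C}
    (hX : F.lower n X) (hY : F.lower n Y) (hV : F.D n V) (h : IsoCls.mk X + IsoCls.mk V = IsoCls.mk Y + IsoCls.mk V) :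
    ∃ Z, F.lower n Z ∧ IsoCls.mk X + IsoCls.mk Z = IsoCls.mk Y + IsoCls.mk Z := by
  obtain ⟨r, a, b, Z, c, d, hZ, hab⟩ := M.exists_dual hV
  have hi : biprod.lift (biproduct.lift a) c ≫ biprod.desc (biproduct.desc b) d = 𝟙 V := by
    rw [biprod.lift_desc, biproduct.lift_desc, hab, add_sub_cancel]
  obtain ⟨V', j, q, h₁, h₂, h₃, h₄⟩ := exists_complement hi
  have hW : IsoCls.mk (⨁ fun _ : Fin r => M.G n) + IsoCls.mk Z = IsoCls.mk V + IsoCls.mk V' := by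
    rw [IsoCls.mk_add, IsoCls.mk_add]
    exact IsoCls.mk_eq.2 (IsDirectSum.nonempty_iso ⟨_, j, _, q, hi, h₁, h₂, h₃, h₄⟩)
  have hXY : IsoCls.mk (⨁ fun _ : Fin r => M.G n) + IsoCls.mk (X ⊞ Z) =
      IsoCls.mk (⨁ fun _ : Fin r => M.G n) + IsoCls.mk (Y ⊞ Z) := by
    rw [← IsoCls.mk_add, ← IsoCls.mk_add, add_left_comm, hW, ← add_assoc, h, add_assoc, ← hW,
      add_left_comm]
  rw [IsoCls.mk_add, IsoCls.mk_add, IsoCls.mk_eq] at hXY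
  obtain ⟨Z', hZ', h'⟩ := M.exists_cancel_power (F.lower_sum (isDirectSum_biprod X Z) hX hZ)
    (F.lower_sum (isDirectSum_biprod Y Z) hY hZ) hXY.some
  refine ⟨Z ⊞ Z', F.lower_sum (isDirectSum_biprod Z Z') hZ hZ', ?_⟩
  rw [← IsoCls.mk_eq, ← IsoCls.mk_add, ← IsoCls.mk_add, ← IsoCls.mk_add, ← IsoCls.mk_add] at h'
  rwa [← IsoCls.mk_add, ← add_assoc, ← add_assoc]

/-- Stably isomorphic objects of a step of the filtration are stably isomorphic in that step. -/
theorem exists_stable (M : F.Model T) [IsIdempotentComplete C] {X Y : C} (hX : F.D n X)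
    (hY : F.D n Y) (V : C)
    (h : IsoCls.mk X + IsoCls.mk V = IsoCls.mk Y + IsoCls.mk V) :
    ∃ Z, F.D n Z ∧ IsoCls.mk X + IsoCls.mk Z = IsoCls.mk Y + IsoCls.mk Z := by
  obtain ⟨N, hN⟩ := M.exhaust V
  have hN' := F.mono (Nat.le_add_left N n) hN
  clear hN
  -- The stabilizing object lies in D (n + N). Since X and Y already lie in D (n + N - 1) when N >
  -- 0, `exists_cancel` replaces it by an object one step lower, until step n is reached.
  induction N generalizing V with
  | zero => exact ⟨V, hN', h⟩
  | succ N ih =>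
    obtain ⟨Z, hZ, h'⟩ := M.exists_cancel (n := n + (N + 1)) (F.mono (Nat.le_add_right n N) hX)
      (F.mono (Nat.le_add_right n N) hY) hN' h
    exact ih Z h' hZ

end Model

end Filtration

end KhovanovSazdanovic

/-! ### Homogeneous objects of the associated graded category -/

namespace KhovanovSazdanovic

section DirectSum

variable {C : Type u} [Category.{v} C] [Preadditive C] {X Y Z X' Y' Z' : C}

theorem IsDirectSum.congr (h : IsDirectSum X Y Z) (e : X' ≅ X) (e' : Y' ≅ Y) (e'' : Z' ≅ Z) :
    IsDirectSum X' Y' Z' := by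
  obtain ⟨i, j, p, q, h₁, h₂, h₃, h₄, h₅⟩ := h
  refine ⟨e.hom ≫ i ≫ e''.inv, e'.hom ≫ j ≫ e''.inv, e''.hom ≫ p ≫ e.inv, e''.hom ≫ q ≫ e'.inv,
    ?_, ?_, ?_, ?_, ?_⟩
  · simp [reassoc_of% h₁]
  · simp [reassoc_of% h₂]
  · simp [reassoc_of% h₃]
  · simp [reassoc_of% h₄]
  · have h : p ≫ i ≫ e''.inv + q ≫ j ≫ e''.inv = e''.inv := by
      rw [← Category.assoc, ← Category.assoc, ← Preadditive.add_comp, h₅, Category.id_comp]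
    simp [← Preadditive.comp_add, h]

theorem IsDirectSum.of_iso_left (e : X ≅ Z) (h : IsZero Y) : IsDirectSum X Y Z :=
  ⟨e.hom, 0, e.inv, 0, e.hom_inv_id, h.eq_of_src _ _, Limits.comp_zero, Limits.zero_comp, by simp⟩

theorem IsDirectSum.of_iso_right (e : Y ≅ Z) (h : IsZero X) : IsDirectSum X Y Z :=
  ⟨0, e.hom, 0, e.inv, h.eq_of_src _ _, e.hom_inv_id, Limits.zero_comp, Limits.comp_zero, by simp⟩

end DirectSum

namespace Filtration

variable {k : Type u} [Field k] {C : Type w} [Category.{v} C] [Preadditive C]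
  [HasFiniteBiproducts C] [MonoidalCategory C] {F : Filtration C} {n : ℕ}

theorem negl_of_lower_left {X Y : C} (h : F.lower n X) (f : X ⟶ Y) : f ∈ F.negl n X Y := by
  rw [← Category.id_comp f]
  exact mem_negl_of_lower h _ _

variable [MonoidalPreadditive C] [Linear k C]

/-- Inverse up to negligible morphisms in each degree is all that the quotient category sees. -/
theorem gr_nonempty_iso {X Y : F.gr k} (h : ∀ n, ∃ (f : X.as.obj n ⟶ Y.as.obj n)
    (g : Y.as.obj n ⟶ X.as.obj n), 𝟙 _ - f ≫ g ∈ F.negl n _ _ ∧ 𝟙 _ - g ≫ f ∈ F.negl n _ _) :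
    Nonempty (X ≅ Y) := by
  choose f g h h' using h
  refine ⟨⟨TensorIdeal.Quot.cls (ObjectProperty.homMk f),
    TensorIdeal.Quot.cls (ObjectProperty.homMk g), ?_, ?_⟩⟩
  · exact (Model.gr_cls_eq_iff (f := 𝟙 X.as) (g := ObjectProperty.homMk f ≫ ObjectProperty.homMk g)).2 h
      |>.symm
  · exact (Model.gr_cls_eq_iff (f := 𝟙 Y.as) (g := ObjectProperty.homMk g ≫ ObjectProperty.homMk f)).2 h'
      |>.symm

theorem gr_nonempty_iso_of_deg {X Y : F.gr k} (hX : F.grDeg k n X) (hY : F.grDeg k n Y)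
    (f : X.as.obj n ⟶ Y.as.obj n) (g : Y.as.obj n ⟶ X.as.obj n)
    (h : 𝟙 _ - f ≫ g ∈ F.negl n _ _) (h' : 𝟙 _ - g ≫ f ∈ F.negl n _ _) : Nonempty (X ≅ Y) := by
  refine gr_nonempty_iso fun l => ?_
  by_cases hl : l = n
  · subst hl
    exact ⟨f, g, h, h'⟩
  · exact ⟨0, 0, negl_of_lower_left (hX l hl) _, negl_of_lower_left (hY l hl) _⟩

theorem gr_isDirectSum {X Y Z : F.gr k}
    (h : ∀ n, IsDirectSum (X.as.obj n) (Y.as.obj n) (Z.as.obj n)) : IsDirectSum X Y Z := by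
  choose i j p q h₁ h₂ h₃ h₄ h₅ using h
  let c {X Y : F.gr k} (f : ∀ n, X.as.obj n ⟶ Y.as.obj n) : X ⟶ Y :=
    TensorIdeal.Quot.cls (ObjectProperty.homMk f)
  have hc : ∀ {X Y : F.gr k} {f g : ∀ n, X.as.obj n ⟶ Y.as.obj n}, (∀ n, f n = g n) → c f = c g :=
    fun h => congrArg _ (funext h)
  exact ⟨c i, c j, c p, c q, hc (f := fun n => i n ≫ p n) h₁, hc (f := fun n => j n ≫ q n) h₂,
    hc (f := fun n => i n ≫ q n) (g := fun _ => 0) h₃,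
    hc (f := fun n => j n ≫ p n) (g := fun _ => 0) h₄,
    hc (f := fun n => p n ≫ i n + q n ≫ j n) h₅⟩

/-- The components of a direct sum are direct sums up to lower steps. -/
theorem gr_biprod_iso [HasBinaryBiproducts C] {X Y Z : F.gr k} (h : IsDirectSum X Y Z) (n : ℕ) :
    ∃ (f : X.as.obj n ⊞ Y.as.obj n ⟶ Z.as.obj n) (g : Z.as.obj n ⟶ X.as.obj n ⊞ Y.as.obj n),
      𝟙 _ - f ≫ g ∈ F.negl n _ _ ∧ 𝟙 _ - g ≫ f ∈ F.negl n _ _ := by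
  obtain ⟨i, j, p, q, h₁, h₂, h₃, h₄, h₅⟩ := h
  obtain ⟨i, rfl⟩ := TensorIdeal.Quot.cls_surj i
  obtain ⟨j, rfl⟩ := TensorIdeal.Quot.cls_surj j
  obtain ⟨p, rfl⟩ := TensorIdeal.Quot.cls_surj p
  obtain ⟨q, rfl⟩ := TensorIdeal.Quot.cls_surj q
  have h₁ := Model.gr_cls_eq_iff.1 (h₁ : TensorIdeal.Quot.cls (i ≫ p) = TensorIdeal.Quot.cls (𝟙 X.as)) n
  have h₂ := Model.gr_cls_eq_iff.1 (h₂ : TensorIdeal.Quot.cls (j ≫ q) = TensorIdeal.Quot.cls (𝟙 Y.as)) n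
  have h₃ := Model.gr_cls_eq_iff.1 (h₃ : TensorIdeal.Quot.cls (i ≫ q) = TensorIdeal.Quot.cls 0) n
  have h₄ := Model.gr_cls_eq_iff.1 (h₄ : TensorIdeal.Quot.cls (j ≫ p) = TensorIdeal.Quot.cls 0) n
  have h₅ := Model.gr_cls_eq_iff.1
    (h₅ : TensorIdeal.Quot.cls (p ≫ i + q ≫ j) = TensorIdeal.Quot.cls (𝟙 Z.as)) n
  change i.hom n ≫ p.hom n - 𝟙 _ ∈ _ at h₁
  change j.hom n ≫ q.hom n - 𝟙 _ ∈ _ at h₂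
  change i.hom n ≫ q.hom n - 0 ∈ _ at h₃
  change j.hom n ≫ p.hom n - 0 ∈ _ at h₄
  change (p.hom n ≫ i.hom n + q.hom n ≫ j.hom n) - 𝟙 _ ∈ _ at h₅
  refine ⟨biprod.desc (i.hom n) (j.hom n), biprod.lift (p.hom n) (q.hom n), ?_, ?_⟩
  · have e : 𝟙 _ - biprod.desc (i.hom n) (j.hom n) ≫ biprod.lift (p.hom n) (q.hom n) =
        -(biprod.fst ≫ (i.hom n ≫ p.hom n - 𝟙 _) ≫ biprod.inl +
          biprod.fst ≫ (i.hom n ≫ q.hom n - 0) ≫ biprod.inr +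
          biprod.snd ≫ (j.hom n ≫ p.hom n - 0) ≫ biprod.inl +
          biprod.snd ≫ (j.hom n ≫ q.hom n - 𝟙 _) ≫ biprod.inr) := by
      apply biprod.hom_ext' <;> apply biprod.hom_ext <;> simp
    rw [e]
    exact neg_mem (add_mem (add_mem (add_mem (comp_negl _ (negl_comp h₁ _))
      (comp_negl _ (negl_comp h₃ _))) (comp_negl _ (negl_comp h₄ _))) (comp_negl _ (negl_comp h₂ _)))
  · rw [biprod.lift_desc, ← neg_sub]
    exact neg_mem h₅

section Update

variable (k)

theorem exists_single {X : C} (hX : F.D n X) :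
    ∃ Z : F.gr k, Nonempty (Z.as.obj n ≅ X) ∧ ∀ l, l ≠ n → IsZero (Z.as.obj l) := by
  have := hasZeroObject_of_hasFiniteBiproducts C
  let Y : ℕ → C := Function.update (fun _ => (HasZeroObject.zero' C).1) n X
  have hY : ∀ l, l ≠ n → IsZero (Y l) := fun l hl => by
    have e : Y l = (HasZeroObject.zero' C).1 := Function.update_of_ne hl ..
    rw [e]
    exact isZero_zero C
  have hY' : Y n = X := Function.update_self ..
  refine ⟨⟨⟨Y, fun l => ?_, n + 1, fun l hl => F.lower_zero (hY l (by omega))⟩⟩,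
    ⟨eqToIso hY'⟩, hY⟩
  by_cases hl : l = n
  · rw [hl, hY']
    exact hX
  · exact F.zero (hY l hl)

/-- The sequence with a single object, in degree `n`. -/
noncomputable def single {X : C} (hX : F.D n X) : F.gr k := (exists_single k hX).choose

/-- The component of `single`. -/
noncomputable def singleIso {X : C} (hX : F.D n X) : (single k hX).as.obj n ≅ X :=
  (exists_single k hX).choose_spec.1.some

theorem isZero_single {X : C} (hX : F.D n X) {l : ℕ} (hl : l ≠ n) :
    IsZero ((single k hX).as.obj l) :=
  (exists_single k hX).choose_spec.2 l hl

theorem grDeg_single {X : C} (hX : F.D n X) : F.grDeg k n (single k hX) :=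
  fun _ hl => F.lower_zero (isZero_single k hX hl)

theorem single_directSum {X Y Z : C} (h : IsDirectSum X Y Z) (hX : F.D n X) (hY : F.D n Y)
    (hZ : F.D n Z) : IsDirectSum (single k hX) (single k hY) (single k hZ) := by
  refine gr_isDirectSum fun l => ?_
  by_cases hl : l = n
  · subst hl
    exact h.congr (singleIso k hX) (singleIso k hY) (singleIso k hZ)
  · exact .of_iso_left ((isZero_single k hX hl).iso (isZero_single k hZ hl))
      (isZero_single k hY hl)

variable {k}

theorem gr_isZero {X : F.gr k} (h : ∀ n, F.lower n (X.as.obj n)) : IsZero X := by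
  refine (IsZero.iff_id_eq_zero X).2 ?_
  exact Model.gr_cls_eq_iff.2 fun n => negl_of_lower_left (h n) _

theorem nonempty_iso_single {X : F.gr k} (hX : F.grDeg k n X) :
    Nonempty (X ≅ single k (Model.gr_D X n)) :=
  gr_nonempty_iso_of_deg hX (grDeg_single k _) (singleIso k (Model.gr_D X n)).inv
    (singleIso k (Model.gr_D X n)).hom (by rw [Iso.inv_hom_id, sub_self]; exact zero_mem _)
    (by rw [Iso.hom_inv_id, sub_self]; exact zero_mem _)

/-- One degree is split off and replaced by zero. Iterating this decomposes an object into
homogeneous ones, as used in `Model.cls_mem_range`. -/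
theorem exists_truncate (X : F.gr k) (n : ℕ) : ∃ X' : F.gr k, IsZero (X'.as.obj n) ∧
    (∀ l, l ≠ n → X'.as.obj l = X.as.obj l) ∧ IsDirectSum X' (single k (Model.gr_D X n)) X := by
  have := hasZeroObject_of_hasFiniteBiproducts C
  let Y : ℕ → C := Function.update X.as.obj n (HasZeroObject.zero' C).1
  have hY : ∀ l, l ≠ n → Y l = X.as.obj l := fun l hl => Function.update_of_ne hl ..
  have hY' : IsZero (Y n) := by
    have e : Y n = (HasZeroObject.zero' C).1 := Function.update_self ..
    rw [e]
    exact isZero_zero C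
  have hY'' : ∀ (P : ObjectProperty C) l, (∀ X, IsZero X → P X) → P (X.as.obj l) → P (Y l) := by
    intro P l h0 h
    by_cases hl : l = n
    · rw [hl]
      exact h0 _ hY'
    · rwa [hY l hl]
  obtain ⟨N, hN⟩ := X.as.property.2
  refine ⟨⟨⟨Y, fun l => hY'' _ l (fun _ => F.zero) (Model.gr_D X l), N, fun l hl =>
    hY'' _ l (fun _ => F.lower_zero) (hN l hl)⟩⟩, hY', hY, gr_isDirectSum fun l => ?_⟩
  by_cases hl : l = n
  · subst hl
    exact .of_iso_right (singleIso k _) hY'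
  · exact .of_iso_left (eqToIso (hY l hl)) (isZero_single k _ hl)

end Update

theorem grDeg_tensor {X Y : F.gr k} {m : ℕ} (hX : F.grDeg k m X) (hY : F.grDeg k n Y) :
    F.grDeg k (m + n) (X ⊗ Y) := by
  intro l hl
  refine F.lower_tensorObj l ?_
  rintro i j rfl
  by_cases hi : i = m
  · exact F.tensor_lower (Model.gr_D X i) (hY j (by omega))
  · exact F.lower_tensor (hX i hi) (Model.gr_D Y j)

/-- Among the summands of the component of degree m + n only the one of bidegree (m, n) is nonzero,
so its inclusion and projection are inverse to each other. In the other degrees both sides are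
lower. -/
theorem single_tensor {X Y : C} {m : ℕ} (hX : F.D m X) (hY : F.D n Y) :
    Nonempty (single k hX ⊗ single k hY ≅ single k (F.tensor hX hY)) := by
  let e := singleIso k hX ⊗ᵢ singleIso k hY
  let s := singleIso k (F.tensor hX hY)
  refine gr_nonempty_iso_of_deg (grDeg_tensor (grDeg_single k hX) (grDeg_single k hY))
    (grDeg_single k _) (Model.prj _ _ rfl ≫ e.hom ≫ s.inv) (s.hom ≫ e.inv ≫ Model.inj _ _ rfl) ?_ ?_
  · have h : (Model.prj (single k hX) (single k hY) rfl ≫ e.hom ≫ s.inv) ≫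
        (s.hom ≫ e.inv ≫ Model.inj (single k hX) (single k hY) rfl) = 𝟙 _ := by
      rw [← Model.sum_prj_inj, Finset.sum_eq_single
        ⟨(m, n), Finset.HasAntidiagonal.mem_antidiagonal.2 rfl⟩]
      · simp only [Category.assoc, Iso.inv_hom_id_assoc, Iso.hom_inv_id_assoc]
      · rintro ⟨⟨i, j⟩, hij⟩ - hne
        have hij' : i + j = m + n := Finset.HasAntidiagonal.mem_antidiagonal.1 hij
        have hz : IsZero ((single k hX).as.obj i ⊗ (single k hY).as.obj j) := by
          by_cases hi : i = m
          · have hj : j = n := by omega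
            subst hi hj
            exact (hne rfl).elim
          · exact zero_tensor (isZero_single k hX hi)
        exact (congrArg (· ≫ _) (hz.eq_of_tgt _ 0)).trans Limits.zero_comp
      · exact fun h => (h (Finset.mem_univ _)).elim
    rw [h, sub_self]
    exact zero_mem _
  · have h : (s.hom ≫ e.inv ≫ Model.inj (single k hX) (single k hY) rfl) ≫
        (Model.prj (single k hX) (single k hY) rfl ≫ e.hom ≫ s.inv) = 𝟙 _ := by
      simp only [Category.assoc]
      rw [← Category.assoc (Model.inj _ _ _), Model.inj_prj_self, Category.id_comp,
        Iso.inv_hom_id_assoc, Iso.hom_inv_id]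
    rw [h, sub_self]
    exact zero_mem _

theorem single_unit : Nonempty (𝟙_ (F.gr k) ≅ single k F.unit) := by
  let e : (𝟙_ (F.gr k)).as.obj 0 ≅ 𝟙_ C := GradedObject.Monoidal.tensorUnit₀ (I := ℕ) (C := C)
  let s := singleIso k F.unit
  refine gr_nonempty_iso_of_deg (fun l hl => F.lower_zero ?_) (grDeg_single k _) (e ≪≫ s.symm).hom
    (e ≪≫ s.symm).inv ?_ ?_
  · have : HasZeroObject C := hasZeroObject_of_hasFiniteBiproducts C
    exact IsZero.of_iso (isZero_zero C) ((GradedObject.Monoidal.isInitialTensorUnitApply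
      l hl).uniqueUpToIso (isZero_zero C).isInitial)
  · rw [Iso.hom_inv_id, sub_self]
    exact zero_mem _
  · rw [Iso.inv_hom_id, sub_self]
    exact zero_mem _

end Filtration

end KhovanovSazdanovic

/-! ### The associated graded ring of the Grothendieck ring -/

namespace KhovanovSazdanovic

section Span

variable {C : Type w} [Category.{v} C] [Preadditive C] [MonoidalCategory C]

/-- Sums of classes are classes of direct sums, so closure of P under direct sums lets all positive
and all negative terms be collected in one object each. -/
theorem K0.exists_sub_of_mem_span [HasBinaryBiproducts C] {P : ObjectProperty C}
    (h0 : ∃ X, P X ∧ IsZero X)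
    (hs : ∀ {X Y Z}, IsDirectSum X Y Z → P X → P Y → P Z) {x : K0 C} (hx : x ∈ K0.span P) :
    ∃ X Y, P X ∧ P Y ∧ x = K0.cls X - K0.cls Y := by
  obtain ⟨O, hO, hO'⟩ := h0
  induction hx using AddSubgroup.closure_induction with
  | zero => exact ⟨O, O, hO, hO, (sub_self _).symm⟩
  | mem x hx =>
    obtain ⟨X, hX, rfl⟩ := hx
    exact ⟨X, O, hX, hO, by rw [K0.cls_isZero hO', sub_zero]⟩
  | neg x _ h =>
    obtain ⟨X, Y, hX, hY, rfl⟩ := h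
    exact ⟨Y, X, hY, hX, neg_sub _ _⟩
  | add x y _ _ h h' =>
    obtain ⟨X, Y, hX, hY, rfl⟩ := h
    obtain ⟨X', Y', hX', hY', rfl⟩ := h'
    refine ⟨X ⊞ X', Y ⊞ Y', hs (isDirectSum_biprod _ _) hX hX', hs (isDirectSum_biprod _ _) hY hY', ?_⟩
    rw [K0.cls_biprod, K0.cls_biprod, add_sub_add_comm]

end Span

theorem ProjMod.deg_of_iso {A : ℕ → Type u} [∀ n, Ring (A n)] {T : Tower A} {X Y : ProjMod T}
    (e : X ≅ Y) {i : ℕ} (h : ProjMod.deg T i Y) : ProjMod.deg T i X := by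
  intro j hj
  have := h j hj
  have hx : ∀ x : X.obj.M j, e.inv.hom j (e.hom.hom j x) = x := fun x =>
    LinearMap.congr_fun (congrFun (congrArg (fun φ : X ⟶ X => φ.hom) e.hom_inv_id) j) x
  exact (Function.LeftInverse.injective hx).subsingleton

namespace Filtration

section Piece

variable {C : Type w} [Category.{v} C] [Preadditive C] [HasFiniteBiproducts C]
  [MonoidalCategory C] {F : Filtration C} {n : ℕ}

theorem cls_mem {X : C} (hX : F.D n X) : K0.cls X ∈ F.k0.F n :=
  AddSubgroup.subset_closure ⟨X, hX, rfl⟩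

/-- The class of an object in the graded piece. -/
noncomputable def pc {X : C} (hX : F.D n X) : F.k0.piece n := F.k0.cls (cls_mem hX)

/-- The case n = 0 reconciles the two conventions for the step -1, the zero subgroup and the zero
objects. -/
theorem k0_lower (n : ℕ) : F.k0.lower n = K0.span (F.lower n) := by
  cases n with
  | zero =>
    refine Eq.symm (le_bot_iff.1 ?_)
    refine (AddSubgroup.closure_le _).2 ?_
    rintro _ ⟨X, hX, rfl⟩
    exact K0.cls_isZero hX
  | succ n => rfl

theorem pc_lower {X : C} (hX : F.D n X) (h : F.lower n X) : pc hX = 0 := by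
  refine ((F.k0.cls_eq _ (zero_mem _)).2 ?_).trans F.k0.cls_zero
  rw [k0_lower, add_zero]
  exact neg_mem (AddSubgroup.subset_closure ⟨X, h, rfl⟩)

theorem pc_add {X Y Z : C} (hX : F.D n X) (hY : F.D n Y) (hZ : F.D n Z) (h : IsDirectSum X Y Z) :
    pc hZ = pc hX + pc hY :=
  F.k0.cls_congr _ (K0.cls_add h)

theorem pc_congr {X Y : C} (hX : F.D n X) (hY : F.D n Y) (e : X ≅ Y) : pc hX = pc hY :=
  F.k0.cls_congr _ (K0.cls_iso e)

theorem exists_pc [HasBinaryBiproducts C] (x : F.k0.piece n) :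
    ∃ (X Y : C) (hX : F.D n X) (hY : F.D n Y), x = pc hX - pc hY := by
  obtain ⟨x, hx, rfl⟩ := F.k0.cls_surj x
  have := hasZeroObject_of_hasFiniteBiproducts C
  obtain ⟨X, Y, hX, hY, rfl⟩ := K0.exists_sub_of_mem_span
    ⟨_, F.zero (n := n) (isZero_zero C), isZero_zero C⟩ F.sum hx
  exact ⟨X, Y, hX, hY, rfl⟩

theorem pc_mul {X Y : C} {m : ℕ} (hX : F.D m X) (hY : F.D n Y) :
    GradedMonoid.GMul.mul (pc hX) (pc hY) = pc (F.tensor hX hY) :=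
  F.k0.cls_congr _ (K0.cls_mul X Y)

theorem pc_one : (GradedMonoid.GOne.one : F.k0.piece 0) = pc F.unit :=
  F.k0.cls_congr _ K0.cls_unit.symm

/-- By `exists_lower_iso` the objects become isomorphic after adding lower objects, whose classes
vanish in the graded piece. -/
theorem pc_iso [IsIdempotentComplete C] [HasBinaryBiproducts C] {X Y : C} (hX : F.D n X)
    (hY : F.D n Y) {f : X ⟶ Y} {g : Y ⟶ X} (hf : 𝟙 X - f ≫ g ∈ F.negl n X X)
    (hg : 𝟙 Y - g ≫ f ∈ F.negl n Y Y) : pc hX = pc hY := by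
  obtain ⟨X', W, hX', hW, h⟩ := exists_lower_iso hf hg
  have hX₁ := F.lower_le hX'
  have hW₁ := F.lower_le hW
  have hZ := F.sum (isDirectSum_biprod Y W) hY hW₁
  have h₁ := pc_add hX hX₁ hZ h
  have h₂ := pc_add hY hW₁ hZ (isDirectSum_biprod Y W)
  rw [pc_lower _ hX', add_zero] at h₁
  rw [pc_lower _ hW, add_zero] at h₂
  rw [← h₁, h₂]

end Piece

section Kappa

variable {k : Type u} [Field k] {C : Type w} [Category.{v} C] [Preadditive C]
  [HasFiniteBiproducts C] [MonoidalCategory C] [MonoidalPreadditive C] [Linear k C]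
  {F : Filtration C}

theorem exists_kappa (X : F.gr k) : ∃ x : F.k0.gr, ∀ n, x n = pc (Model.gr_D X n) := by
  classical
  obtain ⟨N, hN⟩ := X.as.property.2
  refine ⟨DirectSum.mk F.k0.piece (Finset.range N) fun n => pc (Model.gr_D X n), fun n => ?_⟩
  by_cases hn : n ∈ Finset.range N
  · exact DirectSum.mk_apply_of_mem hn
  · rw [pc_lower _ (hN n (by simpa using hn))]
    exact DirectSum.mk_apply_of_notMem hn

/-- The sequence of the classes of the components of an object. -/
noncomputable def kappa (X : F.gr k) : F.k0.gr := (exists_kappa X).choose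

theorem kappa_apply (X : F.gr k) (n : ℕ) : kappa X n = pc (Model.gr_D X n) :=
  (exists_kappa X).choose_spec n

/-- The components of a direct sum in the graded category are direct sums only modulo negligible
morphisms, and `pc_iso` absorbs the difference. -/
theorem kappa_add [IsIdempotentComplete C] [HasBinaryBiproducts C] {X Y Z : F.gr k}
    (h : IsDirectSum X Y Z) : kappa Z = kappa X + kappa Y := by
  refine DFinsupp.ext fun n => ?_
  rw [DirectSum.add_apply, kappa_apply, kappa_apply, kappa_apply]
  obtain ⟨f, g, hf, hg⟩ := gr_biprod_iso h n
  have hXY := F.sum (isDirectSum_biprod _ _) (Model.gr_D X n) (Model.gr_D Y n)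
  rw [← pc_add _ _ hXY (isDirectSum_biprod _ _)]
  exact (pc_iso _ _ hf hg).symm

theorem kappa_iso [IsIdempotentComplete C] [HasBinaryBiproducts C] {X Y : F.gr k} (e : X ≅ Y) :
    kappa X = kappa Y := by
  obtain ⟨Z, hZ⟩ : ∃ Z : F.gr k, IsZero Z := by
    have := hasZeroObject_of_hasFiniteBiproducts C
    exact ⟨single k (F.zero (n := 0) (isZero_zero C)), gr_isZero fun n => by
      by_cases hn : n = 0
      · subst hn
        exact (isZero_zero C).of_iso (singleIso k _)
      · exact F.lower_zero (isZero_single k _ hn)⟩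
  -- Through the isomorphism Y is a direct sum of X and a zero object, and it is also one of Y and
  -- that zero object.
  have h₁ := kappa_add (IsDirectSum.of_iso_left e hZ)
  have h₂ := kappa_add (IsDirectSum.of_iso_left (Iso.refl Y) hZ)
  exact add_right_cancel (h₁.symm.trans h₂)

theorem kappa_single {X : C} {n : ℕ} (hX : F.D n X) :
    kappa (single k hX) = DirectSum.of F.k0.piece n (pc hX) := by
  refine DFinsupp.ext fun l => ?_
  rw [kappa_apply]
  by_cases hl : l = n
  · subst hl
    rw [DirectSum.of_eq_same]
    exact pc_congr _ _ (singleIso k hX)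
  · rw [DirectSum.of_eq_of_ne _ _ _ hl]
    exact pc_lower _ (F.lower_zero (isZero_single k hX hl))

end Kappa

namespace Model

variable {k : Type u} [Field k] {C : Type w} [Category.{v} C] [Preadditive C]
  [HasFiniteBiproducts C] [MonoidalCategory C] [MonoidalPreadditive C] [Linear k C]
  {A : ℕ → Type u} [∀ n, Ring (A n)] {F : Filtration C} {T : Tower A} (M : F.Model T) {n : ℕ}

variable (k) in
/-- The class of the sequence with a single object. -/
noncomputable def phi {X : C} (hX : F.D n X) : K0 (ProjMod T.op) :=
  K0.cls ((M.toProj k).obj (single k hX))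

theorem phi_add {X Y Z : C} (h : IsDirectSum X Y Z) (hX : F.D n X) (hY : F.D n Y) (hZ : F.D n Z) :
    M.phi k hZ = M.phi k hX + M.phi k hY :=
  K0.cls_add ((single_directSum k h hX hY hZ).map (M.toProj k))

theorem phi_lower {X : C} (hX : F.D n X) (h : F.lower n X) : M.phi k hX = 0 := by
  refine K0.cls_isZero ((M.toProj k).map_isZero (gr_isZero fun l => ?_))
  by_cases hl : l = n
  · subst hl
    exact F.lower_retract (singleIso k hX).retract h
  · exact grDeg_single k hX l hl

theorem phi_congr {X Y : C} (hX : F.D n X) (hY : F.D n Y) (e : X ≅ Y) :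
    M.phi k hX = M.phi k hY := by
  have := hasZeroObject_of_hasFiniteBiproducts C
  have h₀ : F.D n (HasZeroObject.zero' C).1 := F.zero (isZero_zero C)
  rw [M.phi_add (IsDirectSum.of_iso_left e (isZero_zero C)) hX h₀ hY,
    M.phi_lower h₀ (F.lower_zero (isZero_zero C)), add_zero]

theorem phi_mul {X Y : C} {m : ℕ} (hX : F.D m X) (hY : F.D n Y) :
    M.phi k (F.tensor hX hY) = M.phi k hX * M.phi k hY := by
  rw [phi, phi, phi, K0.cls_mul]
  exact K0.cls_iso ((M.toProj k).mapIso (single_tensor hX hY).some.symm ≪≫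
    (Functor.Monoidal.μIso (M.toProj k) _ _).symm)

theorem phi_unit : M.phi k F.unit = 1 := by
  rw [phi, ← K0.cls_unit]
  exact K0.cls_iso ((M.toProj k).mapIso single_unit.some.symm ≪≫
    (Functor.Monoidal.εIso (M.toProj k)).symm)

variable [IsIdempotentComplete C] [HasBinaryBiproducts C]

/-- This is the crux for K_0. Equality in the graded piece gives lower W, W' such that X ⊞ W and Y ⊞
W' have the same class in K_0, so they are stably isomorphic, but with a stabilizing object from an
arbitrary step. -/
theorem phi_eq {X Y : C} (hX : F.D n X) (hY : F.D n Y) (h : pc hX = pc hY) :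
    M.phi k hX = M.phi k hY := by
  have := hasZeroObject_of_hasFiniteBiproducts C
  have h := (F.k0.cls_eq _ _).1 h
  rw [k0_lower] at h
  obtain ⟨W, W', hW, hW', e⟩ := K0.exists_sub_of_mem_span ⟨_, F.lower_zero (isZero_zero C), isZero_zero C⟩
    F.lower_sum h
  have hXW := F.sum (isDirectSum_biprod X W) hX (F.lower_le hW)
  have hYW := F.sum (isDirectSum_biprod Y W') hY (F.lower_le hW')
  have e' : K0.cls (X ⊞ W) = K0.cls (Y ⊞ W') := by
    rw [K0.cls_biprod, K0.cls_biprod]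
    rw [neg_add_eq_sub, sub_eq_sub_iff_add_eq_add] at e
    rw [e, add_comm]
  obtain ⟨V, hV⟩ := K0.exists_iso e'
  -- The stabilizing object is moved into D n, where `phi` is defined and additive. There W and W'
  -- contribute zero and Z cancels.
  obtain ⟨Z, hZ, hZ'⟩ := M.exists_stable hXW hYW V (by
    rw [IsoCls.mk_add, IsoCls.mk_add]
    exact IsoCls.mk_eq.2 hV)
  rw [IsoCls.mk_add, IsoCls.mk_add, IsoCls.mk_eq] at hZ'
  have h₁ := M.phi_congr (k := k) (F.sum (isDirectSum_biprod _ _) hXW hZ)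
    (F.sum (isDirectSum_biprod _ _) hYW hZ) hZ'.some
  rw [M.phi_add (isDirectSum_biprod _ _) hXW hZ, M.phi_add (isDirectSum_biprod _ _) hYW hZ,
    M.phi_add (isDirectSum_biprod _ _) hX (F.lower_le hW),
    M.phi_add (isDirectSum_biprod _ _) hY (F.lower_le hW'), M.phi_lower _ hW, M.phi_lower _ hW',
    add_zero, add_zero] at h₁
  exact add_right_cancel h₁

theorem phi_sub_eq {X Y X' Y' : C} (hX : F.D n X) (hY : F.D n Y) (hX' : F.D n X') (hY' : F.D n Y')
    (h : pc hX - pc hY = pc hX' - pc hY') :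
    M.phi k hX - M.phi k hY = M.phi k hX' - M.phi k hY' := by
  rw [sub_eq_sub_iff_add_eq_add] at h ⊢
  have h₁ := F.sum (isDirectSum_biprod _ _) hX hY'
  have h₂ := F.sum (isDirectSum_biprod _ _) hX' hY
  rw [← M.phi_add (isDirectSum_biprod _ _) hX hY' h₁,
    ← M.phi_add (isDirectSum_biprod _ _) hX' hY h₂]
  refine M.phi_eq h₁ h₂ ?_
  rw [pc_add hX hY' h₁ (isDirectSum_biprod _ _), pc_add hX' hY h₂ (isDirectSum_biprod _ _), h]

-- Every element of the piece is a difference of two classes of objects, and `phi_sub_eq` makes the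
-- value on it independent of the chosen difference. Hence choosing one difference per element gives
-- an additive map.
variable (k) in
theorem exists_pieceHom (n : ℕ) : ∃ Φ : F.k0.piece n →+ K0 (ProjMod T.op),
    ∀ {X : C} (hX : F.D n X), Φ (pc hX) = M.phi k hX := by
  choose X Y hX hY h using exists_pc (F := F) (n := n)
  have key : ∀ {X' Y' : C} (hX' : F.D n X') (hY' : F.D n Y') x, x = pc hX' - pc hY' →
      M.phi k (hX x) - M.phi k (hY x) = M.phi k hX' - M.phi k hY' := fun hX' hY' x hx =>
    M.phi_sub_eq _ _ _ _ ((h x).symm.trans hx)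
  refine ⟨AddMonoidHom.mk' (fun x => M.phi k (hX x) - M.phi k (hY x)) fun x y => ?_, fun {X'} hX' => ?_⟩
  · have h₁ := F.sum (isDirectSum_biprod _ _) (hX x) (hX y)
    have h₂ := F.sum (isDirectSum_biprod _ _) (hY x) (hY y)
    rw [key h₁ h₂ _ (by
      rw [pc_add (hX x) (hX y) h₁ (isDirectSum_biprod _ _),
        pc_add (hY x) (hY y) h₂ (isDirectSum_biprod _ _), add_sub_add_comm, ← h, ← h]),
      M.phi_add (isDirectSum_biprod _ _) (hX x) (hX y) h₁,
      M.phi_add (isDirectSum_biprod _ _) (hY x) (hY y) h₂, add_sub_add_comm]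
  · have := hasZeroObject_of_hasFiniteBiproducts C
    have h₀ : F.D n (HasZeroObject.zero' C).1 := F.zero (isZero_zero C)
    have h₀' := F.lower_zero (n := n) (isZero_zero C)
    refine (key hX' h₀ _ ?_).trans ?_
    · rw [pc_lower _ h₀', sub_zero]
    · rw [M.phi_lower _ h₀', sub_zero]

variable (k) in
/-- The map from a graded piece of the Grothendieck ring. -/
noncomputable def pieceHom (n : ℕ) : F.k0.piece n →+ K0 (ProjMod T.op) :=
  (M.exists_pieceHom k n).choose

theorem pieceHom_pc {X : C} (hX : F.D n X) : M.pieceHom k n (pc hX) = M.phi k hX :=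
  (M.exists_pieceHom k n).choose_spec hX

theorem pieceHom_mul {m : ℕ} (x : F.k0.piece m) (y : F.k0.piece n) :
    M.pieceHom k _ (GradedMonoid.GMul.mul x y) = M.pieceHom k m x * M.pieceHom k n y := by
  obtain ⟨X, X', hX, hX', rfl⟩ := exists_pc x
  obtain ⟨Y, Y', hY, hY', rfl⟩ := exists_pc y
  have h : ∀ {X Y : C} (hX : F.D m X) (hY : F.D n Y),
      M.pieceHom k _ (DirectSum.gMulHom F.k0.piece (pc hX) (pc hY)) =
        M.phi k hX * M.phi k hY := fun hX hY =>
    (congrArg _ (pc_mul hX hY)).trans ((M.pieceHom_pc _).trans (M.phi_mul hX hY))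
  change M.pieceHom k _ (DirectSum.gMulHom F.k0.piece (pc hX - pc hX') (pc hY - pc hY')) = _
  simp only [map_sub, AddMonoidHom.sub_apply, h, pieceHom_pc, sub_mul, mul_sub]

variable (k) in
/-- The map from the associated graded ring of the Grothendieck ring. -/
noncomputable def grHom : F.k0.gr →+* K0 (ProjMod T.op) :=
  DirectSum.toSemiring (M.pieceHom k)
    ((congrArg _ pc_one).trans ((M.pieceHom_pc _).trans M.phi_unit)) M.pieceHom_mul

theorem grHom_of (x : F.k0.piece n) :
    M.grHom k (DirectSum.of F.k0.piece n x) = M.pieceHom k n x :=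
  DirectSum.toSemiring_of _ _ _ _ _

theorem grHom_of_pc {X : C} (hX : F.D n X) :
    M.grHom k (DirectSum.of F.k0.piece n (pc hX)) = M.phi k hX := by
  rw [grHom_of, pieceHom_pc]

/-- A left inverse is induced by `kappa`, after passing back along an inverse of the equivalence. It
is enough to compare the two on sequences with a single object. -/
theorem grHom_injective : Function.Injective (M.grHom k) := by
  let e := (M.toProj k).asEquivalence
  have : e.functor.Additive := inferInstanceAs (M.toProj k).Additive
  obtain ⟨ψ, hψ⟩ := K0.exists_lift (fun N : ProjMod T.op => kappa (e.inverse.obj N))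
    (fun _ _ h => kappa_iso (e.inverse.mapIso h.some)) fun _ _ _ h => kappa_add (h.map e.inverse)
  have h : ψ.comp (M.grHom k : _ →+ _) = AddMonoidHom.id _ := by
    refine DirectSum.addHom_ext fun n x => ?_
    obtain ⟨X, Y, hX, hY, rfl⟩ := exists_pc x
    have key : ∀ {X : C} (hX : F.D n X), ψ (M.grHom k (DirectSum.of F.k0.piece n (pc hX))) =
        DirectSum.of F.k0.piece n (pc hX) := fun hX => by
      rw [grHom_of_pc, phi, hψ, ← kappa_single (k := k)]
      exact kappa_iso (e.unitIso.app _).symm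
    change ψ (M.grHom k (DirectSum.of F.k0.piece n (pc hX - pc hY))) =
      DirectSum.of F.k0.piece n (pc hX - pc hY)
    rw [map_sub, map_sub, map_sub, key, key]
  exact Function.LeftInverse.injective (g := ψ) fun x => DFunLike.congr_fun h x

/-- Induction on a bound N for the degrees that matter: the component of degree N is split off by
`exists_truncate`, and its class is a value of `phi`. -/
theorem cls_mem_range (N : ℕ) (X : F.gr k) (hX : ∀ l, N ≤ l → F.lower l (X.as.obj l)) :
    K0.cls ((M.toProj k).obj X) ∈ (M.grHom k : F.k0.gr →+ K0 (ProjMod T.op)).range := by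
  induction N generalizing X with
  | zero =>
    rw [K0.cls_isZero ((M.toProj k).map_isZero (gr_isZero fun l => hX l (Nat.zero_le l)))]
    exact zero_mem _
  | succ N ih =>
    obtain ⟨X', hN, hX', h⟩ := exists_truncate X N
    rw [K0.cls_add (h.map (M.toProj k))]
    refine add_mem (ih X' fun l hl => ?_) ⟨DirectSum.of F.k0.piece N (pc (gr_D X N)), M.grHom_of_pc _⟩
    by_cases hl' : l = N
    · subst hl'
      exact F.lower_zero hN
    · rw [hX' l hl']
      exact hX l (by omega)

theorem grHom_surjective : Function.Surjective (M.grHom k) := by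
  intro x
  change x ∈ (M.grHom k : F.k0.gr →+ K0 (ProjMod T.op)).range
  induction x using K0.induction_on with
  | h0 => exact zero_mem _
  | hadd x y hx hy => exact add_mem hx hy
  | hneg x hx => exact neg_mem hx
  | hcls N =>
    rw [← K0.cls_iso ((M.toProj k).objObjPreimageIso N)]
    obtain ⟨n, hn⟩ := ((M.toProj k).objPreimage N).as.property.2
    exact M.cls_mem_range n _ hn

variable (k) in
/-- The associated graded ring of the Grothendieck ring is the Grothendieck ring of the category of
sequences of modules. -/
noncomputable def grEquiv : F.k0.gr ≃+* K0 (ProjMod T.op) :=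
  RingEquiv.ofBijective (M.grHom k) ⟨M.grHom_injective, M.grHom_surjective⟩

/-- An object concentrated in degree i is the image of one in the graded category, again
concentrated in degree i, and the latter is isomorphic to the sequence with a single object there.
-/
theorem map_grDeg (i : ℕ) : (F.k0.grDeg i).map (M.grEquiv k : _ →+ _) =
    K0.span (ProjMod.deg T.op i) := by
  apply le_antisymm
  · rintro _ ⟨_, ⟨x, rfl⟩, rfl⟩
    obtain ⟨X, Y, hX, hY, rfl⟩ := exists_pc x
    change M.grHom k (DirectSum.of F.k0.piece i (pc hX - pc hY)) ∈ _
    rw [map_sub, map_sub, grHom_of_pc, grHom_of_pc]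
    have key : ∀ {X : C} (hX : F.D i X), M.phi k hX ∈ K0.span (ProjMod.deg T.op i) := fun hX =>
      AddSubgroup.subset_closure ⟨_, (M.deg_iff i _).1 (grDeg_single k hX), rfl⟩
    exact _root_.sub_mem (key hX) (key hY)
  · refine (AddSubgroup.closure_le _).2 ?_
    rintro _ ⟨N, hN, rfl⟩
    let e : (M.toProj k).obj ((M.toProj k).objPreimage N) ≅ N := (M.toProj k).objObjPreimageIso N
    have hZ : F.grDeg k i ((M.toProj k).objPreimage N) := (M.deg_iff i _).2
      (ProjMod.deg_of_iso e hN)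
    refine ⟨DirectSum.of F.k0.piece i (pc (gr_D ((M.toProj k).objPreimage N) i)), ⟨_, rfl⟩, ?_⟩
    refine (M.grHom_of_pc _).trans ?_
    exact K0.cls_iso ((M.toProj k).mapIso (nonempty_iso_single hZ).some.symm ≪≫ e)

end Model

end Filtration

end KhovanovSazdanovic

/-! ### The theorem -/

theorem mainTheorem3 {k : Type u} [Field k] (p q : Polynomial k) (hpq : IsCoprime p q)
    (hq : q.coeff 0 = 1) (α : PowerSeries k) (hα : (q : PowerSeries k) * α = (p : PowerSeries k)) :
    (∃ F : (KhovanovSazdanovic.skeinFiltration p q α).gr k ⥤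
        KhovanovSazdanovic.SymProj (KhovanovSazdanovic.uPoly p q),
      F.IsEquivalence ∧ F.Additive ∧ F.Linear k ∧ Nonempty F.Monoidal ∧
        ∀ i X, (KhovanovSazdanovic.skeinFiltration p q α).grDeg k i X ↔
          KhovanovSazdanovic.SymProj.deg (KhovanovSazdanovic.uPoly p q) i (F.obj X)) ∧
    (∃ e : (KhovanovSazdanovic.skeinFiltration p q α).k0.gr ≃+*
        KhovanovSazdanovic.K0 (KhovanovSazdanovic.SymProj (KhovanovSazdanovic.uPoly p q)),
      ∀ i, ((KhovanovSazdanovic.skeinFiltration p q α).k0.grDeg i).map (e : _ →+ _) =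
        KhovanovSazdanovic.K0.span
          (KhovanovSazdanovic.SymProj.deg (KhovanovSazdanovic.uPoly p q) i)) := by
  -- The equation q α = p enters through the recurrence for the coefficients of α alone, which is
  -- what a model of the filtration requires.
  let M := KhovanovSazdanovic.DCob.model (α := fun i => PowerSeries.coeff i α)
    (KhovanovSazdanovic.sum_uPoly p q α hα)
  have := CategoryTheory.Limits.hasBinaryBiproducts_of_finite_biproducts
    (KhovanovSazdanovic.DCob (fun i => PowerSeries.coeff i α) (KhovanovSazdanovic.uPoly p q))
  exact ⟨⟨M.toProj k, inferInstance, inferInstance,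
    M.toProj_linear (KhovanovSazdanovic.DCob.model_algebraMap _), ⟨inferInstance⟩, M.deg_iff⟩,
    M.grEquiv k, M.map_grDeg⟩
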